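/- Let $\alpha\in(0,1)$, $r,a,k,\lambda>0$, $u(c)=c^\alpha/\alpha$, and $\mathcal U(R)=\left(\frac{1-\alpha}{r}\right)^{1-\alpha}\frac{R^\alpha}{\alpha}$; assume $\varepsilon:=\frac{k}{\lambda\,\mathcal U(a)}<1$. Let $N$ be a Poisson process with intensity $\lambda$, with natural filtration $(\mathcal F_u)_{u\ge 0}$ and jump times $(\xi_n)$, $\xi_0=0$. For unexplored area $x\ge 0$ put $X_n=\xi_n\wedge x$. An admissible strategy for $(x,R)\in[0,\infty)^2$ consists of increasing random times $\theta_0\le\theta_1\le\cdots$ in $[0,\infty]$, with $\theta_n$ $\mathcal F_{X_n}$-measurable, and of $\mathcal F_{X_n}\otimes\mathcal B(\mathbb R_+)$-measurable maps $c^n:\Omega\times\mathbb R_+\to\mathbb R_+$ such that the consumption rate $$c_t=c^0(t)\mathbf 1_{t<\theta_0}+\sum_{n=1}^{N_x}c^n(t)\mathbf 1_{\theta_{n-1}\le t<\theta_n}+c^{N_x+1}(t)\mathbf 1_{\theta_{N_x}\le t}$$ satisfies almost surely $R-\int_0^t c_s\,ds+a\sum_{n=0}^{N_x-1}\mathbf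 1_{\theta_n\le t}\ge 0$ for all $t\ge 0$. The value function is $$V(x,R)=\sup\ \mathbb E\Big[\int_0^\infty e^{-rt}u(c_t)\,dt-k\sum_{n=0}^{N_x}e^{-r\theta_n}(X_{n+1}-X_n)\Big],$$ the supremum being over admissible strategies for $(x,R)$, and the exploration operator is $$MV(x,R)=\int_0^x V(x-s,R+a)\,\lambda e^{-\lambda s}\,ds+\mathcal U(R)e^{-\lambda x}-k\,\frac{1-e^{-\lambda x}}{\lambda}.$$ Let $\mathcal C=\{(x,R)\in[0,\infty)^2:V>MV\}$ be the consumption region and $\mathcal E=\{(x,R)\in[0,\infty)^2:V=MV\}$ the exploration region. Then $0\le V<\infty$, $y\mapsto V(y,R)$ is integrable on bounded intervals, and there is a function $R^*:[0,\infty)\to(0,\infty)$ such that for every $x>0$ and $R\ge 0$: $(x,R)\in\mathcal C$ if and only if $R>R^*(x)$, and $(x,R)\in\mathcal E$ if and only if $R\le R^*(x)$. The function $R^*$ is strictly decreasing and continuously differentiable on $[0,\infty)$ (one-sidedly at $0$); in particular $R^*(x)\to R^*(0)$ as $x\downarrow 0$. Moreover $R^*(0)=R_0$, where $R_0$ is the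 unique positive solution of $$\alpha\Big(1+\frac a{R_0}\Big)^{\alpha-1}+(1-\alpha)\Big(1+\frac a{R_0}\Big)^{\alpha}-(1-\alpha)\Big(\frac a{R_0}\Big)^{\alpha}\varepsilon=1.$$ -/

import Mathlib

open MeasureTheory ProbabilityTheory Set
open scoped NNReal ENNReal

noncomputable section

/-! ## The model -/

/-- Data of the exploration model: exponent `α` of the utility `u(c) = c ^ α / α`, interest rate
`r`, deposit size `a`, marginal exploration cost `k`, density of deposits `lam`. -/
structure ExplorationModel where
  α : ℝ
  r : ℝ
  a : ℝ
  k : ℝ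
  lam : ℝ
  α_pos : 0 < α
  α_lt_one : α < 1
  r_pos : 0 < r
  a_pos : 0 < a
  k_pos : 0 < k
  lam_pos : 0 < lam

/-- Instantaneous utility `u(c) = c ^ α / α`. -/
def ExplorationModel.utility (m : ExplorationModel) (c : ℝ) : ℝ := c ^ m.α / m.α

/-- The Hotelling value `𝒰(R)` of a known reserve `R ≥ 0`. -/
def ExplorationModel.hotelling (m : ExplorationModel) (R : ℝ) : ℝ :=
  ((1 - m.α) / m.r) ^ (1 - m.α) * (R ^ m.α / m.α)

/-- The parameter `ε = k / (λ 𝒰(a))`. -/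
def ExplorationModel.eps (m : ExplorationModel) : ℝ := m.k / (m.lam * m.hotelling m.a)

/-- Discount factor `e ^ (-r t)` at a time `t ∈ [0, ∞]`, with value `0` at `t = ∞`. -/
def ExplorationModel.discount (m : ExplorationModel) (t : ℝ≥0∞) : ℝ≥0∞ :=
  if t = ⊤ then 0 else ENNReal.ofReal (Real.exp (-m.r * t.toReal))

/-! ## Poisson process, deposits, information -/

section Exploration

variable {Ω : Type*} [MeasurableSpace Ω]

/-- `N` is a Poisson process on `[0, ∞)` with intensity `lam` under `P`. -/
structure IsPoissonProcess (N : ℝ≥0 → Ω → ℕ) (lam : ℝ≥0) (P : Measure Ω) : Prop where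
  measurable : ∀ u, Measurable (N u)
  zero : ∀ ω, N 0 ω = 0
  monotone : ∀ ω, Monotone fun u => N u ω
  rightCts : ∀ ω u, ContinuousWithinAt (fun v => N v ω) (Ici u) u
  indepIncrements : HasIndepIncrements N P
  law : ∀ s t, s ≤ t → P.map (fun ω => N t ω - N s ω) = poissonMeasure (lam * (t - s))

/-- The location `ξ_n` of the `n`-th deposit, with `ξ_0 = 0`
(`∞` if there are fewer than `n` deposits). -/
def depositLocation (N : ℝ≥0 → Ω → ℕ) (n : ℕ) (ω : Ω) : ℝ≥0∞ :=
  ⨅ (u : ℝ≥0) (_ : n ≤ N u ω), (u : ℝ≥0∞)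

/-- `X_n = ξ_n ∧ x`, the area explored after `n` exploration episodes. -/
def exploredArea (N : ℝ≥0 → Ω → ℕ) (x : ℝ≥0) (n : ℕ) (ω : Ω) : ℝ≥0 :=
  (min (depositLocation N n ω) x).toNNReal

variable {N : ℝ≥0 → Ω → ℕ} {lam : ℝ≥0} {P : Measure Ω}

/-- The natural filtration `(ℱ_u)` of the Poisson process. -/
def IsPoissonProcess.filtration (hN : IsPoissonProcess N lam P) :
    Filtration ℝ≥0 (inferInstance : MeasurableSpace Ω) :=
  Filtration.natural N fun u => (hN.measurable u).stronglyMeasurable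

theorem IsPoissonProcess.depositLocation_le_iff (hN : IsPoissonProcess N lam P)
    (n : ℕ) (u : ℝ≥0) (ω : Ω) : depositLocation N n ω ≤ u ↔ n ≤ N u ω := by
  constructor
  · intro h
    by_contra hlt
    have hc : ∀ᶠ v in nhdsWithin u (Ici u), N v ω = N u ω :=
      (hN.rightCts ω u).eventually (p := fun y => y = N u ω)
        ((isOpen_discrete {N u ω}).mem_nhds rfl)
    have hc' : ∀ᶠ v in nhdsWithin u (Ioi u), N v ω = N u ω :=
      hc.filter_mono (nhdsWithin_mono _ Ioi_subset_Ici_self)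
    obtain ⟨v, hv, hvu⟩ := (hc'.and self_mem_nhdsWithin).exists
    have hvle : (v : ℝ≥0∞) ≤ depositLocation N n ω := by
      refine le_iInf₂ fun w hw => ?_
      by_contra hwv
      have h1 : w ≤ v := by
        have := (not_le.1 hwv).le
        exact_mod_cast this
      have h2 := hN.monotone ω h1
      simp only [hv] at h2
      omega
    have h3 : (v : ℝ≥0∞) ≤ u := hvle.trans h
    have h4 : v ≤ u := by exact_mod_cast h3
    exact absurd hvu (not_lt.2 h4)
  · intro h
    exact iInf₂_le u h

/-- `X_n` is a stopping time of the filtration of the Poisson process. -/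
theorem IsPoissonProcess.isStoppingTime (hN : IsPoissonProcess N lam P) (x : ℝ≥0) (n : ℕ) :
    IsStoppingTime hN.filtration (fun ω => (exploredArea N x n ω : WithTop ℝ≥0)) := by
  intro u
  have hset : {ω | (exploredArea N x n ω : WithTop ℝ≥0) ≤ (u : WithTop ℝ≥0)} =
      {ω | n ≤ N u ω} ∪ {_ω | x ≤ u} := by
    ext ω
    have hne : min (depositLocation N n ω) (x : ℝ≥0∞) ≠ ⊤ :=
      ne_top_of_le_ne_top ENNReal.coe_ne_top (min_le_right _ _)
    change (exploredArea N x n ω : WithTop ℝ≥0) ≤ (u : WithTop ℝ≥0) ↔ n ≤ N u ω ∨ x ≤ u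
    rw [WithTop.coe_le_coe, exploredArea, ← ENNReal.coe_le_coe, ENNReal.coe_toNNReal hne,
      min_le_iff, hN.depositLocation_le_iff, ENNReal.coe_le_coe]
  rw [hset]
  refine MeasurableSet.union ?_ (MeasurableSet.const _)
  have hm : Measurable[hN.filtration u] (N u) := by
    have h := Filtration.stronglyAdapted_natural (u := N)
      fun v => (hN.measurable v).stronglyMeasurable
    exact (h u).measurable
  exact hm measurableSet_Ici

/-- The σ-field `ℱ_{X_n}` of the information available after `n` exploration episodes. -/
@[reducible] def IsPoissonProcess.info (hN : IsPoissonProcess N lam P) (x : ℝ≥0) (n : ℕ) :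
    MeasurableSpace Ω :=
  (hN.isStoppingTime x n).measurableSpace

/-! ## Bang-bang strategies -/

/-- The consumption rate at time `t` of the strategy `(θ, c)` started with unexplored area `x`:
`c⁰` before `θ_0`, `cⁿ⁺¹` on `[θ_n, θ_{n+1})` for `n < N_x`, and `c^{N_x + 1}` from `θ_{N_x}` on. -/
def consumptionRate (N : ℝ≥0 → Ω → ℕ) (x : ℝ≥0) (θ : ℕ → Ω → ℝ≥0∞) (c : ℕ → Ω → ℝ → ℝ≥0)
    (ω : Ω) (t : ℝ) : ℝ≥0 :=
  (if ENNReal.ofReal t < θ 0 ω then c 0 ω t else 0)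
    + (∑ n ∈ Finset.range (N x ω),
        if θ n ω ≤ ENNReal.ofReal t ∧ ENNReal.ofReal t < θ (n + 1) ω then c (n + 1) ω t else 0)
    + (if θ (N x ω) ω ≤ ENNReal.ofReal t then c (N x ω + 1) ω t else 0)

/-- `(θ, c)` is an admissible bang-bang strategy for unexplored area `x` and reserves `R`.
Here `θ n` is the time (possibly `∞`) at which the exploration episode following the first `n`
episodes starts. The budget constraint says that cumulative consumption up to `t` is at most `R`
plus the deposits found up to `t`. -/
structure IsAdmissible (m : ExplorationModel) (hN : IsPoissonProcess N lam P) (x R : ℝ≥0)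
    (θ : ℕ → Ω → ℝ≥0∞) (c : ℕ → Ω → ℝ → ℝ≥0) : Prop where
  monotone : ∀ ω, Monotone fun n => θ n ω
  measurable_time : ∀ n, Measurable[hN.info x n] (θ n)
  measurable_rate : ∀ n,
    Measurable[(hN.info x n).prod (inferInstance : MeasurableSpace ℝ)]
      (fun p : Ω × ℝ => c n p.1 p.2)
  budget : ∀ᵐ ω ∂P, ∀ t : ℝ, 0 ≤ t →
    ∫⁻ s in Ioc 0 t, (consumptionRate N x θ c ω s : ℝ≥0∞) ≤
      R + ENNReal.ofReal m.a *
        ∑ n ∈ Finset.range (N x ω), if θ n ω ≤ ENNReal.ofReal t then 1 else 0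

/-- Expected discounted utility of consumption. -/
def expectedUtility (m : ExplorationModel) (N : ℝ≥0 → Ω → ℕ) (P : Measure Ω) (x : ℝ≥0)
    (θ : ℕ → Ω → ℝ≥0∞) (c : ℕ → Ω → ℝ → ℝ≥0) : ℝ≥0∞ :=
  ∫⁻ ω, (∫⁻ t in Ioi (0 : ℝ),
    ENNReal.ofReal (Real.exp (-m.r * t) * m.utility (consumptionRate N x θ c ω t))) ∂P

/-- Expected discounted exploration cost; it is at most `k x`. -/
def expectedCost (m : ExplorationModel) (N : ℝ≥0 → Ω → ℕ) (P : Measure Ω) (x : ℝ≥0)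
    (θ : ℕ → Ω → ℝ≥0∞) : ℝ≥0∞ :=
  ∫⁻ ω, ENNReal.ofReal m.k * ∑ n ∈ Finset.range (N x ω + 1),
    m.discount (θ n ω) * ((exploredArea N x (n + 1) ω - exploredArea N x n ω : ℝ≥0) : ℝ≥0∞) ∂P

/-! ## Value function, exploration operator, regions -/

/-- The value function as an extended real number: supremum over the admissible strategies of
expected discounted utility minus (finite) expected discounted exploration cost. -/
def extendedValue (m : ExplorationModel) (hN : IsPoissonProcess N lam P) (x R : ℝ≥0) : EReal :=
  ⨆ (θ : ℕ → Ω → ℝ≥0∞) (c : ℕ → Ω → ℝ → ℝ≥0) (_ : IsAdmissible m hN x R θ c),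
    ((expectedUtility m N P x θ c : ℝ≥0∞) : EReal) - ((expectedCost m N P x θ : ℝ≥0∞) : EReal)

/-- The value function `V(x, R)`, for `x, R ≥ 0`. -/
def valueFunction (m : ExplorationModel) (hN : IsPoissonProcess N lam P) (x R : ℝ) : ℝ :=
  (extendedValue m hN x.toNNReal R.toNNReal).toReal

/-- The exploration operator applied to `V`: the value `MV(x, R)` of starting to explore at once,
until either the next deposit is found or the whole area is explored. -/
def explorationValue (m : ExplorationModel) (hN : IsPoissonProcess N lam P) (x R : ℝ) : ℝ :=
  (∫ s in (0 : ℝ)..x, valueFunction m hN (x - s) (R + m.a) * (m.lam * Real.exp (-m.lam * s)))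
    + m.hotelling R * Real.exp (-m.lam * x)
    - m.k * ((1 - Real.exp (-m.lam * x)) / m.lam)

/-- The consumption region `{V > MV}` in `[0, ∞)²`. -/
def consumptionRegion (m : ExplorationModel) (hN : IsPoissonProcess N lam P) : Set (ℝ × ℝ) :=
  {p | 0 ≤ p.1 ∧ 0 ≤ p.2 ∧ explorationValue m hN p.1 p.2 < valueFunction m hN p.1 p.2}

/-- The exploration region `{V = MV}` in `[0, ∞)²`. -/
def explorationRegion (m : ExplorationModel) (hN : IsPoissonProcess N lam P) : Set (ℝ × ℝ) :=
  {p | 0 ≤ p.1 ∧ 0 ≤ p.2 ∧ valueFunction m hN p.1 p.2 = explorationValue m hN p.1 p.2}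

end Exploration

/-- The equation for the critical reserve level at exhaustion. -/
def ExplorationModel.IsExhaustionLevel (m : ExplorationModel) (R : ℝ) : Prop :=
  m.α * (1 + m.a / R) ^ (m.α - 1) + (1 - m.α) * (1 + m.a / R) ^ m.α
    - (1 - m.α) * (m.a / R) ^ m.α * m.eps = 1

end

/-! Consumption is eliminated first. A known reserve `Z` consumed optimally along the exponential
path with rate `r / (1 - α)` is worth `B * Z ^ α`, and for any consumption during a block of time
that leaves `z`, the utility of the block plus the discounted value `B * z ^ α` is at most the
discounted value `B * Z ^ α` at its start, with equality on the exponential path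
(`blockUtility_add_le`, `blockUtility_depletion`). After division by `B`, a prospect of value `W` is
therefore interchangeable with a reserve `W ^ (1 / α)`. Consuming from `R` down to `S` and then
collecting `W S` is worth at most `(R - S + W(S) ^ (1 / α)) ^ α`. Time disappears, and the dynamic
programming equation reads: `v(x, ·)` is the `envelope` of `W(x, ·)`, the latter being the
exploration operator applied to `v`.

Solving the equation. Value iteration is run on pairs consisting of a value and its derivative in
the reserves. The invariant is `slope`: the reserve level `T(R)` whose marginal utility is the
marginal value at `R` grows at least at rate one. Averaging over the outcome of an exploration keeps
it, because a power mean with the negative exponent `α - 1` is superadditive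
(`inverseMarginal_stopMarginal_slope`). The envelope keeps it too, and is continuously
differentiable by smooth fit (`hasDerivAt_envelope`). The iteration contracts in a `C¹` distance
with exponential weight in the area, so a regular fixed point exists (`exists_fixedPoint`). No
uniqueness argument is needed, because verification identifies any regular solution with the value
function.

The free boundary. For exploring at once let `Z = W ^ (1 / α)` be its reserve equivalent and `T` the
level with marginal utility `∂W/∂R`. One explores where `Z > T` and consumes where `Z < T`. The
slope property gives a single crossing in `R`, hence a threshold. In the area direction the gap `W -
T ^ α` vanishes identically at `x = 0`, and at each of its zeros its derivative is `switchDrift Z`,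
a strictly decreasing function whose unique zero is `R_0` (`stopGapDeriv_eq`,
`strictAntiOn_switchDrift`). A barrier argument then shows that the gap is positive while `Z ≤ R_0`.
Hence for `x > 0` a nonpositive gap forces `Z > R_0`, where the drift is negative: consumption
regions grow with `x` and the threshold `ρ` strictly decreases, tending to `R_0` as `x ↓ 0`.

Smoothness. For fixed area the marginal value can have a kink only at `ρ`. Since `ρ` is strictly
monotone, a given reserve level is hit by the kink for at most one area, so integration over the
area removes it and `W` is twice differentiable in `R`. The gap has negative `R`-derivative at the
threshold by a strict tangent inequality, and the implicit function argument gives `ρ'` for `x > 0`.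
At `x = 0` the quotient for `ρ'` is `0 / 0`. Linearization gives `ρ' = A * (D - Y)` with `A → -1`,
`D → D₀` and `Y = (R_0 - ρ) / x`, and l'Hôpital's rule applied to `x * (R_0 - ρ) / x ^ 2` yields `Y
→ D₀ / 2`, so `ρ' → -D₀ / 2`.

Verification. By the strong Markov property at the deposits, the area up to the next one is
exponential and independent of the information `ℱ_{X_n}` (`lintegral_waitingArea`). Hence utility
collected so far plus discounted value of exploring, net of cost, is a supermartingale along the
episodes of any admissible strategy and a martingale for the threshold strategy
(`expectedUtility_le`, `le_expectedUtility_threshold`). All of this is done in `[0, ∞]` with the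
cost moved to the other side, so that no subtraction occurs before the end. -/

/-! ## Power utility -/

section PowerUtility

open Filter Topology

/-- Marginal utility of `R ↦ R ^ α`. -/
noncomputable def marginal (α T : ℝ) : ℝ := α * T ^ (α - 1)

/-- Inverse of the marginal utility. -/
noncomputable def inverseMarginal (α p : ℝ) : ℝ := (p / α) ^ (1 / (α - 1))

/-- Inverse of the utility. -/
noncomputable def reserveEquivalent (α w : ℝ) : ℝ := w ^ (1 / α)

variable {α : ℝ}

theorem marginal_pos (h0 : 0 < α) {T : ℝ} (hT : 0 < T) : 0 < marginal α T :=
  mul_pos h0 (Real.rpow_pos_of_pos hT _)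

theorem inverseMarginal_pos (h0 : 0 < α) {p : ℝ} (hp : 0 < p) : 0 < inverseMarginal α p :=
  Real.rpow_pos_of_pos (div_pos hp h0) _

theorem marginal_inverseMarginal (h0 : 0 < α) (h1 : α < 1) {p : ℝ} (hp : 0 < p) :
    marginal α (inverseMarginal α p) = p := by
  have : α - 1 ≠ 0 := by linarith
  rw [marginal, inverseMarginal, ← Real.rpow_mul (div_pos hp h0).le, one_div,
    inv_mul_cancel₀ this, Real.rpow_one]
  field_simp

theorem inverseMarginal_marginal (h0 : 0 < α) (h1 : α < 1) {T : ℝ} (hT : 0 < T) :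
    inverseMarginal α (marginal α T) = T := by
  have : α - 1 ≠ 0 := by linarith
  rw [marginal, inverseMarginal, mul_div_cancel_left₀ _ h0.ne', ← Real.rpow_mul hT.le, one_div,
    mul_inv_cancel₀ this, Real.rpow_one]

theorem marginal_le_marginal (h0 : 0 < α) (h1 : α < 1) {S T : ℝ} (hS : 0 < S) (hST : S ≤ T) :
    marginal α T ≤ marginal α S :=
  mul_le_mul_of_nonneg_left (Real.rpow_le_rpow_of_nonpos hS hST (by linarith)) h0.le

theorem marginal_lt_marginal (h0 : 0 < α) (h1 : α < 1) {S T : ℝ} (hS : 0 < S) (hST : S < T) :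
    marginal α T < marginal α S :=
  mul_lt_mul_of_pos_left (Real.rpow_lt_rpow_of_neg hS hST (by linarith)) h0

theorem inverseMarginal_le_iff (h0 : 0 < α) (h1 : α < 1) {p T : ℝ} (hp : 0 < p) (hT : 0 < T) :
    inverseMarginal α p ≤ T ↔ marginal α T ≤ p := by
  constructor
  · intro h
    have := marginal_le_marginal h0 h1 (inverseMarginal_pos h0 hp) h
    rwa [marginal_inverseMarginal h0 h1 hp] at this
  · intro h
    by_contra hc
    have := marginal_lt_marginal h0 h1 hT (not_le.1 hc)
    rw [marginal_inverseMarginal h0 h1 hp] at this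
    linarith

theorem le_inverseMarginal_iff (h0 : 0 < α) (h1 : α < 1) {p T : ℝ} (hp : 0 < p) (hT : 0 < T) :
    T ≤ inverseMarginal α p ↔ p ≤ marginal α T := by
  constructor
  · intro h
    have := marginal_le_marginal h0 h1 hT h
    rwa [marginal_inverseMarginal h0 h1 hp] at this
  · intro h
    by_contra hc
    have := marginal_lt_marginal h0 h1 (inverseMarginal_pos h0 hp) (not_le.1 hc)
    rw [marginal_inverseMarginal h0 h1 hp] at this
    linarith

theorem continuousOn_inverseMarginal (h0 : 0 < α) :
    ContinuousOn (inverseMarginal α) (Ioi 0) := fun _ hp =>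
  ((continuousAt_id.div_const α).rpow_const
    (Or.inl (div_pos hp h0).ne')).continuousWithinAt

theorem continuousOn_marginal : ContinuousOn (marginal α) (Ioi 0) := fun _ hp =>
  (continuousAt_const.mul (continuousAt_id.rpow_const (Or.inl (ne_of_gt hp)))).continuousWithinAt

theorem continuous_reserveEquivalent (h0 : 0 < α) : Continuous (reserveEquivalent α) :=
  Real.continuous_rpow_const (one_div_nonneg.2 h0.le)

theorem reserveEquivalent_nonneg {w : ℝ} (hw : 0 ≤ w) : 0 ≤ reserveEquivalent α w :=
  Real.rpow_nonneg hw _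

theorem reserveEquivalent_pos {w : ℝ} (hw : 0 < w) : 0 < reserveEquivalent α w :=
  Real.rpow_pos_of_pos hw _

theorem reserveEquivalent_rpow (h0 : 0 < α) {w : ℝ} (hw : 0 ≤ w) :
    reserveEquivalent α w ^ α = w := by
  rw [reserveEquivalent, ← Real.rpow_mul hw, one_div, inv_mul_cancel₀ h0.ne', Real.rpow_one]

theorem reserveEquivalent_of_rpow (h0 : 0 < α) {Z : ℝ} (hZ : 0 ≤ Z) :
    reserveEquivalent α (Z ^ α) = Z := by
  rw [reserveEquivalent, ← Real.rpow_mul hZ, one_div, mul_inv_cancel₀ h0.ne', Real.rpow_one]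

theorem reserveEquivalent_le_reserveEquivalent (h0 : 0 < α) {v w : ℝ} (hv : 0 ≤ v) (h : v ≤ w) :
    reserveEquivalent α v ≤ reserveEquivalent α w :=
  Real.rpow_le_rpow hv h (one_div_nonneg.2 h0.le)

theorem hasDerivAt_rpow_marginal {Z : ℝ} (hZ : 0 < Z) :
    HasDerivAt (fun R : ℝ => R ^ α) (marginal α Z) Z := by
  simpa [marginal] using Real.hasDerivAt_rpow_const (p := α) (Or.inl hZ.ne')

theorem hasDerivAt_shift_rpow {c Z : ℝ} (hZ : 0 < Z + c) :
    HasDerivAt (fun R : ℝ => (R + c) ^ α) (marginal α (Z + c)) Z := by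
  simpa using (hasDerivAt_rpow_marginal (α := α) hZ).comp_add_const Z c

/-- Increments of the concave function `z ↦ z ^ α` decrease. -/
theorem rpow_increment_antitone (h0 : 0 < α) (h1 : α < 1) {c Y Z : ℝ} (hc : 0 ≤ c) (hY : 0 ≤ Y)
    (hYZ : Y ≤ Z) : (Z + c) ^ α - Z ^ α ≤ (Y + c) ^ α - Y ^ α := by
  have hanti : AntitoneOn (fun z : ℝ => (z + c) ^ α - z ^ α) (Ici 0) := by
    refine antitoneOn_of_hasDerivWithinAt_nonpos (convex_Ici 0)
      (f' := fun z => marginal α (z + c) - marginal α z) ?_ ?_ ?_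
    · exact (((Real.continuous_rpow_const h0.le).comp (continuous_id.add_const c)).sub
        (Real.continuous_rpow_const h0.le)).continuousOn
    · intro z hz
      rw [interior_Ici, mem_Ioi] at hz
      exact ((hasDerivAt_shift_rpow (by linarith)).sub
        (hasDerivAt_rpow_marginal hz)).hasDerivWithinAt
    · intro z hz
      rw [interior_Ici, mem_Ioi] at hz
      have := marginal_le_marginal h0 h1 hz (by linarith : z ≤ z + c)
      linarith
  exact hanti hY (hY.trans hYZ) hYZ

/-- The map `w ↦ (c + w ^ (1 / α)) ^ α` is nonexpansive. -/
theorem shift_reserveEquivalent_sub_le (h0 : 0 < α) (h1 : α < 1) {c v w e : ℝ} (hc : 0 ≤ c)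
    (hv : 0 ≤ v) (hw : 0 ≤ w) (he : 0 ≤ e) (h : v ≤ w + e) :
    (c + reserveEquivalent α v) ^ α ≤ (c + reserveEquivalent α w) ^ α + e := by
  rcases le_total v w with hvw | hvw
  · have := Real.rpow_le_rpow (add_nonneg hc (reserveEquivalent_nonneg (α := α) hv))
      (add_le_add_right (reserveEquivalent_le_reserveEquivalent h0 hv hvw) c) h0.le
    linarith
  · have := rpow_increment_antitone h0 h1 hc (reserveEquivalent_nonneg (α := α) hw)
      (reserveEquivalent_le_reserveEquivalent h0 hw hvw)
    rw [reserveEquivalent_rpow h0 hv, reserveEquivalent_rpow h0 hw] at this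
    rw [add_comm c, add_comm c]
    linarith

/-- Strict two-point convexity of a negative power. -/
theorem rpow_neg_convex {γ : ℝ} (hγ : γ < 0) {θ τ : ℝ} (hθ0 : 0 ≤ θ) (hθ1 : θ ≤ 1) (hτ : 0 < τ) :
    (θ * τ + (1 - θ)) ^ γ ≤ θ * τ ^ γ + (1 - θ) ∧
    (0 < θ → θ < 1 → τ ≠ 1 → (θ * τ + (1 - θ)) ^ γ < θ * τ ^ γ + (1 - θ)) := by
  have hm : 0 < θ * τ + (1 - θ) := by
    rcases hθ0.eq_or_lt with h | h
    · rw [← h]; norm_num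
    · have := mul_pos h hτ
      linarith
  -- The weighted geometric mean `τ ^ θ` is interposed: convexity of `exp` compares its power with
  -- the right side, concavity of `log` and `γ < 0` compare it with the left side. Strictness is
  -- taken from `log` alone.
  have hexp : Real.exp (θ * (Real.log τ * γ)) ≤ θ * τ ^ γ + (1 - θ) := by
    have := convexOn_exp.2 (mem_univ (Real.log τ * γ)) (mem_univ (0 : ℝ)) hθ0
      (sub_nonneg.2 hθ1) (by ring)
    simpa [Real.rpow_def_of_pos hτ] using this
  have hlog : θ * Real.log τ ≤ Real.log (θ * τ + (1 - θ)) := by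
    have := strictConcaveOn_log_Ioi.concaveOn.2 (mem_Ioi.2 hτ) (mem_Ioi.2 one_pos) hθ0
      (sub_nonneg.2 hθ1) (by ring)
    simpa using this
  rw [Real.rpow_def_of_pos hm]
  refine ⟨le_trans (Real.exp_le_exp.2 ?_) hexp, fun h0 h1 hne => lt_of_lt_of_le
    (Real.exp_lt_exp.2 ?_) hexp⟩
  · nlinarith
  · have hlog' : θ * Real.log τ < Real.log (θ * τ + (1 - θ)) := by
      have := strictConcaveOn_log_Ioi.2 (mem_Ioi.2 hτ) (mem_Ioi.2 one_pos) hne h0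
        (sub_pos.2 h1) (by ring)
      simpa using this
    nlinarith

/-- Tangent inequality behind the superadditivity of power means of negative exponent. -/
theorem marginal_shift_le (h0 : 0 < α) (h1 : α < 1) {T m h : ℝ} (hT : 0 < T) (hm : 0 < m)
    (hh : 0 ≤ h) :
    marginal α (T + h) ≤ marginal α (m + h) +
        m / (m + h) * (marginal α (m + h) / marginal α m) * (marginal α T - marginal α m) ∧
    (0 < h → T ≠ m → marginal α (T + h) < marginal α (m + h) +
        m / (m + h) * (marginal α (m + h) / marginal α m) * (marginal α T - marginal α m)) := by
  have hmh : 0 < m + h := by linarith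
  -- By homogeneity, `T + h` is `m + h` times the convex combination of `T / m` and `1` with this
  -- weight, so the claim is two-point convexity of a negative power.
  set θ := m / (m + h) with hθ
  have hθ0 : 0 < θ := div_pos hm hmh
  have hθ1 : θ ≤ 1 := (div_le_one hmh).2 (by linarith)
  obtain ⟨c1, c2⟩ := rpow_neg_convex (γ := α - 1) (by linarith) hθ0.le hθ1 (div_pos hT hm)
  have e1 : T + h = (m + h) * (θ * (T / m) + (1 - θ)) := by
    rw [hθ]; field_simp; ring
  have hpos : 0 < θ * (T / m) + (1 - θ) := by
    have : 0 < T + h := by linarith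
    rw [e1] at this
    exact pos_of_mul_pos_right this hmh.le
  have e2 : marginal α (T + h) = marginal α (m + h) * (θ * (T / m) + (1 - θ)) ^ (α - 1) := by
    rw [marginal, marginal, e1, Real.mul_rpow hmh.le hpos.le]; ring
  have e3 : marginal α (m + h) + θ * (marginal α (m + h) / marginal α m) *
      (marginal α T - marginal α m) =
      marginal α (m + h) * (θ * (T / m) ^ (α - 1) + (1 - θ)) := by
    have hp : (m : ℝ) ^ (α - 1) ≠ 0 := (Real.rpow_pos_of_pos hm _).ne'
    rw [marginal, marginal, marginal, Real.div_rpow hT.le hm.le]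
    field_simp
    ring
  have hmp := marginal_pos (α := α) h0 hmh
  rw [e3, e2]
  refine ⟨mul_le_mul_of_nonneg_left c1 hmp.le, fun hh0 hne =>
    mul_lt_mul_of_pos_left (c2 hθ0 ((div_lt_one hmh).2 (by linarith)) ?_) hmp⟩
  intro h
  exact hne ((div_eq_one_iff_eq hm.ne').1 h)

end PowerUtility

/-! ## The consumption envelope -/

section Envelope

open Filter Topology

/-- Value of consuming optimally from `R` down to the best level `S ≤ R`, where the value `W S` is
collected; in units in which a reserve `R` without exploration is worth `R ^ α`. -/
noncomputable def envelope (α : ℝ) (W : ℝ → ℝ) (R : ℝ) : ℝ :=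
  sSup ((fun S => (R - S + reserveEquivalent α (W S)) ^ α) '' Icc 0 R)

variable {α : ℝ} {W P : ℝ → ℝ}

theorem isGreatest_envelope (h0 : 0 < α) (hW : ContinuousOn W (Ici 0)) {R : ℝ}
    (hR : 0 ≤ R) :
    IsGreatest ((fun S => (R - S + reserveEquivalent α (W S)) ^ α) '' Icc 0 R)
      (envelope α W R) := by
  have hc : ContinuousOn (fun S => (R - S + reserveEquivalent α (W S)) ^ α) (Icc 0 R) :=
    (Real.continuous_rpow_const h0.le).comp_continuousOn
      ((continuousOn_const.sub continuousOn_id).add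
        ((continuous_reserveEquivalent h0).comp_continuousOn
          (hW.mono Icc_subset_Ici_self)))
  exact (isCompact_Icc.image_of_continuousOn hc).isGreatest_sSup
    ((nonempty_Icc.2 hR).image _)

theorem le_envelope (h0 : 0 < α) (hW : ContinuousOn W (Ici 0)) {R S : ℝ}
    (hS : 0 ≤ S) (hSR : S ≤ R) :
    (R - S + reserveEquivalent α (W S)) ^ α ≤ envelope α W R :=
  (isGreatest_envelope h0 hW (hS.trans hSR)).2 ⟨S, ⟨hS, hSR⟩, rfl⟩

theorem exists_envelope_eq (h0 : 0 < α) (hW : ContinuousOn W (Ici 0)) {R : ℝ} (hR : 0 ≤ R) :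
    ∃ S ∈ Icc 0 R, (R - S + reserveEquivalent α (W S)) ^ α = envelope α W R :=
  (isGreatest_envelope h0 hW hR).1

/-- The stopping level that is best for `W` is available for `W'` as well, and at a fixed level the
map from `W S` to the payoff is nonexpansive. So the envelope is nonexpansive in the supremum norm,
and all contraction comes from the integral over the area. -/
theorem envelope_le_add (h0 : 0 < α) (h1 : α < 1) {W' : ℝ → ℝ} (hW : ContinuousOn W (Ici 0))
    (hW' : ContinuousOn W' (Ici 0)) (hn : ∀ R, 0 ≤ R → 0 ≤ W R) (hn' : ∀ R, 0 ≤ R → 0 ≤ W' R)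
    {R e : ℝ} (hR : 0 ≤ R) (he : 0 ≤ e) (h : ∀ S ∈ Icc 0 R, W S ≤ W' S + e) :
    envelope α W R ≤ envelope α W' R + e := by
  obtain ⟨S, hS, hSe⟩ := exists_envelope_eq h0 hW hR
  rw [← hSe]
  have := shift_reserveEquivalent_sub_le h0 h1 (sub_nonneg.2 hS.2) (hn S hS.1) (hn' S hS.1) he
    (h S hS)
  linarith [le_envelope h0 hW' hS.1 hS.2]

theorem abs_envelope_sub_le (h0 : 0 < α) (h1 : α < 1) {W' : ℝ → ℝ} (hW : ContinuousOn W (Ici 0))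
    (hW' : ContinuousOn W' (Ici 0)) (hn : ∀ R, 0 ≤ R → 0 ≤ W R) (hn' : ∀ R, 0 ≤ R → 0 ≤ W' R)
    {R e : ℝ} (hR : 0 ≤ R) (h : ∀ S ∈ Icc 0 R, |W S - W' S| ≤ e) :
    |envelope α W R - envelope α W' R| ≤ e := by
  have he : 0 ≤ e := (abs_nonneg _).trans (h 0 (left_mem_Icc.2 hR))
  rw [abs_le]
  constructor
  · have := envelope_le_add h0 h1 hW' hW hn' hn hR he
      fun S hS => by linarith [(abs_le.1 (h S hS)).1]
    linarith
  · have := envelope_le_add h0 h1 hW hW' hn hn' hR he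
      fun S hS => by linarith [(abs_le.1 (h S hS)).2]
    linarith

/-- `W` is the value of stopping consumption, with derivative `P`; `slope` says that the reserve
level with marginal utility `P R` grows at least as fast as `R`. -/
structure StoppingProfile (α : ℝ) (W P : ℝ → ℝ) : Prop where
  cont : ContinuousOn W (Ici 0)
  nonneg : 0 ≤ W 0
  deriv : ∀ R, 0 < R → HasDerivAt W (P R) R
  pos : ∀ R, 0 < R → 0 < P R
  contDeriv : ContinuousOn P (Ioi 0)
  slope : ∀ R R', 0 < R → R ≤ R' →
    inverseMarginal α (P R) + (R' - R) ≤ inverseMarginal α (P R')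

/-! ### Single crossing and smooth fit for the envelope. -/

namespace StoppingProfile

theorem strictMonoOn (hp : StoppingProfile α W P) : StrictMonoOn W (Ici 0) := by
  refine strictMonoOn_of_hasDerivWithinAt_pos (convex_Ici 0) (f' := P) hp.cont ?_ ?_
  · intro R hR
    rw [interior_Ici] at hR
    exact (hp.deriv R hR).hasDerivWithinAt
  · intro R hR
    rw [interior_Ici] at hR
    exact hp.pos R hR

theorem value_nonneg (hp : StoppingProfile α W P) {R : ℝ} (hR : 0 ≤ R) : 0 ≤ W R :=
  hp.nonneg.trans (hp.strictMonoOn.monotoneOn self_mem_Ici hR hR)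

theorem value_pos (hp : StoppingProfile α W P) {R : ℝ} (hR : 0 < R) : 0 < W R :=
  hp.nonneg.trans_lt (hp.strictMonoOn self_mem_Ici (mem_Ici.2 hR.le) hR)

/-- Once `Z ≤ T`, this remains so for larger reserves. -/
theorem le_of_le (h0 : 0 < α) (h1 : α < 1) (hp : StoppingProfile α W P) {R R' : ℝ} (hR : 0 < R)
    (hRR : R ≤ R') (h : reserveEquivalent α (W R) ≤ inverseMarginal α (P R)) :
    reserveEquivalent α (W R') ≤ inverseMarginal α (P R) + (R' - R) := by
  set T := inverseMarginal α (P R) with hT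
  have hTp : 0 < T := inverseMarginal_pos h0 (hp.pos R hR)
  -- The translate `r ↦ (r + (T - R)) ^ α` is the value of a pure reserve that equals `T` at `R`. By
  -- `slope` its derivative dominates `P`, so `W` cannot overtake it.
  have hanti : AntitoneOn (fun r => W r - (r + (T - R)) ^ α) (Icc R R') := by
    refine antitoneOn_of_hasDerivWithinAt_nonpos (convex_Icc R R')
      (f' := fun r => P r - marginal α (r + (T - R))) ?_ ?_ ?_
    · exact (hp.cont.mono fun r hr => hR.le.trans hr.1).sub
        ((Real.continuous_rpow_const h0.le).comp (continuous_id.add_const _)).continuousOn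
    · intro r hr
      rw [interior_Icc] at hr
      exact ((hp.deriv r (hR.trans hr.1)).sub
        (hasDerivAt_shift_rpow (by linarith [hr.1]))).hasDerivWithinAt
    · intro r hr
      rw [interior_Icc] at hr
      have hr0 := hR.trans hr.1
      have := (le_inverseMarginal_iff h0 h1 (hp.pos r hr0)
        (by linarith [hr.1] : 0 < r + (T - R))).1 (by linarith [hp.slope R r hR hr.1.le])
      linarith
  have h2 := hanti (left_mem_Icc.2 hRR) (right_mem_Icc.2 hRR) hRR
  simp only at h2
  have h3 : W R ≤ T ^ α := by
    rw [← reserveEquivalent_rpow h0 (hp.value_nonneg hR.le)]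
    exact Real.rpow_le_rpow (reserveEquivalent_nonneg (hp.value_nonneg hR.le)) h h0.le
  rw [show R + (T - R) = T by ring] at h2
  have h4 : W R' ≤ (R' + (T - R)) ^ α := by linarith
  have h5 := reserveEquivalent_le_reserveEquivalent h0 (hp.value_nonneg (hR.le.trans hRR)) h4
  rw [reserveEquivalent_of_rpow h0 (by linarith)] at h5
  linarith

/-- Single crossing: `Z` grows at most as fast as the reserve once it lies below `T`, while `T`
grows at least as fast. This is why consuming is optimal on an upper half-line of reserves. -/
theorem le_mono (h0 : 0 < α) (h1 : α < 1) (hp : StoppingProfile α W P) {R R' : ℝ} (hR : 0 < R)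
    (hRR : R ≤ R') (h : reserveEquivalent α (W R) ≤ inverseMarginal α (P R)) :
    reserveEquivalent α (W R') ≤ inverseMarginal α (P R') :=
  (hp.le_of_le h0 h1 hR hRR h).trans (hp.slope R R' hR hRR)

theorem hasDerivAt_reserveEquivalent (h0 : 0 < α) (hp : StoppingProfile α W P) {R : ℝ}
    (hR : 0 < R) :
    HasDerivAt (fun r => reserveEquivalent α (W r))
      (P R / marginal α (reserveEquivalent α (W R))) R := by
  have hW := hp.value_pos hR
  have h := (hp.deriv R hR).rpow_const (p := 1 / α) (Or.inl hW.ne')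
  refine h.congr_deriv ?_
  have e : (W R) ^ (1 / α - 1) = (reserveEquivalent α (W R) ^ (α - 1))⁻¹ := by
    rw [reserveEquivalent, ← Real.rpow_mul hW.le, ← Real.rpow_neg hW.le]
    congr 1
    field_simp
    ring
  rw [e, marginal]
  have : reserveEquivalent α (W R) ^ (α - 1) ≠ 0 :=
    (Real.rpow_pos_of_pos (reserveEquivalent_pos hW) _).ne'
  field_simp

theorem continuousOn_reserveEquivalent (h0 : 0 < α) (hp : StoppingProfile α W P) :
    ContinuousOn (fun r => reserveEquivalent α (W r)) (Ici 0) :=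
  (continuous_reserveEquivalent h0).comp_continuousOn hp.cont

theorem continuousOn_inverseMarginal (h0 : 0 < α) (hp : StoppingProfile α W P) :
    ContinuousOn (fun r => inverseMarginal α (P r)) (Ioi 0) :=
  (_root_.continuousOn_inverseMarginal h0).comp hp.contDeriv hp.pos

/-- The gain `Z(r) - r` is what the choice of the stopping level maximizes. Its derivative is `P /
marginal Z - 1`, whose sign is that of `Z` compared with `T`, in reverse. -/
theorem antitoneOn_gain (h0 : 0 < α) (h1 : α < 1) (hp : StoppingProfile α W P) {R : ℝ}
    (hR : 0 < R) (h : reserveEquivalent α (W R) ≤ inverseMarginal α (P R)) :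
    AntitoneOn (fun r => reserveEquivalent α (W r) - r) (Ici R) := by
  refine antitoneOn_of_hasDerivWithinAt_nonpos (convex_Ici R)
    (f' := fun r => P r / marginal α (reserveEquivalent α (W r)) - 1) ?_ ?_ ?_
  · exact ((hp.continuousOn_reserveEquivalent h0).mono (Ici_subset_Ici.2 hR.le)).sub
      continuousOn_id
  · intro r hr
    rw [interior_Ici] at hr
    exact ((hp.hasDerivAt_reserveEquivalent h0 (hR.trans hr)).sub
      (hasDerivAt_id r)).hasDerivWithinAt
  · intro r hr
    rw [interior_Ici] at hr
    have hr0 := hR.trans hr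
    have hz := reserveEquivalent_pos (α := α) (hp.value_pos hr0)
    have := (le_inverseMarginal_iff h0 h1 (hp.pos r hr0) hz).1
      (hp.le_mono h0 h1 hR (le_of_lt hr) h)
    have := (div_le_one (marginal_pos h0 hz)).2 this
    linarith

theorem monotoneOn_gain (h0 : 0 < α) (h1 : α < 1) (hp : StoppingProfile α W P) {R R' : ℝ}
    (hR : 0 ≤ R)
    (h : ∀ r ∈ Ioo R R', inverseMarginal α (P r) ≤ reserveEquivalent α (W r)) :
    MonotoneOn (fun r => reserveEquivalent α (W r) - r) (Icc R R') := by
  refine monotoneOn_of_hasDerivWithinAt_nonneg (convex_Icc R R')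
    (f' := fun r => P r / marginal α (reserveEquivalent α (W r)) - 1) ?_ ?_ ?_
  · exact ((hp.continuousOn_reserveEquivalent h0).mono fun r hr => hR.trans hr.1).sub
      continuousOn_id
  · intro r hr
    rw [interior_Icc] at hr
    exact ((hp.hasDerivAt_reserveEquivalent h0 (hR.trans_lt hr.1)).sub
      (hasDerivAt_id r)).hasDerivWithinAt
  · intro r hr
    rw [interior_Icc] at hr
    have hr0 := hR.trans_lt hr.1
    have hz := reserveEquivalent_pos (α := α) (hp.value_pos hr0)
    have := (inverseMarginal_le_iff h0 h1 (hp.pos r hr0) hz).1 (h r hr)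
    have := (one_le_div (marginal_pos h0 hz)).2 this
    linarith

theorem value_le_envelope (h0 : 0 < α) (hp : StoppingProfile α W P) {R : ℝ} (hR : 0 ≤ R) :
    W R ≤ envelope α W R := by
  have := le_envelope h0 hp.cont hR le_rfl
  rwa [sub_self, zero_add, reserveEquivalent_rpow h0 (hp.value_nonneg hR)] at this

theorem envelope_nonneg (h0 : 0 < α) (hp : StoppingProfile α W P) {R : ℝ} (hR : 0 ≤ R) :
    0 ≤ envelope α W R := (hp.value_nonneg hR).trans (hp.value_le_envelope h0 hR)

theorem envelope_pos (h0 : 0 < α) (hp : StoppingProfile α W P) {R : ℝ} (hR : 0 < R) :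
    0 < envelope α W R := (hp.value_pos hR).trans_le (hp.value_le_envelope h0 hR.le)

theorem le_reserveEquivalent_envelope (h0 : 0 < α) (hp : StoppingProfile α W P) {R S : ℝ}
    (hS : 0 ≤ S) (hSR : S ≤ R) :
    R - S + reserveEquivalent α (W S) ≤ reserveEquivalent α (envelope α W R) := by
  have hz := reserveEquivalent_nonneg (α := α) (hp.value_nonneg hS)
  have := reserveEquivalent_le_reserveEquivalent h0
    (Real.rpow_nonneg (add_nonneg (sub_nonneg.2 hSR) hz) _) (le_envelope h0 hp.cont hS hSR)
  rwa [reserveEquivalent_of_rpow h0 (add_nonneg (sub_nonneg.2 hSR) hz)] at this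

theorem exists_reserveEquivalent_envelope (h0 : 0 < α) (hp : StoppingProfile α W P) {R : ℝ}
    (hR : 0 ≤ R) :
    ∃ S ∈ Icc 0 R,
      reserveEquivalent α (envelope α W R) = R - S + reserveEquivalent α (W S) := by
  obtain ⟨S, hS, h⟩ := exists_envelope_eq h0 hp.cont hR
  refine ⟨S, hS, ?_⟩
  rw [← h, reserveEquivalent_of_rpow h0 (add_nonneg (sub_nonneg.2 hS.2)
    (reserveEquivalent_nonneg (hp.value_nonneg hS.1)))]

theorem reserveEquivalent_envelope_slope (h0 : 0 < α) (hp : StoppingProfile α W P) {R R' : ℝ}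
    (hR : 0 ≤ R) (hRR : R ≤ R') :
    reserveEquivalent α (envelope α W R) + (R' - R) ≤
      reserveEquivalent α (envelope α W R') := by
  obtain ⟨S, hS, h⟩ := hp.exists_reserveEquivalent_envelope h0 hR
  have := hp.le_reserveEquivalent_envelope h0 hS.1 (hS.2.trans hRR)
  linarith

/-- Where the marginal value of stopping exceeds that of consumption, one stops at once. -/
theorem envelope_eq_value (h0 : 0 < α) (h1 : α < 1) (hp : StoppingProfile α W P) {R : ℝ}
    (hR : 0 ≤ R)
    (h : ∀ r ∈ Ioo 0 R, inverseMarginal α (P r) ≤ reserveEquivalent α (W r)) :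
    envelope α W R = W R := by
  refine le_antisymm ?_ (hp.value_le_envelope h0 hR)
  obtain ⟨S, hS, he⟩ := exists_envelope_eq h0 hp.cont hR
  rw [← he]
  have hmono := hp.monotoneOn_gain h0 h1 le_rfl h hS (right_mem_Icc.2 hR) hS.2
  simp only at hmono
  conv_rhs => rw [← reserveEquivalent_rpow h0 (hp.value_nonneg hR)]
  exact Real.rpow_le_rpow (add_nonneg (sub_nonneg.2 hS.2)
    (reserveEquivalent_nonneg (hp.value_nonneg hS.1))) (by linarith) h0.le

theorem envelope_eq_value_of_lt (h0 : 0 < α) (h1 : α < 1) (hp : StoppingProfile α W P) {R : ℝ}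
    (hR : 0 < R) (h : inverseMarginal α (P R) < reserveEquivalent α (W R)) :
    envelope α W R = W R := by
  refine hp.envelope_eq_value h0 h1 hR.le fun r hr => ?_
  -- If consuming were at least as good at some `r < R`, single crossing would carry this to `R`.
  by_contra hc
  exact absurd (hp.le_mono h0 h1 hr.1 hr.2.le (not_le.1 hc).le) (not_le.2 h)

/-- It says that, where consuming is weakly better, the marginal utility at the reserve equivalent
of the envelope dominates `P`. This selects the correct branch of the maximum in
`hasDerivAt_envelope`. -/
theorem reserveEquivalent_envelope_le (h0 : 0 < α) (h1 : α < 1) (hp : StoppingProfile α W P)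
    {R : ℝ} (hR : 0 < R) (h : reserveEquivalent α (W R) ≤ inverseMarginal α (P R)) :
    reserveEquivalent α (envelope α W R) ≤ inverseMarginal α (P R) := by
  have key : ∀ S ∈ Ioc 0 R, R - S + reserveEquivalent α (W S) ≤ inverseMarginal α (P R) := by
    intro S hS
    -- Let `s` be the first point of `[S, R]` with `Z ≤ T`. The gain increases on `[S, s]`, so `R -
    -- S + Z(S) ≤ R - s + Z(s) ≤ R - s + T(s) ≤ T(R)`, the last step by `slope`.
    set B := {s | reserveEquivalent α (W s) ≤ inverseMarginal α (P s)} ∩ Icc S R with hB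
    have hBc : IsClosed B := by
      have hc1 : ContinuousOn (fun r => reserveEquivalent α (W r)) (Icc S R) :=
        (hp.continuousOn_reserveEquivalent h0).mono fun r hr => hS.1.le.trans hr.1
      have hc2 : ContinuousOn (fun r => inverseMarginal α (P r)) (Icc S R) :=
        (hp.continuousOn_inverseMarginal h0).mono fun r hr => hS.1.trans_le hr.1
      have := isClosed_Icc.isClosed_le hc1 hc2
      convert this using 1
      ext; simp [hB, and_comm]
    have hBne : B.Nonempty := ⟨R, h, hS.2, le_rfl⟩
    have hBb : BddBelow B := ⟨S, fun s hs => hs.2.1⟩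
    obtain ⟨hs1, hs2⟩ := hBc.csInf_mem hBne hBb
    set s := sInf B
    have hmono := hp.monotoneOn_gain (R := S) (R' := s) h0 h1 hS.1.le fun r hr => by
      by_contra hc
      have : r ∈ B := ⟨(not_le.1 hc).le, hr.1.le, hr.2.le.trans hs2.2⟩
      exact absurd (csInf_le hBb this) (not_le.2 hr.2)
    have h2 := hmono (left_mem_Icc.2 hs2.1) (right_mem_Icc.2 hs2.1) hs2.1
    have h3 := hp.slope s R (hS.1.trans_le hs2.1) hs2.2
    have h4 : reserveEquivalent α (W s) ≤ inverseMarginal α (P s) := hs1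
    simp only at h2
    linarith
  obtain ⟨S, hS, he⟩ := hp.exists_reserveEquivalent_envelope h0 hR.le
  rw [he]
  rcases hS.1.eq_or_lt with h' | h'
  · subst h'
    -- The derivative `P` is controlled only for positive reserves, so the level `S = 0` is reached
    -- as a limit.
    have ht : Tendsto (fun S => R - S + reserveEquivalent α (W S)) (𝓝[>] 0)
        (𝓝 (R - 0 + reserveEquivalent α (W 0))) := by
      refine ((tendsto_const_nhds.sub (tendsto_id.mono_left nhdsWithin_le_nhds)).add ?_)
      exact ((hp.continuousOn_reserveEquivalent h0) 0 self_mem_Ici).mono_left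
        (nhdsWithin_mono _ Ioi_subset_Ici_self)
    refine le_of_tendsto ht ?_
    filter_upwards [Ioc_mem_nhdsGT hR] with S hS using key S hS
  · exact key S ⟨h', hS.2⟩

/-- In the consumption regime the reserve equivalent grows at rate one. -/
theorem reserveEquivalent_envelope_eq (h0 : 0 < α) (h1 : α < 1) (hp : StoppingProfile α W P)
    {R R' : ℝ} (hR : 0 < R) (hRR : R ≤ R')
    (h : reserveEquivalent α (W R) ≤ inverseMarginal α (P R)) :
    reserveEquivalent α (envelope α W R') =
      reserveEquivalent α (envelope α W R) + (R' - R) := by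
  refine le_antisymm ?_ (hp.reserveEquivalent_envelope_slope h0 hR.le hRR)
  obtain ⟨S, hS, he⟩ := hp.exists_reserveEquivalent_envelope h0 (hR.le.trans hRR)
  rw [he]
  rcases le_total S R with hSR | hSR
  · linarith [hp.le_reserveEquivalent_envelope h0 hS.1 hSR]
  · have h2 := hp.antitoneOn_gain h0 h1 hR h self_mem_Ici (mem_Ici.2 hSR) hSR
    have h3 := hp.le_reserveEquivalent_envelope h0 hR.le le_rfl
    simp only at h2
    linarith

theorem envelope_eq_shift (h0 : 0 < α) (h1 : α < 1) (hp : StoppingProfile α W P)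
    {R R' : ℝ} (hR : 0 < R) (hRR : R ≤ R')
    (h : reserveEquivalent α (W R) ≤ inverseMarginal α (P R)) :
    envelope α W R' = (R' + (reserveEquivalent α (envelope α W R) - R)) ^ α := by
  conv_lhs => rw [← reserveEquivalent_rpow h0 (hp.envelope_nonneg h0 (hR.le.trans hRR))]
  rw [hp.reserveEquivalent_envelope_eq h0 h1 hR hRR h]
  congr 1
  ring

end StoppingProfile

/-- For the point of smooth fit: nearby, the envelope may switch between two functions in an
uncontrolled way, but both have the same value and slope there. -/
theorem hasDerivAt_of_eq_or_eq {f g h : ℝ → ℝ} {c x : ℝ} (hg : HasDerivAt g c x)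
    (hh : HasDerivAt h c x) (hgx : g x = f x) (hhx : h x = f x)
    (hf : ∀ᶠ y in 𝓝 x, f y = g y ∨ f y = h y) : HasDerivAt f c x := by
  rw [hasDerivAt_iff_isLittleO, Asymptotics.isLittleO_iff] at *
  intro e he
  filter_upwards [hg he, hh he, hf] with y h1 h2 h3
  rcases h3 with h3 | h3
  · rw [h3, ← hgx]; exact h1
  · rw [h3, ← hhx]; exact h2

namespace StoppingProfile

/-- Smooth fit. Where `T < Z` the envelope is locally `W`, where `Z < T` it is locally a translate
of `r ^ α`. Where `Z = T` the equality of the levels is equality of the two slopes. -/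
theorem hasDerivAt_envelope (h0 : 0 < α) (h1 : α < 1) (hp : StoppingProfile α W P) {R : ℝ}
    (hR : 0 < R) :
    HasDerivAt (envelope α W)
      (max (P R) (marginal α (reserveEquivalent α (envelope α W R)))) R := by
  have hcZ : ContinuousAt (fun r => reserveEquivalent α (W r)) R :=
    (hp.continuousOn_reserveEquivalent h0).continuousAt (Ici_mem_nhds hR)
  have hcT : ContinuousAt (fun r => inverseMarginal α (P r)) R :=
    (hp.continuousOn_inverseMarginal h0).continuousAt (Ioi_mem_nhds hR)
  have hpos : ∀ᶠ r in 𝓝 R, 0 < r := Ioi_mem_nhds hR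
  have hZpos : 0 < reserveEquivalent α (envelope α W R) :=
    reserveEquivalent_pos (hp.envelope_pos h0 hR)
  have hshift : HasDerivAt (fun r => (r + (reserveEquivalent α (envelope α W R) - R)) ^ α)
      (marginal α (reserveEquivalent α (envelope α W R))) R := by
    have := hasDerivAt_shift_rpow (α := α) (Z := R)
      (c := reserveEquivalent α (envelope α W R) - R) (by linarith)
    convert this using 2
    ring
  have hle : reserveEquivalent α (W R) ≤ inverseMarginal α (P R) →
      P R ≤ marginal α (reserveEquivalent α (envelope α W R)) := fun h =>
    (le_inverseMarginal_iff h0 h1 (hp.pos R hR) hZpos).1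
      (hp.reserveEquivalent_envelope_le h0 h1 hR h)
  have hshift_eq : reserveEquivalent α (W R) ≤ inverseMarginal α (P R) → ∀ r, 0 < r →
      reserveEquivalent α (W r) ≤ inverseMarginal α (P r) →
      envelope α W r = (r + (reserveEquivalent α (envelope α W R) - R)) ^ α := by
    intro h r hr0 hr
    rcases le_total r R with hrR | hrR
    · rw [hp.envelope_eq_shift h0 h1 hr0 le_rfl hr,
        hp.reserveEquivalent_envelope_eq h0 h1 hr0 hrR hr]
      congr 1; ring
    · exact hp.envelope_eq_shift h0 h1 hR hrR h
  rcases lt_trichotomy (inverseMarginal α (P R)) (reserveEquivalent α (W R)) with h | h | h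
  · have hval := hp.envelope_eq_value_of_lt h0 h1 hR h
    have hm : marginal α (reserveEquivalent α (envelope α W R)) ≤ P R := by
      rw [hval]
      exact (inverseMarginal_le_iff h0 h1 (hp.pos R hR)
        (reserveEquivalent_pos (hp.value_pos hR))).1 h.le
    rw [max_eq_left hm]
    refine (hp.deriv R hR).congr_of_eventuallyEq ?_
    filter_upwards [hcT.eventually_lt hcZ h, hpos] with r hr hr0
    exact hp.envelope_eq_value_of_lt h0 h1 hr0 hr
  · have hZ : reserveEquivalent α (envelope α W R) = reserveEquivalent α (W R) :=
      le_antisymm ((hp.reserveEquivalent_envelope_le h0 h1 hR h.ge).trans h.le)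
        (by simpa using hp.le_reserveEquivalent_envelope h0 hR.le le_rfl)
    have hval : envelope α W R = W R := by
      rw [← reserveEquivalent_rpow h0 (hp.envelope_nonneg h0 hR.le), hZ,
        reserveEquivalent_rpow h0 (hp.value_nonneg hR.le)]
    have hPm : P R = marginal α (reserveEquivalent α (envelope α W R)) := by
      rw [hZ, ← h, marginal_inverseMarginal h0 h1 (hp.pos R hR)]
    rw [← hPm, max_self]
    rw [← hPm] at hshift
    refine hasDerivAt_of_eq_or_eq (hp.deriv R hR) hshift hval.symm ?_ ?_
    · rw [add_sub_cancel, reserveEquivalent_rpow h0 (hp.envelope_nonneg h0 hR.le)]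
    · filter_upwards [hpos] with r hr0
      rcases lt_or_ge (inverseMarginal α (P r)) (reserveEquivalent α (W r)) with hr | hr
      · exact Or.inl (hp.envelope_eq_value_of_lt h0 h1 hr0 hr)
      · exact Or.inr (hshift_eq h.ge r hr0 hr)
  · rw [max_eq_right (hle h.le)]
    refine hshift.congr_of_eventuallyEq ?_
    filter_upwards [hcZ.eventually_lt hcT h, hpos] with r hr hr0
    exact hshift_eq h.le r hr0 hr.le

end StoppingProfile

end Envelope

/-! ## The exploration operator in normalized units -/

section Mixture

open Filter Topology

/-- The data of the model in units in which a reserve `R` without exploration is worth `R ^ α`. -/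
structure NormalizedModel where
  α : ℝ
  a : ℝ
  κ : ℝ
  lam : ℝ
  α_pos : 0 < α
  α_lt_one : α < 1
  a_pos : 0 < a
  κ_pos : 0 < κ
  lam_pos : 0 < lam
  gain : κ < lam * a ^ α

namespace NormalizedModel

variable (M : NormalizedModel)

/-- The expectation of `g`, evaluated at the area left when the next deposit is found, on the event
that it is found. -/
noncomputable def depositMean (g : ℝ → ℝ) (x : ℝ) : ℝ :=
  ∫ y in (0 : ℝ)..x, M.lam * Real.exp (M.lam * y) * g y

/-- Value of exploring, if `f` is the continuation value after a discovery. -/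
noncomputable def stopValue (f : ℝ → ℝ → ℝ) (x R : ℝ) : ℝ :=
  Real.exp (-(M.lam * x)) * (R ^ M.α + M.depositMean (fun y => f y (R + M.a)) x) -
    M.κ * ((1 - Real.exp (-(M.lam * x))) / M.lam)

/-- Derivative of `stopValue` in the reserves, if `q` is that of the continuation value. -/
noncomputable def stopMarginal (q : ℝ → ℝ → ℝ) (x R : ℝ) : ℝ :=
  Real.exp (-(M.lam * x)) * (marginal M.α R + M.depositMean (fun y => q y (R + M.a)) x)

/-- Regularity of a continuation value `f` with derivative `q` on `R ≥ a`. -/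
structure IsContinuation (f q : ℝ → ℝ → ℝ) : Prop where
  cont : Continuous (Function.uncurry f)
  contDeriv : Continuous (Function.uncurry q)
  deriv : ∀ x R, 0 ≤ x → M.a < R → HasDerivAt (f x) (q x R) R
  pos : ∀ x R, 0 ≤ x → M.a ≤ R → 0 < q x R
  slope : ∀ x R R', 0 ≤ x → M.a ≤ R → R ≤ R' →
    inverseMarginal M.α (q x R) + (R' - R) ≤ inverseMarginal M.α (q x R')
  le_marginal : ∀ x R, 0 ≤ x → M.a ≤ R → q x R ≤ marginal M.α R
  lower : ∀ x R, 0 ≤ x → M.a ≤ R → R ^ M.α ≤ f x R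
  upper : ∀ x R, 0 ≤ x → M.a ≤ R → f x R ≤ R ^ M.α + M.lam * M.a ^ M.α * x

variable {M}

theorem add_rpow_le (M : NormalizedModel) {R : ℝ} (hR : 0 ≤ R) :
    (R + M.a) ^ M.α ≤ R ^ M.α + M.a ^ M.α := by
  have := rpow_increment_antitone M.α_pos M.α_lt_one M.a_pos.le le_rfl hR
  rw [zero_add, Real.zero_rpow M.α_pos.ne'] at this
  linarith

theorem continuous_depositMean_uncurry {X : Type*} [TopologicalSpace X] {g : X → ℝ → ℝ}
    (hg : Continuous (Function.uncurry g)) {s : X → ℝ} (hs : Continuous s) :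
    Continuous fun z => M.depositMean (g z) (s z) := by
  unfold depositMean
  refine intervalIntegral.continuous_parametric_intervalIntegral_of_continuous ?_ hs
  exact (by fun_prop : Continuous fun p : X × ℝ => M.lam * Real.exp (M.lam * p.2)).mul hg

theorem intervalIntegrable_depositMean {g : ℝ → ℝ} (hg : Continuous g) (x y : ℝ) :
    IntervalIntegrable (fun y => M.lam * Real.exp (M.lam * y) * g y) volume x y :=
  ((by fun_prop : Continuous fun y => M.lam * Real.exp (M.lam * y)).mul hg).intervalIntegrable _ _

theorem depositMean_mono {g g' : ℝ → ℝ} (hg : Continuous g) (hg' : Continuous g') {x : ℝ}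
    (hx : 0 ≤ x) (h : ∀ y ∈ Icc 0 x, g y ≤ g' y) : M.depositMean g x ≤ M.depositMean g' x :=
  intervalIntegral.integral_mono_on hx (intervalIntegrable_depositMean hg _ _)
    (intervalIntegrable_depositMean hg' _ _) fun y hy =>
    mul_le_mul_of_nonneg_left (h y hy) (mul_nonneg M.lam_pos.le (Real.exp_pos _).le)

theorem depositMean_const (c x : ℝ) :
    M.depositMean (fun _ => c) x = c * (Real.exp (M.lam * x) - 1) := by
  have h : ∀ y ∈ uIcc 0 x, HasDerivAt (fun y => c * Real.exp (M.lam * y))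
      (M.lam * Real.exp (M.lam * y) * c) y := fun y _ => by
    refine ((((hasDerivAt_id y).const_mul M.lam).exp).const_mul c).congr_deriv ?_
    simp only [id]; ring
  rw [depositMean, intervalIntegral.integral_eq_sub_of_hasDerivAt h
    (intervalIntegrable_depositMean continuous_const _ _)]
  simp
  ring

/-- The integrand is chosen so that `exp (-(λ x)) * (c + ·)` returns `c + λ d x`: with `c = R ^ α`
and `d = a ^ α`, the growth bound `upper` reproduces itself under exploration. -/
theorem depositMean_affine (c d x : ℝ) :
    M.depositMean (fun y => c + d + M.lam * d * y) x =
      c * (Real.exp (M.lam * x) - 1) + M.lam * d * x * Real.exp (M.lam * x) := by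
  have h : ∀ y ∈ uIcc 0 x, HasDerivAt
      (fun y => c * Real.exp (M.lam * y) + M.lam * d * y * Real.exp (M.lam * y))
      (M.lam * Real.exp (M.lam * y) * (c + d + M.lam * d * y)) y := fun y _ => by
    have he := ((hasDerivAt_id y).const_mul M.lam).exp
    refine ((he.const_mul c).add (((hasDerivAt_id y).const_mul (M.lam * d)).mul he)).congr_deriv ?_
    simp only [id]; ring
  rw [depositMean, intervalIntegral.integral_eq_sub_of_hasDerivAt h
    (intervalIntegrable_depositMean (by fun_prop) _ _)]
  simp
  ring

theorem depositMean_linear {g : ℝ → ℝ} (hg : Continuous g) (c d x : ℝ) :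
    M.depositMean (fun y => c + d * g y) x =
      c * (Real.exp (M.lam * x) - 1) + d * M.depositMean g x := by
  rw [← depositMean_const, depositMean, depositMean, depositMean,
    ← intervalIntegral.integral_const_mul, ← intervalIntegral.integral_add
    (intervalIntegrable_depositMean continuous_const _ _)
    ((intervalIntegrable_depositMean hg _ _).const_mul d)]
  exact intervalIntegral.integral_congr fun y _ => by ring

theorem hasDerivAt_depositMean {g : ℝ → ℝ} (hg : Continuous g) (x : ℝ) :
    HasDerivAt (M.depositMean g) (M.lam * Real.exp (M.lam * x) * g x) x := by
  have hc : Continuous fun y => M.lam * Real.exp (M.lam * y) * g y := by fun_prop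
  exact intervalIntegral.integral_hasDerivAt_right (hc.intervalIntegrable _ _)
    (hc.stronglyMeasurableAtFilter _ _) hc.continuousAt

theorem exp_neg_mul_exp (x : ℝ) : Real.exp (-(M.lam * x)) * Real.exp (M.lam * x) = 1 := by
  rw [← Real.exp_add]; simp

/-- Integrating over the area that remains at the discovery, with `exp (-(λ x))` pulled out, turns
the dependence on `x` into the linear equation `w' = λ (g - w)`. The values and marginals of
exploring are both instances. -/
theorem hasDerivAt_exp_neg_mul_add_depositMean {g : ℝ → ℝ} (hg : Continuous g) (c x : ℝ) :
    HasDerivAt (fun x => Real.exp (-(M.lam * x)) * (c + M.depositMean g x))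
      (M.lam * (g x - Real.exp (-(M.lam * x)) * (c + M.depositMean g x))) x := by
  have he : HasDerivAt (fun x => Real.exp (-(M.lam * x))) (Real.exp (-(M.lam * x)) * -M.lam) x := by
    have := (((hasDerivAt_id x).const_mul M.lam).neg).exp
    simpa using this
  refine (he.mul ((hasDerivAt_depositMean hg x).const_add c)).congr_deriv ?_
  linear_combination M.lam * g x * M.exp_neg_mul_exp x

variable {f q : ℝ → ℝ → ℝ}

theorem continuous_slice {f : ℝ → ℝ → ℝ} (hf : Continuous (Function.uncurry f)) (R : ℝ) :
    Continuous fun y => f y R := hf.comp (by fun_prop : Continuous fun y : ℝ => (y, R))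

/-- Evolution of the value of exploring as the unexplored area grows. -/
theorem hasDerivAt_stopValue (hf : Continuous (Function.uncurry f)) (x R : ℝ) :
    HasDerivAt (fun x => M.stopValue f x R)
      (M.lam * (f x (R + M.a) - M.stopValue f x R) - M.κ) x := by
  have he : HasDerivAt (fun x => M.κ * ((1 - Real.exp (-(M.lam * x))) / M.lam))
      (M.κ * Real.exp (-(M.lam * x))) x := by
    have := (((((hasDerivAt_id x).const_mul M.lam).neg).exp.const_sub 1).div_const
      M.lam).const_mul M.κ
    refine this.congr_deriv ?_
    have := M.lam_pos.ne'
    simp only [id, Pi.neg_apply]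
    field_simp
  refine ((hasDerivAt_exp_neg_mul_add_depositMean (continuous_slice hf (R + M.a))
    (R ^ M.α) x).sub he).congr_deriv ?_
  have := M.lam_pos.ne'
  rw [stopValue]
  field_simp
  ring

theorem hasDerivAt_stopMarginal (hq : Continuous (Function.uncurry q)) (x R : ℝ) :
    HasDerivAt (fun x => M.stopMarginal q x R)
      (M.lam * (q x (R + M.a) - M.stopMarginal q x R)) x :=
  hasDerivAt_exp_neg_mul_add_depositMean (continuous_slice hq (R + M.a)) (marginal M.α R) x

theorem continuous_stopValue (hf : Continuous (Function.uncurry f)) :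
    Continuous (Function.uncurry (M.stopValue f)) := by
  have h : Continuous fun z : ℝ × ℝ => M.depositMean (fun y => f y (z.2 + M.a)) z.1 :=
    continuous_depositMean_uncurry (g := fun (z : ℝ × ℝ) y => f y (z.2 + M.a))
      (hf.comp (by fun_prop : Continuous fun p : (ℝ × ℝ) × ℝ => (p.2, p.1.2 + M.a)))
      continuous_fst
  have h2 : Continuous fun z : ℝ × ℝ => z.2 ^ M.α :=
    (Real.continuous_rpow_const M.α_pos.le).comp continuous_snd
  unfold Function.uncurry stopValue
  fun_prop

theorem continuousOn_stopMarginal (hq : Continuous (Function.uncurry q)) :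
    ContinuousOn (Function.uncurry (M.stopMarginal q)) {z | 0 < z.2} := by
  have h : Continuous fun z : ℝ × ℝ => M.depositMean (fun y => q y (z.2 + M.a)) z.1 :=
    continuous_depositMean_uncurry (g := fun (z : ℝ × ℝ) y => q y (z.2 + M.a))
      (hq.comp (by fun_prop : Continuous fun p : (ℝ × ℝ) × ℝ => (p.2, p.1.2 + M.a)))
      continuous_fst
  have h2 : ContinuousOn (fun z : ℝ × ℝ => marginal M.α z.2) {z | 0 < z.2} :=
    continuousOn_marginal.comp continuousOn_snd fun z hz => hz
  unfold Function.uncurry stopMarginal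
  exact (by fun_prop : Continuous fun z : ℝ × ℝ => Real.exp (-(M.lam * z.1))).continuousOn.mul
    (h2.add h.continuousOn)

/-! ### What exploration inherits from the continuation value. -/

namespace IsContinuation

variable (hc : M.IsContinuation f q)
include hc

theorem hasDerivAt_stopValue_reserve {x R : ℝ} (hx : 0 ≤ x) (hR : 0 < R) :
    HasDerivAt (M.stopValue f x) (M.stopMarginal q x R) R := by
  have hF : Continuous fun z : ℝ × ℝ =>
      M.lam * Real.exp (M.lam * z.2) * q z.2 (z.1 + M.a) :=
    (by fun_prop : Continuous fun z : ℝ × ℝ => M.lam * Real.exp (M.lam * z.2)).mul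
      (hc.contDeriv.comp (by fun_prop : Continuous fun z : ℝ × ℝ => (z.2, z.1 + M.a)))
  obtain ⟨C, hC⟩ := (isCompact_Icc.prod isCompact_Icc :
    IsCompact (Icc (R / 2) (2 * R) ×ˢ Icc 0 x)).exists_bound_of_continuousOn hF.continuousOn
  have h := (intervalIntegral.hasDerivAt_integral_of_dominated_loc_of_deriv_le
    (F := fun r y => M.lam * Real.exp (M.lam * y) * f y (r + M.a))
    (F' := fun r y => M.lam * Real.exp (M.lam * y) * q y (r + M.a)) (μ := volume)
    (x₀ := R) (a := 0) (b := x) (bound := fun _ => C)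
    (Ioo_mem_nhds (by linarith : R / 2 < R) (by linarith : R < 2 * R)) ?_ ?_ ?_ ?_ ?_ ?_).2
  · have h2 := ((hasDerivAt_rpow_marginal (α := M.α) hR).add h).const_mul
      (Real.exp (-(M.lam * x)))
    exact h2.sub_const _
  · exact Eventually.of_forall fun r =>
      (by have := continuous_slice hc.cont (r + M.a); fun_prop : Continuous fun y =>
        M.lam * Real.exp (M.lam * y) * f y (r + M.a)).aestronglyMeasurable
  · exact intervalIntegrable_depositMean (continuous_slice hc.cont (R + M.a)) _ _
  · exact (by have := continuous_slice hc.contDeriv (R + M.a); fun_prop : Continuous fun y =>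
        M.lam * Real.exp (M.lam * y) * q y (R + M.a)).aestronglyMeasurable
  · refine Eventually.of_forall fun y hy r hr => ?_
    rw [uIoc_of_le hx] at hy
    exact hC (r, y) ⟨Ioo_subset_Icc_self hr, Ioc_subset_Icc_self hy⟩
  · exact intervalIntegrable_const
  · refine Eventually.of_forall fun y hy r hr => ?_
    rw [uIoc_of_le hx] at hy
    exact ((hc.deriv y (r + M.a) hy.1.le (by linarith [hr.1])).comp_add_const r M.a).const_mul _

theorem stopMarginal_pos {x R : ℝ} (hx : 0 ≤ x) (hR : 0 < R) : 0 < M.stopMarginal q x R := by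
  have h1 := depositMean_mono (M := M) (g := fun _ => 0) (g' := fun y => q y (R + M.a))
    continuous_const (continuous_slice hc.contDeriv _) hx
    fun y hy => (hc.pos y _ hy.1 (by linarith)).le
  rw [depositMean_const, zero_mul] at h1
  exact mul_pos (Real.exp_pos _) (add_pos_of_pos_of_nonneg (marginal_pos M.α_pos hR) h1)

theorem exp_mul_marginal_le_stopMarginal {x R : ℝ} (hx : 0 ≤ x) (hR : 0 < R) :
    Real.exp (-(M.lam * x)) * marginal M.α R ≤ M.stopMarginal q x R := by
  have h1 := depositMean_mono (M := M) (g := fun _ => 0) (g' := fun y => q y (R + M.a))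
    continuous_const (continuous_slice hc.contDeriv _) hx
    fun y hy => (hc.pos y _ hy.1 (by linarith)).le
  rw [depositMean_const, zero_mul] at h1
  exact mul_le_mul_of_nonneg_left (by linarith) (Real.exp_pos _).le

theorem stopMarginal_le_mix {x R : ℝ} (hx : 0 ≤ x) (hR : 0 < R) :
    M.stopMarginal q x R ≤ Real.exp (-(M.lam * x)) * marginal M.α R +
      (1 - Real.exp (-(M.lam * x))) * marginal M.α (R + M.a) := by
  have h1 := depositMean_mono (M := M) (g := fun y => q y (R + M.a))
    (g' := fun _ => marginal M.α (R + M.a)) (continuous_slice hc.contDeriv _) continuous_const hx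
    fun y hy => (hc.le_marginal y _ hy.1 (by linarith))
  rw [depositMean_const] at h1
  have := mul_le_mul_of_nonneg_left (add_le_add_right h1 (marginal M.α R))
    (Real.exp_pos (-(M.lam * x))).le
  refine this.trans_eq ?_
  linear_combination marginal M.α (R + M.a) * M.exp_neg_mul_exp x

theorem stopMarginal_le_marginal {x R : ℝ} (hx : 0 ≤ x) (hR : 0 < R) :
    M.stopMarginal q x R ≤ marginal M.α R := by
  have h := hc.stopMarginal_le_mix hx hR
  have h2 := marginal_le_marginal M.α_pos M.α_lt_one hR (by linarith [M.a_pos] : R ≤ R + M.a)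
  have h3 : Real.exp (-(M.lam * x)) ≤ 1 :=
    Real.exp_le_one_iff.2 (by nlinarith [M.lam_pos])
  nlinarith

theorem stopMarginal_lt_marginal {x R : ℝ} (hx : 0 < x) (hR : 0 < R) :
    M.stopMarginal q x R < marginal M.α R := by
  have h := hc.stopMarginal_le_mix hx.le hR
  have h2 := marginal_lt_marginal M.α_pos M.α_lt_one hR (by linarith [M.a_pos] : R < R + M.a)
  have h3 : Real.exp (-(M.lam * x)) < 1 :=
    Real.exp_lt_one_iff.2 (by nlinarith [M.lam_pos])
  nlinarith

/-- Superadditivity of the power mean with negative exponent `α - 1`. -/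
theorem inverseMarginal_stopMarginal_slope {x R R' : ℝ} (hx : 0 ≤ x) (hR : 0 < R)
    (hRR : R ≤ R') :
    inverseMarginal M.α (M.stopMarginal q x R) + (R' - R) ≤
        inverseMarginal M.α (M.stopMarginal q x R') ∧
    (0 < x → R < R' → inverseMarginal M.α (M.stopMarginal q x R) + (R' - R) <
        inverseMarginal M.α (M.stopMarginal q x R')) := by
  have h0 := M.α_pos
  have h1 := M.α_lt_one
  have hR' := hR.trans_le hRR
  have hp := hc.stopMarginal_pos hx hR
  have hp' := hc.stopMarginal_pos hx hR'
  -- The level `m` is the power mean of the atom `R`, of weight `exp (-(λ x))`, and of the levels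
  -- with marginal utility `q y (R + a)`.
  set m := inverseMarginal M.α (M.stopMarginal q x R) with hm
  have hmp : 0 < m := inverseMarginal_pos h0 hp
  have hmm : marginal M.α m = M.stopMarginal q x R := marginal_inverseMarginal h0 h1 hp
  obtain ⟨h, rfl⟩ : ∃ h, R' = R + h := ⟨R' - R, by ring⟩
  have hh : 0 ≤ h := by linarith
  rw [add_sub_cancel_left]
  set K := marginal M.α (m + h)
  set c := m / (m + h) * (marginal M.α (m + h) / marginal M.α m)
  -- The tangent inequality at `m` is linear in the marginal utilities, so it may be averaged over
  -- the atom and the integral. The linear term then cancels because the average marginal utility is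
  -- that of `m`.
  have hatom := marginal_shift_le h0 h1 hR hmp hh
  have hmean : M.depositMean (fun y => q y (R + h + M.a)) x ≤
      (K - c * marginal M.α m) * (Real.exp (M.lam * x) - 1) +
        c * M.depositMean (fun y => q y (R + M.a)) x := by
    rw [← depositMean_linear (continuous_slice hc.contDeriv _)]
    have hcs := continuous_slice hc.contDeriv (R + M.a)
    refine depositMean_mono (continuous_slice hc.contDeriv _) (by fun_prop) hx fun y hy => ?_
    have hqp := hc.pos y (R + M.a) hy.1 (by linarith)
    have hT := inverseMarginal_pos h0 hqp
    have h2 := (marginal_shift_le h0 h1 hT hmp hh).1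
    rw [marginal_inverseMarginal h0 h1 hqp] at h2
    have h3 := hc.slope y (R + M.a) (R + h + M.a) hy.1 (by linarith) (by linarith)
    have h4 := (le_inverseMarginal_iff h0 h1 (hc.pos y (R + h + M.a) hy.1 (by linarith))
      (by linarith : 0 < inverseMarginal M.α (q y (R + M.a)) + h)).1 (by linarith)
    refine h4.trans (h2.trans_eq ?_)
    ring
  have he := Real.exp_pos (-(M.lam * x))
  have hee := M.exp_neg_mul_exp x
  have hsum : Real.exp (-(M.lam * x)) * ((K + c * (marginal M.α R - marginal M.α m)) +
      ((K - c * marginal M.α m) * (Real.exp (M.lam * x) - 1) +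
        c * M.depositMean (fun y => q y (R + M.a)) x)) = K := by
    have hpd : M.stopMarginal q x R = Real.exp (-(M.lam * x)) *
      (marginal M.α R + M.depositMean (fun y => q y (R + M.a)) x) := rfl
    rw [hmm, hpd]
    rw [hmm, hpd] at hmean
    linear_combination (K - c * (Real.exp (-(M.lam * x)) * (marginal M.α R +
      M.depositMean (fun y => q y (R + M.a)) x))) * hee
  constructor
  · rw [le_inverseMarginal_iff h0 h1 hp' (by linarith)]
    change _ ≤ K
    rw [← hsum]
    exact mul_le_mul_of_nonneg_left (add_le_add hatom.1 hmean) he.le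
  · intro hx0 hRR'
    -- Strictness comes from the atom: for `x > 0` a discovery has positive probability and lowers
    -- the marginal value, so `m` differs from `R`.
    have hne : R ≠ m := by
      intro hEq
      have := hc.stopMarginal_lt_marginal hx0 hR
      rw [← hmm, ← hEq] at this
      exact lt_irrefl _ this
    have hlt : M.stopMarginal q x (R + h) < marginal M.α (m + h) := by
      change _ < K
      rw [← hsum]
      exact mul_lt_mul_of_pos_left (add_lt_add_of_lt_of_le (hatom.2 (by linarith) hne) hmean) he
    by_contra hcon
    have := (inverseMarginal_le_iff h0 h1 hp' (by linarith : 0 < m + h)).1 (not_lt.1 hcon)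
    linarith

theorem le_stopValue {x R : ℝ} (hx : 0 ≤ x) (hR : 0 ≤ R) :
    Real.exp (-(M.lam * x)) * R ^ M.α +
      (1 - Real.exp (-(M.lam * x))) * ((R + M.a) ^ M.α - M.κ / M.lam) ≤ M.stopValue f x R := by
  have h1 := depositMean_mono (M := M) (g := fun _ => (R + M.a) ^ M.α)
    (g' := fun y => f y (R + M.a)) continuous_const (continuous_slice hc.cont _) hx
    fun y hy => hc.lower y _ hy.1 (by linarith)
  rw [depositMean_const] at h1
  have h2 := mul_le_mul_of_nonneg_left h1 (Real.exp_pos (-(M.lam * x))).le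
  have h3 := M.exp_neg_mul_exp x
  rw [stopValue]
  linear_combination h2 - (R + M.a) ^ M.α * h3

theorem stopValue_le {x R : ℝ} (hx : 0 ≤ x) (hR : 0 ≤ R) :
    M.stopValue f x R ≤ R ^ M.α + M.lam * M.a ^ M.α * x := by
  have h1 := depositMean_mono (M := M) (g := fun y => f y (R + M.a))
    (g' := fun y => R ^ M.α + M.a ^ M.α + M.lam * M.a ^ M.α * y)
    (continuous_slice hc.cont _) (by fun_prop) hx
    fun y hy => by
      have := hc.upper y (R + M.a) hy.1 (by linarith)
      linarith [M.add_rpow_le hR]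
  rw [depositMean_affine] at h1
  have h2 := mul_le_mul_of_nonneg_left h1 (Real.exp_pos (-(M.lam * x))).le
  have h3 := M.exp_neg_mul_exp x
  have h4 : 0 ≤ M.κ * ((1 - Real.exp (-(M.lam * x))) / M.lam) :=
    mul_nonneg M.κ_pos.le (div_nonneg (sub_nonneg.2
      (Real.exp_le_one_iff.2 (by nlinarith [M.lam_pos]))) M.lam_pos.le)
  rw [stopValue]
  linear_combination h2 + h4 + (R ^ M.α + M.lam * M.a ^ M.α * x) * h3

/-- Here `ε < 1` enters through `gain`: a deposit found from zero reserves is worth `a ^ α`, more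
than the mean cost `κ / λ` of finding it. Without it the reserve equivalent would not make sense at
small `R`. -/
theorem stopValue_zero_nonneg {x : ℝ} (hx : 0 ≤ x) :
    0 ≤ M.stopValue f x 0 ∧ (0 < x → 0 < M.stopValue f x 0) := by
  have h := hc.le_stopValue hx le_rfl
  rw [Real.zero_rpow M.α_pos.ne', zero_add, mul_zero, zero_add] at h
  have hg : 0 < M.a ^ M.α - M.κ / M.lam := by
    rw [sub_pos, div_lt_iff₀' M.lam_pos]; exact M.gain
  exact ⟨le_trans (mul_nonneg (sub_nonneg.2 (Real.exp_le_one_iff.2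
      (by nlinarith [M.lam_pos]))) hg.le) h,
    fun hx0 => lt_of_lt_of_le (mul_pos (sub_pos.2 (Real.exp_lt_one_iff.2
      (by nlinarith [M.lam_pos]))) hg) h⟩

theorem stoppingProfile {x : ℝ} (hx : 0 ≤ x) :
    StoppingProfile M.α (M.stopValue f x) (M.stopMarginal q x) where
  cont := ((continuous_stopValue hc.cont).comp
    (by fun_prop : Continuous fun R : ℝ => (x, R))).continuousOn
  nonneg := (hc.stopValue_zero_nonneg hx).1
  deriv R hR := hc.hasDerivAt_stopValue_reserve hx hR
  pos R hR := hc.stopMarginal_pos hx hR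
  contDeriv := (continuousOn_stopMarginal hc.contDeriv).comp
    (by fun_prop : ContinuousOn (fun R : ℝ => (x, R)) (Ioi 0)) fun R hR => hR
  slope R R' hR hRR := (hc.inverseMarginal_stopMarginal_slope hx hR hRR).1

end IsContinuation

end NormalizedModel

end Mixture

/-! ## The value function as a fixed point -/

section FixedPoint

open Filter Topology

/-- The substitution `S = t * R` makes the supremum range over the fixed compact interval `[0, 1]`,
whence joint continuity. -/
theorem continuous_envelope {α : ℝ} (h0 : 0 < α) {X : Type*} [TopologicalSpace X]
    {W : X → ℝ → ℝ} (hW : Continuous (Function.uncurry W)) {r : X → ℝ} (hr : Continuous r)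
    (hr0 : ∀ z, 0 ≤ r z) : Continuous fun z => envelope α (W z) (r z) := by
  have h : Continuous fun z => sSup ((fun t =>
      (r z - t * r z + reserveEquivalent α (W z (t * r z))) ^ α) '' Icc (0 : ℝ) 1) := by
    refine isCompact_Icc.continuous_sSup ?_
    have h1 : Continuous fun p : X × ℝ => W p.1 (p.2 * r p.1) :=
      hW.comp (by fun_prop : Continuous fun p : X × ℝ => (p.1, p.2 * r p.1))
    exact (Real.continuous_rpow_const h0.le).comp ((by fun_prop : Continuous fun p : X × ℝ =>
      r p.1 - p.2 * r p.1).add ((continuous_reserveEquivalent h0).comp h1))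
  convert h using 2 with z
  rw [envelope]
  congr 1
  have : (Icc 0 (r z)) = (fun t => t * r z) '' Icc (0 : ℝ) 1 := by
    rcases (hr0 z).eq_or_lt with h' | h'
    · rw [← h']; simp
    · rw [image_mul_right_Icc zero_le_one h'.le]; simp
  rw [this, image_image]

namespace NormalizedModel

variable {M : NormalizedModel}

/-- One step of value iteration. -/
noncomputable def improve (M : NormalizedModel) (f : ℝ → ℝ → ℝ) (x R : ℝ) : ℝ :=
  envelope M.α (M.stopValue f x) R

/-- The derivative of `improve` in the reserves. -/
noncomputable def improveMarginal (M : NormalizedModel) (f q : ℝ → ℝ → ℝ) (x R : ℝ) : ℝ :=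
  max (M.stopMarginal q x R) (marginal M.α (reserveEquivalent M.α (M.improve f x R)))

/-- Constant extension of a function on `x ≥ 0`, `R ≥ a`. -/
noncomputable def clip (M : NormalizedModel) (f : ℝ → ℝ → ℝ) (x R : ℝ) : ℝ :=
  f (max x 0) (max R M.a)

theorem clip_of_le {f : ℝ → ℝ → ℝ} {x R : ℝ} (hx : 0 ≤ x) (hR : M.a ≤ R) :
    M.clip f x R = f x R := by rw [clip, max_eq_left hx, max_eq_left hR]

theorem clip_clip {f : ℝ → ℝ → ℝ} (x R : ℝ) :
    M.clip f (max x 0) (max R M.a) = M.clip f x R :=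
  clip_of_le (le_max_right _ _) (le_max_right _ _)

variable {f q : ℝ → ℝ → ℝ}

/-! ### One step of value iteration preserves regularity. -/

namespace IsContinuation

variable (hc : M.IsContinuation f q)
include hc

theorem le_reserveEquivalent_improve {x R : ℝ} (hx : 0 ≤ x) (hR : 0 ≤ R) :
    R ≤ reserveEquivalent M.α (M.improve f x R) := by
  have hp := hc.stoppingProfile hx
  have h := hp.le_reserveEquivalent_envelope M.α_pos le_rfl hR
  have := reserveEquivalent_nonneg (α := M.α) hp.nonneg
  exact le_trans (by linarith) h

theorem improve_lower {x R : ℝ} (hx : 0 ≤ x) (hR : 0 ≤ R) : R ^ M.α ≤ M.improve f x R := by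
  have h := Real.rpow_le_rpow hR (hc.le_reserveEquivalent_improve hx hR) M.α_pos.le
  have h2 : 0 ≤ M.improve f x R := (hc.stoppingProfile hx).envelope_nonneg M.α_pos hR
  rwa [reserveEquivalent_rpow M.α_pos h2] at h

theorem improve_upper {x R : ℝ} (hx : 0 ≤ x) (hR : 0 ≤ R) :
    M.improve f x R ≤ R ^ M.α + M.lam * M.a ^ M.α * x := by
  have hp := hc.stoppingProfile hx
  obtain ⟨S, hS, he⟩ := exists_envelope_eq M.α_pos hp.cont hR
  rw [improve, ← he]
  have h := shift_reserveEquivalent_sub_le M.α_pos M.α_lt_one (sub_nonneg.2 hS.2)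
    (hp.value_nonneg hS.1) (Real.rpow_nonneg hS.1 M.α)
    (mul_nonneg (mul_nonneg M.lam_pos.le (Real.rpow_nonneg M.a_pos.le M.α)) hx)
    (hc.stopValue_le hx hS.1)
  rwa [reserveEquivalent_of_rpow M.α_pos hS.1, sub_add_cancel] at h

theorem improveMarginal_pos {x R : ℝ} (hx : 0 ≤ x) (hR : 0 < R) :
    0 < M.improveMarginal f q x R :=
  lt_max_of_lt_left (hc.stopMarginal_pos hx hR)

theorem hasDerivAt_improve {x R : ℝ} (hx : 0 ≤ x) (hR : 0 < R) :
    HasDerivAt (M.improve f x) (M.improveMarginal f q x R) R :=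
  (hc.stoppingProfile hx).hasDerivAt_envelope M.α_pos M.α_lt_one hR

theorem improveMarginal_le {x R : ℝ} (hx : 0 ≤ x) (hR : 0 < R) :
    M.improveMarginal f q x R ≤ marginal M.α R :=
  max_le (hc.stopMarginal_le_marginal hx hR) (marginal_le_marginal M.α_pos M.α_lt_one hR
    (hc.le_reserveEquivalent_improve hx hR.le))

/-- A maximum of marginal utilities is a minimum of reserve levels. Both levels, `T` and the reserve
equivalent of the envelope, grow at least at rate one, hence so does the smaller. -/
theorem improveMarginal_slope {x R R' : ℝ} (hx : 0 ≤ x) (hR : 0 < R) (hRR : R ≤ R') :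
    inverseMarginal M.α (M.improveMarginal f q x R) + (R' - R) ≤
      inverseMarginal M.α (M.improveMarginal f q x R') := by
  have h0 := M.α_pos
  have h1 := M.α_lt_one
  have hp := hc.stoppingProfile hx
  have hR' := hR.trans_le hRR
  have hq := hc.improveMarginal_pos hx hR
  have hT := inverseMarginal_pos h0 hq
  have hT0 : 0 < inverseMarginal M.α (M.improveMarginal f q x R) + (R' - R) := by linarith
  have hZ := hR.trans_le (hc.le_reserveEquivalent_improve hx hR.le)
  have hZ' := hR'.trans_le (hc.le_reserveEquivalent_improve hx hR'.le)
  rw [le_inverseMarginal_iff h0 h1 (hc.improveMarginal_pos hx hR') hT0]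
  refine max_le ?_ (marginal_le_marginal h0 h1 hT0 ?_)
  · rw [← le_inverseMarginal_iff h0 h1 (hp.pos R' hR') hT0]
    have h2 : inverseMarginal M.α (M.improveMarginal f q x R) ≤
        inverseMarginal M.α (M.stopMarginal q x R) := by
      rw [le_inverseMarginal_iff h0 h1 (hp.pos R hR) hT, marginal_inverseMarginal h0 h1 hq]
      exact le_max_left _ _
    linarith [hp.slope R R' hR hRR]
  · have h2 : inverseMarginal M.α (M.improveMarginal f q x R) ≤
        reserveEquivalent M.α (M.improve f x R) := by
      rw [inverseMarginal_le_iff h0 h1 hq hZ]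
      exact le_max_right _ _
    have := hp.reserveEquivalent_envelope_slope h0 hR.le hRR
    simp only [improve] at h2 ⊢
    linarith

theorem continuous_improve {X : Type*} [TopologicalSpace X] {s r : X → ℝ} (hs : Continuous s)
    (hr : Continuous r) (hr0 : ∀ z, 0 ≤ r z) : Continuous fun z => M.improve f (s z) (r z) :=
  continuous_envelope M.α_pos (W := fun z => M.stopValue f (s z))
    ((continuous_stopValue hc.cont).comp (by fun_prop : Continuous fun p : X × ℝ => (s p.1, p.2)))
    hr hr0

theorem continuous_improveMarginal {X : Type*} [TopologicalSpace X] {s r : X → ℝ}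
    (hs : Continuous s) (hr : Continuous r) (hs0 : ∀ z, 0 ≤ s z) (hr0 : ∀ z, 0 < r z) :
    Continuous fun z => M.improveMarginal f q (s z) (r z) := by
  refine Continuous.max ?_ ?_
  · exact (continuousOn_stopMarginal hc.contDeriv).comp_continuous (hs.prodMk hr) hr0
  · exact continuousOn_marginal.comp_continuous ((continuous_reserveEquivalent M.α_pos).comp
      (hc.continuous_improve hs hr fun z => (hr0 z).le))
      fun z => (hr0 z).trans_le (hc.le_reserveEquivalent_improve (hs0 z) (hr0 z).le)

/-- The exploration operator evaluates the continuation value only after a discovery, at reserves at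
least `a`. Freezing everything below `a` and for negative area gives functions continuous on the
whole plane and keeps away from the singularity of the marginal utility at `0`. -/
theorem clip_improve :
    M.IsContinuation (M.clip (M.improve f)) (M.clip (M.improveMarginal f q)) where
  cont := hc.continuous_improve (by fun_prop) (by fun_prop)
    fun z => M.a_pos.le.trans (le_max_right _ _)
  contDeriv := hc.continuous_improveMarginal (by fun_prop) (by fun_prop)
    (fun z => le_max_right _ _) fun z => M.a_pos.trans_le (le_max_right _ _)
  deriv x R hx hR := by
    rw [clip_of_le hx hR.le]
    refine (hc.hasDerivAt_improve hx (M.a_pos.trans hR)).congr_of_eventuallyEq ?_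
    filter_upwards [Ioi_mem_nhds hR] with r hr
    exact clip_of_le hx (le_of_lt hr)
  pos x R hx hR := by
    rw [clip_of_le hx hR]; exact hc.improveMarginal_pos hx (M.a_pos.trans_le hR)
  slope x R R' hx hR hRR := by
    rw [clip_of_le hx hR, clip_of_le hx (hR.trans hRR)]
    exact hc.improveMarginal_slope hx (M.a_pos.trans_le hR) hRR
  le_marginal x R hx hR := by
    rw [clip_of_le hx hR]; exact hc.improveMarginal_le hx (M.a_pos.trans_le hR)
  lower x R hx hR := by
    rw [clip_of_le hx hR]; exact hc.improve_lower hx (M.a_pos.le.trans hR)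
  upper x R hx hR := by
    rw [clip_of_le hx hR]; exact hc.improve_upper hx (M.a_pos.le.trans hR)

end IsContinuation

/-- Lipschitz constant of the marginal utility as a function of the utility. -/
noncomputable def marginalLip (M : NormalizedModel) : ℝ := (1 - M.α) / M.a

theorem marginalLip_nonneg : 0 ≤ M.marginalLip :=
  div_nonneg (sub_nonneg.2 M.α_lt_one.le) M.a_pos.le

/-- As a function of the utility `v`, the marginal utility has derivative `(α - 1) * v ^ (-1 / α)`,
bounded by `(1 - α) / a` as long as `v ≥ a ^ α`. This controls the derivative of the envelope by its
value. -/
theorem abs_marginal_reserveEquivalent_sub_le {v v' : ℝ} (hv : M.a ^ M.α ≤ v)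
    (hv' : M.a ^ M.α ≤ v') :
    |marginal M.α (reserveEquivalent M.α v) - marginal M.α (reserveEquivalent M.α v')| ≤
      M.marginalLip * |v - v'| := by
  have h0 := M.α_pos
  have h1 := M.α_lt_one
  have haα : 0 < M.a ^ M.α := Real.rpow_pos_of_pos M.a_pos _
  have heq : ∀ v ∈ Ici (M.a ^ M.α), marginal M.α (reserveEquivalent M.α v) =
      M.α * v ^ (1 / M.α * (M.α - 1)) := fun v hv => by
    rw [marginal, reserveEquivalent, ← Real.rpow_mul (haα.le.trans hv)]
  have hd : ∀ v ∈ Ici (M.a ^ M.α), HasDerivWithinAt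
      (fun v => marginal M.α (reserveEquivalent M.α v))
      ((M.α - 1) * v ^ (1 / M.α * (M.α - 1) - 1)) (Ici (M.a ^ M.α)) v := by
    intro v hv
    have hv0 : 0 < v := haα.trans_le hv
    have := ((Real.hasDerivAt_rpow_const (p := 1 / M.α * (M.α - 1))
      (Or.inl hv0.ne')).const_mul M.α).hasDerivWithinAt (s := Ici (M.a ^ M.α))
    refine (this.congr heq (heq v hv)).congr_deriv ?_
    field_simp
  have hb : ∀ v ∈ Ici (M.a ^ M.α),
      ‖(M.α - 1) * v ^ (1 / M.α * (M.α - 1) - 1)‖ ≤ M.marginalLip := by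
    intro v hv
    have hv0 : 0 < v := haα.trans_le hv
    have e : 1 / M.α * (M.α - 1) - 1 = -(1 / M.α) := by field_simp; ring
    rw [e, norm_mul, Real.norm_eq_abs, Real.norm_eq_abs, abs_of_nonpos (by linarith),
      abs_of_pos (Real.rpow_pos_of_pos hv0 _), marginalLip, div_eq_mul_inv, neg_sub]
    refine mul_le_mul_of_nonneg_left ?_ (by linarith)
    rw [Real.rpow_neg hv0.le]
    refine inv_anti₀ M.a_pos ?_
    have := reserveEquivalent_le_reserveEquivalent h0 haα.le hv
    rwa [reserveEquivalent_of_rpow h0 M.a_pos.le] at this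
  have := (convex_Ici (M.a ^ M.α)).norm_image_sub_le_of_norm_hasDerivWithin_le hd hb hv' hv
  simpa using this

/-- Growth rate of the weight in which value iteration is a contraction. -/
noncomputable def rate (M : NormalizedModel) : ℝ := M.lam * (1 + 2 * M.marginalLip)

theorem lam_le_rate : M.lam ≤ M.rate := by
  have := M.marginalLip_nonneg
  have := M.lam_pos
  rw [rate]; nlinarith

/-- Integrating the weight against `λ exp (λ y)` produces the exponent `λ + rate = λ (2 + 2 L)`,
with `L` the Lipschitz constant, and so gains the factor `1 / (2 + 2 L)`. This absorbs the factor
`L` lost when passing from values to marginals and still leaves `1 / 2`. -/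
theorem abs_exp_mul_depositMean_sub_le {g g' : ℝ → ℝ} (hg : Continuous g) (hg' : Continuous g')
    {C x : ℝ} (hC : 0 ≤ C) (hx : 0 ≤ x)
    (h : ∀ y ∈ Icc 0 x, |g y - g' y| ≤ C * Real.exp (M.rate * y)) :
    |Real.exp (-(M.lam * x)) * M.depositMean g x -
      Real.exp (-(M.lam * x)) * M.depositMean g' x| ≤
      C / (2 + 2 * M.marginalLip) * Real.exp (M.rate * x) := by
  have hL := M.marginalLip_nonneg
  have hl := M.lam_pos
  rw [← mul_sub, abs_mul, abs_of_pos (Real.exp_pos _), depositMean, depositMean,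
    ← intervalIntegral.integral_sub (intervalIntegrable_depositMean hg _ _)
    (intervalIntegrable_depositMean hg' _ _)]
  set b := M.lam * (2 + 2 * M.marginalLip) with hb
  have hb0 : 0 < b := by positivity
  have hd : ∀ y ∈ uIcc 0 x, HasDerivAt (fun y => C / (2 + 2 * M.marginalLip) * Real.exp (b * y))
      (C * M.lam * Real.exp (b * y)) y := fun y _ => by
    refine ((((hasDerivAt_id y).const_mul b).exp).const_mul _).congr_deriv ?_
    simp only [id, hb]
    field_simp
  have h1 : |∫ y in (0 : ℝ)..x, (M.lam * Real.exp (M.lam * y) * g y -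
      M.lam * Real.exp (M.lam * y) * g' y)| ≤ ∫ y in (0 : ℝ)..x, C * M.lam * Real.exp (b * y) := by
    rw [← Real.norm_eq_abs]
    refine intervalIntegral.norm_integral_le_of_norm_le hx (Eventually.of_forall fun y hy => ?_)
      ((by fun_prop : Continuous fun y => C * M.lam * Real.exp (b * y)).intervalIntegrable
        (μ := volume) _ _)
    have := h y (Ioc_subset_Icc_self hy)
    rw [← mul_sub, Real.norm_eq_abs, abs_mul,
      abs_of_pos (by positivity : 0 < M.lam * Real.exp (M.lam * y))]
    refine (mul_le_mul_of_nonneg_left this (by positivity)).trans_eq ?_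
    rw [show b * y = M.lam * y + M.rate * y by rw [hb, rate]; ring, Real.exp_add]
    ring
  rw [intervalIntegral.integral_eq_sub_of_hasDerivAt hd
    ((by fun_prop : Continuous fun y => C * M.lam * Real.exp (b * y)).intervalIntegrable
      (μ := volume) _ _)] at h1
  have h2 : |∫ y in (0 : ℝ)..x, (M.lam * Real.exp (M.lam * y) * g y -
      M.lam * Real.exp (M.lam * y) * g' y)| ≤
      C / (2 + 2 * M.marginalLip) * Real.exp (b * x) := by
    have : 0 ≤ C / (2 + 2 * M.marginalLip) * Real.exp (b * 0) := by positivity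
    linarith
  refine (mul_le_mul_of_nonneg_left h2 (Real.exp_pos _).le).trans_eq ?_
  rw [show b * x = M.lam * x + M.rate * x by rw [hb, rate]; ring, Real.exp_add]
  linear_combination (C / (2 + 2 * M.marginalLip) * Real.exp (M.rate * x)) * M.exp_neg_mul_exp x

/-- Value iteration is a contraction in a weighted `C¹` distance. -/
theorem IsContinuation.contraction {f' q' : ℝ → ℝ → ℝ} (hc : M.IsContinuation f q)
    (hc' : M.IsContinuation f' q') {C : ℝ} (hC : 0 ≤ C)
    (hf : ∀ x R, 0 ≤ x → M.a ≤ R → |f x R - f' x R| ≤ C * Real.exp (M.rate * x))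
    (hq : ∀ x R, 0 ≤ x → M.a ≤ R → |q x R - q' x R| ≤ C * Real.exp (M.rate * x))
    {x R : ℝ} (hx : 0 ≤ x) (hR : M.a ≤ R) :
    |M.improve f x R - M.improve f' x R| ≤ C / 2 * Real.exp (M.rate * x) ∧
    |M.improveMarginal f q x R - M.improveMarginal f' q' x R| ≤
      C / 2 * Real.exp (M.rate * x) := by
  have hL := M.marginalLip_nonneg
  have he := Real.exp_pos (M.rate * x)
  have hR0 : 0 < R := M.a_pos.trans_le hR
  have hw : ∀ S, 0 ≤ S → |M.stopValue f x S - M.stopValue f' x S| ≤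
      C / (2 + 2 * M.marginalLip) * Real.exp (M.rate * x) := fun S hS => by
    have := abs_exp_mul_depositMean_sub_le (M := M) (continuous_slice hc.cont (S + M.a))
      (continuous_slice hc'.cont (S + M.a)) hC hx
      fun y hy => hf y _ hy.1 (by linarith)
    rw [stopValue, stopValue]
    convert this using 2
    ring
  have hp : |M.stopMarginal q x R - M.stopMarginal q' x R| ≤
      C / (2 + 2 * M.marginalLip) * Real.exp (M.rate * x) := by
    have := abs_exp_mul_depositMean_sub_le (M := M) (continuous_slice hc.contDeriv (R + M.a))
      (continuous_slice hc'.contDeriv (R + M.a)) hC hx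
      fun y hy => hq y _ hy.1 (by linarith)
    rw [stopMarginal, stopMarginal]
    convert this using 2
    ring
  have hv : |M.improve f x R - M.improve f' x R| ≤
      C / (2 + 2 * M.marginalLip) * Real.exp (M.rate * x) :=
    abs_envelope_sub_le M.α_pos M.α_lt_one (hc.stoppingProfile hx).cont
      (hc'.stoppingProfile hx).cont (fun r hr => (hc.stoppingProfile hx).value_nonneg hr)
      (fun r hr => (hc'.stoppingProfile hx).value_nonneg hr) hR0.le fun S hS => hw S hS.1
  have hle : C / (2 + 2 * M.marginalLip) ≤ C / 2 :=
    div_le_div_of_nonneg_left hC two_pos (by linarith)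
  have hle2 : M.marginalLip * (C / (2 + 2 * M.marginalLip)) ≤ C / 2 := by
    rw [← mul_div_assoc, div_le_div_iff₀ (by positivity) two_pos]
    nlinarith
  refine ⟨hv.trans (mul_le_mul_of_nonneg_right hle he.le),
    (abs_max_sub_max_le_max _ _ _ _).trans (max_le
      (hp.trans (mul_le_mul_of_nonneg_right hle he.le)) ?_)⟩
  have haR : M.a ^ M.α ≤ R ^ M.α := Real.rpow_le_rpow M.a_pos.le hR M.α_pos.le
  refine (abs_marginal_reserveEquivalent_sub_le (haR.trans (hc.improve_lower hx hR0.le))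
    (haR.trans (hc'.improve_lower hx hR0.le))).trans ?_
  refine (mul_le_mul_of_nonneg_left hv hL).trans ?_
  rw [← mul_assoc]
  exact mul_le_mul_of_nonneg_right hle2 he.le

/-- Value iteration from the value without exploration, together with its derivative. -/
noncomputable def iterate (M : NormalizedModel) : ℕ → (ℝ → ℝ → ℝ) × (ℝ → ℝ → ℝ)
  | 0 => (M.clip fun _ R => R ^ M.α, M.clip fun _ R => marginal M.α R)
  | n + 1 => (M.clip (M.improve (iterate M n).1),
      M.clip (M.improveMarginal (iterate M n).1 (iterate M n).2))

theorem isContinuation_iterate (n : ℕ) :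
    M.IsContinuation (M.iterate n).1 (M.iterate n).2 := by
  induction n with
  | succ n ih => exact ih.clip_improve
  | zero =>
    have ha := M.a_pos
    refine ⟨?_, ?_, ?_, ?_, ?_, ?_, ?_, ?_⟩
    · exact (Real.continuous_rpow_const M.α_pos.le).comp
        (by fun_prop : Continuous fun z : ℝ × ℝ => max z.2 M.a)
    · exact continuousOn_marginal.comp_continuous
        (by fun_prop : Continuous fun z : ℝ × ℝ => max z.2 M.a)
        fun z => ha.trans_le (le_max_right _ _)
    · intro x R hx hR
      simp only [iterate]
      rw [clip_of_le hx hR.le]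
      refine (hasDerivAt_rpow_marginal (ha.trans hR)).congr_of_eventuallyEq ?_
      filter_upwards [Ioi_mem_nhds hR] with r hr
      exact clip_of_le hx (le_of_lt hr)
    · intro x R hx hR
      simp only [iterate]
      rw [clip_of_le hx hR]
      exact marginal_pos M.α_pos (ha.trans_le hR)
    · intro x R R' hx hR hRR
      simp only [iterate]
      rw [clip_of_le hx hR, clip_of_le hx (hR.trans hRR),
        inverseMarginal_marginal M.α_pos M.α_lt_one (ha.trans_le hR),
        inverseMarginal_marginal M.α_pos M.α_lt_one (ha.trans_le (hR.trans hRR))]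
      linarith
    · intro x R hx hR
      simp only [iterate]
      rw [clip_of_le hx hR]
    · intro x R hx hR
      simp only [iterate]
      rw [clip_of_le hx hR]
    · intro x R hx hR
      simp only [iterate]
      rw [clip_of_le hx hR]
      have := mul_nonneg (mul_nonneg M.lam_pos.le (Real.rpow_nonneg ha.le M.α)) hx
      linarith

theorem iterate_clip (n : ℕ) (x R : ℝ) :
    (M.iterate n).1 (max x 0) (max R M.a) = (M.iterate n).1 x R ∧
    (M.iterate n).2 (max x 0) (max R M.a) = (M.iterate n).2 x R := by
  cases n <;> simp only [iterate, clip_clip, and_self]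

theorem iterate_zero_of_le {x R : ℝ} (hx : 0 ≤ x) (hR : M.a ≤ R) :
    (M.iterate 0).1 x R = R ^ M.α := by
  simp only [iterate]; exact clip_of_le hx hR

theorem iterate_succ_of_le {x R : ℝ} (hx : 0 ≤ x) (hR : M.a ≤ R) (k : ℕ) :
    (M.iterate (k + 1)).1 x R = M.improve (M.iterate k).1 x R := by
  simp only [iterate]; exact clip_of_le hx hR

theorem iterate_succ_marginal_of_le {x R : ℝ} (hx : 0 ≤ x) (hR : M.a ≤ R) (k : ℕ) :
    (M.iterate (k + 1)).2 x R = M.improveMarginal (M.iterate k).1 (M.iterate k).2 x R := by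
  simp only [iterate]; exact clip_of_le hx hR

/-- Distance of the first two iterates. -/
noncomputable def initialGap (M : NormalizedModel) : ℝ := M.a ^ M.α + marginal M.α M.a

theorem initialGap_nonneg : 0 ≤ M.initialGap :=
  add_nonneg (Real.rpow_nonneg M.a_pos.le _) (marginal_pos M.α_pos M.a_pos).le

theorem abs_iterate_sub_le_of_le (n : ℕ) {x R : ℝ} (hx : 0 ≤ x) (hR : M.a ≤ R) :
    |(M.iterate n).1 x R - (M.iterate (n + 1)).1 x R| ≤
      M.initialGap * (1 / 2) ^ n * Real.exp (M.rate * x) ∧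
    |(M.iterate n).2 x R - (M.iterate (n + 1)).2 x R| ≤
      M.initialGap * (1 / 2) ^ n * Real.exp (M.rate * x) := by
  induction n generalizing x R with
  | zero =>
    have c0 := M.isContinuation_iterate 0
    have c1 := M.isContinuation_iterate 1
    have haα : 0 < M.a ^ M.α := Real.rpow_pos_of_pos M.a_pos _
    have hma := marginal_pos M.α_pos M.a_pos
    have hexp := Real.add_one_le_exp (M.rate * x)
    have hlr := mul_le_mul_of_nonneg_right M.lam_le_rate hx
    have hlx := mul_nonneg M.lam_pos.le hx
    have e0 := M.iterate_zero_of_le hx hR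
    have hmR := marginal_le_marginal M.α_pos M.α_lt_one M.a_pos hR
    rw [pow_zero, mul_one, initialGap]
    -- The first two iterates differ by at most `λ a ^ α x` in value and `marginal a` in derivative.
    -- The linear growth in `x` is absorbed by the exponential weight, since `λ ≤ rate`.
    have hge : M.a ^ M.α * (M.lam * x) + marginal M.α M.a ≤
        (M.a ^ M.α + marginal M.α M.a) * Real.exp (M.rate * x) := by
      rw [add_mul]
      exact add_le_add (mul_le_mul_of_nonneg_left (by linarith) haα.le)
        (le_mul_of_one_le_right hma.le (by linarith))
    constructor
    · have h1 := c1.lower x R hx hR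
      have h2 := c1.upper x R hx hR
      rw [abs_le, e0]
      constructor <;> nlinarith
    · have h1 := c0.pos x R hx hR
      have h2 := c1.pos x R hx hR
      have h3 := c0.le_marginal x R hx hR
      have h4 := c1.le_marginal x R hx hR
      have h5 := mul_nonneg haα.le hlx
      rw [abs_le]
      constructor <;> linarith
  | succ n ih =>
    have h := (M.isContinuation_iterate n).contraction (M.isContinuation_iterate (n + 1))
      (mul_nonneg M.initialGap_nonneg (by positivity)) (fun y S hy hS => (ih hy hS).1)
      (fun y S hy hS => (ih hy hS).2) hx hR
    have e : M.initialGap * (1 / 2) ^ n / 2 = M.initialGap * (1 / 2) ^ (n + 1) := by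
      rw [pow_succ]; ring
    rw [e] at h
    rw [iterate_succ_of_le hx hR, iterate_succ_of_le hx hR, iterate_succ_marginal_of_le hx hR,
      iterate_succ_marginal_of_le hx hR]
    exact h

theorem continuous_of_geometric {X : Type*} [TopologicalSpace X] {F : ℕ → X → ℝ} {G b : X → ℝ}
    (hF : ∀ n, Continuous (F n)) (hb : Continuous b)
    (h : ∀ n z, |F n z - G z| ≤ b z * (1 / 2) ^ n) : Continuous G := by
  have hu : TendstoLocallyUniformly F G atTop := by
    rw [Metric.tendstoLocallyUniformly_iff]
    intro ε hε z
    refine ⟨{y | b y < b z + 1}, hb.continuousAt.eventually_lt continuousAt_const (by simp), ?_⟩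
    have ht : Tendsto (fun n : ℕ => (b z + 1) * (1 / 2 : ℝ) ^ n) atTop (𝓝 ((b z + 1) * 0)) :=
      (tendsto_pow_atTop_nhds_zero_of_lt_one (by norm_num) (by norm_num)).const_mul _
    rw [mul_zero] at ht
    filter_upwards [ht.eventually_lt_const hε] with n hn y hy
    rw [dist_comm, Real.dist_eq]
    refine (h n y).trans_lt (lt_of_le_of_lt ?_ hn)
    exact mul_le_mul_of_nonneg_right (le_of_lt hy) (by positivity)
  exact hu.continuous (Frequently.of_forall hF)

theorem abs_iterate_sub_le (n : ℕ) (x R : ℝ) :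
    |(M.iterate n).1 x R - (M.iterate (n + 1)).1 x R| ≤
      M.initialGap * Real.exp (M.rate * max x 0) * (1 / 2) ^ n ∧
    |(M.iterate n).2 x R - (M.iterate (n + 1)).2 x R| ≤
      M.initialGap * Real.exp (M.rate * max x 0) * (1 / 2) ^ n := by
  have h := M.abs_iterate_sub_le_of_le n (le_max_right x 0) (le_max_right R M.a)
  rw [(M.iterate_clip n x R).1, (M.iterate_clip (n + 1) x R).1, (M.iterate_clip n x R).2,
    (M.iterate_clip (n + 1) x R).2] at h
  rwa [mul_right_comm]

theorem exists_limit {u : ℕ → ℝ → ℝ → ℝ} {C : ℝ → ℝ}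
    (h : ∀ n x R, |u n x R - u (n + 1) x R| ≤ C x * (1 / 2) ^ n) :
    ∃ g : ℝ → ℝ → ℝ, (∀ x R, Tendsto (fun n => u n x R) atTop (𝓝 (g x R))) ∧
      ∀ n x R, |u n x R - g x R| ≤ 2 * C x * (1 / 2) ^ n := by
  have hcs : ∀ x R, CauchySeq fun n => u n x R := fun x R =>
    cauchySeq_of_le_geometric (1 / 2) (C x) (by norm_num) fun n => h n x R
  choose g hg using fun x R => cauchySeq_tendsto_of_complete (hcs x R)
  refine ⟨g, hg, fun n x R => ?_⟩
  have := dist_le_of_le_geometric_of_tendsto (1 / 2) (C x) (by norm_num) (fun n => h n x R)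
    (hg x R) n
  exact this.trans_eq (by ring)

/-- The dynamic programming equation `v = improve v` has a regular solution. -/
theorem exists_fixedPoint (M : NormalizedModel) : ∃ f q : ℝ → ℝ → ℝ, M.IsContinuation f q ∧
    (∀ x R, 0 ≤ x → M.a ≤ R → f x R = M.improve f x R) ∧
    ∀ x R, 0 ≤ x → M.a ≤ R → q x R = M.improveMarginal f q x R := by
  obtain ⟨f, hf, hfn⟩ := exists_limit fun n x R => (M.abs_iterate_sub_le n x R).1
  obtain ⟨q, hq, hqn⟩ := exists_limit fun n x R => (M.abs_iterate_sub_le n x R).2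
  have hb : Continuous fun z : ℝ × ℝ =>
      2 * (M.initialGap * Real.exp (M.rate * max z.1 0)) := by fun_prop
  have hit := M.isContinuation_iterate
  have hslope : ∀ x R R', 0 ≤ x → M.a ≤ R → R ≤ R' →
      0 < q x R → 0 < q x R' →
      inverseMarginal M.α (q x R) + (R' - R) ≤ inverseMarginal M.α (q x R') := by
    intro x R R' hx hR hRR hp hp'
    refine le_of_tendsto_of_tendsto (((((continuousOn_inverseMarginal M.α_pos).continuousAt
      (Ioi_mem_nhds hp)).tendsto.comp (hq x R))).add_const (R' - R))
      (((continuousOn_inverseMarginal M.α_pos).continuousAt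
      (Ioi_mem_nhds hp')).tendsto.comp (hq x R')) (Eventually.of_forall fun n => ?_)
    exact (hit n).slope x R R' hx hR hRR
  -- Positivity could be lost in the limit. It survives because every iterate after the first is
  -- bounded below by the contribution of finding nothing.
  have hpos : ∀ x R, 0 ≤ x → M.a ≤ R → 0 < q x R := by
    intro x R hx hR
    have hle : Real.exp (-(M.lam * x)) * marginal M.α R ≤ q x R := by
      refine ge_of_tendsto (hq x R) ?_
      filter_upwards [eventually_ge_atTop 1] with n hn
      obtain ⟨k, rfl⟩ := Nat.exists_eq_add_of_le' hn
      rw [iterate_succ_marginal_of_le hx hR]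
      exact ((hit k).exp_mul_marginal_le_stopMarginal hx (M.a_pos.trans_le hR)).trans
        (le_max_left _ _)
    exact lt_of_lt_of_le (mul_pos (Real.exp_pos _)
      (marginal_pos M.α_pos (M.a_pos.trans_le hR))) hle
  have hc : M.IsContinuation f q := by
    refine ⟨?_, ?_, ?_, hpos, fun x R R' hx hR hRR => hslope x R R' hx hR hRR (hpos x R hx hR)
      (hpos x R' hx (hR.trans hRR)), ?_, ?_, ?_⟩
    · exact continuous_of_geometric (F := fun n => Function.uncurry (M.iterate n).1)
        (fun n => (hit n).cont) hb fun n z => hfn n z.1 z.2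
    · exact continuous_of_geometric (F := fun n => Function.uncurry (M.iterate n).2)
        (fun n => (hit n).contDeriv) hb fun n z => hqn n z.1 z.2
    · intro x R hx hR
      refine hasDerivAt_of_tendstoUniformlyOn (l := atTop) isOpen_Ioi (s := Ioi M.a)
        (f := fun n => (M.iterate n).1 x) (f' := fun n => (M.iterate n).2 x) ?_
        (Eventually.of_forall fun n r hr => (hit n).deriv x r hx hr) (fun r _ => hf x r) hR
      -- The error bound depends on the area but not on the reserves, so for fixed `x` the
      -- derivatives converge uniformly and the limit may be differentiated.
      rw [Metric.tendstoUniformlyOn_iff]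
      intro ε hε
      have ht : Tendsto (fun n : ℕ => 2 * (M.initialGap * Real.exp (M.rate * max x 0)) *
          (1 / 2 : ℝ) ^ n) atTop (𝓝 (2 * (M.initialGap * Real.exp (M.rate * max x 0)) * 0)) :=
        (tendsto_pow_atTop_nhds_zero_of_lt_one (by norm_num) (by norm_num)).const_mul _
      rw [mul_zero] at ht
      filter_upwards [ht.eventually_lt_const hε] with n hn r _
      rw [dist_comm, Real.dist_eq]
      exact (hqn n x r).trans_lt hn
    · exact fun x R hx hR => le_of_tendsto (hq x R)
        (Eventually.of_forall fun n => (hit n).le_marginal x R hx hR)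
    · exact fun x R hx hR => ge_of_tendsto (hf x R)
        (Eventually.of_forall fun n => (hit n).lower x R hx hR)
    · exact fun x R hx hR => le_of_tendsto (hf x R)
        (Eventually.of_forall fun n => (hit n).upper x R hx hR)
  have hlim : ∀ x R, 0 ≤ x → M.a ≤ R →
      Tendsto (fun n => (M.iterate (n + 1)).1 x R) atTop (𝓝 (M.improve f x R)) ∧
      Tendsto (fun n => (M.iterate (n + 1)).2 x R) atTop (𝓝 (M.improveMarginal f q x R)) := by
    intro x R hx hR
    -- The limit is itself a regular continuation, so the contraction can be applied between it and
    -- the iterates, and the shifted iterates converge to its improvement.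
    have hcon : ∀ n, _ := fun n => (hit n).contraction hc
      (C := 2 * M.initialGap * (1 / 2) ^ n)
      (mul_nonneg (mul_nonneg two_pos.le M.initialGap_nonneg) (by positivity))
      (fun y S hy _ => by have := hfn n y S; rw [max_eq_left hy] at this; linarith)
      (fun y S hy _ => by have := hqn n y S; rw [max_eq_left hy] at this; linarith) hx hR
    have hz : Tendsto (fun n : ℕ => 2 * M.initialGap * (1 / 2 : ℝ) ^ n / 2 *
        Real.exp (M.rate * x)) atTop (𝓝 0) := by
      have := (((tendsto_pow_atTop_nhds_zero_of_lt_one (r := (1 / 2 : ℝ)) (by norm_num)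
        (by norm_num)).const_mul (2 * M.initialGap)).div_const 2).mul_const
        (Real.exp (M.rate * x))
      simpa using this
    simp only [iterate_succ_of_le hx hR, iterate_succ_marginal_of_le hx hR]
    exact ⟨tendsto_iff_dist_tendsto_zero.2 (squeeze_zero (fun _ => dist_nonneg)
      (fun n => (hcon n).1) hz), tendsto_iff_dist_tendsto_zero.2 (squeeze_zero
      (fun _ => dist_nonneg) (fun n => (hcon n).2) hz)⟩
  exact ⟨f, q, hc, fun x R hx hR => tendsto_nhds_unique ((tendsto_add_atTop_iff_nat 1).2 (hf x R))
    (hlim x R hx hR).1, fun x R hx hR => tendsto_nhds_unique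
    ((tendsto_add_atTop_iff_nat 1).2 (hq x R)) (hlim x R hx hR).2⟩

end NormalizedModel

end FixedPoint

/-! ## The critical reserve level at exhaustion -/

section CriticalLevel

open Filter Topology

/-- Bernoulli's inequality for the ratio `Y / Z`; it holds up to `Y = 0`, where the marginal utility
is not available. -/
theorem rpow_le_tangent {α : ℝ} (h0 : 0 < α) (h1 : α < 1) {Y Z : ℝ} (hY : 0 ≤ Y) (hZ : 0 < Z) :
    Y ^ α ≤ Z ^ α + (Y - Z) * marginal α Z := by
  have h := rpow_one_add_le_one_add_mul_self (s := Y / Z - 1) (by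
    have := div_nonneg hY hZ.le; linarith) h0.le h1.le
  rw [add_sub_cancel, Real.div_rpow hY hZ.le, div_le_iff₀ (Real.rpow_pos_of_pos hZ α)] at h
  refine h.trans_eq ?_
  rw [marginal, Real.rpow_sub_one hZ.ne']
  field_simp

theorem mul_marginal {α Z : ℝ} (hZ : 0 < Z) : Z * marginal α Z = α * Z ^ α := by
  rw [marginal, Real.rpow_sub_one hZ.ne']
  field_simp

namespace NormalizedModel

variable {M : NormalizedModel}

/-- Rate at which exploration increases the value at reserve equivalent `Z`. -/
noncomputable def gainRate (M : NormalizedModel) (Z : ℝ) : ℝ :=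
  M.lam * ((Z + M.a) ^ M.α - Z ^ M.α) - M.κ

/-- Rate at which the advantage of stopping consumption changes at the free boundary. -/
noncomputable def switchDrift (M : NormalizedModel) (Z : ℝ) : ℝ :=
  M.gainRate Z + Z / (1 - M.α) * (M.lam * (marginal M.α (Z + M.a) - marginal M.α Z))

/-- The derivative of `switchDrift`. -/
noncomputable def switchDriftDeriv (M : NormalizedModel) (Z : ℝ) : ℝ :=
  M.lam * (marginal M.α (Z + M.a) * (M.a / (Z + M.a)) -
    (marginal M.α Z - marginal M.α (Z + M.a)) / (1 - M.α))

theorem hasDerivAt_marginal {α Z : ℝ} (hZ : 0 < Z) :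
    HasDerivAt (marginal α) ((α - 1) * marginal α Z / Z) Z := by
  refine ((Real.hasDerivAt_rpow_const (p := α - 1) (Or.inl hZ.ne')).const_mul α).congr_deriv ?_
  rw [marginal, Real.rpow_sub_one hZ.ne']
  field_simp

theorem hasDerivAt_switchDrift {Z : ℝ} (hZ : 0 < Z) :
    HasDerivAt M.switchDrift (M.switchDriftDeriv Z) Z := by
  have ha := M.a_pos
  have h1 : (1 - M.α) ≠ 0 := by linarith [M.α_lt_one]
  have hza : 0 < Z + M.a := by linarith
  have d1 := (((hasDerivAt_shift_rpow (α := M.α) (c := M.a) hza).sub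
    (hasDerivAt_rpow_marginal (α := M.α) hZ)).const_mul M.lam).sub_const M.κ
  have d2 := ((hasDerivAt_id Z).div_const (1 - M.α)).mul
    ((((hasDerivAt_marginal (α := M.α) hza).comp_add_const Z M.a).sub
      (hasDerivAt_marginal (α := M.α) hZ)).const_mul M.lam)
  refine (d1.add d2).congr_deriv ?_
  rw [switchDriftDeriv]
  simp only [id, Pi.sub_apply]
  have h2 : (1 - M.α) * (1 - M.α)⁻¹ = 1 := mul_inv_cancel₀ h1
  field_simp
  ring

/-- After clearing powers this is the strict Bernoulli inequality `(1 + a / Z) ^ (2 - α) > 1 + (2 -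
α) * (a / Z)`. -/
theorem switchDriftDeriv_neg {Z : ℝ} (hZ : 0 < Z) : M.switchDriftDeriv Z < 0 := by
  have ha := M.a_pos
  have h1 : 0 < 1 - M.α := by linarith [M.α_lt_one]
  have hza : 0 < Z + M.a := by linarith
  have hb := one_add_mul_self_lt_rpow_one_add (s := M.a / Z)
    (by have := div_pos ha hZ; linarith) (div_pos ha hZ).ne' (p := 2 - M.α)
    (by linarith [M.α_lt_one])
  have e : 1 + M.a / Z = (Z + M.a) / Z := by field_simp
  rw [e, Real.div_rpow hza.le hZ.le, lt_div_iff₀ (Real.rpow_pos_of_pos hZ _),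
    show 2 - M.α = 1 - (M.α - 1) by ring, Real.rpow_sub hza, Real.rpow_sub hZ, Real.rpow_one,
    Real.rpow_one] at hb
  have hm1 : 0 < Z ^ (M.α - 1) := Real.rpow_pos_of_pos hZ _
  have hm2 : 0 < (Z + M.a) ^ (M.α - 1) := Real.rpow_pos_of_pos hza _
  rw [← mul_div_assoc, div_lt_div_iff₀ hm1 hm2] at hb
  have key : (1 - M.α) * (M.a * (Z + M.a) ^ (M.α - 1)) <
      (Z ^ (M.α - 1) - (Z + M.a) ^ (M.α - 1)) * (Z + M.a) := by
    have h3 : (1 + (1 - (M.α - 1)) * (M.a / Z)) * Z = Z + (2 - M.α) * M.a := by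
      field_simp; ring
    rw [h3] at hb
    nlinarith
  rw [switchDriftDeriv]
  refine mul_neg_of_pos_of_neg M.lam_pos ?_
  rw [sub_neg, ← mul_div_assoc, div_lt_div_iff₀ hza h1, marginal, marginal]
  nlinarith [mul_lt_mul_of_pos_left key M.α_pos]

theorem strictAntiOn_switchDrift : StrictAntiOn M.switchDrift (Ioi 0) := by
  refine strictAntiOn_of_hasDerivWithinAt_neg (convex_Ioi 0) (f' := M.switchDriftDeriv)
    (fun Z hZ => (hasDerivAt_switchDrift hZ).continuousAt.continuousWithinAt) ?_ ?_
  · intro Z hZ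
    rw [interior_Ioi] at hZ
    exact (hasDerivAt_switchDrift hZ).hasDerivWithinAt
  · intro Z hZ
    rw [interior_Ioi] at hZ
    exact switchDriftDeriv_neg hZ

theorem exists_switchDrift_eq_zero (M : NormalizedModel) : ∃ Z, 0 < Z ∧ M.switchDrift Z = 0 := by
  have h0 := M.α_pos
  have h1 : 0 < 1 - M.α := by linarith [M.α_lt_one]
  have hl := M.lam_pos
  have ha := M.a_pos
  have hg : 0 < M.lam * M.a ^ M.α - M.κ := sub_pos.2 M.gain
  have hsmall : ∃ Z, 0 < Z ∧ 0 < M.switchDrift Z := by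
    -- At `Z ^ α = c` the negative terms in `Z ^ α` add up to half of the net gain `λ a ^ α - κ`, so
    -- the drift is still positive.
    set c := (1 - M.α) * (M.lam * M.a ^ M.α - M.κ) / (2 * M.lam) with hc
    have hc0 : 0 < c := by positivity
    have hZ := reserveEquivalent_pos (α := M.α) hc0
    set Z := reserveEquivalent M.α c
    have hZc : Z ^ M.α = c := reserveEquivalent_rpow h0 hc0.le
    refine ⟨Z, hZ, ?_⟩
    have h2 : M.a ^ M.α ≤ (Z + M.a) ^ M.α := Real.rpow_le_rpow ha.le (by linarith) h0.le
    have h3 : 0 < Z * marginal M.α (Z + M.a) := mul_pos hZ (marginal_pos h0 (by linarith))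
    have h4 := mul_marginal (α := M.α) hZ
    have h5 : M.switchDrift Z = M.lam * (Z + M.a) ^ M.α - M.κ - M.lam * c +
        M.lam / (1 - M.α) * (Z * marginal M.α (Z + M.a) - M.α * c) := by
      rw [switchDrift, gainRate, ← hZc, ← h4]; field_simp; ring
    have h6 : M.lam * c + M.lam / (1 - M.α) * (M.α * c) = (M.lam * M.a ^ M.α - M.κ) / 2 := by
      rw [hc]; field_simp; ring
    have h7 : 0 < M.lam / (1 - M.α) * (Z * marginal M.α (Z + M.a)) := by positivity
    have h8 := mul_le_mul_of_nonneg_left h2 hl.le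
    rw [h5]
    linarith
  have hlarge : ∃ Z, 0 < Z ∧ M.switchDrift Z < 0 := by
    -- At the level whose marginal utility is `κ / (λ a)`, concavity makes `gainRate` nonpositive,
    -- and the remaining term is negative.
    have hp : 0 < M.κ / (M.lam * M.a) := div_pos M.κ_pos (mul_pos hl ha)
    have hZ := inverseMarginal_pos h0 hp
    have hm := marginal_inverseMarginal h0 M.α_lt_one hp
    set Z := inverseMarginal M.α (M.κ / (M.lam * M.a))
    refine ⟨Z, hZ, ?_⟩
    have h2 := rpow_le_tangent h0 M.α_lt_one (by linarith : 0 ≤ Z + M.a) hZ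
    rw [hm, add_sub_cancel_left] at h2
    have h3 := mul_le_mul_of_nonneg_left h2 hl.le
    have h4 : M.lam * (M.a * (M.κ / (M.lam * M.a))) = M.κ := by field_simp
    have h5 := marginal_lt_marginal h0 M.α_lt_one hZ (by linarith : Z < Z + M.a)
    have h6 : Z / (1 - M.α) * (M.lam * (marginal M.α (Z + M.a) - marginal M.α Z)) < 0 :=
      mul_neg_of_pos_of_neg (div_pos hZ h1) (mul_neg_of_pos_of_neg hl (by linarith))
    rw [switchDrift, gainRate]
    linarith
  obtain ⟨Z1, hZ1, h1'⟩ := hsmall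
  obtain ⟨Z2, hZ2, h2'⟩ := hlarge
  have hlt : Z1 < Z2 := by
    by_contra hcon
    have := (strictAntiOn_switchDrift (M := M)).antitoneOn hZ2 hZ1 (not_lt.1 hcon)
    linarith
  have hcont : ContinuousOn M.switchDrift (Icc Z1 Z2) := fun Z hZ =>
    (hasDerivAt_switchDrift (hZ1.trans_le hZ.1)).continuousAt.continuousWithinAt
  obtain ⟨Z, hZ, hz⟩ := intermediate_value_Icc' hlt.le hcont ⟨h2'.le, h1'.le⟩
  exact ⟨Z, hZ1.trans_le hZ.1, hz⟩

/-- The critical reserve level at exhaustion of the unexplored area. -/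
noncomputable def criticalLevel (M : NormalizedModel) : ℝ :=
  Classical.choose M.exists_switchDrift_eq_zero

theorem criticalLevel_pos : 0 < M.criticalLevel :=
  (Classical.choose_spec M.exists_switchDrift_eq_zero).1

theorem switchDrift_criticalLevel : M.switchDrift M.criticalLevel = 0 :=
  (Classical.choose_spec M.exists_switchDrift_eq_zero).2

theorem switchDrift_pos {Z : ℝ} (hZ : 0 < Z) (h : Z < M.criticalLevel) : 0 < M.switchDrift Z := by
  have := strictAntiOn_switchDrift (M := M) hZ criticalLevel_pos h
  rwa [switchDrift_criticalLevel] at this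

theorem switchDrift_neg {Z : ℝ} (h : M.criticalLevel < Z) : M.switchDrift Z < 0 := by
  have := strictAntiOn_switchDrift (M := M) criticalLevel_pos (criticalLevel_pos.trans h) h
  rwa [switchDrift_criticalLevel] at this

theorem eq_criticalLevel {Z : ℝ} (hZ : 0 < Z) (h : M.switchDrift Z = 0) : Z = M.criticalLevel :=
  (strictAntiOn_switchDrift (M := M)).injOn hZ criticalLevel_pos
    (h.trans switchDrift_criticalLevel.symm)

/-- At the critical level the gain balances a strictly negative term, so it is positive there; by
concavity it only increases as `Z` decreases. -/
theorem gainRate_pos {Z : ℝ} (hZ : 0 ≤ Z) (h : Z ≤ M.criticalLevel) : 0 < M.gainRate Z := by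
  have hR := M.criticalLevel_pos
  have ha := M.a_pos
  have h1 := mul_le_mul_of_nonneg_left
    (rpow_increment_antitone M.α_pos M.α_lt_one ha.le hZ h) M.lam_pos.le
  have h2 := M.switchDrift_criticalLevel
  have h3 := marginal_lt_marginal M.α_pos M.α_lt_one hR
    (by linarith : M.criticalLevel < M.criticalLevel + M.a)
  have h6 : M.criticalLevel / (1 - M.α) * (M.lam * (marginal M.α (M.criticalLevel + M.a) -
      marginal M.α M.criticalLevel)) < 0 :=
    mul_neg_of_pos_of_neg (div_pos hR (by linarith [M.α_lt_one]))
      (mul_neg_of_pos_of_neg M.lam_pos (by linarith))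
  rw [switchDrift, gainRate] at h2
  rw [gainRate]
  linarith

end NormalizedModel

end CriticalLevel

/-! ## The free boundary -/

section FreeBoundary

open Filter Topology

/-- Barrier principle: a zero reached through nonnegative values has nonpositive left derivative,
which is excluded. Thus the sign of a function is decided by its drift at its zeros only, the one
place where the drift of the gap is known exactly. -/
theorem pos_of_hasDerivAt_pos_of_eq_zero {g g' : ℝ → ℝ} {s t : ℝ}
    (hg : ∀ y ∈ Icc s t, HasDerivAt g (g' y) y) (h0 : 0 ≤ g s)
    (h : ∀ y ∈ Icc s t, g y = 0 → 0 < g' y) {y : ℝ} (hy : y ∈ Ioc s t) : 0 < g y := by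
  have hle : ∀ y ∈ Icc s t, 0 ≤ g y := by
    intro y hy
    have := image_le_of_deriv_right_lt_deriv_boundary' (f := fun y => -g y)
      (f' := fun y => -g' y) (B := fun _ => 0) (B' := fun _ => 0)
      (fun y hy => (hg y hy).neg.continuousAt.continuousWithinAt)
      (fun y hy => (hg y (Ico_subset_Icc_self hy)).neg.hasDerivWithinAt)
      (by simpa using h0) continuousOn_const (fun y _ => hasDerivWithinAt_const _ _ _)
      (fun y hy hy0 => neg_lt_zero.2 (h y (Ico_subset_Icc_self hy) (neg_eq_zero.1 hy0))) hy
    simpa using this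
  have hyI := Ioc_subset_Icc_self hy
  refine (hle y hyI).lt_of_ne fun hEq => ?_
  have hmin : ∀ᶠ z in 𝓝[<] y, 0 ≤ g z := by
    filter_upwards [Ioo_mem_nhdsLT hy.1] with z hz
    exact hle z ⟨hz.1.le, hz.2.le.trans hy.2⟩
  have hs := (hasDerivAt_iff_tendsto_slope_left_right.1 (hg y hyI)).1
  have hle0 : g' y ≤ 0 := by
    refine le_of_tendsto hs ?_
    filter_upwards [hmin, self_mem_nhdsWithin] with z hz hzy
    rw [slope_def_field, ← hEq, sub_zero]
    exact div_nonpos_of_nonneg_of_nonpos hz (sub_nonpos.2 (le_of_lt hzy))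
  exact absurd (h y hyI hEq.symm) (not_lt.2 hle0)

namespace NormalizedModel

variable {M : NormalizedModel}

/-- A regular solution of the dynamic programming equation. -/
structure IsSolution (M : NormalizedModel) (f q : ℝ → ℝ → ℝ) : Prop where
  toCont : M.IsContinuation f q
  val : ∀ x R, 0 ≤ x → M.a ≤ R → f x R = M.improve f x R
  marg : ∀ x R, 0 ≤ x → M.a ≤ R → q x R = M.improveMarginal f q x R

/-- Reserve equivalent of exploring at once. -/
noncomputable def stopReserve (M : NormalizedModel) (f : ℝ → ℝ → ℝ) (x R : ℝ) : ℝ :=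
  reserveEquivalent M.α (M.stopValue f x R)

/-- Reserve level whose marginal utility is the marginal value of exploring at once. -/
noncomputable def marginalReserve (M : NormalizedModel) (q : ℝ → ℝ → ℝ) (x R : ℝ) : ℝ :=
  inverseMarginal M.α (M.stopMarginal q x R)

/-- The advantage of stopping consumption: positive where one should explore, negative where one
should consume. -/
noncomputable def stopGap (M : NormalizedModel) (f q : ℝ → ℝ → ℝ) (x R : ℝ) : ℝ :=
  M.stopValue f x R - M.marginalReserve q x R ^ M.α

/-- The derivative of `stopGap` in the area. -/
noncomputable def stopGapDeriv (M : NormalizedModel) (f q : ℝ → ℝ → ℝ) (x R : ℝ) : ℝ :=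
  M.lam * (f x (R + M.a) - M.stopValue f x R) - M.κ +
    M.marginalReserve q x R / (1 - M.α) * (M.lam * (q x (R + M.a) - M.stopMarginal q x R))

theorem hasDerivAt_inverseMarginal_rpow {α p : ℝ} (h0 : 0 < α) (h1 : α < 1) (hp : 0 < p) :
    HasDerivAt (fun p => inverseMarginal α p ^ α) (-(inverseMarginal α p / (1 - α))) p := by
  have h1' : α - 1 ≠ 0 := by linarith
  have h1'' : 1 - α ≠ 0 := by linarith
  have hpa := div_pos hp h0
  have h := (((hasDerivAt_id p).div_const α).rpow_const (p := α / (α - 1)) (Or.inl hpa.ne'))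
  refine (h.congr_of_eventuallyEq ?_).congr_deriv ?_
  · filter_upwards [Ioi_mem_nhds hp] with r hr
    rw [inverseMarginal, ← Real.rpow_mul (div_pos hr h0).le]
    congr 1
    field_simp
  · rw [inverseMarginal, show α / (α - 1) - 1 = 1 / (α - 1) by field_simp; ring]
    simp only [id]
    rw [show (1 - α) = -(α - 1) by ring]
    field_simp

variable {f q : ℝ → ℝ → ℝ}

theorem stopValue_zero_area {R : ℝ} : M.stopValue f 0 R = R ^ M.α := by
  simp [stopValue, depositMean]

theorem stopMarginal_zero_area {R : ℝ} : M.stopMarginal q 0 R = marginal M.α R := by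
  simp [stopMarginal, depositMean]

theorem stopReserve_zero_area {R : ℝ} (hR : 0 ≤ R) : M.stopReserve f 0 R = R := by
  rw [stopReserve, stopValue_zero_area, reserveEquivalent_of_rpow M.α_pos hR]

theorem marginalReserve_zero_area {R : ℝ} (hR : 0 < R) : M.marginalReserve q 0 R = R := by
  rw [marginalReserve, stopMarginal_zero_area, inverseMarginal_marginal M.α_pos M.α_lt_one hR]

namespace IsContinuation

variable (hc : M.IsContinuation f q)
include hc

theorem stopValue_pos {x R : ℝ} (hx : 0 ≤ x) (hR : 0 < R) : 0 < M.stopValue f x R :=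
  (hc.stoppingProfile hx).value_pos hR

theorem stopReserve_pos {x R : ℝ} (hx : 0 ≤ x) (hR : 0 < R) : 0 < M.stopReserve f x R :=
  reserveEquivalent_pos (hc.stopValue_pos hx hR)

theorem stopReserve_rpow {x R : ℝ} (hx : 0 ≤ x) (hR : 0 ≤ R) :
    M.stopReserve f x R ^ M.α = M.stopValue f x R :=
  reserveEquivalent_rpow M.α_pos ((hc.stoppingProfile hx).value_nonneg hR)

theorem marginalReserve_pos {x R : ℝ} (hx : 0 ≤ x) (hR : 0 < R) : 0 < M.marginalReserve q x R :=
  inverseMarginal_pos M.α_pos (hc.stopMarginal_pos hx hR)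

theorem marginal_marginalReserve {x R : ℝ} (hx : 0 ≤ x) (hR : 0 < R) :
    marginal M.α (M.marginalReserve q x R) = M.stopMarginal q x R :=
  marginal_inverseMarginal M.α_pos M.α_lt_one (hc.stopMarginal_pos hx hR)

theorem hasDerivAt_stopGap {x R : ℝ} (hx : 0 ≤ x) (hR : 0 < R) :
    HasDerivAt (fun x => M.stopGap f q x R) (M.stopGapDeriv f q x R) x := by
  have h := (hasDerivAt_inverseMarginal_rpow M.α_pos M.α_lt_one
    (hc.stopMarginal_pos hx hR)).comp x (hasDerivAt_stopMarginal hc.contDeriv x R)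
  refine ((hasDerivAt_stopValue hc.cont x R).sub h).congr_deriv ?_
  rw [stopGapDeriv, marginalReserve]
  ring

theorem stopGap_pos_iff {x R : ℝ} (hx : 0 ≤ x) (hR : 0 < R) :
    0 < M.stopGap f q x R ↔ M.marginalReserve q x R < M.stopReserve f x R := by
  rw [stopGap, sub_pos, ← hc.stopReserve_rpow hx hR.le]
  exact Real.rpow_lt_rpow_iff (hc.marginalReserve_pos hx hR).le (hc.stopReserve_pos hx hR).le
    M.α_pos

theorem stopGap_nonpos_iff {x R : ℝ} (hx : 0 ≤ x) (hR : 0 < R) :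
    M.stopGap f q x R ≤ 0 ↔ M.stopReserve f x R ≤ M.marginalReserve q x R := by
  rw [← not_lt, hc.stopGap_pos_iff hx hR, not_lt]

theorem stopGap_nonneg_iff {x R : ℝ} (hx : 0 ≤ x) (hR : 0 < R) :
    0 ≤ M.stopGap f q x R ↔ M.marginalReserve q x R ≤ M.stopReserve f x R := by
  rw [stopGap, sub_nonneg, ← hc.stopReserve_rpow hx hR.le]
  exact Real.rpow_le_rpow_iff (hc.marginalReserve_pos hx hR).le (hc.stopReserve_pos hx hR).le
    M.α_pos

theorem stopGap_eq_zero_iff {x R : ℝ} (hx : 0 ≤ x) (hR : 0 < R) :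
    M.stopGap f q x R = 0 ↔ M.marginalReserve q x R = M.stopReserve f x R := by
  rw [le_antisymm_iff, hc.stopGap_nonpos_iff hx hR, hc.stopGap_nonneg_iff hx hR,
    le_antisymm_iff, and_comm]

/-- Strict single crossing: from a point with `Z ≤ T`, the reserve equivalent grows by at most `R' -
R`, whereas for positive area `T` grows by strictly more. -/
theorem stopGap_neg_of_lt {x R R' : ℝ} (hx : 0 < x) (hR : 0 < R) (hRR : R < R')
    (h : M.stopGap f q x R ≤ 0) : M.stopGap f q x R' < 0 := by
  have hp := hc.stoppingProfile hx.le
  have h1 := hp.le_of_le M.α_pos M.α_lt_one hR hRR.le ((hc.stopGap_nonpos_iff hx.le hR).1 h)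
  have h2 := (hc.inverseMarginal_stopMarginal_slope hx.le hR hRR.le).2 hx hRR
  rw [← not_le, hc.stopGap_nonneg_iff hx.le (hR.trans hRR), not_le]
  exact h1.trans_lt h2

theorem continuousOn_stopGap : ContinuousOn (Function.uncurry (M.stopGap f q))
    {z | 0 ≤ z.1 ∧ 0 < z.2} := by
  refine (continuous_stopValue hc.cont).continuousOn.sub ?_
  refine (Real.continuous_rpow_const M.α_pos.le).comp_continuousOn ?_
  exact (continuousOn_inverseMarginal M.α_pos).comp
    ((continuousOn_stopMarginal hc.contDeriv).mono fun z hz => hz.2)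
    fun z hz => hc.stopMarginal_pos hz.1 hz.2

/-- The degenerate initial condition: with nothing left to explore, stopping changes nothing. The
sign of the gap for small area is therefore decided by its drift alone. -/
theorem stopGap_zero_area {R : ℝ} (hR : 0 < R) : M.stopGap f q 0 R = 0 := by
  rw [hc.stopGap_eq_zero_iff le_rfl hR, marginalReserve_zero_area hR,
    stopReserve_zero_area hR.le]

end IsContinuation

/-- The derivative in `s` is `marginal s * (s - T) / s`. It allows the unknown reserve equivalent
after a discovery to be replaced by its lower bound `Z + a` in the drift of the gap. -/
theorem add_mul_marginal_monotone {α T Y Y' : ℝ} (h0 : 0 < α) (h1 : α < 1) (hT : 0 < T)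
    (hTY : T ≤ Y) (hY : Y ≤ Y') :
    Y ^ α + T / (1 - α) * marginal α Y ≤ Y' ^ α + T / (1 - α) * marginal α Y' := by
  have hmono : MonotoneOn (fun s => s ^ α + T / (1 - α) * marginal α s) (Ici T) := by
    have hd : ∀ s, T ≤ s → HasDerivAt (fun s => s ^ α + T / (1 - α) * marginal α s)
        (marginal α s + T / (1 - α) * ((α - 1) * marginal α s / s)) s := fun s hs =>
      (hasDerivAt_rpow_marginal (hT.trans_le hs)).add
        ((hasDerivAt_marginal (hT.trans_le hs)).const_mul _)
    refine monotoneOn_of_hasDerivWithinAt_nonneg (convex_Ici T)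
      (fun s hs => (hd s hs).continuousAt.continuousWithinAt)
      (f' := fun s => marginal α s + T / (1 - α) * ((α - 1) * marginal α s / s)) ?_ ?_
    · intro s hs
      rw [interior_Ici] at hs
      exact (hd s (le_of_lt hs)).hasDerivWithinAt
    · intro s hs
      rw [interior_Ici, mem_Ioi] at hs
      have hs0 : 0 < s := hT.trans hs
      have h1' : 1 - α ≠ 0 := by linarith
      have e : marginal α s + T / (1 - α) * ((α - 1) * marginal α s / s) =
          marginal α s * ((s - T) / s) := by
        field_simp; ring
      rw [e]
      exact mul_nonneg (marginal_pos h0 hs0).le (div_nonneg (by linarith) hs0.le)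
  exact hmono hTY (hTY.trans hY) hY

/-! ### The sign of the gap as reserves and area vary. -/

namespace IsSolution

variable (hs : M.IsSolution f q)
include hs

theorem val_shift {x R : ℝ} (hx : 0 ≤ x) (hR : 0 ≤ R) :
    f x (R + M.a) = M.improve f x (R + M.a) := hs.val x _ hx (by linarith)

/-- A deposit can at worst be consumed as it is: the reserve equivalent of the envelope grows at
least at rate one and is at least that of exploring. -/
theorem stopReserve_add_le {x R : ℝ} (hx : 0 ≤ x) (hR : 0 ≤ R) :
    M.stopReserve f x R + M.a ≤ reserveEquivalent M.α (f x (R + M.a)) := by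
  have hp := hs.toCont.stoppingProfile hx
  have h1 := hp.reserveEquivalent_envelope_slope M.α_pos hR (by linarith [M.a_pos] : R ≤ R + M.a)
  have h2 := hp.le_reserveEquivalent_envelope M.α_pos hR le_rfl
  rw [hs.val_shift hx hR, improve, stopReserve]
  linarith

theorem val_nonneg {x R : ℝ} (hx : 0 ≤ x) (hR : 0 ≤ R) : 0 ≤ f x (R + M.a) := by
  rw [hs.val_shift hx hR]
  exact (hs.toCont.stoppingProfile hx).envelope_nonneg M.α_pos (by linarith [M.a_pos])

theorem gainRate_le {x R : ℝ} (hx : 0 ≤ x) (hR : 0 ≤ R) :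
    M.gainRate (M.stopReserve f x R) ≤ M.lam * (f x (R + M.a) - M.stopValue f x R) - M.κ := by
  have hZ : 0 ≤ M.stopReserve f x R :=
    reserveEquivalent_nonneg ((hs.toCont.stoppingProfile hx).value_nonneg hR)
  have h := Real.rpow_le_rpow (by linarith [M.a_pos]) (hs.stopReserve_add_le hx hR) M.α_pos.le
  rw [reserveEquivalent_rpow M.α_pos (hs.val_nonneg hx hR)] at h
  rw [gainRate, hs.toCont.stopReserve_rpow hx hR]
  have := mul_le_mul_of_nonneg_left h M.lam_pos.le
  linarith

/-- Lower bound for the drift of the gap where it is nonnegative. -/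
theorem switchDrift_sub_le {x R : ℝ} (hx : 0 ≤ x) (hR : 0 < R) (h : 0 ≤ M.stopGap f q x R) :
    M.switchDrift (M.stopReserve f x R) - M.lam * M.stopGap f q x R ≤ M.stopGapDeriv f q x R := by
  have hc := hs.toCont
  have h0 := M.α_pos
  have h1 := M.α_lt_one
  have h1' : 0 < 1 - M.α := by linarith
  have hl := M.lam_pos
  have ha := M.a_pos
  have hZ := hc.stopReserve_pos hx hR
  have hT := hc.marginalReserve_pos hx hR
  have hTZ := (hc.stopGap_nonneg_iff hx hR).1 h
  have hY := hs.stopReserve_add_le hx hR.le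
  have hfY := reserveEquivalent_rpow h0 (hs.val_nonneg hx hR.le)
  have hq : marginal M.α (reserveEquivalent M.α (f x (R + M.a))) ≤ q x (R + M.a) := by
    rw [hs.marg x _ hx (by linarith), hs.val_shift hx hR.le]
    exact le_max_right _ _
  have hp := hc.marginal_marginalReserve hx hR
  have hw := hc.stopReserve_rpow hx hR.le
  rw [stopGapDeriv, stopGap, ← hp, ← hw]
  set Z := M.stopReserve f x R
  set T := M.marginalReserve q x R
  set Y := reserveEquivalent M.α (f x (R + M.a))
  rw [← hfY]
  have hmono := add_mul_marginal_monotone h0 h1 hT (by linarith : T ≤ Z + M.a) hY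
  have hq' := mul_le_mul_of_nonneg_left hq (div_pos hT h1').le
  have htan := rpow_le_tangent h0 h1 hT.le hZ
  have hmle := marginal_le_marginal h0 h1 hZ (by linarith : Z ≤ Z + M.a)
  have hmul := mul_le_mul_of_nonneg_left hmle (sub_nonneg.2 hTZ)
  have eT := mul_marginal (α := M.α) hT
  have eZ := mul_marginal (α := M.α) hZ
  -- Since `s * marginal s = α * s ^ α`, the difference of the two sides is `(Z - T) * marginal (Z +
  -- a) - (Z ^ α - T ^ α)`, nonpositive by concavity as `T ≤ Z`.
  have key : (1 - M.α) * ((Z + M.a) ^ M.α - Z ^ M.α) +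
      Z * (marginal M.α (Z + M.a) - marginal M.α Z) - (1 - M.α) * (Z ^ M.α - T ^ M.α) ≤
      (1 - M.α) * ((Z + M.a) ^ M.α - Z ^ M.α) +
        T * (marginal M.α (Z + M.a) - marginal M.α T) := by
    nlinarith
  have hkey := mul_le_mul_of_nonneg_left key (div_pos hl h1').le
  rw [switchDrift, gainRate]
  have hmain := mul_le_mul_of_nonneg_left (hmono.trans (add_le_add_right hq' _)) hl.le
  have e1 : M.lam / (1 - M.α) * ((1 - M.α) * ((Z + M.a) ^ M.α - Z ^ M.α) +
      Z * (marginal M.α (Z + M.a) - marginal M.α Z) - (1 - M.α) * (Z ^ M.α - T ^ M.α)) =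
      M.lam * ((Z + M.a) ^ M.α - Z ^ M.α) + Z / (1 - M.α) * (M.lam *
      (marginal M.α (Z + M.a) - marginal M.α Z)) - M.lam * (Z ^ M.α - T ^ M.α) := by
    field_simp
  have e2 : M.lam / (1 - M.α) * ((1 - M.α) * ((Z + M.a) ^ M.α - Z ^ M.α) +
        T * (marginal M.α (Z + M.a) - marginal M.α T)) =
      M.lam * ((Z + M.a) ^ M.α - Z ^ M.α) + T / (1 - M.α) * (M.lam *
      (marginal M.α (Z + M.a) - marginal M.α T)) := by
    field_simp
  rw [e1, e2] at hkey
  linarith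

/-- At the free boundary the gap drifts at the rate `switchDrift`. -/
theorem stopGapDeriv_eq {x R : ℝ} (hx : 0 ≤ x) (hR : 0 < R) (h : M.stopGap f q x R = 0) :
    M.stopGapDeriv f q x R = M.switchDrift (M.stopReserve f x R) := by
  have hc := hs.toCont
  have h0 := M.α_pos
  have h1 := M.α_lt_one
  have ha := M.a_pos
  have hp := hc.stoppingProfile hx
  have hZ := hc.stopReserve_pos hx hR
  have hTZ := (hc.stopGap_eq_zero_iff hx hR).1 h
  have hle : reserveEquivalent M.α (M.stopValue f x R) ≤
    inverseMarginal M.α (M.stopMarginal q x R) := hTZ.ge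
  -- At the boundary the envelope coincides with the value of exploring, and to its right the
  -- reserve equivalent grows exactly at rate one. So a discovery leads exactly to `Z + a`, both in
  -- value and in marginal value.
  have hE : reserveEquivalent M.α (envelope M.α (M.stopValue f x) R) = M.stopReserve f x R :=
    le_antisymm ((hp.reserveEquivalent_envelope_le h0 h1 hR hle).trans hTZ.le)
      (by
        have := hp.le_reserveEquivalent_envelope h0 hR.le le_rfl
        rwa [sub_self, zero_add] at this)
  have hf : f x (R + M.a) = (M.stopReserve f x R + M.a) ^ M.α := by
    rw [hs.val_shift hx hR.le, improve, hp.envelope_eq_shift h0 h1 hR (by linarith) hle, hE]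
    congr 1; ring
  have hZa : 0 < M.stopReserve f x R + M.a := by linarith
  have hq : q x (R + M.a) = marginal M.α (M.stopReserve f x R + M.a) := by
    rw [hs.marg x _ hx (by linarith), improveMarginal, ← hs.val_shift hx hR.le, hf,
      reserveEquivalent_of_rpow h0 hZa.le]
    refine max_eq_right ?_
    rw [← le_inverseMarginal_iff h0 h1 (hc.stopMarginal_pos hx (by linarith)) hZa, ← hTZ]
    have := hp.slope R (R + M.a) hR (by linarith)
    rwa [add_sub_cancel_left] at this
  rw [stopGapDeriv, hf, hq, ← hc.marginal_marginalReserve hx hR, hTZ,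
    ← hc.stopReserve_rpow hx hR.le, switchDrift, gainRate]

/-- Barrier at the critical level: when `Z` equals it, `gainRate` is positive and the value of
exploring strictly increases with the area, so `Z` cannot come back down to it. -/
theorem stopReserve_lt_of_lt {x y R : ℝ} (hy : 0 ≤ y) (hyx : y < x) (hR : 0 < R)
    (h : M.stopReserve f x R ≤ M.criticalLevel) : M.stopReserve f y R < M.criticalLevel := by
  have hc := hs.toCont
  by_contra hcon
  have hlt : 0 < M.stopValue f x R - M.criticalLevel ^ M.α := by
    refine pos_of_hasDerivAt_pos_of_eq_zero
      (fun z _ => (hasDerivAt_stopValue hc.cont z R).sub_const (M.criticalLevel ^ M.α)) ?_ ?_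
      (right_mem_Ioc.2 hyx)
    · rw [← hc.stopReserve_rpow hy hR.le, sub_nonneg]
      exact Real.rpow_le_rpow M.criticalLevel_pos.le (not_lt.1 hcon) M.α_pos.le
    · intro z hz hz0
      have hz1 : M.stopReserve f z R = M.criticalLevel := by
        rw [stopReserve, sub_eq_zero.1 hz0,
          reserveEquivalent_of_rpow M.α_pos M.criticalLevel_pos.le]
      have h2 := hs.gainRate_le (hy.trans hz.1) hR.le
      rw [hz1] at h2
      exact (gainRate_pos M.criticalLevel_pos.le le_rfl).trans_le h2
  rw [← hc.stopReserve_rpow (hy.trans hyx.le) hR.le, sub_pos] at hlt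
  have := Real.rpow_le_rpow (hc.stopReserve_pos (hy.trans hyx.le) hR).le h M.α_pos.le
  linarith

/-- It is optimal to explore while the reserve equivalent is at most the critical level. -/
theorem stopGap_pos_of_stopReserve_le {x R : ℝ} (hx : 0 < x) (hR : 0 < R)
    (h : M.stopReserve f x R ≤ M.criticalLevel) : 0 < M.stopGap f q x R := by
  have hc := hs.toCont
  have hpos : ∀ y, 0 < y → y < x → 0 < M.stopGap f q y R := by
    intro y hy hyx
    refine pos_of_hasDerivAt_pos_of_eq_zero (s := 0) (t := y)
      (fun z hz => hc.hasDerivAt_stopGap hz.1 hR) (hc.stopGap_zero_area hR).ge ?_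
      (right_mem_Ioc.2 hy)
    intro z hz hz0
    rw [hs.stopGapDeriv_eq hz.1 hR hz0]
    exact switchDrift_pos (hc.stopReserve_pos hz.1 hR)
      (hs.stopReserve_lt_of_lt hz.1 (hz.2.trans_lt hyx) hR h)
  -- At `x` itself the reserve equivalent may equal the critical level, where the drift vanishes and
  -- the barrier fails. The one-sided bound `switchDrift Z - λ * gap` for the drift makes `exp (λ y)
  -- * gap` monotone up to `x`, which keeps it positive.
  have hd : ∀ y, 0 ≤ y → HasDerivAt (fun y => Real.exp (M.lam * y) * M.stopGap f q y R)
      (Real.exp (M.lam * y) * (M.lam * M.stopGap f q y R + M.stopGapDeriv f q y R)) y := by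
    intro y hy
    have he : HasDerivAt (fun y => Real.exp (M.lam * y)) (Real.exp (M.lam * y) * M.lam) y := by
      simpa using ((hasDerivAt_id y).const_mul M.lam).exp
    refine (he.mul (hc.hasDerivAt_stopGap hy hR)).congr_deriv ?_
    ring
  have hmono : MonotoneOn (fun y => Real.exp (M.lam * y) * M.stopGap f q y R)
      (Icc (x / 2) x) := by
    refine monotoneOn_of_hasDerivWithinAt_nonneg (convex_Icc _ _)
      (f' := fun y => Real.exp (M.lam * y) *
        (M.lam * M.stopGap f q y R + M.stopGapDeriv f q y R))
      (fun y hy => (hd y (by linarith [hy.1])).continuousAt.continuousWithinAt) ?_ ?_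
    · intro y hy
      rw [interior_Icc] at hy
      exact (hd y (by linarith [hy.1])).hasDerivWithinAt
    · intro y hy
      rw [interior_Icc] at hy
      have hy0 : 0 < y := by linarith [hy.1]
      have h1 := hs.switchDrift_sub_le hy0.le hR (hpos y hy0 hy.2).le
      have h2 := switchDrift_pos (hc.stopReserve_pos hy0.le hR)
        (hs.stopReserve_lt_of_lt hy0.le hy.2 hR h)
      exact mul_nonneg (Real.exp_pos _).le (by linarith)
  have h1 := hmono (left_mem_Icc.2 (by linarith)) (right_mem_Icc.2 (by linarith))
    (by linarith : x / 2 ≤ x)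
  have h2 := mul_pos (Real.exp_pos (M.lam * (x / 2))) (hpos (x / 2) (by linarith) (by linarith))
  exact pos_of_mul_pos_right (h2.trans_le h1) (Real.exp_pos _).le

theorem criticalLevel_lt_stopReserve {x R : ℝ} (hx : 0 < x) (hR : 0 < R)
    (h : M.stopGap f q x R ≤ 0) : M.criticalLevel < M.stopReserve f x R := by
  by_contra hcon
  exact absurd (hs.stopGap_pos_of_stopReserve_le hx hR (not_lt.1 hcon)) (not_lt.2 h)

/-- Once it is optimal to consume, this remains so for larger unexplored areas. -/
theorem stopGap_neg_of_area_lt {x x' R : ℝ} (hx : 0 ≤ x) (hxx : x < x') (hR : 0 < R)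
    (h : M.stopGap f q x R ≤ 0) (h' : 0 < x ∨ M.criticalLevel < R) :
    M.stopGap f q x' R < 0 := by
  have hc := hs.toCont
  have hpos : 0 < -M.stopGap f q x' R := by
    refine pos_of_hasDerivAt_pos_of_eq_zero (s := x) (t := x')
      (g := fun z => -M.stopGap f q z R)
      (fun z hz => (hc.hasDerivAt_stopGap (hx.trans hz.1) hR).neg) (neg_nonneg.2 h) ?_
      (right_mem_Ioc.2 hxx)
    intro z hz hz0
    have hz0' : M.stopGap f q z R = 0 := neg_eq_zero.1 hz0
    have hz1 := hx.trans hz.1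
    rw [hs.stopGapDeriv_eq hz1 hR hz0', neg_pos]
    refine switchDrift_neg ?_
    -- At zero area every reserve has zero gap, so the sign of the drift must come from `R` above
    -- the critical level. At positive area a zero gap already forces `Z` above it.
    rcases hz1.eq_or_lt with he | hlt
    · subst he
      rw [stopReserve_zero_area hR.le]
      rcases h' with h' | h'
      · exact absurd (h'.trans_le hz.1) (lt_irrefl _)
      · exact h'
    · exact hs.criticalLevel_lt_stopReserve hlt hR hz0'.le
  linarith

theorem stopGap_neg_of_criticalLevel_le {x R : ℝ} (hx : 0 < x) (hR : M.criticalLevel ≤ R) :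
    M.stopGap f q x R < 0 := by
  have hc := hs.toCont
  have hR0 := M.criticalLevel_pos
  have hgt : ∀ y r, 0 < y → M.criticalLevel < r → M.stopGap f q y r < 0 := fun y r hy hr =>
    hs.stopGap_neg_of_area_lt le_rfl hy (hR0.trans hr)
      (hc.stopGap_zero_area (hR0.trans hr)).le (Or.inr hr)
  rcases hR.eq_or_lt with he | hlt
  · subst he
    -- At the critical level the drift at zero area vanishes. The weak inequality is obtained at
    -- area `x / 2` as a limit of larger reserves, and strictness by enlarging the area to `x`.
    have hle : M.stopGap f q (x / 2) M.criticalLevel ≤ 0 := by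
      have hcont : ContinuousAt (fun r => M.stopGap f q (x / 2) r) M.criticalLevel := by
        have := hc.continuousOn_stopGap.comp
          (by fun_prop : ContinuousOn (fun r : ℝ => (x / 2, r)) (Ioi 0))
          fun r hr => ⟨(half_pos hx).le, hr⟩
        exact this.continuousAt (Ioi_mem_nhds hR0)
      refine le_of_tendsto (hcont.tendsto.mono_left (nhdsWithin_le_nhds (s := Ioi M.criticalLevel))) ?_
      filter_upwards [self_mem_nhdsWithin] with r hr
      exact (hgt _ r (by linarith) hr).le
    exact hs.stopGap_neg_of_area_lt (by linarith) (by linarith : x / 2 < x) hR0 hle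
      (Or.inl (by linarith))
  · exact hgt x R hx hlt

theorem exists_stopGap_pos {x : ℝ} (hx : 0 < x) : ∃ R, 0 < R ∧ 0 < M.stopGap f q x R := by
  have hc := hs.toCont
  have h0 := M.α_pos
  have h1 := M.α_lt_one
  have hp := hc.stoppingProfile hx.le
  have hw := (hc.stopValue_zero_nonneg hx.le).2 hx
  set c := Real.exp (-(M.lam * x)) with hcdef
  have hc0 : 0 < c := Real.exp_pos _
  -- With this `K`, `marginal (K * R) = exp (-(λ x)) * marginal R`, whence `T ≤ K * R`: `T` tends to
  -- zero with `R`, whereas `Z` stays above its positive value at zero reserves.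
  set K := c ^ (1 / (M.α - 1)) with hK
  have hK0 : 0 < K := Real.rpow_pos_of_pos hc0 _
  have hZ := reserveEquivalent_pos (α := M.α) hw
  set R := reserveEquivalent M.α (M.stopValue f x 0) / (2 * K) with hRdef
  have hR : 0 < R := by positivity
  refine ⟨R, hR, ?_⟩
  rw [hc.stopGap_pos_iff hx.le hR]
  have hT : M.marginalReserve q x R ≤ K * R := by
    rw [marginalReserve, inverseMarginal_le_iff h0 h1 (hc.stopMarginal_pos hx.le hR)
      (by positivity)]
    refine le_trans (le_of_eq ?_) (hc.exp_mul_marginal_le_stopMarginal hx.le hR)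
    have : M.α - 1 ≠ 0 := by linarith
    rw [marginal, marginal, Real.mul_rpow hK0.le hR.le, hK, ← Real.rpow_mul hc0.le, one_div,
      inv_mul_cancel₀ this, Real.rpow_one]
    ring
  have hKR : K * R < reserveEquivalent M.α (M.stopValue f x 0) := by
    have : K * R = reserveEquivalent M.α (M.stopValue f x 0) / 2 := by
      rw [hRdef]; field_simp
    linarith
  exact (hT.trans_lt hKR).trans_le (reserveEquivalent_le_reserveEquivalent h0 hw.le
    (hp.strictMonoOn.monotoneOn self_mem_Ici hR.le hR.le))

theorem exists_stopGap_eq_zero {x : ℝ} (hx : 0 < x) :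
    ∃ R, 0 < R ∧ R < M.criticalLevel ∧ M.stopGap f q x R = 0 := by
  have hc := hs.toCont
  obtain ⟨S, hS, hS0⟩ := hs.exists_stopGap_pos hx
  have hneg := hs.stopGap_neg_of_criticalLevel_le hx le_rfl
  have hlt : S < M.criticalLevel := by
    by_contra hcon
    have := hs.stopGap_neg_of_criticalLevel_le hx (not_lt.1 hcon)
    linarith
  have hcont : ContinuousOn (fun r => M.stopGap f q x r) (Icc S M.criticalLevel) :=
    hc.continuousOn_stopGap.comp
      (by fun_prop : ContinuousOn (fun r : ℝ => (x, r)) (Icc S M.criticalLevel))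
      fun r hr => ⟨hx.le, hS.trans_le hr.1⟩
  obtain ⟨R, hR, hR0⟩ := intermediate_value_Icc' hlt.le hcont ⟨hneg.le, hS0.le⟩
  refine ⟨R, hS.trans_le hR.1, lt_of_le_of_ne hR.2 ?_, hR0⟩
  rintro rfl
  exact hneg.ne hR0

end IsSolution

/-- `ρ` is the boundary between exploration and consumption. -/
structure IsThreshold (M : NormalizedModel) (f q : ℝ → ℝ → ℝ) (ρ : ℝ → ℝ) : Prop where
  pos : ∀ x, 0 < ρ x
  of_nonpos : ∀ x, x ≤ 0 → ρ x = M.criticalLevel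
  lt_criticalLevel : ∀ x, 0 < x → ρ x < M.criticalLevel
  stopGap_eq_zero : ∀ x, 0 < x → M.stopGap f q x (ρ x) = 0

theorem IsSolution.exists_isThreshold (hs : M.IsSolution f q) : ∃ ρ, M.IsThreshold f q ρ := by
  have h : ∀ x : ℝ, ∃ R, 0 < R ∧ (x ≤ 0 → R = M.criticalLevel) ∧
      (0 < x → R < M.criticalLevel) ∧ (0 < x → M.stopGap f q x R = 0) := by
    intro x
    rcases le_or_gt x 0 with hx | hx
    · exact ⟨_, M.criticalLevel_pos, fun _ => rfl, fun h => absurd h (not_lt.2 hx),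
        fun h => absurd h (not_lt.2 hx)⟩
    · obtain ⟨R, h1, h2, h3⟩ := hs.exists_stopGap_eq_zero hx
      exact ⟨R, h1, fun h => absurd hx (not_lt.2 h), fun _ => h2, fun _ => h3⟩
  choose ρ h1 h2 h3 h4 using h
  exact ⟨ρ, h1, h2, h3, h4⟩

/-! ### Monotonicity, continuity and optimality of the threshold. -/

namespace IsThreshold

variable {ρ : ℝ → ℝ} (hρ : M.IsThreshold f q ρ) (hs : M.IsSolution f q)
include hρ hs

theorem stopGap_neg {x R : ℝ} (hx : 0 < x) (h : ρ x < R) : M.stopGap f q x R < 0 :=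
  hs.toCont.stopGap_neg_of_lt hx (hρ.pos x) h (hρ.stopGap_eq_zero x hx).le

theorem stopGap_pos {x R : ℝ} (hx : 0 < x) (hR : 0 < R) (h : R < ρ x) :
    0 < M.stopGap f q x R := by
  by_contra hcon
  have := hs.toCont.stopGap_neg_of_lt hx hR h (not_lt.1 hcon)
  rw [hρ.stopGap_eq_zero x hx] at this
  exact lt_irrefl _ this

theorem lt_of_stopGap_neg {x R : ℝ} (hx : 0 < x) (hR : 0 < R) (h : M.stopGap f q x R < 0) :
    ρ x < R := by
  by_contra hcon
  rcases (not_lt.1 hcon).eq_or_lt with he | hlt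
  · rw [he, hρ.stopGap_eq_zero x hx] at h; exact lt_irrefl _ h
  · exact lt_asymm h (hρ.stopGap_pos hs hx hR hlt)

theorem lt_of_stopGap_pos {x R : ℝ} (hx : 0 < x) (h : 0 < M.stopGap f q x R) :
    R < ρ x := by
  by_contra hcon
  rcases (not_lt.1 hcon).eq_or_lt with he | hlt
  · rw [← he, hρ.stopGap_eq_zero x hx] at h; exact lt_irrefl _ h
  · exact lt_asymm h (hρ.stopGap_neg hs hx hlt)

theorem strictAntiOn : StrictAntiOn ρ (Ici 0) := by
  intro x hx y hy hxy
  have hy0 : 0 < y := lt_of_le_of_lt hx hxy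
  rcases (mem_Ici.1 hx).eq_or_lt with he | hlt
  · rw [← he, hρ.of_nonpos 0 le_rfl]
    exact hρ.lt_criticalLevel y hy0
  · exact hρ.lt_of_stopGap_neg hs hy0 (hρ.pos x) (hs.stopGap_neg_of_area_lt hlt.le hxy (hρ.pos x)
      (hρ.stopGap_eq_zero x hlt).le (Or.inl hlt))

omit hs in
theorem le_criticalLevel (x : ℝ) : ρ x ≤ M.criticalLevel := by
  rcases le_or_gt x 0 with hx | hx
  · exact (hρ.of_nonpos x hx).le
  · exact (hρ.lt_criticalLevel x hx).le

theorem continuousAt {x : ℝ} (hx : 0 < x) : ContinuousAt ρ x := by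
  have hc := hs.toCont
  have hcx : ∀ R, 0 < R → ContinuousAt (fun y => M.stopGap f q y R) x := fun R hR =>
    (hc.hasDerivAt_stopGap hx.le hR).continuousAt
  refine (tendsto_order.2 ⟨fun a ha => ?_, fun b hb => ?_⟩ : Tendsto ρ (𝓝 x) (𝓝 (ρ x)))
  · have hlt : max a (ρ x / 2) < ρ x := max_lt ha (by linarith [hρ.pos x])
    have hpos : 0 < max a (ρ x / 2) := lt_max_of_lt_right (by linarith [hρ.pos x])
    filter_upwards [(hcx _ hpos).eventually_const_lt (hρ.stopGap_pos hs hx hpos hlt),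
      Ioi_mem_nhds hx] with y hy hy0
    exact (le_max_left _ _).trans_lt (hρ.lt_of_stopGap_pos hs hy0 hy)
  · have hpos : 0 < b := (hρ.pos x).trans hb
    filter_upwards [(hcx _ hpos).eventually_lt_const (hρ.stopGap_neg hs hx hb),
      Ioi_mem_nhds hx] with y hy hy0
    exact hρ.lt_of_stopGap_neg hs hy0 hpos hy

/-- A reserve below the critical level has reserve equivalent below it for small area, since the two
agree at zero area. It then lies in the exploration region, that is, below the threshold. -/
theorem tendsto_zero : Tendsto ρ (𝓝[>] 0) (𝓝 M.criticalLevel) := by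
  have hc := hs.toCont
  have h0 := M.criticalLevel_pos
  refine tendsto_order.2 ⟨fun a ha => ?_, fun b hb => Eventually.of_forall fun y =>
    (hρ.le_criticalLevel y).trans_lt hb⟩
  set R := max a (M.criticalLevel / 2)
  have hR : 0 < R := lt_max_of_lt_right (by linarith)
  have hRlt : R < M.criticalLevel := max_lt ha (by linarith)
  have hcz : ContinuousAt (fun y => M.stopReserve f y R) 0 :=
    (continuous_reserveEquivalent M.α_pos).continuousAt.comp
      (hasDerivAt_stopValue hc.cont 0 R).continuousAt
  have hz : M.stopReserve f 0 R < M.criticalLevel := by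
    rwa [stopReserve_zero_area hR.le]
  filter_upwards [(hcz.eventually_lt_const hz).filter_mono nhdsWithin_le_nhds,
    self_mem_nhdsWithin] with y hy hy0
  exact (le_max_left _ _).trans_lt (hρ.lt_of_stopGap_pos hs hy0
    (hs.stopGap_pos_of_stopReserve_le hy0 hR (le_of_lt hy)))

/-- In the exploration region the value is that of exploring at once. -/
theorem improve_eq {x R : ℝ} (hx : 0 < x) (hR : 0 ≤ R) (h : R ≤ ρ x) :
    M.improve f x R = M.stopValue f x R :=
  (hs.toCont.stoppingProfile hx.le).envelope_eq_value M.α_pos M.α_lt_one hR fun _ hr =>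
    ((hs.toCont.stopGap_pos_iff hx.le hr.1).1
      (hρ.stopGap_pos hs hx hr.1 (hr.2.trans_le h))).le

/-- In the consumption region one consumes down to the threshold. -/
theorem improve_eq_shift {x R : ℝ} (hx : 0 < x) (h : ρ x ≤ R) :
    M.improve f x R = (R - ρ x + M.stopReserve f x (ρ x)) ^ M.α := by
  have hp := hs.toCont.stoppingProfile hx.le
  rw [improve, hp.envelope_eq_shift M.α_pos M.α_lt_one (hρ.pos x) h
    ((hs.toCont.stopGap_nonpos_iff hx.le (hρ.pos x)).1 (hρ.stopGap_eq_zero x hx).le)]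
  have := hρ.improve_eq hs hx (hρ.pos x).le le_rfl
  rw [improve] at this
  rw [this, stopReserve]
  congr 1
  ring

/-- Consuming is strictly better above the threshold. -/
theorem stopValue_lt_improve {x R : ℝ} (hx : 0 < x) (h : ρ x < R) :
    M.stopValue f x R < M.improve f x R := by
  have hc := hs.toCont
  have hp := hc.stoppingProfile hx.le
  have hρx := hρ.pos x
  have hR := hρx.trans h
  have hzero : reserveEquivalent M.α (M.stopValue f x (ρ x)) ≤
      inverseMarginal M.α (M.stopMarginal q x (ρ x)) :=
    (hc.stopGap_nonpos_iff hx.le hρx).1 (hρ.stopGap_eq_zero x hx).le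
  refine lt_of_not_ge fun hcon => ?_
  have heq : M.stopReserve f x R = R - ρ x + M.stopReserve f x (ρ x) := by
    have h1 : M.improve f x R = M.stopValue f x R :=
      le_antisymm hcon (hp.value_le_envelope M.α_pos hR.le)
    have h2 := hρ.improve_eq_shift hs hx h.le
    rw [h1] at h2
    rw [stopReserve, h2, reserveEquivalent_of_rpow M.α_pos]
    linarith [hc.stopReserve_pos hx.le hρx]
  have hanti := hp.antitoneOn_gain M.α_pos M.α_lt_one hρx hzero
  -- Equality at `R` would force the antitone gain to be constant from the threshold to `R`. Its
  -- derivative at the midpoint would vanish, against the strictly negative gap there.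
  have hconst : ∀ r ∈ Icc (ρ x) R, M.stopReserve f x r - r = M.stopReserve f x (ρ x) - ρ x := by
    intro r hr
    have h1 := hanti self_mem_Ici (mem_Ici.2 hr.1) hr.1
    have h2 := hanti (mem_Ici.2 hr.1) (mem_Ici.2 h.le) hr.2
    simp only [stopReserve] at h1 h2 heq ⊢
    linarith
  set r := (ρ x + R) / 2 with hr
  have hr1 : ρ x < r := by rw [hr]; linarith
  have hr2 : r < R := by rw [hr]; linarith
  have hr0 := hρx.trans hr1
  have hneg := hρ.stopGap_neg hs hx hr1
  have hd := (hp.hasDerivAt_reserveEquivalent M.α_pos hr0).sub (hasDerivAt_id r)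
  have hev : (fun r => reserveEquivalent M.α (M.stopValue f x r) - id r) =ᶠ[𝓝 r]
      fun _ => M.stopReserve f x (ρ x) - ρ x := by
    filter_upwards [Ioo_mem_nhds hr1 hr2] with s hs
    exact hconst s ⟨hs.1.le, hs.2.le⟩
  have hz := hd.unique ((hasDerivAt_const r _).congr_of_eventuallyEq hev)
  have hm : M.stopMarginal q x r < marginal M.α (M.stopReserve f x r) := by
    rw [← hc.marginal_marginalReserve hx.le hr0]
    refine marginal_lt_marginal M.α_pos M.α_lt_one (hc.stopReserve_pos hx.le hr0) ?_
    rw [← not_le, ← hc.stopGap_nonneg_iff hx.le hr0]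
    exact not_le.2 hneg
  have := (div_lt_one (marginal_pos M.α_pos (hc.stopReserve_pos hx.le hr0))).2 hm
  rw [stopReserve] at this
  linarith

end IsThreshold

end NormalizedModel

end FreeBoundary

/-! ## Second derivatives in the reserves -/

section SecondDerivative

open Filter Topology

/-- The second derivative of `T ↦ T ^ α`. -/
noncomputable def marginalDeriv (α T : ℝ) : ℝ := (α - 1) * marginal α T / T

theorem marginalDeriv_neg {α T : ℝ} (h0 : 0 < α) (h1 : α < 1) (hT : 0 < T) :
    marginalDeriv α T < 0 :=
  div_neg_of_neg_of_pos (mul_neg_of_neg_of_pos (by linarith) (marginal_pos h0 hT)) hT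

theorem marginalDeriv_mono {α r T : ℝ} (h0 : 0 < α) (h1 : α < 1) (hr : 0 < r) (hT : r ≤ T) :
    marginalDeriv α r ≤ marginalDeriv α T := by
  have h2 := div_le_div₀ (marginal_pos h0 hr).le (marginal_le_marginal h0 h1 hr hT) hr hT
  rw [marginalDeriv, marginalDeriv, mul_div_assoc, mul_div_assoc]
  nlinarith

theorem continuousOn_marginalDeriv {α : ℝ} : ContinuousOn (marginalDeriv α) (Ioi 0) :=
  (continuousOn_const.mul continuousOn_marginal).div continuousOn_id fun _ h => ne_of_gt h

theorem marginal_sub_le {α r S S' : ℝ} (h0 : 0 < α) (h1 : α < 1) (hr : 0 < r) (hS : r ≤ S)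
    (hSS : S ≤ S') : marginal α S - marginal α S' ≤ -marginalDeriv α r * (S' - S) := by
  rcases hSS.eq_or_lt with rfl | hlt
  · simp
  obtain ⟨ξ, hξ, he⟩ := exists_hasDerivAt_eq_slope (marginal α) (marginalDeriv α) hlt
    (continuousOn_marginal.mono fun s hs => hr.trans_le (hS.trans hs.1))
    fun s hs => NormalizedModel.hasDerivAt_marginal (hr.trans_le (hS.trans hs.1.le))
  have h2 := marginalDeriv_mono h0 h1 hr (hS.trans hξ.1.le)
  rw [he, le_div_iff₀ (by linarith)] at h2
  linarith

namespace NormalizedModel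

variable {M : NormalizedModel} {f q : ℝ → ℝ → ℝ}

/-- Gain in the reserve equivalent from exploring at the threshold. -/
noncomputable def surplus (M : NormalizedModel) (f : ℝ → ℝ → ℝ) (ρ : ℝ → ℝ) (x : ℝ) : ℝ :=
  M.stopReserve f x (ρ x) - ρ x

/-- The second derivative of `stopValue` in the reserves. -/
noncomputable def stopMarginalDeriv (M : NormalizedModel) (q : ℝ → ℝ → ℝ) (x R : ℝ) : ℝ :=
  Real.exp (-(M.lam * x)) *
    (marginalDeriv M.α R + M.depositMean (fun y => deriv (q y) (R + M.a)) x)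

namespace IsThreshold

variable {ρ : ℝ → ℝ} (hρ : M.IsThreshold f q ρ) (hs : M.IsSolution f q)
include hρ hs

theorem le_stopReserve {x : ℝ} (hx : 0 ≤ x) : ρ x ≤ M.stopReserve f x (ρ x) := by
  rcases hx.eq_or_lt with rfl | hx
  · exact (stopReserve_zero_area (hρ.pos 0).le).ge
  · exact (hρ.le_criticalLevel x).trans
      (hs.criticalLevel_lt_stopReserve hx (hρ.pos x) (hρ.stopGap_eq_zero x hx).le).le

theorem surplus_nonneg {x : ℝ} (hx : 0 ≤ x) : 0 ≤ M.surplus f ρ x :=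
  sub_nonneg.2 (hρ.le_stopReserve hs hx)

theorem improveMarginal_eq {x R : ℝ} (hx : 0 < x) (hR : 0 < R) (h : R ≤ ρ x) :
    M.improveMarginal f q x R = M.stopMarginal q x R := by
  have hc := hs.toCont
  have h1 : 0 ≤ M.stopGap f q x R := by
    rcases h.eq_or_lt with rfl | h
    · exact (hρ.stopGap_eq_zero x hx).ge
    · exact (hρ.stopGap_pos hs hx hR h).le
  rw [improveMarginal, max_eq_left]
  rw [hρ.improve_eq hs hx hR.le h, ← hc.marginal_marginalReserve hx.le hR]
  exact marginal_le_marginal M.α_pos M.α_lt_one (hc.marginalReserve_pos hx.le hR)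
    ((hc.stopGap_nonneg_iff hx.le hR).1 h1)

theorem improveMarginal_eq_shift {x R : ℝ} (hx : 0 < x) (h : ρ x ≤ R) :
    M.improveMarginal f q x R = marginal M.α (R + M.surplus f ρ x) := by
  have hc := hs.toCont
  have hρx := hρ.pos x
  have h1 := (hc.stopGap_eq_zero_iff hx.le hρx).1 (hρ.stopGap_eq_zero x hx)
  have h2 := (hc.inverseMarginal_stopMarginal_slope hx.le hρx h).1
  have h3 := hc.stopReserve_pos hx.le hρx
  have h4 : M.marginalReserve q x (ρ x) + (R - ρ x) ≤ M.marginalReserve q x R := h2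
  have e : R - ρ x + M.stopReserve f x (ρ x) = R + M.surplus f ρ x := by rw [surplus]; ring
  rw [improveMarginal, hρ.improve_eq_shift hs hx h, e,
    reserveEquivalent_of_rpow M.α_pos (by rw [← e]; linarith), max_eq_right]
  rw [← hc.marginal_marginalReserve hx.le (hρx.trans_le h), ← e]
  refine marginal_le_marginal M.α_pos M.α_lt_one (by linarith) (by linarith)

/-- Lipschitz bound by induction on the number of deposits separating `S` from the critical level.
Above the threshold the marginal value is a translate of the marginal utility; below, it is a
mixture of the marginal utility and of marginal values one deposit higher, with the same constant.
-/
theorem marg_sub_le_of_pos (n : ℕ) : ∀ y S S', 0 < y → M.a ≤ S → M.criticalLevel ≤ S + n * M.a →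
    S ≤ S' → q y S - q y S' ≤ -marginalDeriv M.α M.a * (S' - S) := by
  have hc := hs.toCont
  have ha := M.a_pos
  induction n with
  | zero =>
    intro y S S' hy hS hn hSS
    have h1 : ρ y ≤ S := (hρ.le_criticalLevel y).trans (by simpa using hn)
    rw [hs.marg _ _ hy.le hS, hs.marg _ _ hy.le (hS.trans hSS),
      hρ.improveMarginal_eq_shift hs hy h1, hρ.improveMarginal_eq_shift hs hy (h1.trans hSS)]
    have := hρ.surplus_nonneg hs hy.le
    exact (marginal_sub_le M.α_pos M.α_lt_one ha (by linarith) (by linarith)).trans_eq (by ring)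
  | succ n ih =>
    intro y S S' hy hS hn hSS
    have hsh : ∀ S, ρ y ≤ S → M.a ≤ S → ∀ S', S ≤ S' →
        q y S - q y S' ≤ -marginalDeriv M.α M.a * (S' - S) := by
      intro S h1 hS S' hSS
      rw [hs.marg _ _ hy.le hS, hs.marg _ _ hy.le (hS.trans hSS),
        hρ.improveMarginal_eq_shift hs hy h1, hρ.improveMarginal_eq_shift hs hy (h1.trans hSS)]
      have := hρ.surplus_nonneg hs hy.le
      exact (marginal_sub_le M.α_pos M.α_lt_one ha (by linarith) (by linarith)).trans_eq (by ring)
    have hst : ∀ S', S ≤ S' → S' ≤ ρ y →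
        q y S - q y S' ≤ -marginalDeriv M.α M.a * (S' - S) := by
      intro S' hSS h1
      have hS0 : 0 < S := ha.trans_le hS
      rw [hs.marg _ _ hy.le hS, hs.marg _ _ hy.le (hS.trans hSS),
        hρ.improveMarginal_eq hs hy hS0 (hSS.trans h1),
        hρ.improveMarginal_eq hs hy (hS0.trans_le hSS) h1, stopMarginal, stopMarginal]
      have hq := hc.contDeriv
      have h2 : ∀ z ∈ Icc 0 y, q z (S + M.a) ≤
          -marginalDeriv M.α M.a * (S' - S) + 1 * q z (S' + M.a) := by
        have hpos : ∀ z, 0 < z → q z (S + M.a) ≤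
          -marginalDeriv M.α M.a * (S' - S) + 1 * q z (S' + M.a) := by
          intro z hz
          have := ih z (S + M.a) (S' + M.a) hz (by linarith)
            (by push_cast at hn; linarith) (by linarith)
          linarith
        intro z hz
        rcases hz.1.eq_or_lt with rfl | hz0
        -- The induction covers positive areas only, where the threshold separates the regimes; zero
        -- area follows by continuity.
        · have c1 := (continuous_slice hq (S + M.a)).continuousWithinAt (s := Ioi 0) (x := 0)
          have c2 := ((continuous_slice hq (S' + M.a)).const_mul 1).const_add
            (-marginalDeriv M.α M.a * (S' - S)) |>.continuousWithinAt (s := Ioi 0) (x := 0)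
          refine le_of_tendsto_of_tendsto c1 c2 ?_
          filter_upwards [self_mem_nhdsWithin] with z hz
          exact hpos z hz
        · exact hpos z hz0
      have h3 := depositMean_mono (M := M) (continuous_slice hq (S + M.a))
        (((continuous_slice hq (S' + M.a)).const_mul 1).const_add _) hy.le h2
      rw [depositMean_linear (continuous_slice hq (S' + M.a))] at h3
      have h4 := marginal_sub_le M.α_pos M.α_lt_one ha hS hSS
      have h5 := Real.exp_pos (-(M.lam * y))
      have h6 := exp_neg_mul_exp (M := M) y
      have h7 : Real.exp (-(M.lam * y)) * (marginal M.α S - marginal M.α S' +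
          (M.depositMean (fun y => q y (S + M.a)) y - M.depositMean (fun y => q y (S' + M.a)) y)) ≤
          Real.exp (-(M.lam * y)) * (Real.exp (M.lam * y) *
            (-marginalDeriv M.α M.a * (S' - S))) :=
        mul_le_mul_of_nonneg_left (by linarith) h5.le
      rw [← mul_assoc, h6, one_mul] at h7
      linarith
    rcases le_total (ρ y) S with h1 | h1
    · exact hsh S h1 hS S' hSS
    rcases le_total S' (ρ y) with h2 | h2
    · exact hst S' hSS h2
    · have h3 := hst (ρ y) h1 le_rfl
      have h4 := hsh (ρ y) le_rfl (hS.trans h1) S' h2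
      linarith

theorem marg_sub_le {y S S' : ℝ} (hy : 0 < y) (hS : M.a ≤ S) (hSS : S ≤ S') :
    q y S - q y S' ≤ -marginalDeriv M.α M.a * (S' - S) := by
  obtain ⟨n, hn⟩ := exists_nat_ge (M.criticalLevel / M.a)
  rw [div_le_iff₀ M.a_pos] at hn
  exact hρ.marg_sub_le_of_pos hs n y S S' hy hS (by linarith [M.a_pos]) hSS

omit hρ in
theorem _root_.NormalizedModel.IsSolution.marg_antitone {y S S' : ℝ} (hy : 0 ≤ y) (hS : M.a ≤ S)
    (hSS : S ≤ S') : q y S' ≤ q y S := by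
  have hc := hs.toCont
  have h := hc.slope y S S' hy hS hSS
  have hp := hc.pos y S hy hS
  have hp' := hc.pos y S' hy (hS.trans hSS)
  rw [← marginal_inverseMarginal M.α_pos M.α_lt_one hp,
    ← marginal_inverseMarginal M.α_pos M.α_lt_one hp']
  exact marginal_le_marginal M.α_pos M.α_lt_one (inverseMarginal_pos M.α_pos hp) (by linarith)

theorem abs_marg_sub_le {y S S' : ℝ} (hy : 0 < y) (hS : M.a ≤ S) (hS' : M.a ≤ S') :
    |q y S - q y S'| ≤ -marginalDeriv M.α M.a * |S - S'| := by
  rcases le_total S S' with h | h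
  · rw [abs_of_nonneg (sub_nonneg.2 (hs.marg_antitone hy.le hS h)), abs_sub_comm,
      abs_of_nonneg (sub_nonneg.2 h)]
    exact hρ.marg_sub_le hs hy hS h
  · rw [abs_sub_comm, abs_of_nonneg (sub_nonneg.2 (hs.marg_antitone hy.le hS' h)),
      abs_of_nonneg (sub_nonneg.2 h)]
    exact hρ.marg_sub_le hs hy hS' h

theorem abs_deriv_marg_le {y S : ℝ} (hy : 0 < y) (hS : M.a < S) :
    ‖deriv (q y) S‖ ≤ -marginalDeriv M.α M.a := by
  refine norm_deriv_le_of_lip' (neg_nonneg.2 (marginalDeriv_neg M.α_pos M.α_lt_one M.a_pos).le) ?_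
  filter_upwards [Ioi_mem_nhds hS] with s hs'
  exact hρ.abs_marg_sub_le hs hy (le_of_lt hs') hS.le

theorem hasDerivAt_marg_of_lt {y S : ℝ} (hy : 0 < y) (hS : M.a < S) (h : ρ y < S) :
    HasDerivAt (q y) (marginalDeriv M.α (S + M.surplus f ρ y)) S := by
  have h0 := hρ.surplus_nonneg hs hy.le
  have hd : HasDerivAt (fun s => marginal M.α (s + M.surplus f ρ y))
      (marginalDeriv M.α (S + M.surplus f ρ y)) S :=
    (hasDerivAt_marginal (α := M.α)
      (by linarith [M.a_pos] : 0 < S + M.surplus f ρ y)).comp_add_const S _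
  refine hd.congr_of_eventuallyEq ?_
  filter_upwards [Ioi_mem_nhds hS, Ioi_mem_nhds h] with s h1 h2
  rw [hs.marg _ _ hy.le (le_of_lt h1), hρ.improveMarginal_eq_shift hs hy (le_of_lt h2)]

theorem marg_eventuallyEq {y S : ℝ} (hy : 0 < y) (hS : M.a < S) (h : S < ρ y) :
    q y =ᶠ[𝓝 S] M.stopMarginal q y := by
  filter_upwards [Ioi_mem_nhds hS, Iio_mem_nhds h] with s h1 h2
  rw [hs.marg _ _ hy.le (le_of_lt h1),
    hρ.improveMarginal_eq hs hy (M.a_pos.trans h1) (le_of_lt h2)]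

/-- The possible kink of `q y` sits at `ρ y`. By strict monotonicity it hits a given level for at
most one area, so integrals over the area do not see it. -/
theorem ae_threshold_ne (S : ℝ) : ∀ᵐ y : ℝ, 0 < y → ρ y ≠ S := by
  have hsub : ({y | 0 < y ∧ ρ y = S} : Set ℝ).Subsingleton := fun y hy z hz =>
    (hρ.strictAntiOn hs).injOn (le_of_lt hy.1) (le_of_lt hz.1) (hy.2.trans hz.2.symm)
  have h0 := hsub.measure_zero volume
  rw [ae_iff]
  convert h0 using 2
  ext y
  simp

/-- Differentiation under the integral with a Lipschitz bound needs differentiability only for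
almost every area, so a kink on the null set of areas with threshold `R + a` is harmless. -/
theorem hasDerivAt_stopMarginal_of_ae {R x : ℝ} (hR : 0 < R) (hx : 0 ≤ x)
    (h : ∀ y, 0 < y → ρ y ≠ R + M.a → DifferentiableAt ℝ (q y) (R + M.a)) :
    HasDerivAt (M.stopMarginal q x) (M.stopMarginalDeriv q x R) R := by
  have hc := hs.toCont
  have hq := hc.contDeriv
  have hl := M.lam_pos
  set L := -marginalDeriv M.α M.a with hL
  have hL0 : 0 ≤ L := neg_nonneg.2 (marginalDeriv_neg M.α_pos M.α_lt_one M.a_pos).le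
  have hm : Measurable fun y => deriv (q y) (R + M.a) :=
    (measurable_deriv_with_param hq).comp (measurable_id.prodMk measurable_const)
  have key := (intervalIntegral.hasDerivAt_integral_of_dominated_loc_of_lip (μ := volume)
    (F := fun r y => M.lam * Real.exp (M.lam * y) * q y (r + M.a))
    (F' := fun y => M.lam * Real.exp (M.lam * y) * deriv (q y) (R + M.a)) (x₀ := R)
    (s := Ioi 0) (a := 0) (b := x) (bound := fun y => M.lam * Real.exp (M.lam * y) * L)
    (Ioi_mem_nhds hR) ?_ ?_ ?_ ?_ ?_ ?_).2
  · refine ((hasDerivAt_marginal (α := M.α) hR).add key).const_mul _ |>.congr_of_eventuallyEq ?_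
    exact Eventually.of_forall fun r => rfl
  · refine Eventually.of_forall fun r => ?_
    exact ((by fun_prop : Continuous fun y => M.lam * Real.exp (M.lam * y)).mul
      (continuous_slice hq (r + M.a))).aestronglyMeasurable
  · exact intervalIntegrable_depositMean (continuous_slice hq (R + M.a)) _ _
  · exact ((by fun_prop : Measurable fun y => M.lam * Real.exp (M.lam * y)).mul
      hm).aestronglyMeasurable
  · refine ae_of_all _ fun y hy => ?_
    rw [uIoc_of_le hx] at hy
    refine LipschitzOnWith.of_dist_le_mul fun r hr r' hr' => ?_
    have h1 := hρ.abs_marg_sub_le hs hy.1 (by linarith [mem_Ioi.1 hr] : M.a ≤ r + M.a)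
      (by linarith [mem_Ioi.1 hr'] : M.a ≤ r' + M.a)
    have h2 : 0 < M.lam * Real.exp (M.lam * y) := mul_pos hl (Real.exp_pos _)
    rw [Real.dist_eq, Real.dist_eq, ← mul_sub, abs_mul, abs_of_pos h2, Real.coe_nnabs,
      abs_of_nonneg (mul_nonneg h2.le hL0), mul_assoc _ L]
    refine mul_le_mul_of_nonneg_left (h1.trans_eq ?_) h2.le
    rw [add_sub_add_right_eq_sub]
  · exact (by fun_prop : Continuous fun y => M.lam * Real.exp (M.lam * y) * L).intervalIntegrable _ _
  · filter_upwards [hρ.ae_threshold_ne hs (R + M.a)] with y hy hyx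
    rw [uIoc_of_le hx] at hyx
    exact ((h y hyx.1 (hy hyx.1)).hasDerivAt.comp_add_const R M.a).const_mul _

theorem continuousWithinAt_stopMarginalDeriv_of_ae {R x : ℝ} (hR : 0 < R) (hx : 0 ≤ x)
    (h : ∀ y, 0 < y → ρ y ≠ R + M.a → ContinuousAt (deriv (q y)) (R + M.a)) :
    ContinuousWithinAt (Function.uncurry (M.stopMarginalDeriv q)) {z | 0 ≤ z.1} (x, R) := by
  have hc := hs.toCont
  have hq := hc.contDeriv
  have hl := M.lam_pos
  set L := -marginalDeriv M.α M.a with hL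
  have hL0 : 0 ≤ L := neg_nonneg.2 (marginalDeriv_neg M.α_pos M.α_lt_one M.a_pos).le
  have hm : ∀ r, Measurable fun y => deriv (q y) (r + M.a) := fun r =>
    (measurable_deriv_with_param hq).comp (measurable_id.prodMk measurable_const)
  -- The moving upper limit is put into the integrand as an indicator, over an interval reaching
  -- slightly beyond `x`, so that dominated convergence treats area and reserves together. The
  -- indicator is discontinuous in the area only at `y = x`, a null set.
  have hmain : ContinuousWithinAt (fun z : ℝ × ℝ =>
      ∫ y in Ioc 0 (x + 1), (Iio z.1).indicator
        (fun y => M.lam * Real.exp (M.lam * y) * deriv (q y) (z.2 + M.a)) y)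
      {z | 0 ≤ z.1} (x, R) := by
    refine continuousWithinAt_of_dominated (bound := fun y => M.lam * Real.exp (M.lam * y) * L)
      ?_ ?_ ?_ ?_
    · refine Eventually.of_forall fun z => ?_
      exact (((by fun_prop : Measurable fun y => M.lam * Real.exp (M.lam * y)).mul
        (hm z.2)).indicator measurableSet_Iio).aestronglyMeasurable
    · have hev : ∀ᶠ z : ℝ × ℝ in 𝓝 (x, R), 0 < z.2 :=
        (continuous_snd.tendsto (x, R)).eventually (lt_mem_nhds hR)
      filter_upwards [hev.filter_mono nhdsWithin_le_nhds] with z hz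
      rw [ae_restrict_iff' measurableSet_Ioc]
      refine ae_of_all _ fun y hy => ?_
      have h2 : 0 < M.lam * Real.exp (M.lam * y) := mul_pos hl (Real.exp_pos _)
      refine (norm_indicator_le_norm_self _ _).trans ?_
      rw [norm_mul, Real.norm_of_nonneg h2.le]
      exact mul_le_mul_of_nonneg_left (hρ.abs_deriv_marg_le hs hy.1 (by linarith)) h2.le
    · exact ((by fun_prop : Continuous fun y => M.lam * Real.exp (M.lam * y) * L).integrableOn_Ioc)
    · rw [ae_restrict_iff' measurableSet_Ioc]
      have hne : ∀ᵐ y : ℝ, y ≠ x := by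
        rw [ae_iff]; simp
      filter_upwards [hρ.ae_threshold_ne hs (R + M.a), hne] with y hy hyx hyI
      refine ContinuousAt.continuousWithinAt ?_
      rcases lt_or_gt_of_ne hyx with hlt | hgt
      · have h1 : ContinuousAt (fun z : ℝ × ℝ =>
            M.lam * Real.exp (M.lam * y) * deriv (q y) (z.2 + M.a)) (x, R) :=
          continuousAt_const.mul (ContinuousAt.comp (g := deriv (q y))
            (f := fun z : ℝ × ℝ => z.2 + M.a) (h y hyI.1 (hy hyI.1)) (by fun_prop))
        refine h1.congr ?_
        filter_upwards [(continuous_fst.tendsto (x, R)).eventually (lt_mem_nhds hlt)] with z hz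
        rw [indicator_of_mem (show y ∈ Iio z.1 from hz)]
      · refine (continuousAt_const (y := (0 : ℝ))).congr ?_
        filter_upwards [(continuous_fst.tendsto (x, R)).eventually (gt_mem_nhds hgt)] with z hz
        rw [indicator_of_notMem (show y ∉ Iio z.1 from not_lt.2 (le_of_lt hz))]
  have hA : ContinuousWithinAt (fun z : ℝ × ℝ => Real.exp (-(M.lam * z.1)) *
      (marginalDeriv M.α z.2 + ∫ y in Ioc 0 (x + 1), (Iio z.1).indicator
        (fun y => M.lam * Real.exp (M.lam * y) * deriv (q y) (z.2 + M.a)) y))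
      {z | 0 ≤ z.1} (x, R) := by
    refine ContinuousWithinAt.mul (by fun_prop) (ContinuousWithinAt.add ?_ hmain)
    exact (ContinuousAt.comp (g := marginalDeriv M.α) (f := fun z : ℝ × ℝ => z.2)
      (continuousOn_marginalDeriv.continuousAt (Ioi_mem_nhds hR)) (by fun_prop)).continuousWithinAt
  have hEq : ∀ z : ℝ × ℝ, 0 ≤ z.1 → z.1 < x + 1 →
      Function.uncurry (M.stopMarginalDeriv q) z = Real.exp (-(M.lam * z.1)) *
      (marginalDeriv M.α z.2 + ∫ y in Ioc 0 (x + 1), (Iio z.1).indicator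
        (fun y => M.lam * Real.exp (M.lam * y) * deriv (q y) (z.2 + M.a)) y) := by
    intro z h0 h1
    change M.stopMarginalDeriv q z.1 z.2 = _
    have hset : Ioc 0 (x + 1) ∩ Iio z.1 = Ioo 0 z.1 := by
      ext y
      simp only [mem_inter_iff, mem_Ioc, mem_Iio, mem_Ioo]
      exact ⟨fun h => ⟨h.1.1, h.2⟩, fun h => ⟨⟨h.1, by linarith [h.2]⟩, h.2⟩⟩
    rw [stopMarginalDeriv, depositMean, intervalIntegral.integral_of_le h0,
      setIntegral_indicator measurableSet_Iio, hset, integral_Ioc_eq_integral_Ioo]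
  refine hA.congr_of_eventuallyEq ?_ (hEq _ hx (by simp))
  have hev : ∀ᶠ z : ℝ × ℝ in 𝓝 (x, R), z.1 < x + 1 :=
    (continuous_fst.tendsto (x, R)).eventually (gt_mem_nhds (by simp))
  filter_upwards [hev.filter_mono nhdsWithin_le_nhds, self_mem_nhdsWithin] with z h1 h2
  exact hEq z h2 h1

/-- Again induction on the number of deposits up to the critical level. Regularity at `R` needs that
of `q y` at `R + a`: above the threshold it is explicit, below it `q y` is locally the marginal
value of exploring, known by the induction hypothesis. -/
theorem stopMarginal_regular (n : ℕ) : ∀ R, 0 < R → M.criticalLevel < R + n * M.a → ∀ x, 0 ≤ x →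
    HasDerivAt (M.stopMarginal q x) (M.stopMarginalDeriv q x R) R ∧
    ContinuousWithinAt (Function.uncurry (M.stopMarginalDeriv q)) {z | 0 ≤ z.1} (x, R) := by
  have hkey : ∀ R, 0 < R → (∀ y, 0 < y → R + M.a < ρ y →
      DifferentiableAt ℝ (q y) (R + M.a) ∧ ContinuousAt (deriv (q y)) (R + M.a)) → ∀ x, 0 ≤ x →
      HasDerivAt (M.stopMarginal q x) (M.stopMarginalDeriv q x R) R ∧
      ContinuousWithinAt (Function.uncurry (M.stopMarginalDeriv q)) {z | 0 ≤ z.1} (x, R) := by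
    intro R hR h x hx
    have hall : ∀ y, 0 < y → ρ y ≠ R + M.a →
        DifferentiableAt ℝ (q y) (R + M.a) ∧ ContinuousAt (deriv (q y)) (R + M.a) := by
      intro y hy hne
      rcases lt_or_gt_of_ne hne with hlt | hgt
      · have ha : M.a < R + M.a := by linarith
        refine ⟨(hρ.hasDerivAt_marg_of_lt hs hy ha hlt).differentiableAt, ?_⟩
        have h0 := hρ.surplus_nonneg hs hy.le
        have hcont : ContinuousAt (fun s => marginalDeriv M.α (s + M.surplus f ρ y)) (R + M.a) :=
          ContinuousAt.comp (g := marginalDeriv M.α) (f := fun s => s + M.surplus f ρ y)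
            (continuousOn_marginalDeriv.continuousAt
              (Ioi_mem_nhds (by linarith [M.a_pos] : 0 < R + M.a + M.surplus f ρ y)))
            (by fun_prop)
        refine hcont.congr ?_
        filter_upwards [Ioi_mem_nhds ha, Ioi_mem_nhds hlt] with s h1 h2
        exact (hρ.hasDerivAt_marg_of_lt hs hy h1 h2).deriv.symm
      · exact h y hy hgt
    exact ⟨hρ.hasDerivAt_stopMarginal_of_ae hs hR hx fun y hy hne => (hall y hy hne).1,
      hρ.continuousWithinAt_stopMarginalDeriv_of_ae hs hR hx fun y hy hne => (hall y hy hne).2⟩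
  induction n with
  | zero =>
    intro R hR hn
    refine hkey R hR fun y hy hlt => ?_
    have := hρ.le_criticalLevel y
    push_cast at hn
    linarith [M.a_pos]
  | succ n ih =>
    intro R hR hn
    refine hkey R hR fun y hy hlt => ?_
    have ha : M.a < R + M.a := by linarith
    have hev : ∀ᶠ S in 𝓝 (R + M.a), M.a < S ∧ S < ρ y ∧ M.criticalLevel < S + n * M.a := by
      push_cast at hn
      filter_upwards [Ioi_mem_nhds ha, Iio_mem_nhds hlt,
        Ioi_mem_nhds (by linarith : M.criticalLevel - n * M.a < R + M.a)] with S h1 h2 h3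
      exact ⟨h1, h2, by linarith [mem_Ioi.1 h3]⟩
    have hd : ∀ S, M.a < S ∧ S < ρ y ∧ M.criticalLevel < S + n * M.a →
        HasDerivAt (q y) (M.stopMarginalDeriv q y S) S := fun S hS =>
      (ih S (M.a_pos.trans hS.1) hS.2.2 y hy.le).1.congr_of_eventuallyEq
        (hρ.marg_eventuallyEq hs hy hS.1 hS.2.1)
    have hS := hev.self_of_nhds
    refine ⟨(hd _ hS).differentiableAt, ?_⟩
    have hcont : ContinuousAt (M.stopMarginalDeriv q y) (R + M.a) := by
      have h1 := (ih (R + M.a) (by linarith [M.a_pos]) hS.2.2 y hy.le).2.continuousAt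
        ((continuous_fst.tendsto (y, R + M.a)).eventually (Ici_mem_nhds hy))
      exact ContinuousAt.comp (g := Function.uncurry (M.stopMarginalDeriv q))
        (f := fun S => (y, S)) h1 (by fun_prop)
    refine hcont.congr ?_
    filter_upwards [hev] with S hS
    exact (hd S hS).deriv.symm

theorem hasDerivAt_stopMarginal_reserve {x R : ℝ} (hx : 0 ≤ x) (hR : 0 < R) :
    HasDerivAt (M.stopMarginal q x) (M.stopMarginalDeriv q x R) R := by
  obtain ⟨n, hn⟩ := exists_nat_ge (M.criticalLevel / M.a)
  rw [div_le_iff₀ M.a_pos] at hn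
  exact (hρ.stopMarginal_regular hs n R hR (by linarith) x hx).1

theorem continuousOn_stopMarginalDeriv :
    ContinuousOn (Function.uncurry (M.stopMarginalDeriv q)) {z | 0 ≤ z.1 ∧ 0 < z.2} := by
  intro z hz
  obtain ⟨n, hn⟩ := exists_nat_ge (M.criticalLevel / M.a)
  rw [div_le_iff₀ M.a_pos] at hn
  exact (hρ.stopMarginal_regular hs n z.2 hz.2 (by linarith [hz.2]) z.1 hz.1).2.mono
    fun w hw => hw.1

end IsThreshold

end NormalizedModel

end SecondDerivative

/-! ## Smoothness of the threshold -/

section ThresholdDerivative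

open Filter Topology

theorem exists_sub_eq_mul_of_hasDerivAt {g g' : ℝ → ℝ} {u v : ℝ}
    (h : ∀ z ∈ uIcc u v, HasDerivAt g (g' z) z) : ∃ η ∈ uIcc u v, g v - g u = g' η * (v - u) := by
  wlog huv : u ≤ v generalizing u v
  · obtain ⟨η, hη, he⟩ := this (u := v) (v := u) (by rwa [uIcc_comm]) (le_of_not_ge huv)
    exact ⟨η, by rwa [uIcc_comm], by linarith⟩
  rw [uIcc_of_le huv] at h ⊢
  rcases huv.eq_or_lt with rfl | hlt
  · exact ⟨u, by simp, by simp⟩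
  obtain ⟨η, hη, he⟩ := exists_hasDerivAt_eq_slope g g' hlt
    (fun z hz => (h z hz).continuousAt.continuousWithinAt) fun z hz => h z (Ioo_subset_Icc_self hz)
  refine ⟨η, Ioo_subset_Icc_self hη, ?_⟩
  rw [he, div_mul_cancel₀ _ (by linarith)]

theorem tendsto_of_eventually_mem_uIcc {X : Type*} {l : Filter X} {u v η : X → ℝ} {c : ℝ}
    (hu : Tendsto u l (𝓝 c)) (hv : Tendsto v l (𝓝 c)) (h : ∀ᶠ t in l, η t ∈ uIcc (u t) (v t)) :
    Tendsto η l (𝓝 c) := by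
  refine tendsto_of_tendsto_of_tendsto_of_le_of_le' (by simpa using hu.min hv)
    (by simpa using hu.max hv) ?_ ?_
  · filter_upwards [h] with t ht using ht.1
  · filter_upwards [h] with t ht using ht.2

/-- For `u(T) = T ^ α`, the second derivative expressed through the first is a negative multiple of
the power `(2 - α) / (1 - α) > 1`, hence strictly concave. This is its tangent inequality at
`marginal T`, with slope `u''' / u'' = -(2 - α) / T`. -/
theorem marginalDeriv_inverseMarginal_le {α t T : ℝ} (h0 : 0 < α) (h1 : α < 1) (ht : 0 < t)
    (hT : 0 < T) :
    marginalDeriv α (inverseMarginal α t) ≤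
      marginalDeriv α T - (2 - α) / T * (t - marginal α T) ∧
    (inverseMarginal α t ≠ T → marginalDeriv α (inverseMarginal α t) <
      marginalDeriv α T - (2 - α) / T * (t - marginal α T)) := by
  have hY := inverseMarginal_pos h0 ht
  have htY := marginal_inverseMarginal h0 h1 ht
  set Y := inverseMarginal α t
  have hs : -1 ≤ Y / T - 1 := by have := div_pos hY hT; linarith
  have hmT := marginal_pos h0 hT
  have hmY := marginal_pos h0 hY
  have e1 : (1 + (Y / T - 1)) ^ (2 - α) = Y * marginal α T / (T * marginal α Y) := by
    rw [add_sub_cancel, show 2 - α = 1 - (α - 1) by ring, Real.rpow_sub (div_pos hY hT),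
      Real.rpow_one, Real.div_rpow hY.le hT.le, marginal, marginal]
    have := Real.rpow_pos_of_pos hY (α - 1)
    have := Real.rpow_pos_of_pos hT (α - 1)
    field_simp
  have e2 : marginalDeriv α T - (2 - α) / T * (t - marginal α T) - marginalDeriv α Y =
      marginal α Y / Y * ((1 + (Y / T - 1)) ^ (2 - α) - (1 + (2 - α) * (Y / T - 1))) := by
    rw [e1, ← htY, marginalDeriv, marginalDeriv]
    field_simp
    ring
  have hp : 0 < marginal α Y / Y := div_pos hmY hY
  constructor
  · have := mul_nonneg hp.le (sub_nonneg.2 (one_add_mul_self_le_rpow_one_add hs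
      (by linarith : 1 ≤ 2 - α)))
    linarith
  · intro hne
    have := mul_pos hp (sub_pos.2 (one_add_mul_self_lt_rpow_one_add hs
      (by rw [sub_ne_zero]; rwa [Ne, div_eq_one_iff_eq hT.ne']) (by linarith : 1 < 2 - α)))
    linarith

theorem hasDerivAt_marginalDeriv {α T : ℝ} (hT : 0 < T) :
    HasDerivAt (marginalDeriv α) ((α - 1) * (α - 2) * marginal α T / T ^ 2) T := by
  refine (((NormalizedModel.hasDerivAt_marginal hT).const_mul (α - 1)).div (hasDerivAt_id T)
    hT.ne').congr_deriv ?_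
  simp only [id]
  field_simp
  ring

namespace NormalizedModel

variable {M : NormalizedModel} {f q : ℝ → ℝ → ℝ}

/-- The derivative of the threshold. -/
noncomputable def thresholdDeriv (M : NormalizedModel) (f q : ℝ → ℝ → ℝ) (ρ : ℝ → ℝ) (x : ℝ) : ℝ :=
  (1 - M.α) * M.switchDrift (M.stopReserve f x (ρ x)) / (M.stopReserve f x (ρ x) *
    (marginalDeriv M.α (M.stopReserve f x (ρ x)) - M.stopMarginalDeriv q x (ρ x)))

theorem IsContinuation.continuousOn_stopGapDeriv (hc : M.IsContinuation f q) :
    ContinuousOn (Function.uncurry (M.stopGapDeriv f q)) {z | 0 ≤ z.1 ∧ 0 < z.2} := by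
  have h1 : ContinuousOn (Function.uncurry (M.stopMarginal q)) {z | 0 ≤ z.1 ∧ 0 < z.2} :=
    (continuousOn_stopMarginal hc.contDeriv).mono fun z hz => hz.2
  have h2 : ContinuousOn (Function.uncurry (M.marginalReserve q)) {z | 0 ≤ z.1 ∧ 0 < z.2} :=
    (continuousOn_inverseMarginal M.α_pos).comp h1 fun z hz => hc.stopMarginal_pos hz.1 hz.2
  have h3 : ContinuousOn (Function.uncurry (M.stopValue f)) {z | 0 ≤ z.1 ∧ 0 < z.2} :=
    (continuous_stopValue hc.cont).continuousOn
  have h4 : ContinuousOn (fun z : ℝ × ℝ => f z.1 (z.2 + M.a)) {z | 0 ≤ z.1 ∧ 0 < z.2} :=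
    (hc.cont.comp (by fun_prop : Continuous fun z : ℝ × ℝ => (z.1, z.2 + M.a))).continuousOn
  have h5 : ContinuousOn (fun z : ℝ × ℝ => q z.1 (z.2 + M.a)) {z | 0 ≤ z.1 ∧ 0 < z.2} :=
    (hc.contDeriv.comp (by fun_prop : Continuous fun z : ℝ × ℝ => (z.1, z.2 + M.a))).continuousOn
  exact ((continuousOn_const.mul (h4.sub h3)).sub continuousOn_const).add
    ((h2.div_const _).mul (continuousOn_const.mul (h5.sub h1)))

theorem IsContinuation.continuous_stopReserve (hc : M.IsContinuation f q) :
    Continuous (Function.uncurry (M.stopReserve f)) :=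
  (continuous_reserveEquivalent M.α_pos).comp (continuous_stopValue hc.cont)

namespace IsThreshold

variable {ρ : ℝ → ℝ} (hρ : M.IsThreshold f q ρ) (hs : M.IsSolution f q)
include hρ hs

theorem differentiableAt_marg {y S : ℝ} (hy : 0 < y) (hS : M.a < S) (hne : ρ y ≠ S) :
    DifferentiableAt ℝ (q y) S := by
  rcases lt_or_gt_of_ne hne with h | h
  · exact (hρ.hasDerivAt_marg_of_lt hs hy hS h).differentiableAt
  · exact ((hρ.hasDerivAt_stopMarginal_reserve hs hy.le
      (M.a_pos.trans hS)).congr_of_eventuallyEq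
      (hρ.marg_eventuallyEq hs hy hS h)).differentiableAt

/-- Infinitesimal form of `slope`: to the right of `S`, the marginal value stays below the
translated marginal utility that touches it at `S`. -/
theorem deriv_marg_le {y S : ℝ} (hy : 0 < y) (hS : M.a < S) (hne : ρ y ≠ S) :
    deriv (q y) S ≤ marginalDeriv M.α (inverseMarginal M.α (q y S)) := by
  have hc := hs.toCont
  have hd := (hρ.differentiableAt_marg hs hy hS hne).hasDerivAt
  have hp := hc.pos y S hy.le hS.le
  have hT := inverseMarginal_pos M.α_pos hp
  set T := inverseMarginal M.α (q y S) with hTdef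
  have hd2 : HasDerivAt (fun s => marginal M.α (s + (T - S))) (marginalDeriv M.α T) S := by
    have h := hasDerivAt_marginal (α := M.α) hT
    rw [show T = S + (T - S) by ring] at h
    have h' := h.comp_add_const S (T - S)
    rwa [← show T = S + (T - S) by ring] at h'
  refine le_of_tendsto_of_tendsto (hasDerivAt_iff_tendsto_slope_left_right.1 hd).2
    (hasDerivAt_iff_tendsto_slope_left_right.1 hd2).2 ?_
  filter_upwards [self_mem_nhdsWithin] with s hsS
  rw [mem_Ioi] at hsS
  rw [slope_def_field, slope_def_field]
  refine div_le_div_of_nonneg_right (sub_le_sub ?_ ?_) (by linarith)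
  · have h1 := hc.slope y S s hy.le hS.le hsS.le
    have hp' := hc.pos y s hy.le (hS.le.trans hsS.le)
    rw [← marginal_inverseMarginal M.α_pos M.α_lt_one hp']
    exact marginal_le_marginal M.α_pos M.α_lt_one (by linarith) (by linarith)
  · rw [add_sub_cancel, hTdef, marginal_inverseMarginal M.α_pos M.α_lt_one hp]

theorem intervalIntegrable_deriv_marg {R x : ℝ} (hR : 0 < R) (hx : 0 ≤ x) :
    IntervalIntegrable (fun y => M.lam * Real.exp (M.lam * y) * deriv (q y) (R + M.a))
      volume 0 x := by
  have hm : Measurable fun y => deriv (q y) (R + M.a) :=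
    (measurable_deriv_with_param hs.toCont.contDeriv).comp
      (measurable_id.prodMk measurable_const)
  refine ((by fun_prop : Continuous fun y => M.lam * Real.exp (M.lam * y) *
    -marginalDeriv M.α M.a).intervalIntegrable 0 x).mono_fun'
    ((by fun_prop : Measurable fun y => M.lam * Real.exp (M.lam * y)).mul hm).aestronglyMeasurable ?_
  refine (ae_restrict_iff' measurableSet_uIoc).2 (ae_of_all _ fun y hy => ?_)
  rw [uIoc_of_le hx] at hy
  have h2 : 0 < M.lam * Real.exp (M.lam * y) := mul_pos M.lam_pos (Real.exp_pos _)
  beta_reduce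
  rw [norm_mul, Real.norm_of_nonneg h2.le]
  exact mul_le_mul_of_nonneg_left (hρ.abs_deriv_marg_le hs hy.1 (by linarith)) h2.le

/-- The concave tangent inequality at `T` is averaged over the outcomes of exploration; the linear
term cancels since `T` carries the average marginal utility. The atom at `R ≠ T` makes it strict. At
the threshold this says that the gap has negative derivative in the reserves. -/
theorem stopMarginalDeriv_lt {x R : ℝ} (hx : 0 < x) (hR : 0 < R)
    (h : R ≠ M.marginalReserve q x R) :
    M.stopMarginalDeriv q x R < marginalDeriv M.α (M.marginalReserve q x R) := by
  have hc := hs.toCont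
  have h0 := M.α_pos
  have h1 := M.α_lt_one
  have hT := hc.marginalReserve_pos hx.le hR
  have hmT := hc.marginal_marginalReserve hx.le hR
  set T := M.marginalReserve q x R
  set p := M.stopMarginal q x R with hp
  set c := marginalDeriv M.α T + (2 - M.α) / T * p with hcdef
  set d := -((2 - M.α) / T) with hd
  have hatom : marginalDeriv M.α R < c + d * marginal M.α R := by
    have := (marginalDeriv_inverseMarginal_le h0 h1 (marginal_pos h0 hR) hT).2
    rw [inverseMarginal_marginal h0 h1 hR] at this
    refine (this h).trans_eq ?_
    rw [hmT, hcdef, hd]; ring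
  have hq := continuous_slice hc.contDeriv (R + M.a)
  have hint : M.depositMean (fun y => deriv (q y) (R + M.a)) x ≤
      M.depositMean (fun y => c + d * q y (R + M.a)) x := by
    refine intervalIntegral.integral_mono_ae_restrict hx.le
      (hρ.intervalIntegrable_deriv_marg hs hR hx.le)
      (intervalIntegrable_depositMean ((hq.const_mul d).const_add c) _ _) ?_
    have hne0 : ∀ᵐ y : ℝ, y ≠ 0 := by rw [ae_iff]; simp
    refine (ae_restrict_iff' measurableSet_Icc).2 ?_
    filter_upwards [hρ.ae_threshold_ne hs (R + M.a), hne0] with y hy hy0 hyI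
    have hy0' : 0 < y := lt_of_le_of_ne hyI.1 (Ne.symm hy0)
    have hS : M.a < R + M.a := by linarith
    refine mul_le_mul_of_nonneg_left ((hρ.deriv_marg_le hs hy0' hS (hy hy0')).trans ?_)
      (mul_pos M.lam_pos (Real.exp_pos _)).le
    refine (marginalDeriv_inverseMarginal_le h0 h1 (hc.pos y _ hyI.1 hS.le) hT).1.trans_eq ?_
    rw [hmT, hcdef, hd]; ring
  rw [depositMean_linear hq] at hint
  have he := Real.exp_pos (-(M.lam * x))
  have h6 := exp_neg_mul_exp (M := M) x
  rw [stopMarginalDeriv]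
  calc _ < Real.exp (-(M.lam * x)) * (c + d * marginal M.α R +
        (c * (Real.exp (M.lam * x) - 1) + d * M.depositMean (fun y => q y (R + M.a)) x)) :=
        mul_lt_mul_of_pos_left (by linarith) he
    _ = c * (Real.exp (-(M.lam * x)) * Real.exp (M.lam * x)) + d * p := by
        rw [hp, stopMarginal]; ring
    _ = marginalDeriv M.α T := by rw [h6, hcdef, hd]; ring

theorem hasDerivAt_stopGap_reserve {x R : ℝ} (hx : 0 ≤ x) (hR : 0 < R) :
    HasDerivAt (M.stopGap f q x) (M.stopMarginal q x R + M.marginalReserve q x R / (1 - M.α) *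
      M.stopMarginalDeriv q x R) R := by
  have hc := hs.toCont
  have h := (hasDerivAt_inverseMarginal_rpow M.α_pos M.α_lt_one
    (hc.stopMarginal_pos hx hR)).comp R (hρ.hasDerivAt_stopMarginal_reserve hs hx hR)
  refine ((hc.hasDerivAt_stopValue_reserve hx hR).sub h).congr_deriv ?_
  rw [marginalReserve]
  ring

theorem marginalReserve_threshold {x : ℝ} (hx : 0 < x) :
    M.marginalReserve q x (ρ x) = M.stopReserve f x (ρ x) :=
  (hs.toCont.stopGap_eq_zero_iff hx.le (hρ.pos x)).1 (hρ.stopGap_eq_zero x hx)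

theorem criticalLevel_lt_stopReserve {x : ℝ} (hx : 0 < x) :
    M.criticalLevel < M.stopReserve f x (ρ x) :=
  hs.criticalLevel_lt_stopReserve hx (hρ.pos x) (hρ.stopGap_eq_zero x hx).le

theorem denominator_pos {x : ℝ} (hx : 0 < x) :
    0 < marginalDeriv M.α (M.stopReserve f x (ρ x)) - M.stopMarginalDeriv q x (ρ x) := by
  have h := hρ.stopMarginalDeriv_lt hs hx (hρ.pos x) (by
    rw [hρ.marginalReserve_threshold hs hx]
    exact ((hρ.lt_criticalLevel x hx).trans (hρ.criticalLevel_lt_stopReserve hs hx)).ne)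
  rw [hρ.marginalReserve_threshold hs hx] at h
  exact sub_pos.2 h

/-- Implicit differentiation of `gap (x, ρ x) = 0`. The change of the gap is split into a change of
area at reserve `ρ y` and a change of reserve at area `x`; the quotient of the two limiting
derivatives simplifies to `thresholdDeriv`. -/
theorem hasDerivAt {x : ℝ} (hx : 0 < x) : HasDerivAt ρ (M.thresholdDeriv f q ρ x) x := by
  have hc := hs.toCont
  have hρx := hρ.pos x
  set Z := M.stopReserve f x (ρ x) with hZdef
  have hZ : 0 < Z := hc.stopReserve_pos hx.le hρx
  have h1' : 1 - M.α ≠ 0 := by linarith [M.α_lt_one]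
  set B := M.stopMarginal q x (ρ x) + M.marginalReserve q x (ρ x) / (1 - M.α) *
      M.stopMarginalDeriv q x (ρ x) with hBdef
  have hdB := hρ.hasDerivAt_stopGap_reserve hs hx.le hρx
  rw [← hBdef] at hdB
  have hB : B = -(Z / (1 - M.α) * (marginalDeriv M.α Z - M.stopMarginalDeriv q x (ρ x))) := by
    rw [hBdef, ← hc.marginal_marginalReserve hx.le hρx, hρ.marginalReserve_threshold hs hx,
      ← hZdef, marginalDeriv]
    field_simp
    ring
  have hden := hρ.denominator_pos hs hx
  rw [← hZdef] at hden
  have hBneg : B < 0 := by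
    rw [hB, neg_lt_zero]
    exact mul_pos (div_pos hZ (by linarith [M.α_lt_one])) hden
  have hA : M.stopGapDeriv f q x (ρ x) = M.switchDrift Z :=
    hs.stopGapDeriv_eq hx.le hρx (hρ.stopGap_eq_zero x hx)
  have hmvt : ∀ y, ∃ η ∈ uIcc x y, 0 < y →
      M.stopGap f q y (ρ y) - M.stopGap f q x (ρ y) = M.stopGapDeriv f q η (ρ y) * (y - x) := by
    intro y
    rcases le_or_gt y 0 with hy | hy
    · exact ⟨x, left_mem_uIcc, fun h => absurd h (not_lt.2 hy)⟩
    · obtain ⟨η, hη, he⟩ := exists_sub_eq_mul_of_hasDerivAt (u := x) (v := y)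
        (g := fun z => M.stopGap f q z (ρ y)) (g' := fun z => M.stopGapDeriv f q z (ρ y))
        fun z hz => hc.hasDerivAt_stopGap ((le_min hx.le hy.le).trans hz.1) (hρ.pos y)
      exact ⟨η, hη, fun _ => he⟩
  choose η hη hmv using hmvt
  have hηt : Tendsto η (𝓝[≠] x) (𝓝 x) := tendsto_of_eventually_mem_uIcc tendsto_const_nhds
    (tendsto_id.mono_left nhdsWithin_le_nhds) (Eventually.of_forall hη)
  have hρt : Tendsto ρ (𝓝[≠] x) (𝓝 (ρ x)) :=
    (hρ.continuousAt hs hx).tendsto.mono_left nhdsWithin_le_nhds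
  have hGx : Tendsto (fun y => M.stopGapDeriv f q (η y) (ρ y)) (𝓝[≠] x) (𝓝 (M.switchDrift Z)) := by
    rw [← hA]
    have hcont : ContinuousAt (Function.uncurry (M.stopGapDeriv f q)) (x, ρ x) :=
      hc.continuousOn_stopGapDeriv.continuousAt (by
        filter_upwards [(continuous_fst.tendsto (x, ρ x)).eventually (lt_mem_nhds hx),
          (continuous_snd.tendsto (x, ρ x)).eventually (lt_mem_nhds hρx)] with z h1 h2
        exact ⟨le_of_lt h1, h2⟩)
    exact hcont.tendsto.comp (hηt.prodMk_nhds hρt)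
  -- The completed difference quotient `dslope` is used so that no division by `ρ y - ρ x` occurs.
  have hGR : Tendsto (fun y => dslope (M.stopGap f q x) (ρ x) (ρ y)) (𝓝[≠] x) (𝓝 B) := by
    have h := (continuousAt_dslope_same.2 hdB.differentiableAt).tendsto
    rw [dslope_same, hdB.deriv] at h
    exact h.comp hρt
  rw [hasDerivAt_iff_tendsto_slope]
  have hlim := hGx.neg.div hGR hBneg.ne
  have hval : -M.switchDrift Z / B = M.thresholdDeriv f q ρ x := by
    rw [hB, thresholdDeriv, ← hZdef]
    have := hden.ne'
    field_simp
  rw [hval] at hlim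
  refine hlim.congr' ?_
  filter_upwards [self_mem_nhdsWithin, mem_nhdsWithin_of_mem_nhds (Ioi_mem_nhds hx),
    hGR.eventually_ne hBneg.ne] with y hyx hy hne
  rw [mem_Ioi] at hy
  have h1 := hmv y hy
  have h2 := sub_smul_dslope (M.stopGap f q x) (ρ x) (ρ y)
  rw [hρ.stopGap_eq_zero x hx, smul_eq_mul] at h2
  rw [hρ.stopGap_eq_zero y hy] at h1
  have hyx' : y - x ≠ 0 := sub_ne_zero.2 hyx
  rw [slope_def_field, Pi.div_apply, div_eq_div_iff hne hyx']
  linarith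

theorem continuousAt_thresholdDeriv {x : ℝ} (hx : 0 < x) :
    ContinuousAt (M.thresholdDeriv f q ρ) x := by
  have hc := hs.toCont
  have hρc := hρ.continuousAt hs hx
  have hpair : ContinuousAt (fun y => (y, ρ y)) x := continuousAt_id.prodMk hρc
  have hZ : ContinuousAt (fun y => M.stopReserve f y (ρ y)) x :=
    ContinuousAt.comp (f := fun y => (y, ρ y)) hc.continuous_stopReserve.continuousAt hpair
  have hZpos := hc.stopReserve_pos hx.le (hρ.pos x)
  have h1 : ContinuousAt (fun y => M.switchDrift (M.stopReserve f y (ρ y))) x :=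
    ContinuousAt.comp (g := M.switchDrift) (hasDerivAt_switchDrift hZpos).continuousAt hZ
  have h2 : ContinuousAt (fun y => marginalDeriv M.α (M.stopReserve f y (ρ y))) x :=
    ContinuousAt.comp (g := marginalDeriv M.α) (hasDerivAt_marginalDeriv hZpos).continuousAt hZ
  have h3 : ContinuousAt (fun y => M.stopMarginalDeriv q y (ρ y)) x := by
    have hcont : ContinuousAt (Function.uncurry (M.stopMarginalDeriv q)) (x, ρ x) :=
      (hρ.continuousOn_stopMarginalDeriv hs).continuousAt (by
        filter_upwards [(continuous_fst.tendsto (x, ρ x)).eventually (lt_mem_nhds hx),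
          (continuous_snd.tendsto (x, ρ x)).eventually (lt_mem_nhds (hρ.pos x))] with z h1 h2
        exact ⟨le_of_lt h1, h2⟩)
    exact ContinuousAt.comp (f := fun y => (y, ρ y)) hcont hpair
  exact (continuousAt_const.mul h1).div (hZ.mul (h2.sub h3))
    (mul_pos hZpos (hρ.denominator_pos hs hx)).ne'

end IsThreshold

end NormalizedModel

end ThresholdDerivative

/-! ## The threshold at exhaustion -/

section Exhaustion

open Filter Topology

namespace NormalizedModel

variable {M : NormalizedModel} {f q : ℝ → ℝ → ℝ}

theorem continuousAt_switchDriftDeriv {Z : ℝ} (hZ : 0 < Z) :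
    ContinuousAt M.switchDriftDeriv Z := by
  have ha := M.a_pos
  have hza : 0 < Z + M.a := by linarith
  have h1 : ContinuousAt (fun z => marginal M.α (z + M.a)) Z :=
    ContinuousAt.comp (g := marginal M.α) (hasDerivAt_marginal hza).continuousAt (by fun_prop)
  have h2 : ContinuousAt (marginal M.α) Z := (hasDerivAt_marginal hZ).continuousAt
  have h3 : ContinuousAt (fun z => M.a / (z + M.a)) Z :=
    continuousAt_const.div (by fun_prop) hza.ne'
  exact continuousAt_const.mul ((h1.mul h3).sub ((h2.sub h1).div_const _))

/-- The limit of the ratio of surplus and area at exhaustion. -/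
noncomputable def surplusRate (M : NormalizedModel) : ℝ :=
  M.gainRate M.criticalLevel / marginal M.α M.criticalLevel

/-- The limit of the ratio of denominator of `thresholdDeriv` and area at exhaustion. -/
noncomputable def denominatorRate (M : NormalizedModel) : ℝ :=
  (M.α - 1) * (M.α - 2) * marginal M.α M.criticalLevel / M.criticalLevel ^ 2 * M.surplusRate +
    (M.lam * marginalDeriv M.α M.criticalLevel -
      M.lam * marginalDeriv M.α (M.criticalLevel + M.a))

/-- Uses `switchDrift = 0` at the critical level to eliminate the gain. It is the identity that
makes the ratio of the linearized numerator and denominator of the threshold derivative exactly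
`-1`. -/
theorem denominatorRate_eq :
    M.criticalLevel * M.denominatorRate = -((1 - M.α) * M.switchDriftDeriv M.criticalLevel) := by
  have hR := M.criticalLevel_pos
  have ha := M.a_pos
  have h1 : 1 - M.α ≠ 0 := by linarith [M.α_lt_one]
  have hm := (marginal_pos M.α_pos hR).ne'
  have hRa : M.criticalLevel + M.a ≠ 0 := by linarith
  have h := M.switchDrift_criticalLevel
  have hg : M.gainRate M.criticalLevel = M.criticalLevel / (1 - M.α) *
      (M.lam * (marginal M.α M.criticalLevel - marginal M.α (M.criticalLevel + M.a))) := by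
    rw [switchDrift] at h
    linear_combination h
  rw [denominatorRate, surplusRate, hg, switchDriftDeriv, marginalDeriv, marginalDeriv]
  field_simp
  ring

theorem denominatorRate_ne_zero : M.denominatorRate ≠ 0 := by
  intro h
  have h1 := M.denominatorRate_eq
  rw [h, mul_zero, eq_comm, neg_eq_zero] at h1
  exact (mul_neg_of_pos_of_neg (by linarith [M.α_lt_one] : 0 < 1 - M.α)
    (switchDriftDeriv_neg M.criticalLevel_pos)).ne h1

theorem IsContinuation.val_zero_area (hc : M.IsContinuation f q) {R : ℝ} (hR : M.a ≤ R) :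
    f 0 R = R ^ M.α :=
  le_antisymm (by simpa using hc.upper 0 R le_rfl hR) (hc.lower 0 R le_rfl hR)

/-! ### The first-order expansion at zero area. -/

namespace IsThreshold

variable {ρ : ℝ → ℝ} (hρ : M.IsThreshold f q ρ) (hs : M.IsSolution f q)
include hρ hs

theorem tendsto_stopReserve_zero :
    Tendsto (fun x => M.stopReserve f x (ρ x)) (𝓝[>] 0) (𝓝 M.criticalLevel) := by
  have h := (hs.toCont.continuous_stopReserve.tendsto (0, M.criticalLevel)).comp
    (f := fun x : ℝ => (x, ρ x)) (x := 𝓝[>] 0)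
    ((tendsto_id.mono_left nhdsWithin_le_nhds).prodMk_nhds (hρ.tendsto_zero hs))
  rw [Function.uncurry_apply_pair, stopReserve_zero_area M.criticalLevel_pos.le] at h
  exact h

theorem tendsto_surplus_zero : Tendsto (M.surplus f ρ) (𝓝[>] 0) (𝓝 0) := by
  have h := (hρ.tendsto_stopReserve_zero hs).sub (hρ.tendsto_zero hs)
  rw [sub_self] at h
  exact h

/-- To first order in the area, exploring adds `gainRate` to the value; dividing by the marginal
utility converts it into reserves. Both steps are mean value theorems with intermediate points
tending to zero area and to the critical level. -/
theorem tendsto_surplus_div :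
    Tendsto (fun x => M.surplus f ρ x / x) (𝓝[>] 0) (𝓝 M.surplusRate) := by
  have hc := hs.toCont
  have hR0 := M.criticalLevel_pos
  have hρ0 := hρ.tendsto_zero hs
  have hZ0 := hρ.tendsto_stopReserve_zero hs
  have h1 : ∀ x, ∃ η ∈ uIcc 0 x, M.stopValue f x (ρ x) - ρ x ^ M.α =
      (M.lam * (f η (ρ x + M.a) - M.stopValue f η (ρ x)) - M.κ) * (x - 0) := by
    intro x
    obtain ⟨η, hη, he⟩ := exists_sub_eq_mul_of_hasDerivAt (u := 0) (v := x)
      (g := fun z => M.stopValue f z (ρ x))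
      (g' := fun z => M.lam * (f z (ρ x + M.a) - M.stopValue f z (ρ x)) - M.κ)
      fun z _ => hasDerivAt_stopValue hc.cont z (ρ x)
    rw [stopValue_zero_area] at he
    exact ⟨η, hη, he⟩
  choose η hη hη' using h1
  have h2 : ∀ x, ∃ ζ ∈ uIcc (ρ x) (M.stopReserve f x (ρ x)), 0 ≤ x →
      M.stopReserve f x (ρ x) ^ M.α - ρ x ^ M.α =
      marginal M.α ζ * (M.stopReserve f x (ρ x) - ρ x) := by
    intro x
    rcases lt_or_ge x 0 with hx | hx
    · exact ⟨ρ x, left_mem_uIcc, fun h => absurd h (not_le.2 hx)⟩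
    · obtain ⟨ζ, hζ, he⟩ := exists_sub_eq_mul_of_hasDerivAt
        (u := ρ x) (v := M.stopReserve f x (ρ x)) (g := fun z => z ^ M.α) (g' := marginal M.α)
        fun z hz => hasDerivAt_rpow_marginal ((lt_min (hρ.pos x)
          (hc.stopReserve_pos hx (hρ.pos x))).trans_le hz.1)
      exact ⟨ζ, hζ, fun _ => he⟩
  choose ζ hζ hζ' using h2
  have hη0 : Tendsto η (𝓝[>] 0) (𝓝 0) := tendsto_of_eventually_mem_uIcc tendsto_const_nhds
    (tendsto_id.mono_left nhdsWithin_le_nhds) (Eventually.of_forall hη)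
  have hζ0 : Tendsto ζ (𝓝[>] 0) (𝓝 M.criticalLevel) :=
    tendsto_of_eventually_mem_uIcc hρ0 hZ0 (Eventually.of_forall hζ)
  have hm : Tendsto (fun x => marginal M.α (ζ x)) (𝓝[>] 0) (𝓝 (marginal M.α M.criticalLevel)) :=
    (hasDerivAt_marginal hR0).continuousAt.tendsto.comp hζ0
  have hnum : Tendsto (fun x => M.lam * (f (η x) (ρ x + M.a) - M.stopValue f (η x) (ρ x)) - M.κ)
      (𝓝[>] 0) (𝓝 (M.gainRate M.criticalLevel)) := by
    have hg : Continuous fun z : ℝ × ℝ =>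
        M.lam * (f z.1 (z.2 + M.a) - M.stopValue f z.1 z.2) - M.κ :=
      (continuous_const.mul ((hc.cont.comp
        (by fun_prop : Continuous fun z : ℝ × ℝ => (z.1, z.2 + M.a))).sub
        (continuous_stopValue hc.cont))).sub continuous_const
    have h := (hg.tendsto (0, M.criticalLevel)).comp (hη0.prodMk_nhds hρ0)
    simp only [stopValue_zero_area,
      hc.val_zero_area (by linarith : M.a ≤ M.criticalLevel + M.a)] at h
    exact h
  refine (hnum.div hm (marginal_pos M.α_pos hR0).ne').congr' ?_
  filter_upwards [self_mem_nhdsWithin] with x hx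
  rw [mem_Ioi] at hx
  have e1 := hη' x
  have e2 := hζ' x hx.le
  rw [hc.stopReserve_rpow hx.le (hρ.pos x).le, e1, sub_zero] at e2
  have hζpos : 0 < ζ x := (lt_min (hρ.pos x)
    (hc.stopReserve_pos hx.le (hρ.pos x))).trans_le (hζ x).1
  rw [Pi.div_apply, div_eq_div_iff (marginal_pos M.α_pos hζpos).ne' hx.ne', surplus]
  linarith

theorem tendsto_depositMean_deriv_div :
    Tendsto (fun x => M.depositMean (fun y => deriv (q y) (ρ x + M.a)) x / x) (𝓝[>] 0)
      (𝓝 (M.lam * marginalDeriv M.α (M.criticalLevel + M.a))) := by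
  have hR0 := M.criticalLevel_pos
  have ha := M.a_pos
  set c := M.lam * marginalDeriv M.α (M.criticalLevel + M.a) with hcdef
  have hρ0 := hρ.tendsto_zero hs
  have hlim : Tendsto (fun z : ℝ × ℝ => M.lam * Real.exp (M.lam * z.1) *
      marginalDeriv M.α (z.2 + M.a + M.surplus f ρ z.1)) (𝓝[>] 0 ×ˢ 𝓝 M.criticalLevel) (𝓝 c) := by
    have hd : Tendsto (fun z : ℝ × ℝ => M.surplus f ρ z.1) (𝓝[>] 0 ×ˢ 𝓝 M.criticalLevel) (𝓝 0) :=
      (hρ.tendsto_surplus_zero hs).comp tendsto_fst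
    have hsum : Tendsto (fun z : ℝ × ℝ => z.2 + M.a + M.surplus f ρ z.1)
        (𝓝[>] 0 ×ˢ 𝓝 M.criticalLevel) (𝓝 (M.criticalLevel + M.a)) := by
      simpa using (tendsto_snd.add_const M.a).add hd
    have h1 := (hasDerivAt_marginalDeriv (α := M.α)
      (by linarith : 0 < M.criticalLevel + M.a)).continuousAt.tendsto.comp hsum
    have h2 : Tendsto (fun z : ℝ × ℝ => M.lam * Real.exp (M.lam * z.1))
        (𝓝[>] 0 ×ˢ 𝓝 M.criticalLevel) (𝓝 M.lam) := by
      have h3 : Tendsto (fun y : ℝ => M.lam * Real.exp (M.lam * y)) (𝓝[>] 0) (𝓝 M.lam) := by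
        have h4 : Continuous fun y : ℝ => M.lam * Real.exp (M.lam * y) := by fun_prop
        have h5 := h4.tendsto 0
        simp only [mul_zero, Real.exp_zero, mul_one] at h5
        exact h5.mono_left nhdsWithin_le_nhds
      exact h3.comp tendsto_fst
    exact h2.mul h1
  rw [Metric.tendsto_nhds]
  intro ε hε
  obtain ⟨P1, hP1, P2, hP2, hP⟩ := eventually_prod_iff.1
    (Metric.tendsto_nhds.1 hlim (ε / 2) (half_pos hε))
  obtain ⟨b, hb, hbP⟩ := mem_nhdsGT_iff_exists_Ioc_subset.1 hP1
  filter_upwards [Ioc_mem_nhdsGT hb, hρ0.eventually hP2,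
    hρ0.eventually (lt_mem_nhds (by linarith : M.criticalLevel - M.a < M.criticalLevel))]
    with x hx hx2 hx3
  -- For small `x`, `ρ x + a` exceeds the critical level and hence every threshold, so the
  -- derivative is given by the explicit formula above the threshold and no kink interferes.
  have hbound : ∀ y ∈ uIoc 0 x, ‖M.lam * Real.exp (M.lam * y) * deriv (q y) (ρ x + M.a) - c‖ ≤
      ε / 2 := by
    intro y hy
    rw [uIoc_of_le hx.1.le] at hy
    have h := hP (hbP ⟨hy.1, hy.2.trans hx.2⟩) hx2
    rw [(hρ.hasDerivAt_marg_of_lt hs hy.1 (by linarith [hρ.pos x] : M.a < ρ x + M.a)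
      (by linarith [hρ.le_criticalLevel y])).deriv]
    rw [Real.dist_eq] at h
    exact h.le
  have h := intervalIntegral.norm_integral_le_of_norm_le_const hbound
  rw [intervalIntegral.integral_sub (hρ.intervalIntegrable_deriv_marg hs (hρ.pos x) hx.1.le)
    (continuous_const.intervalIntegrable _ _), intervalIntegral.integral_const, smul_eq_mul,
    sub_zero, abs_of_pos hx.1, Real.norm_eq_abs] at h
  rw [Real.dist_eq, depositMean, show (∫ y in (0 : ℝ)..x, M.lam * Real.exp (M.lam * y) *
    deriv (q y) (ρ x + M.a)) / x - c = ((∫ y in (0 : ℝ)..x, M.lam * Real.exp (M.lam * y) *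
    deriv (q y) (ρ x + M.a)) - x * c) / x by have := hx.1.ne'; field_simp, abs_div,
    abs_of_pos hx.1, div_lt_iff₀ hx.1]
  exact h.trans_lt (mul_lt_mul_of_pos_right (by linarith) hx.1)

/-- The difference is split into the change of the second derivative of the utility from `ρ` to `Z`,
of order the surplus, the factor `1 - exp (-(λ x))` on the atom, and the integral over discoveries.
All three are linear in the area. -/
theorem tendsto_denominator_div :
    Tendsto (fun x => (marginalDeriv M.α (M.stopReserve f x (ρ x)) -
      M.stopMarginalDeriv q x (ρ x)) / x) (𝓝[>] 0) (𝓝 M.denominatorRate) := by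
  have hc := hs.toCont
  have hR0 := M.criticalLevel_pos
  have hρ0 := hρ.tendsto_zero hs
  have hZ0 := hρ.tendsto_stopReserve_zero hs
  set u3 : ℝ → ℝ := fun T => (M.α - 1) * (M.α - 2) * marginal M.α T / T ^ 2 with hu3
  have h2 : ∀ x, ∃ ζ ∈ uIcc (ρ x) (M.stopReserve f x (ρ x)), 0 ≤ x →
      marginalDeriv M.α (M.stopReserve f x (ρ x)) - marginalDeriv M.α (ρ x) =
      u3 ζ * (M.stopReserve f x (ρ x) - ρ x) := by
    intro x
    rcases lt_or_ge x 0 with hx | hx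
    · exact ⟨ρ x, left_mem_uIcc, fun h => absurd h (not_le.2 hx)⟩
    · obtain ⟨ζ, hζ, he⟩ := exists_sub_eq_mul_of_hasDerivAt
        (u := ρ x) (v := M.stopReserve f x (ρ x)) (g := marginalDeriv M.α) (g' := u3)
        fun z hz => hasDerivAt_marginalDeriv ((lt_min (hρ.pos x)
          (hc.stopReserve_pos hx (hρ.pos x))).trans_le hz.1)
      exact ⟨ζ, hζ, fun _ => he⟩
  choose ζ hζ hζ' using h2
  have hζ0 : Tendsto ζ (𝓝[>] 0) (𝓝 M.criticalLevel) :=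
    tendsto_of_eventually_mem_uIcc hρ0 hZ0 (Eventually.of_forall hζ)
  have hu3c : ContinuousAt u3 M.criticalLevel :=
    (continuousAt_const.mul (hasDerivAt_marginal hR0).continuousAt).div (by fun_prop)
      (pow_pos hR0 2).ne'
  have t1 : Tendsto (fun x => u3 (ζ x) * (M.surplus f ρ x / x)) (𝓝[>] 0)
      (𝓝 (u3 M.criticalLevel * M.surplusRate)) :=
    (hu3c.tendsto.comp hζ0).mul (hρ.tendsto_surplus_div hs)
  have hexp : Tendsto (fun x : ℝ => (1 - Real.exp (-(M.lam * x))) / x) (𝓝[>] 0) (𝓝 M.lam) := by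
    have hd : HasDerivAt (fun x : ℝ => 1 - Real.exp (-(M.lam * x))) M.lam 0 := by
      refine ((((hasDerivAt_id (0 : ℝ)).const_mul M.lam).neg).exp.const_sub 1).congr_deriv ?_
      simp
    refine (hasDerivAt_iff_tendsto_slope_left_right.1 hd).2.congr fun x => ?_
    rw [slope_def_field]
    simp
  have hu2 : Tendsto (fun x => marginalDeriv M.α (ρ x)) (𝓝[>] 0)
      (𝓝 (marginalDeriv M.α M.criticalLevel)) :=
    (hasDerivAt_marginalDeriv hR0).continuousAt.tendsto.comp hρ0
  have he : Tendsto (fun x : ℝ => Real.exp (-(M.lam * x))) (𝓝[>] 0) (𝓝 1) := by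
    have h4 : Continuous fun x : ℝ => Real.exp (-(M.lam * x)) := by fun_prop
    have h5 := h4.tendsto 0
    simp only [mul_zero, neg_zero, Real.exp_zero] at h5
    exact h5.mono_left nhdsWithin_le_nhds
  have t2 := t1.add ((hexp.mul hu2).sub (he.mul (hρ.tendsto_depositMean_deriv_div hs)))
  rw [one_mul] at t2
  refine t2.congr' ?_
  filter_upwards [self_mem_nhdsWithin] with x hx
  rw [mem_Ioi] at hx
  have e := hζ' x hx.le
  rw [stopMarginalDeriv, show marginalDeriv M.α (M.stopReserve f x (ρ x)) =
    u3 (ζ x) * (M.stopReserve f x (ρ x) - ρ x) + marginalDeriv M.α (ρ x) by linarith, surplus]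
  field_simp
  ring

/-- Numerator and denominator of the derivative both vanish linearly. The numerator is `switchDrift
Z`, proportional to `Z - R_0`, which is the surplus minus `R_0 - ρ`. So `ρ` satisfies a singular
linear differential equation at zero. -/
theorem exists_thresholdDeriv_eq : ∃ A : ℝ → ℝ, Tendsto A (𝓝[>] 0) (𝓝 (-1)) ∧
    ∀ x, 0 < x → M.thresholdDeriv f q ρ x =
      A x * (M.surplus f ρ x / x - (M.criticalLevel - ρ x) / x) := by
  have hc := hs.toCont
  have hR0 := M.criticalLevel_pos
  have hZ0 := hρ.tendsto_stopReserve_zero hs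
  have h2 : ∀ x, ∃ ζ ∈ uIcc M.criticalLevel (M.stopReserve f x (ρ x)), 0 ≤ x →
      M.switchDrift (M.stopReserve f x (ρ x)) - M.switchDrift M.criticalLevel =
      M.switchDriftDeriv ζ * (M.stopReserve f x (ρ x) - M.criticalLevel) := by
    intro x
    rcases lt_or_ge x 0 with hx | hx
    · exact ⟨_, left_mem_uIcc, fun h => absurd h (not_le.2 hx)⟩
    · obtain ⟨ζ, hζ, he⟩ := exists_sub_eq_mul_of_hasDerivAt
        (u := M.criticalLevel) (v := M.stopReserve f x (ρ x)) (g := M.switchDrift)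
        (g' := M.switchDriftDeriv) fun z hz => hasDerivAt_switchDrift ((lt_min hR0
          (hc.stopReserve_pos hx (hρ.pos x))).trans_le hz.1)
      exact ⟨ζ, hζ, fun _ => he⟩
  choose ζ hζ hζ' using h2
  have hζ0 : Tendsto ζ (𝓝[>] 0) (𝓝 M.criticalLevel) :=
    tendsto_of_eventually_mem_uIcc tendsto_const_nhds hZ0 (Eventually.of_forall hζ)
  have hsd := (continuousAt_switchDriftDeriv (M := M) hR0).tendsto.comp hζ0
  have hlim := (hsd.const_mul (1 - M.α)).div (hZ0.mul (hρ.tendsto_denominator_div hs))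
    (mul_ne_zero hR0.ne' M.denominatorRate_ne_zero)
  refine ⟨fun x => (1 - M.α) * M.switchDriftDeriv (ζ x) / (M.stopReserve f x (ρ x) *
      ((marginalDeriv M.α (M.stopReserve f x (ρ x)) - M.stopMarginalDeriv q x (ρ x)) / x)), ?_, ?_⟩
  · rw [denominatorRate_eq, div_neg, div_self (mul_neg_of_pos_of_neg
      (by linarith [M.α_lt_one] : 0 < 1 - M.α) (switchDriftDeriv_neg hR0)).ne] at hlim
    exact hlim
  · intro x hx
    have e := hζ' x hx.le
    rw [switchDrift_criticalLevel, sub_zero] at e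
    have hden := (hρ.denominator_pos hs hx).ne'
    have hZ := (hc.stopReserve_pos hx.le (hρ.pos x)).ne'
    rw [thresholdDeriv, e, surplus]
    field_simp
    ring

/-- With `Y = (R_0 - ρ) / x` and `D = surplus / x`, the equation `ρ' = A * (D - Y)` with `A → -1`
shows that the derivative of `x * (R_0 - ρ)`, divided by `2 * x`, equals `((1 + A) * Y - A * D) /
2`. Its limit is half that of `D`, and l'Hôpital's rule gives the limit of `Y`. -/
theorem tendsto_thresholdDeriv_zero :
    Tendsto (M.thresholdDeriv f q ρ) (𝓝[>] 0) (𝓝 (-(M.surplusRate / 2))) := by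
  obtain ⟨A, hA, hA'⟩ := hρ.exists_thresholdDeriv_eq hs
  have hd := hρ.tendsto_surplus_div hs
  have hid : Tendsto (fun x : ℝ => x) (𝓝[>] 0) (𝓝 0) := tendsto_id.mono_left nhdsWithin_le_nhds
  set Y : ℝ → ℝ := fun x => (M.criticalLevel - ρ x) / x with hY
  -- An a priori bound, needed to kill `(1 + A) * Y`: since `ρ < R_0 < Z`, the distance `R_0 - ρ` is
  -- at most the surplus.
  have hYb : ∀ᶠ x in 𝓝[>] 0, ‖Y x‖ ≤ M.surplusRate + 1 := by
    filter_upwards [self_mem_nhdsWithin, hd.eventually (gt_mem_nhds (by linarith :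
      M.surplusRate < M.surplusRate + 1))] with x hx hx2
    rw [mem_Ioi] at hx
    have h1 := hρ.lt_criticalLevel x hx
    have h2 := hρ.criticalLevel_lt_stopReserve hs hx
    rw [Real.norm_of_nonneg (div_nonneg (by linarith) hx.le)]
    refine le_trans (div_le_div_of_nonneg_right ?_ hx.le) hx2.le
    rw [surplus]
    linarith
  have hA1 : Tendsto (fun x => 1 + A x) (𝓝[>] 0) (𝓝 0) := by
    have := hA.const_add 1
    rwa [add_neg_cancel] at this
  have hAY : Tendsto (fun x => (1 + A x) * Y x) (𝓝[>] 0) (𝓝 0) :=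
    hA1.zero_mul_isBoundedUnder_le (isBoundedUnder_of_eventually_le hYb)
  have hdiv : Tendsto (fun x => ((M.criticalLevel - ρ x) + x * -M.thresholdDeriv f q ρ x) / (2 * x))
      (𝓝[>] 0) (𝓝 (M.surplusRate / 2)) := by
    have h := (hAY.sub (hA.mul hd)).div_const 2
    rw [zero_sub, neg_mul, one_mul, neg_neg] at h
    refine h.congr' ?_
    filter_upwards [self_mem_nhdsWithin] with x hx
    rw [hA' x hx, hY]
    have := (mem_Ioi.1 hx).ne'
    field_simp
    ring
  have hlh := HasDerivAt.lhopital_zero_nhdsGT (a := 0) (f := fun x => x * (M.criticalLevel - ρ x))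
    (g := fun x => x ^ 2) (f' := fun x => (M.criticalLevel - ρ x) + x * -M.thresholdDeriv f q ρ x)
    (g' := fun x => 2 * x) ?_ ?_ ?_ ?_ ?_ hdiv
  · have hYlim : Tendsto Y (𝓝[>] 0) (𝓝 (M.surplusRate / 2)) := by
      refine hlh.congr' ?_
      filter_upwards [self_mem_nhdsWithin] with x hx
      have := (mem_Ioi.1 hx).ne'
      rw [hY]
      field_simp
    have h := hA.mul (hd.sub hYlim)
    rw [show -1 * (M.surplusRate - M.surplusRate / 2) = -(M.surplusRate / 2) by ring] at h
    refine h.congr' ?_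
    filter_upwards [self_mem_nhdsWithin] with x hx
    exact (hA' x hx).symm
  · filter_upwards [self_mem_nhdsWithin] with x hx
    refine ((hasDerivAt_id x).mul ((hρ.hasDerivAt hs hx).const_sub M.criticalLevel)).congr_deriv ?_
    simp
  · filter_upwards with x
    simpa using hasDerivAt_pow 2 x
  · filter_upwards [self_mem_nhdsWithin] with x hx
    exact (mul_pos two_pos (mem_Ioi.1 hx)).ne'
  · simpa using hid.mul ((hρ.tendsto_zero hs).const_sub M.criticalLevel)
  · simpa using hid.pow 2

theorem contDiffOn : ContDiffOn ℝ 1 ρ (Ici 0) := by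
  have hcwa : ContinuousWithinAt ρ (Ioi 0) 0 := by
    have h := hρ.tendsto_zero hs
    rwa [← hρ.of_nonpos 0 le_rfl] at h
  have hd0 : HasDerivWithinAt ρ (-(M.surplusRate / 2)) (Ici 0) 0 := by
    refine hasDerivWithinAt_Ici_of_tendsto_deriv (s := Ioi 0)
      (fun x hx => (hρ.hasDerivAt hs hx).differentiableAt.differentiableWithinAt) hcwa
      self_mem_nhdsWithin ((hρ.tendsto_thresholdDeriv_zero hs).congr' ?_)
    filter_upwards [self_mem_nhdsWithin] with x hx
    exact (hρ.hasDerivAt hs hx).deriv.symm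
  rw [contDiffOn_one_iff_derivWithin (uniqueDiffOn_Ici 0)]
  have e0 : derivWithin ρ (Ici 0) 0 = -(M.surplusRate / 2) :=
    hd0.derivWithin (uniqueDiffOn_Ici 0 0 self_mem_Ici)
  have epos : ∀ x, 0 < x → derivWithin ρ (Ici 0) x = M.thresholdDeriv f q ρ x := fun x hx =>
    (hρ.hasDerivAt hs hx).hasDerivWithinAt.derivWithin (uniqueDiffOn_Ici 0 x (le_of_lt hx))
  constructor
  · intro x hx
    rcases (mem_Ici.1 hx).eq_or_lt with rfl | hx
    · exact hd0.differentiableWithinAt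
    · exact (hρ.hasDerivAt hs hx).differentiableAt.differentiableWithinAt
  · intro x hx
    rcases (mem_Ici.1 hx).eq_or_lt with rfl | hx
    · rw [← Ioi_insert, continuousWithinAt_insert_self, ContinuousWithinAt, Ioi_insert, e0]
      refine (hρ.tendsto_thresholdDeriv_zero hs).congr' ?_
      filter_upwards [self_mem_nhdsWithin] with x hx
      exact (epos x hx).symm
    · refine ((hρ.continuousAt_thresholdDeriv hs hx).congr ?_).continuousWithinAt
      filter_upwards [Ioi_mem_nhds hx] with y hy
      exact (epos y hy).symm

end IsThreshold

end NormalizedModel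

end Exhaustion

/-! ## The strong Markov property at the deposits -/

section StrongMarkov

open Filter Topology

variable {Ω : Type*} [MeasurableSpace Ω] {N : ℝ≥0 → Ω → ℕ} {lam : ℝ≥0} {P : Measure Ω}

theorem poissonMeasure_two_le (μ : ℝ≥0) :
    poissonMeasure μ {n | 2 ≤ n} ≤ ENNReal.ofReal ((μ : ℝ) ^ 2) := by
  have hset : {n : ℕ | 2 ≤ n} = ({0} ∪ {1})ᶜ := by
    ext n
    simp only [mem_ofPred_eq, mem_compl_iff, mem_union, mem_singleton_iff]
    omega
  rw [← ofReal_measureReal, hset, probReal_compl_eq_one_sub (by measurability),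
    measureReal_union (by simp) (by measurability), poissonMeasure_real_singleton,
    poissonMeasure_real_singleton]
  refine ENNReal.ofReal_le_ofReal ?_
  -- The probability is `1 - (1 + μ) * exp (-μ) ≤ 1 - (1 + μ) * (1 - μ) = μ ^ 2`.
  have h := Real.add_one_le_exp (-(μ : ℝ))
  have h0 : (0 : ℝ) ≤ μ := μ.2
  simp only [pow_zero, Nat.factorial_zero, Nat.cast_one, div_one, mul_one, pow_one,
    Nat.factorial_one]
  nlinarith

namespace IsPoissonProcess

variable (hN : IsPoissonProcess N lam P)
include hN

theorem measure_increment_eq_zero {s t : ℝ≥0} (hst : s ≤ t) :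
    P {ω | N t ω - N s ω = 0} = ENNReal.ofReal (Real.exp (-(lam * (t - s)))) := by
  have hm : Measurable fun ω => N t ω - N s ω := (hN.measurable t).sub (hN.measurable s)
  have h := Measure.map_apply (μ := P) hm (measurableSet_singleton 0)
  rw [hN.law s t hst, poissonMeasure_singleton] at h
  have e : {ω | N t ω - N s ω = 0} = (fun ω => N t ω - N s ω) ⁻¹' {0} := rfl
  rw [e, ← h]
  push_cast [NNReal.coe_sub hst]
  simp

theorem measure_two_le_increment {s t : ℝ≥0} (hst : s ≤ t) :
    P {ω | 2 ≤ N t ω - N s ω} ≤ ENNReal.ofReal ((lam * (t - s) : ℝ≥0) ^ 2) := by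
  have hm : Measurable fun ω => N t ω - N s ω := (hN.measurable t).sub (hN.measurable s)
  have h := Measure.map_apply (μ := P) (s := {n | 2 ≤ n}) hm (MeasurableSet.of_discrete)
  rw [hN.law s t hst] at h
  have e : {ω | 2 ≤ N t ω - N s ω} = (fun ω => N t ω - N s ω) ⁻¹' {n | 2 ≤ n} := rfl
  rw [e, ← h]
  exact poissonMeasure_two_le _

theorem indepFun_range_increment {τ : ℕ → ℝ≥0} (hτ : Monotone τ) (h0 : τ 0 = 0) (k : ℕ) :
    IndepFun (fun ω (i : Finset.range (k + 1)) => N (τ i) ω)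
      (fun ω => N (τ (k + 1)) ω - N (τ k) ω) P := by
  have hm : ∀ i, Measurable fun ω => N (τ (i + 1)) ω - N (τ i) ω := fun i =>
    (hN.measurable _).sub (hN.measurable _)
  have h := (hN.indepIncrements.nat hτ).indepFun_finset (Finset.range k) {k} (by simp) hm
  -- The values at the grid points are partial sums of the increments, because the process starts at
  -- zero.
  let φ : (Finset.range k → ℕ) → (Finset.range (k + 1) → ℕ) := fun g i =>
    ∑ j ∈ Finset.range i, if hj : j < k then g ⟨j, Finset.mem_range.2 hj⟩ else 0
  let ψ : (({k} : Finset ℕ) → ℕ) → ℕ := fun g => g ⟨k, Finset.mem_singleton_self k⟩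
  have hφ : Measurable φ := by
    refine measurable_pi_lambda _ fun i => Finset.measurable_sum _ fun j _ => ?_
    split_ifs with hj
    · exact measurable_pi_apply _
    · exact measurable_const
  have hψ : Measurable ψ := measurable_pi_apply _
  have h2 := h.comp hφ hψ
  have e1 : (φ ∘ fun ω (i : Finset.range k) => N (τ (i + 1)) ω - N (τ i) ω) =
      fun ω (i : Finset.range (k + 1)) => N (τ i) ω := by
    funext ω i
    have hi : (i : ℕ) ≤ k := Nat.lt_succ_iff.1 (Finset.mem_range.1 i.2)
    have hs : ∀ n ≤ k, ∑ j ∈ Finset.range n,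
        (if _ : j < k then N (τ (j + 1)) ω - N (τ j) ω else 0) = N (τ n) ω := by
      intro n hn
      induction n with
      | zero => simp [h0, hN.zero]
      | succ n ih =>
        rw [Finset.sum_range_succ, ih (by omega), dif_pos (by omega)]
        have := hN.monotone ω (hτ (Nat.le_succ n))
        simp only [Nat.succ_eq_add_one] at this
        omega
    exact hs i hi
  rw [e1] at h2
  exact h2

/-- Independence of the whole past reduces to finitely many times; these, together with `0` and `s`,
are sorted into a grid ending with `t`, to which independence of increments applies. -/
theorem indep_increment {s t : ℝ≥0} (hst : s ≤ t) {A : Set Ω}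
    (hA : MeasurableSet[hN.filtration s] A) :
    P (A ∩ {ω | N t ω - N s ω = 0}) =
      P A * ENNReal.ofReal (Real.exp (-(lam * (t - s)))) := by
  have hind : IndepFun (fun ω (j : Iic s) => N j ω) (fun ω => N t ω - N s ω) P := by
    have hprob : IsProbabilityMeasure P := (hN.indepIncrements 0 (fun _ => 0)
      (fun _ _ _ => le_rfl)).isProbabilityMeasure
    refine IndepFun.process_indepFun (fun j => hN.measurable j)
      ((hN.measurable t).sub (hN.measurable s)) fun I => ?_
    classical
    let J : Finset ℝ≥0 := insert 0 (insert s (I.image Subtype.val))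
    have hJs : ∀ j ∈ J, j ≤ s := by
      intro j hj
      simp only [J, Finset.mem_insert, Finset.mem_image] at hj
      rcases hj with rfl | rfl | ⟨i, _, rfl⟩
      · exact zero_le
      · exact le_rfl
      · exact i.2
    have hpos : 0 < J.card := Finset.card_pos.2 ⟨0, Finset.mem_insert_self _ _⟩
    obtain ⟨k, hk⟩ : ∃ k, J.card = k + 1 := ⟨J.card - 1, by omega⟩
    let e := J.orderEmbOfFin hk
    let τ : ℕ → ℝ≥0 := fun i => if h : i < k + 1 then e ⟨i, h⟩ else t
    have hτ : Monotone τ := by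
      intro i j hij
      simp only [τ]
      split_ifs with h1 h2 h2
      · exact e.monotone hij
      · exact (hJs _ (Finset.orderEmbOfFin_mem _ _ _)).trans hst
      · omega
      · exact le_rfl
    have h0 : τ 0 = 0 := by
      simp only [τ, dif_pos (Nat.succ_pos k), e]
      rw [Finset.orderEmbOfFin_zero hk (Nat.succ_pos k)]
      exact le_antisymm (Finset.min'_le _ _ (Finset.mem_insert_self _ _)) zero_le
    have hτk : τ k = s := by
      simp only [τ, dif_pos (Nat.lt_succ_self k), e]
      have h := Finset.orderEmbOfFin_last hk (Nat.succ_pos k)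
      simp only [Nat.add_sub_cancel] at h
      rw [h]
      refine le_antisymm (hJs _ (Finset.max'_mem _ _)) (Finset.le_max' _ _ ?_)
      simp [J]
    have hτk1 : τ (k + 1) = t := by simp [τ]
    have hI : ∀ i : I, ∃ l : Finset.range (k + 1), τ l = i.1.1 := by
      intro i
      have hi : (i.1.1 : ℝ≥0) ∈ (J : Set ℝ≥0) := by
        simp only [J, Finset.coe_insert, Finset.coe_image]
        exact Or.inr (Or.inr ⟨i.1, i.2, rfl⟩)
      rw [← Finset.range_orderEmbOfFin J hk] at hi
      obtain ⟨l, hl⟩ := hi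
      exact ⟨⟨l, Finset.mem_range.2 l.2⟩, by simp only [τ, dif_pos l.2]; exact hl⟩
    choose l hl using hI
    have h := (hN.indepFun_range_increment hτ h0 k).comp
      (φ := fun g (i : I) => g (l i)) (measurable_pi_lambda _ fun i => measurable_pi_apply _)
      measurable_id
    rw [hτk, hτk1] at h
    have e1 : ((fun (g : Finset.range (k + 1) → ℕ) (i : I) => g (l i)) ∘
        fun ω (i : Finset.range (k + 1)) => N (τ i) ω) = fun ω (i : I) => N i ω := by
      funext ω i
      simp [hl i]
    rw [e1] at h
    exact h
  have hF : hN.filtration s = .comap (fun ω (j : Iic s) => N j ω) inferInstance :=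
    Filtration.natural_eq_comap _ _ s
  rw [hF] at hA
  obtain ⟨B, hB, rfl⟩ := hA
  have h := hind.measure_inter_preimage_eq_mul B {0} hB (measurableSet_singleton 0)
  have e : {ω | N t ω - N s ω = 0} = (fun ω => N t ω - N s ω) ⁻¹' {0} := rfl
  rw [e, h, ← e, hN.measure_increment_eq_zero hst]

theorem measurable_depositLocation (n : ℕ) : Measurable (depositLocation N n) := by
  refine measurable_of_Iic fun u => ?_
  rcases eq_or_ne u ⊤ with rfl | hu
  · simp
  · lift u to ℝ≥0 using hu
    have : depositLocation N n ⁻¹' Iic (u : ℝ≥0∞) = {ω | n ≤ N u ω} := by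
      ext ω
      exact hN.depositLocation_le_iff n u ω
    rw [this]
    exact hN.measurable u measurableSet_Ici

theorem exploredArea_le_iff (x : ℝ≥0) (n : ℕ) (u : ℝ≥0) (ω : Ω) :
    exploredArea N x n ω ≤ u ↔ n ≤ N u ω ∨ x ≤ u := by
  have hne : min (depositLocation N n ω) (x : ℝ≥0∞) ≠ ⊤ :=
    ne_top_of_le_ne_top ENNReal.coe_ne_top (min_le_right _ _)
  rw [exploredArea, ← ENNReal.coe_le_coe, ENNReal.coe_toNNReal hne,
    min_le_iff, hN.depositLocation_le_iff, ENNReal.coe_le_coe]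

omit hN in
omit [MeasurableSpace Ω] in
theorem exploredArea_le (x : ℝ≥0) (n : ℕ) (ω : Ω) : exploredArea N x n ω ≤ x := by
  have hne : min (depositLocation N n ω) (x : ℝ≥0∞) ≠ ⊤ :=
    ne_top_of_le_ne_top ENNReal.coe_ne_top (min_le_right _ _)
  rw [exploredArea, ← ENNReal.coe_le_coe, ENNReal.coe_toNNReal hne]
  exact min_le_right _ _

theorem coe_exploredArea {x : ℝ≥0} {n : ℕ} {ω : Ω} (h : n ≤ N x ω) :
    (exploredArea N x n ω : ℝ≥0∞) = depositLocation N n ω := by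
  have h1 := (hN.depositLocation_le_iff n x ω).2 h
  rw [exploredArea, min_eq_left h1, ENNReal.coe_toNNReal (ne_top_of_le_ne_top ENNReal.coe_ne_top h1)]

theorem exploredArea_of_lt {x : ℝ≥0} {n : ℕ} {ω : Ω} (h : N x ω < n) :
    exploredArea N x n ω = x := by
  have h1 : (x : ℝ≥0∞) ≤ depositLocation N n ω := by
    refine le_of_not_ge fun hcon => ?_
    exact absurd ((hN.depositLocation_le_iff n x ω).1 hcon) (not_le.2 h)
  rw [exploredArea, min_eq_right h1, ENNReal.toNNReal_coe]

theorem exploredArea_mono (x : ℝ≥0) (ω : Ω) : Monotone fun n => exploredArea N x n ω := by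
  intro n m hnm
  refine (hN.exploredArea_le_iff x n _ ω).2 ?_
  rcases (hN.exploredArea_le_iff x m _ ω).1 le_rfl with h | h
  · exact Or.inl (hnm.trans h)
  · exact Or.inr h

theorem exploredArea_zero (x : ℝ≥0) (ω : Ω) : exploredArea N x 0 ω = 0 :=
  le_antisymm ((hN.exploredArea_le_iff x 0 0 ω).2 (Or.inl (Nat.zero_le _))) zero_le

theorem info_le (x : ℝ≥0) (n : ℕ) : hN.info x n ≤ (inferInstance : MeasurableSpace Ω) :=
  (hN.isStoppingTime x n).measurableSpace_le

theorem info_mono (x : ℝ≥0) {n m : ℕ} (h : n ≤ m) : hN.info x n ≤ hN.info x m :=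
  (hN.isStoppingTime x n).measurableSpace_mono (hN.isStoppingTime x m) fun ω =>
    WithTop.coe_le_coe.2 (hN.exploredArea_mono x ω h)

theorem measurableSet_filtration_le (u : ℝ≥0) (n : ℕ) :
    MeasurableSet[hN.filtration u] {ω | n ≤ N u ω} := by
  have hm : Measurable[hN.filtration u] (N u) :=
    (Filtration.stronglyAdapted_natural (u := N)
      (fun v => (hN.measurable v).stronglyMeasurable) u).measurable
  exact hm measurableSet_Ici

theorem measurableSet_info_iff (x : ℝ≥0) (n : ℕ) (A : Set Ω) :
    MeasurableSet[hN.info x n] A ↔ MeasurableSet[⨆ u, hN.filtration u] A ∧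
      ∀ u : ℝ≥0, MeasurableSet[hN.filtration u] (A ∩ {ω | exploredArea N x n ω ≤ u}) := by
  have e : ∀ u : ℝ≥0, {ω | (exploredArea N x n ω : WithTop ℝ≥0) ≤ (u : WithTop ℝ≥0)} =
      {ω | exploredArea N x n ω ≤ u} := fun u => by
    ext ω
    exact WithTop.coe_le_coe
  rw [(hN.isStoppingTime x n).measurableSet]
  simp only [e]

theorem measurable_exploredArea (x : ℝ≥0) (n : ℕ) :
    Measurable[hN.info x n] (exploredArea N x n) := by
  have hle : ∀ u : ℝ≥0, MeasurableSet[hN.filtration u] {ω | exploredArea N x n ω ≤ u} := fun u =>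
    (hN.isStoppingTime x n).measurableSet_le u |> fun h => by
      have e : {ω | (exploredArea N x n ω : WithTop ℝ≥0) ≤ (u : WithTop ℝ≥0)} =
          {ω | exploredArea N x n ω ≤ u} := by
        ext ω
        exact WithTop.coe_le_coe
      rwa [e] at h
  refine @measurable_of_Iic _ Ω _ _ _ (hN.info x n) _ _ _ _ fun u => ?_
  rw [hN.measurableSet_info_iff]
  refine ⟨le_iSup (fun u => hN.filtration u) u _ (hle u), fun v => ?_⟩
  have e : exploredArea N x n ⁻¹' Iic u ∩ {ω | exploredArea N x n ω ≤ v} =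
      {ω | exploredArea N x n ω ≤ min u v} := by
    ext ω
    simp
  rw [e]
  exact hN.filtration.mono (min_le_right u v) _ (hle _)

/-- Whether the `n`-th deposit lies in the area is known after `n` episodes: if exploration has
stopped at `u < x`, it was because that deposit was found by `u`. -/
theorem measurableSet_info_le (x : ℝ≥0) (n : ℕ) : MeasurableSet[hN.info x n] {ω | n ≤ N x ω} := by
  rw [hN.measurableSet_info_iff]
  refine ⟨le_iSup (fun u => hN.filtration u) x _ (hN.measurableSet_filtration_le x n), fun u => ?_⟩
  rcases le_total x u with h | h
  · have e : {ω | n ≤ N x ω} ∩ {ω | exploredArea N x n ω ≤ u} = {ω | n ≤ N x ω} := by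
      ext ω
      simp only [mem_inter_iff, mem_ofPred_eq, hN.exploredArea_le_iff, h, or_true, and_true]
    rw [e]
    exact hN.filtration.mono h _ (hN.measurableSet_filtration_le x n)
  · rcases h.eq_or_lt with rfl | hlt
    · have e : {ω | n ≤ N u ω} ∩ {ω | exploredArea N u n ω ≤ u} = {ω | n ≤ N u ω} := by
        ext ω
        simp only [mem_inter_iff, mem_ofPred_eq, hN.exploredArea_le_iff, le_refl, or_true, and_true]
      rw [e]
      exact hN.measurableSet_filtration_le u n
    · have e : {ω | n ≤ N x ω} ∩ {ω | exploredArea N x n ω ≤ u} = {ω | n ≤ N u ω} := by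
        ext ω
        simp only [mem_inter_iff, mem_ofPred_eq, hN.exploredArea_le_iff, not_le.2 hlt, or_false]
        exact ⟨fun h => h.2, fun h' => ⟨h'.trans (hN.monotone ω h), h'⟩⟩
      rw [e]
      exact hN.measurableSet_filtration_le u n

/-- Deposits are found one at a time. -/
theorem ae_count_exploredArea (x : ℝ≥0) (n : ℕ) :
    ∀ᵐ ω ∂P, n ≤ N x ω → N (exploredArea N x n ω) ω = n := by
  -- Two deposits at one location would fall into a single cell of every grid. There are `O(K)`
  -- cells of length `1 / (K + 1)`, each containing two deposits with probability `O(K ^ (-2))`.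
  have hcover : ∀ K : ℕ, {ω | ¬(n ≤ N x ω → N (exploredArea N x n ω) ω = n)} ⊆
      ⋃ i ∈ Finset.range ⌈((K + 1 : ℕ) : ℝ≥0) * x⌉₊, {ω | 2 ≤ N (((i + 1 : ℕ) : ℝ≥0) / (K + 1 : ℕ)) ω -
        N ((i : ℝ≥0) / (K + 1 : ℕ)) ω} := by
    intro K ω hω
    simp only [mem_ofPred_eq, Classical.not_imp] at hω
    obtain ⟨hn, hne⟩ := hω
    set u := exploredArea N x n ω with hu
    have hux : u ≤ x := exploredArea_le x n ω
    have hξ := hN.coe_exploredArea hn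
    rw [← hu] at hξ
    have hge : n ≤ N u ω := (hN.depositLocation_le_iff n u ω).1 hξ.ge
    have hgt : n + 1 ≤ N u ω := by omega
    have hu0 : 0 < u := by
      refine pos_iff_ne_zero.2 fun h0 => ?_
      rw [h0, hN.zero] at hgt
      omega
    have hK : (0 : ℝ≥0) < (K + 1 : ℕ) := by positivity
    have hpos : 0 < ⌈((K + 1 : ℕ) : ℝ≥0) * u⌉₊ := Nat.ceil_pos.2 (mul_pos hK hu0)
    obtain ⟨i, hi⟩ : ∃ i, ⌈((K + 1 : ℕ) : ℝ≥0) * u⌉₊ = i + 1 :=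
      ⟨⌈((K + 1 : ℕ) : ℝ≥0) * u⌉₊ - 1, by omega⟩
    have h1 : (i : ℝ≥0) / (K + 1 : ℕ) < u := by
      rw [div_lt_iff₀ hK, mul_comm]
      exact Nat.lt_ceil.1 (by omega)
    have h2 : u ≤ ((i + 1 : ℕ) : ℝ≥0) / (K + 1 : ℕ) := by
      rw [le_div_iff₀ hK, mul_comm, ← hi]
      exact Nat.le_ceil _
    simp only [mem_iUnion, Finset.mem_range]
    refine ⟨i, ?_, ?_⟩
    · have : ⌈((K + 1 : ℕ) : ℝ≥0) * u⌉₊ ≤ ⌈((K + 1 : ℕ) : ℝ≥0) * x⌉₊ :=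
        Nat.ceil_mono (mul_le_mul_of_nonneg_left hux hK.le)
      omega
    · have h3 : N ((i : ℝ≥0) / (K + 1 : ℕ)) ω < n := by
        by_contra hcon
        have := (hN.depositLocation_le_iff n _ ω).2 (not_lt.1 hcon)
        rw [← hξ, ENNReal.coe_le_coe] at this
        exact absurd h1 (not_lt.2 this)
      have h4 := hN.monotone ω h2
      simp only [mem_ofPred_eq] at h4 ⊢
      omega
  have hbound : ∀ K : ℕ, P {ω | ¬(n ≤ N x ω → N (exploredArea N x n ω) ω = n)} ≤
      ENNReal.ofReal ((((K + 1 : ℕ) : ℝ) * x + 1) * ((lam : ℝ) / (K + 1 : ℕ)) ^ 2) := by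
    intro K
    have hK : (0 : ℝ) < (K + 1 : ℕ) := by positivity
    refine (measure_mono (hcover K)).trans ((measure_biUnion_finset_le _ _).trans ?_)
    refine (Finset.sum_le_sum (g := fun _ => ENNReal.ofReal (((lam : ℝ) / (K + 1 : ℕ)) ^ 2))
      fun i _ => ?_).trans ?_
    · refine (hN.measure_two_le_increment (by gcongr; simp)).trans (ENNReal.ofReal_le_ofReal ?_)
      refine le_of_eq ?_
      congr 1
      rw [NNReal.coe_mul, NNReal.coe_sub (by gcongr; simp)]
      push_cast
      field_simp
      ring
    · rw [Finset.sum_const, Finset.card_range, nsmul_eq_mul, ← ENNReal.ofReal_natCast,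
        ← ENNReal.ofReal_mul (Nat.cast_nonneg _)]
      refine ENNReal.ofReal_le_ofReal (mul_le_mul_of_nonneg_right ?_ (sq_nonneg _))
      have h := Nat.ceil_lt_add_one (a := ((K + 1 : ℕ) : ℝ≥0) * x) zero_le
      have h2 : ((⌈((K + 1 : ℕ) : ℝ≥0) * x⌉₊ : ℝ≥0) : ℝ) ≤ (((K + 1 : ℕ) : ℝ≥0) * x + 1 : ℝ≥0) :=
        NNReal.coe_le_coe.2 h.le
      push_cast at h2 ⊢
      exact h2
  have hlim : Tendsto (fun K : ℕ => ENNReal.ofReal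
      ((((K + 1 : ℕ) : ℝ) * x + 1) * ((lam : ℝ) / (K + 1 : ℕ)) ^ 2)) atTop (𝓝 0) := by
    rw [← ENNReal.ofReal_zero]
    refine ENNReal.tendsto_ofReal ?_
    have h1 : Tendsto (fun K : ℕ => 1 / ((K : ℝ) + 1)) atTop (𝓝 0) :=
      tendsto_one_div_add_atTop_nhds_zero_nat
    have h2 := ((h1.const_mul ((x : ℝ) * lam ^ 2)).add ((h1.pow 2).const_mul ((lam : ℝ) ^ 2)))
    simp only [mul_zero, ne_eq, OfNat.ofNat_ne_zero, not_false_eq_true, zero_pow, add_zero] at h2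
    refine h2.congr fun K => ?_
    have hK : ((K : ℝ) + 1) ≠ 0 := by positivity
    push_cast
    field_simp
  exact le_antisymm (ge_of_tendsto' hlim hbound) zero_le

theorem eventually_count_eq {u : ℝ≥0} {ω : Ω} {v : ℕ → ℝ≥0} (hv : Tendsto v atTop (𝓝 u))
    (hle : ∀ k, u ≤ v k) : ∀ᶠ k in atTop, N (v k) ω = N u ω := by
  have hc : ∀ᶠ w in 𝓝[≥] u, N w ω = N u ω :=
    (hN.rightCts ω u).eventually (p := fun y => y = N u ω) ((isOpen_discrete {N u ω}).mem_nhds rfl)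
  exact (tendsto_nhdsWithin_iff.2 ⟨hv, Eventually.of_forall hle⟩).eventually hc

/-- Rounded up to the grid, the stopping location takes countably many values, and an event known at
that location and intersected with one of these values is known at the corresponding grid point. -/
theorem measurableSet_inter_ceil (x : ℝ≥0) (n K j : ℕ) {A : Set Ω}
    (hA : MeasurableSet[hN.info x n] A) :
    MeasurableSet[hN.filtration ((j : ℝ≥0) / (K + 1 : ℕ))]
      (A ∩ {ω | ⌈((K + 1 : ℕ) : ℝ≥0) * exploredArea N x n ω⌉₊ = j}) := by
  have hK : (0 : ℝ≥0) < (K + 1 : ℕ) := by positivity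
  have hle : ∀ i : ℕ, A ∩ {ω | ⌈((K + 1 : ℕ) : ℝ≥0) * exploredArea N x n ω⌉₊ ≤ i} =
      A ∩ {ω | exploredArea N x n ω ≤ (i : ℝ≥0) / (K + 1 : ℕ)} := by
    intro i
    ext ω
    simp only [mem_inter_iff, mem_ofPred_eq, Nat.ceil_le, le_div_iff₀ hK, mul_comm]
  have e : A ∩ {ω | ⌈((K + 1 : ℕ) : ℝ≥0) * exploredArea N x n ω⌉₊ = j} =
      (A ∩ {ω | ⌈((K + 1 : ℕ) : ℝ≥0) * exploredArea N x n ω⌉₊ ≤ j}) \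
      ⋃ i ∈ Finset.range j, (A ∩ {ω | ⌈((K + 1 : ℕ) : ℝ≥0) * exploredArea N x n ω⌉₊ ≤ i}) := by
    ext ω
    simp only [mem_inter_iff, mem_ofPred_eq, Set.mem_sdiff, mem_iUnion, Finset.mem_range, not_exists,
      not_and, exists_prop]
    constructor
    · rintro ⟨h1, h2⟩
      exact ⟨⟨h1, h2.le⟩, fun i hi _ => by omega⟩
    · rintro ⟨⟨h1, h2⟩, h3⟩
      refine ⟨h1, le_antisymm h2 (le_of_not_gt fun hlt => ?_)⟩
      exact absurd le_rfl (h3 _ hlt h1)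
  rw [e, hle]
  have hinfo := ((hN.measurableSet_info_iff x n A).1 hA).2
  refine (hinfo _).diff (Finset.measurableSet_biUnion _ fun i hi => ?_)
  rw [hle]
  refine hN.filtration.mono ?_ _ (hinfo _)
  have : (i : ℝ≥0) ≤ j := by exact_mod_cast (Finset.mem_range.1 hi).le
  gcongr

/-- The stopping location is approximated from above by grid values, where independence of
increments gives the exact probability. Right continuity of the paths passes to the limit, and
uniqueness of deposits at a location turns absence of increments into the next deposit lying farther
than `s`. -/
theorem strongMarkov [IsProbabilityMeasure P] (x : ℝ≥0) (n : ℕ) {A : Set Ω}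
    (hA : MeasurableSet[hN.info x n] A) (hAn : A ⊆ {ω | n ≤ N x ω}) (s : ℝ≥0) :
    P (A ∩ {ω | ((exploredArea N x n ω + s : ℝ≥0) : ℝ≥0∞) < depositLocation N (n + 1) ω}) =
      P A * ENNReal.ofReal (Real.exp (-(lam * s))) := by
  set X := exploredArea N x n with hX
  have hXm : Measurable X := (hN.measurable_exploredArea x n).mono (hN.info_le x n) le_rfl
  have hAm : MeasurableSet A := hN.info_le x n _ hA
  let c : ℕ → Ω → ℕ := fun K ω => ⌈((K + 1 : ℕ) : ℝ≥0) * X ω⌉₊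
  let g : ℕ → ℕ → ℝ≥0 := fun K j => (j : ℝ≥0) / (K + 1 : ℕ)
  -- The event that no deposit is found within `s` after the rounded location; its probability does
  -- not depend on `K`.
  let E : ℕ → Set Ω := fun K => ⋃ j : ℕ, (A ∩ {ω | c K ω = j}) ∩
    {ω | N (g K j + s) ω - N (g K j) ω = 0}
  have hcm : ∀ K j, MeasurableSet (A ∩ {ω | c K ω = j}) := fun K j =>
    hN.filtration.le _ _ (hN.measurableSet_inter_ceil x n K j hA)
  have hzm : ∀ u v, MeasurableSet {ω | N u ω - N v ω = 0} := fun u v =>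
    ((hN.measurable u).sub (hN.measurable v)) (measurableSet_singleton 0)
  have hEm : ∀ K, MeasurableSet (E K) := fun K =>
    MeasurableSet.iUnion fun j => (hcm K j).inter (hzm _ _)
  have hdisj : ∀ K, Pairwise (Function.onFun Disjoint fun j => A ∩ {ω | c K ω = j}) := by
    intro K i j hij
    refine Set.disjoint_left.2 fun ω h1 h2 => hij ?_
    exact h1.2.symm.trans h2.2
  have hEP : ∀ K, P (E K) = P A * ENNReal.ofReal (Real.exp (-(lam * s))) := by
    intro K
    have h1 : P (E K) = ∑' j : ℕ, P (A ∩ {ω | c K ω = j}) *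
        ENNReal.ofReal (Real.exp (-(lam * s))) := by
      rw [measure_iUnion (fun i j hij => ((hdisj K) hij).mono inter_subset_left inter_subset_left)
        fun j => (hcm K j).inter (hzm _ _)]
      congr 1
      funext j
      rw [hN.indep_increment (s := g K j) (t := g K j + s) le_self_add
        (hN.measurableSet_inter_ceil x n K j hA)]
      simp only [NNReal.coe_add, add_sub_cancel_left]
      rfl
    rw [h1, ENNReal.tsum_mul_right, ← measure_iUnion (hdisj K) (hcm K)]
    congr 2
    ext ω
    simp
  have hBm : MeasurableSet (A ∩ {ω | ((X ω + s : ℝ≥0) : ℝ≥0∞) < depositLocation N (n + 1) ω}) :=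
    hAm.inter (measurableSet_lt (hXm.add_const s).coe_nnreal_ennreal
      (hN.measurable_depositLocation _))
  have hlim : Tendsto (fun K => P (E K)) atTop
      (𝓝 (P (A ∩ {ω | ((X ω + s : ℝ≥0) : ℝ≥0∞) < depositLocation N (n + 1) ω}))) := by
    refine tendsto_measure_of_ae_tendsto_indicator_of_isFiniteMeasure atTop hBm hEm ?_
    filter_upwards [hN.ae_count_exploredArea x n] with ω hω
    by_cases hωA : ω ∈ A
    · have hcount : N (X ω) ω = n := hω (hAn hωA)
      have hgle : ∀ K, X ω ≤ g K (c K ω) := fun K => by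
        have hK : (0 : ℝ≥0) < (K + 1 : ℕ) := by positivity
        simp only [g]
        rw [le_div_iff₀ hK, mul_comm]
        exact Nat.le_ceil _
      have hgt : Tendsto (fun K => g K (c K ω)) atTop (𝓝 (X ω)) := by
        have h1 : Tendsto (fun K : ℕ => X ω + 1 / ((K : ℝ≥0) + 1)) atTop (𝓝 (X ω)) := by
          simpa using (tendsto_one_div_add_atTop_nhds_zero_nat (𝕜 := ℝ≥0)).const_add (X ω)
        refine tendsto_of_tendsto_of_tendsto_of_le_of_le tendsto_const_nhds h1 hgle fun K => ?_
        have hK : (0 : ℝ≥0) < (K + 1 : ℕ) := by positivity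
        have h := (Nat.ceil_lt_add_one (a := ((K + 1 : ℕ) : ℝ≥0) * X ω) zero_le).le
        simp only [g]
        rw [div_le_iff₀ hK]
        refine h.trans_eq ?_
        push_cast
        field_simp
      have hgts : Tendsto (fun K => g K (c K ω) + s) atTop (𝓝 (X ω + s)) := hgt.add_const s
      filter_upwards [hN.eventually_count_eq (ω := ω) hgt hgle, hN.eventually_count_eq (ω := ω) hgts
        fun K => add_le_add (hgle K) le_rfl] with K h1 h2
      have h3 : ω ∈ E K ↔ N (X ω + s) ω - N (X ω) ω = 0 := by
        simp only [E, mem_iUnion, mem_inter_iff, mem_ofPred_eq]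
        constructor
        · rintro ⟨j, ⟨_, rfl⟩, hj⟩
          rwa [h1, h2] at hj
        · intro h
          exact ⟨c K ω, ⟨hωA, rfl⟩, by rwa [h1, h2]⟩
      rw [h3, mem_inter_iff, mem_ofPred_eq, ← not_le, hN.depositLocation_le_iff, hcount]
      simp only [hωA, true_and]
      omega
    · refine Eventually.of_forall fun K => ?_
      simp only [E, mem_iUnion, mem_inter_iff, hωA, false_and, exists_false]
  simp only [hEP] at hlim
  exact tendsto_nhds_unique hlim tendsto_const_nhds

end IsPoissonProcess

end StrongMarkov

/-! ## The law of the next deposit -/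

section NextDeposit

open Filter Topology

theorem expMeasure_Ioi {r : ℝ} (hr : 0 < r) {s : ℝ} (hs : 0 ≤ s) :
    expMeasure r (Ioi s) = ENNReal.ofReal (Real.exp (-(r * s))) := by
  have := isProbabilityMeasure_expMeasure hr
  rw [← compl_Iic, prob_compl_eq_one_sub measurableSet_Iic, ← ofReal_cdf, cdf_expMeasure_eq hr,
    if_pos hs, ← ENNReal.ofReal_one, ← ENNReal.ofReal_sub _ (by
      rw [sub_nonneg, Real.exp_le_one_iff]; nlinarith), sub_sub_cancel]

theorem lintegral_expMeasure {r : ℝ} {φ : ℝ → ℝ≥0∞} (hφ : Measurable φ) :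
    ∫⁻ s, φ s ∂expMeasure r =
      ∫⁻ s in Ioi 0, ENNReal.ofReal (r * Real.exp (-(r * s))) * φ s := by
  have h : expMeasure r = volume.withDensity (exponentialPDF r) := rfl
  have hm : Measurable (exponentialPDF r) := (measurable_exponentialPDFReal r).ennreal_ofReal
  rw [h, lintegral_withDensity_eq_lintegral_mul _ hm hφ,
    ← lintegral_add_compl _ (measurableSet_Ioi (a := (0 : ℝ)))]
  have h0 : ∫⁻ s in (Ioi (0 : ℝ))ᶜ, (exponentialPDF r * φ) s = 0 := by
    rw [compl_Ioi, ← setLIntegral_congr Iio_ae_eq_Iic]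
    refine (setLIntegral_congr_fun measurableSet_Iio fun s hs => ?_).trans (lintegral_zero)
    simp [exponentialPDF_of_neg hs]
  rw [h0, add_zero]
  refine setLIntegral_congr_fun measurableSet_Ioi fun s hs => ?_
  simp [exponentialPDF_of_nonneg (le_of_lt hs)]

variable {Ω : Type*} [MeasurableSpace Ω] {N : ℝ≥0 → Ω → ℕ} {lam : ℝ≥0} {P : Measure Ω}

/-- The area explored between the `n`-th and the next deposit. -/
noncomputable def waitingArea (N : ℝ≥0 → Ω → ℕ) (x : ℝ≥0) (n : ℕ) (ω : Ω) : ℝ :=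
  (depositLocation N (n + 1) ω - exploredArea N x n ω).toReal

namespace IsPoissonProcess

variable (hN : IsPoissonProcess N lam P)
include hN

theorem measurable_waitingArea (x : ℝ≥0) (n : ℕ) : Measurable (waitingArea N x n) :=
  ((hN.measurable_depositLocation _).sub ((hN.measurable_exploredArea x n).mono
    (hN.info_le x n) le_rfl).coe_nnreal_ennreal).ennreal_toReal

theorem ae_depositLocation_lt_top [IsProbabilityMeasure P] (hlam : 0 < lam) (x : ℝ≥0) (n : ℕ) :
    ∀ᵐ ω ∂P, n ≤ N x ω → depositLocation N (n + 1) ω < ⊤ := by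
  have hb : ∀ k : ℕ, P {ω | ¬(n ≤ N x ω → depositLocation N (n + 1) ω < ⊤)} ≤
      ENNReal.ofReal (Real.exp (-(lam * (k : ℝ)))) := by
    intro k
    have h := hN.strongMarkov x n (hN.measurableSet_info_le x n) subset_rfl k
    refine le_trans (measure_mono ?_) (h.le.trans ?_)
    · intro ω hω
      simp only [mem_ofPred_eq, Classical.not_imp, not_lt, top_le_iff] at hω
      exact ⟨hω.1, by simp [hω.2]⟩
    · simpa using mul_le_mul_of_nonneg_right (prob_le_one (μ := P) (s := {ω | n ≤ N x ω}))
        (zero_le (a := ENNReal.ofReal (Real.exp (-(lam * (k : ℝ))))))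
  have hlim : Tendsto (fun k : ℕ => ENNReal.ofReal (Real.exp (-(lam * (k : ℝ))))) atTop (𝓝 0) := by
    rw [← ENNReal.ofReal_zero]
    refine ENNReal.tendsto_ofReal (Real.tendsto_exp_neg_atTop_nhds_zero.comp ?_)
    exact tendsto_natCast_atTop_atTop.const_mul_atTop (NNReal.coe_pos.2 hlam)
  exact le_antisymm (ge_of_tendsto' hlim hb) zero_le

omit hN in
omit [MeasurableSpace Ω] in
theorem depositLocation_mono (ω : Ω) : Monotone fun n => depositLocation N n ω := by
  intro n m hnm
  refine le_iInf₂ fun u hu => iInf₂_le u (hnm.trans hu)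

theorem waitingArea_spec {x : ℝ≥0} {n : ℕ} {ω : Ω} (hn : n ≤ N x ω)
    (h : depositLocation N (n + 1) ω < ⊤) :
    0 ≤ waitingArea N x n ω ∧
    depositLocation N (n + 1) ω = ENNReal.ofReal (exploredArea N x n ω + waitingArea N x n ω) := by
  refine ⟨ENNReal.toReal_nonneg, ?_⟩
  have h1 : (exploredArea N x n ω : ℝ≥0∞) ≤ depositLocation N (n + 1) ω := by
    rw [hN.coe_exploredArea hn]
    exact depositLocation_mono ω (Nat.le_succ n)
  rw [waitingArea, ENNReal.ofReal_add NNReal.zero_le_coe ENNReal.toReal_nonneg,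
    ENNReal.ofReal_coe_nnreal, ENNReal.ofReal_toReal (ENNReal.sub_ne_top h.ne), add_tsub_cancel_of_le h1]

theorem succ_le_count_iff {x : ℝ≥0} {n : ℕ} {ω : Ω} (hn : n ≤ N x ω)
    (h : depositLocation N (n + 1) ω < ⊤) :
    n + 1 ≤ N x ω ↔ exploredArea N x n ω + waitingArea N x n ω ≤ x := by
  rw [← hN.depositLocation_le_iff, (hN.waitingArea_spec hn h).2, ← ENNReal.ofReal_coe_nnreal,
    ENNReal.ofReal_le_ofReal_iff NNReal.zero_le_coe]

theorem exploredArea_succ {x : ℝ≥0} {n : ℕ} {ω : Ω} (hn : n ≤ N x ω)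
    (h : depositLocation N (n + 1) ω < ⊤) :
    (exploredArea N x (n + 1) ω : ℝ) =
      min (exploredArea N x n ω + waitingArea N x n ω : ℝ) x := by
  have h1 := hN.waitingArea_spec hn h
  rw [exploredArea, h1.2, ← ENNReal.ofReal_coe_nnreal (p := x), ← ENNReal.ofReal_min]
  exact ENNReal.toReal_ofReal (le_min (add_nonneg NNReal.zero_le_coe h1.1) NNReal.zero_le_coe)

variable [IsProbabilityMeasure P] (hlam : 0 < lam)
include hlam

theorem measure_inter_waitingArea (x : ℝ≥0) (n : ℕ) {A : Set Ω}
    (hA : MeasurableSet[hN.info x n] A) (hAn : A ⊆ {ω | n ≤ N x ω}) {B : Set ℝ}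
    (hB : MeasurableSet B) :
    P (A ∩ waitingArea N x n ⁻¹' B) = P A * expMeasure lam B := by
  have hr : (0 : ℝ) < lam := NNReal.coe_pos.2 hlam
  have := isProbabilityMeasure_expMeasure hr
  have hD := hN.measurable_waitingArea x n
  have hAm : MeasurableSet A := hN.info_le x n _ hA
  have hIoi : ∀ s : ℝ, 0 ≤ s → P (A ∩ waitingArea N x n ⁻¹' Ioi s) = P A * expMeasure lam (Ioi s) := by
    intro s hs
    rw [expMeasure_Ioi hr hs]
    have h := hN.strongMarkov x n hA hAn s.toNNReal
    rw [Real.coe_toNNReal s hs] at h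
    rw [← h]
    refine measure_congr ?_
    filter_upwards [hN.ae_depositLocation_lt_top hlam x n] with ω hω
    refine propext (and_congr_right fun hωA => ?_)
    have h1 := hN.waitingArea_spec (hAn hωA) (hω (hAn hωA))
    rw [mem_preimage, mem_Ioi, mem_ofPred_eq, h1.2, ← ENNReal.ofReal_coe_nnreal,
      ENNReal.ofReal_lt_ofReal_iff_of_nonneg NNReal.zero_le_coe, NNReal.coe_add,
      Real.coe_toNNReal s hs, add_lt_add_iff_left]
  have hext : (P.restrict A).map (waitingArea N x n) = P A • expMeasure lam := by
    refine Measure.ext_of_Iic _ _ fun s => ?_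
    rw [Measure.map_apply hD measurableSet_Iic, Measure.smul_apply, smul_eq_mul,
      Measure.restrict_apply (hD measurableSet_Iic), inter_comm]
    rcases lt_or_ge s 0 with hs | hs
    · have e1 : A ∩ waitingArea N x n ⁻¹' Iic s = ∅ := by
        ext ω
        simp only [mem_inter_iff, mem_preimage, mem_Iic, mem_empty_iff_false, iff_false, not_and,
          not_le]
        exact fun _ => hs.trans_le ENNReal.toReal_nonneg
      have e2 : expMeasure lam (Iic s) = 0 := by
        rw [← ofReal_cdf, cdf_expMeasure_eq hr, if_neg (not_le.2 hs), ENNReal.ofReal_zero]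
      rw [e1, e2, measure_empty, mul_zero]
    · have e1 : A ∩ waitingArea N x n ⁻¹' Iic s = A \ (A ∩ waitingArea N x n ⁻¹' Ioi s) := by
        ext ω
        simp only [mem_inter_iff, mem_preimage, mem_Iic, Set.mem_sdiff, mem_Ioi, not_and, not_lt]
        tauto
      rw [e1, measure_sdiff inter_subset_left
        (hAm.inter (hD measurableSet_Ioi)).nullMeasurableSet (measure_ne_top _ _), hIoi s hs,
        ← compl_Ioi, prob_compl_eq_one_sub measurableSet_Ioi, ENNReal.mul_sub (by simp), mul_one]
  have h := congrArg (fun μ => μ B) hext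
  simp only [Measure.smul_apply, smul_eq_mul] at h
  rw [Measure.map_apply hD hB, Measure.restrict_apply (hD hB), inter_comm] at h
  exact h

/-- On the event that the `n`-th deposit exists, the area up to the next deposit is independent of
the information at hand, so it can be integrated out with the known data `Y` frozen. -/
theorem lintegral_waitingArea (x : ℝ≥0) (n : ℕ) {β : Type*} [MeasurableSpace β] {Y : Ω → β}
    (hY : Measurable[hN.info x n] Y) {h : β × ℝ → ℝ≥0∞} (hh : Measurable h) :
    ∫⁻ ω in {ω | n ≤ N x ω}, h (Y ω, waitingArea N x n ω) ∂P =
      ∫⁻ ω in {ω | n ≤ N x ω}, ∫⁻ s, h (Y ω, s) ∂expMeasure lam ∂P := by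
  have hr : (0 : ℝ) < lam := NNReal.coe_pos.2 hlam
  have := isProbabilityMeasure_expMeasure hr
  have hD := hN.measurable_waitingArea x n
  have hY' : Measurable Y := hY.mono (hN.info_le x n) le_rfl
  have hE := hN.measurableSet_info_le x n
  have hE' : MeasurableSet {ω | n ≤ N x ω} := hN.info_le x n _ hE
  have hprod : ((P.restrict {ω | n ≤ N x ω}).map Y).prod (expMeasure lam) =
      (P.restrict {ω | n ≤ N x ω}).map fun ω => (Y ω, waitingArea N x n ω) := by
    refine Measure.prod_eq fun s t hs ht => ?_
    rw [Measure.map_apply (hY'.prodMk hD) (hs.prod ht), Measure.map_apply hY' hs,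
      Measure.restrict_apply (hY'.prodMk hD (hs.prod ht)), Measure.restrict_apply (hY' hs),
      ← hN.measure_inter_waitingArea hlam x n (A := Y ⁻¹' s ∩ {ω | n ≤ N x ω})
        (@MeasurableSet.inter _ (hN.info x n) _ _ (hY hs) hE) inter_subset_right ht]
    congr 1
    ext ω
    simp only [mem_inter_iff, mem_preimage, mem_prod]
    tauto
  rw [← lintegral_map (f := h) (g := fun ω => (Y ω, waitingArea N x n ω)) hh (hY'.prodMk hD),
    ← hprod, lintegral_prod _ hh.aemeasurable,
    lintegral_map hh.lintegral_prod_right' hY']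

end IsPoissonProcess

/-! ### Expected value after exploring until the next deposit -/

namespace NormalizedModel

variable {M : NormalizedModel} {f q : ℝ → ℝ → ℝ}

/-- The expected area explored in an episode when area `y` is left; multiplied by the unit cost it
is the cost term of the exploration operator. -/
theorem lintegral_min_expMeasure {r y : ℝ} (hr : 0 < r) (hy : 0 ≤ y) :
    ∫⁻ s, ENNReal.ofReal (min s y) ∂expMeasure r =
      ENNReal.ofReal ((1 - Real.exp (-(r * y))) / r) := by
  rw [lintegral_expMeasure (by fun_prop), ← Ioc_union_Ioi_eq_Ioi hy,
    lintegral_union measurableSet_Ioi (by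
      rw [Set.disjoint_left]; exact fun s h1 h2 => absurd h1.2 (not_le.2 h2))]
  have h1 : ∫⁻ s in Ioc 0 y, ENNReal.ofReal (r * Real.exp (-(r * s))) * ENNReal.ofReal (min s y) =
      ENNReal.ofReal ((1 - Real.exp (-(r * y))) / r - y * Real.exp (-(r * y))) := by
    have hint : ∫ s in (0 : ℝ)..y, r * Real.exp (-(r * s)) * s =
        (1 - Real.exp (-(r * y))) / r - y * Real.exp (-(r * y)) := by
      have hd : ∀ s ∈ uIcc 0 y, HasDerivAt (fun s => -((s + 1 / r) * Real.exp (-(r * s))))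
          (r * Real.exp (-(r * s)) * s) s := fun s _ => by
        refine ((((hasDerivAt_id s).add_const (1 / r)).mul
          (((hasDerivAt_id s).const_mul r).neg.exp)).neg).congr_deriv ?_
        simp only [id, Pi.neg_apply]
        field_simp
        ring
      rw [intervalIntegral.integral_eq_sub_of_hasDerivAt hd
        ((by fun_prop : Continuous fun s => r * Real.exp (-(r * s)) * s).intervalIntegrable _ _)]
      simp only [mul_zero, neg_zero, Real.exp_zero, zero_add, mul_one]
      field_simp
      ring
    rw [← hint, intervalIntegral.integral_of_le hy, ofReal_integral_eq_lintegral_ofReal]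
    · refine setLIntegral_congr_fun measurableSet_Ioc fun s hs => ?_
      rw [min_eq_left hs.2, ← ENNReal.ofReal_mul (by positivity : 0 ≤ r * Real.exp (-(r * s)))]
    · exact (by fun_prop : Continuous fun s => r * Real.exp (-(r * s)) * s).integrableOn_Ioc
    · exact (ae_restrict_iff' measurableSet_Ioc).2 (ae_of_all _ fun s hs =>
        mul_nonneg (by positivity) hs.1.le)
  have h2 : ∫⁻ s in Ioi y, ENNReal.ofReal (r * Real.exp (-(r * s))) * ENNReal.ofReal (min s y) =
      ENNReal.ofReal (y * Real.exp (-(r * y))) := by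
    have e : ∫⁻ s, (Ioi y).indicator (fun _ => ENNReal.ofReal y) s ∂expMeasure r =
        ENNReal.ofReal (y * Real.exp (-(r * y))) := by
      rw [lintegral_indicator measurableSet_Ioi, setLIntegral_const, expMeasure_Ioi hr hy,
        ENNReal.ofReal_mul hy]
    rw [← e, lintegral_expMeasure (measurable_const.indicator measurableSet_Ioi),
      ← lintegral_indicator measurableSet_Ioi, ← lintegral_indicator measurableSet_Ioi]
    congr 1
    funext s
    by_cases hs : y < s
    · rw [indicator_of_mem (show s ∈ Ioi y from hs),
        indicator_of_mem (show s ∈ Ioi 0 from hy.trans_lt hs),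
        indicator_of_mem (show s ∈ Ioi y from hs), min_eq_right hs.le]
    · simp only [indicator_apply, mem_Ioi, if_neg hs, mul_zero, ite_self]
  have h3 : 0 ≤ y * Real.exp (-(r * y)) := by positivity
  have h4 : 0 ≤ (1 - Real.exp (-(r * y))) / r - y * Real.exp (-(r * y)) := by
    have := Real.add_one_le_exp (r * y)
    have h5 : Real.exp (-(r * y)) * Real.exp (r * y) = 1 := by rw [← Real.exp_add]; simp
    rw [sub_nonneg, le_div_iff₀ hr]
    nlinarith [Real.exp_pos (-(r * y))]
  rw [h1, h2, ← ENNReal.ofReal_add h4 h3]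
  congr 1
  ring

/-- The exploration operator with its cost moved to the other side, which keeps the identity in `[0,
∞]` free of subtraction. -/
theorem IsContinuation.lintegral_nextValue (hc : M.IsContinuation f q) {y R : ℝ} (hy : 0 ≤ y)
    (hR : 0 ≤ R) :
    ∫⁻ s, (if s ≤ y then ENNReal.ofReal (f (y - s) (R + M.a)) else ENNReal.ofReal (R ^ M.α))
        ∂expMeasure M.lam =
      ENNReal.ofReal (M.stopValue f y R) +
        ENNReal.ofReal M.κ * ∫⁻ s, ENNReal.ofReal (min s y) ∂expMeasure M.lam := by
  have hr := M.lam_pos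
  have hfy : Continuous fun s => f (y - s) (R + M.a) :=
    hc.cont.comp (by fun_prop : Continuous fun s => (y - s, R + M.a))
  have hf0 : ∀ s ≤ y, 0 ≤ f (y - s) (R + M.a) := fun s hs =>
    (Real.rpow_nonneg (by linarith [M.a_pos]) _).trans
      (hc.lower (y - s) (R + M.a) (by linarith) (by linarith))
  have hmeas : Measurable fun s => if s ≤ y then ENNReal.ofReal (f (y - s) (R + M.a))
      else ENNReal.ofReal (R ^ M.α) :=
    Measurable.ite measurableSet_Iic hfy.measurable.ennreal_ofReal measurable_const
  rw [lintegral_expMeasure hmeas, ← Ioc_union_Ioi_eq_Ioi hy,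
    lintegral_union measurableSet_Ioi (by
      rw [Set.disjoint_left]; exact fun s h1 h2 => absurd h1.2 (not_le.2 h2))]
  have h1 : ∫⁻ s in Ioc 0 y, ENNReal.ofReal (M.lam * Real.exp (-(M.lam * s))) *
      (if s ≤ y then ENNReal.ofReal (f (y - s) (R + M.a)) else ENNReal.ofReal (R ^ M.α)) =
      ENNReal.ofReal (Real.exp (-(M.lam * y)) * M.depositMean (fun z => f z (R + M.a)) y) := by
    have hint : ∫ s in (0 : ℝ)..y, M.lam * Real.exp (-(M.lam * s)) * f (y - s) (R + M.a) =
        Real.exp (-(M.lam * y)) * M.depositMean (fun z => f z (R + M.a)) y := by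
      rw [depositMean, ← intervalIntegral.integral_const_mul]
      have h := intervalIntegral.integral_comp_sub_left (a := 0) (b := y)
        (fun z => Real.exp (-(M.lam * y)) * (M.lam * Real.exp (M.lam * z) * f z (R + M.a))) y
      rw [sub_zero, sub_self] at h
      rw [← h]
      refine intervalIntegral.integral_congr fun s _ => ?_
      rw [show -(M.lam * s) = -(M.lam * y) + M.lam * (y - s) by ring, Real.exp_add]
      ring
    rw [← hint, intervalIntegral.integral_of_le hy, ofReal_integral_eq_lintegral_ofReal]
    · refine setLIntegral_congr_fun measurableSet_Ioc fun s hs => ?_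
      rw [if_pos hs.2, ← ENNReal.ofReal_mul (by positivity : 0 ≤ M.lam * Real.exp (-(M.lam * s)))]
    · exact ((by fun_prop : Continuous fun s => M.lam * Real.exp (-(M.lam * s))).mul
        hfy).integrableOn_Ioc
    · exact (ae_restrict_iff' measurableSet_Ioc).2 (ae_of_all _ fun s hs =>
        mul_nonneg (by positivity) (hf0 s hs.2))
  have h2 : ∫⁻ s in Ioi y, ENNReal.ofReal (M.lam * Real.exp (-(M.lam * s))) *
      (if s ≤ y then ENNReal.ofReal (f (y - s) (R + M.a)) else ENNReal.ofReal (R ^ M.α)) =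
      ENNReal.ofReal (Real.exp (-(M.lam * y)) * R ^ M.α) := by
    have e : ∫⁻ s, (Ioi y).indicator (fun _ => ENNReal.ofReal (R ^ M.α)) s ∂expMeasure M.lam =
        ENNReal.ofReal (Real.exp (-(M.lam * y)) * R ^ M.α) := by
      rw [lintegral_indicator measurableSet_Ioi, setLIntegral_const, expMeasure_Ioi hr hy,
        mul_comm, ENNReal.ofReal_mul (Real.exp_pos _).le]
    rw [← e, lintegral_expMeasure (measurable_const.indicator measurableSet_Ioi),
      ← lintegral_indicator measurableSet_Ioi, ← lintegral_indicator measurableSet_Ioi]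
    congr 1
    funext s
    by_cases hs : y < s
    · rw [indicator_of_mem (show s ∈ Ioi y from hs),
        indicator_of_mem (show s ∈ Ioi 0 from hy.trans_lt hs),
        indicator_of_mem (show s ∈ Ioi y from hs), if_neg (not_le.2 hs)]
    · simp only [indicator_apply, mem_Ioi, if_neg hs, mul_zero, ite_self]
  have hd : 0 ≤ M.depositMean (fun z => f z (R + M.a)) y := by
    have h3 := depositMean_mono (M := M) (g := fun _ => 0) (g' := fun z => f z (R + M.a))
      continuous_const (continuous_slice hc.cont _) hy
      fun z hz => by simpa using hf0 (y - z) (by linarith [hz.1])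
    rwa [depositMean_const, zero_mul] at h3
  have hexp : Real.exp (-(M.lam * y)) ≤ 1 := Real.exp_le_one_iff.2 (by nlinarith)
  have hRα := Real.rpow_nonneg hR M.α
  rw [h1, h2, lintegral_min_expMeasure hr hy, ← ENNReal.ofReal_mul M.κ_pos.le,
    ← ENNReal.ofReal_add (by positivity) (by positivity),
    ← ENNReal.ofReal_add ((hc.stoppingProfile hy).value_nonneg hR)
      (mul_nonneg M.κ_pos.le (div_nonneg (by linarith) hr.le)), stopValue]
  congr 1
  ring

end NormalizedModel

namespace IsPoissonProcess

variable {M : NormalizedModel} {f q : ℝ → ℝ → ℝ}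

/-- Value, per unit of discount, of an exploration episode with continuation value `f` and reserves
`S`. -/
noncomputable def _root_.NormalizedModel.episodeValue (M : NormalizedModel) (f : ℝ → ℝ → ℝ)
    (N : ℝ≥0 → Ω → ℕ) (x : ℝ≥0) (n : ℕ) (S : ℝ) (ω : Ω) : ℝ≥0∞ :=
  if n + 1 ≤ N x ω then ENNReal.ofReal (f (x - exploredArea N x (n + 1) ω) (S + M.a))
  else ENNReal.ofReal (S ^ M.α)

/-- The tower property for one episode: discount and reserves are known when it starts, so taking
expectations over its outcome replaces the next value by the value of exploring plus the expected
cost. -/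
theorem lintegral_episode [IsProbabilityMeasure P] (hN : IsPoissonProcess N M.lam.toNNReal P)
    (hc : M.IsContinuation f q) (x : ℝ≥0) (n : ℕ) {δ : Ω → ℝ≥0∞} {S : Ω → ℝ}
    (hδ : Measurable[hN.info x n] δ) (hS : Measurable[hN.info x n] S) (hS0 : ∀ ω, 0 ≤ S ω) :
    ∫⁻ ω in {ω | n ≤ N x ω}, δ ω * M.episodeValue f N x n (S ω) ω ∂P =
      (∫⁻ ω in {ω | n ≤ N x ω}, δ ω *
        ENNReal.ofReal (M.stopValue f (x - exploredArea N x n ω) (S ω)) ∂P) +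
      ENNReal.ofReal M.κ * ∫⁻ ω in {ω | n ≤ N x ω}, δ ω *
        ((exploredArea N x (n + 1) ω - exploredArea N x n ω : ℝ≥0) : ℝ≥0∞) ∂P := by
  have hlam : 0 < M.lam.toNNReal := Real.toNNReal_pos.2 M.lam_pos
  have hcoe : (M.lam.toNNReal : ℝ) = M.lam := Real.coe_toNNReal _ M.lam_pos.le
  have := isProbabilityMeasure_expMeasure M.lam_pos
  have hX := hN.measurable_exploredArea x n
  have hEm : MeasurableSet {ω | n ≤ N x ω} := hN.info_le x n _ (hN.measurableSet_info_le x n)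
  have hY : Measurable[hN.info x n] fun ω => (δ ω, (exploredArea N x n ω, S ω)) :=
    Measurable.prodMk hδ (Measurable.prodMk hX hS)
  let h1 : (ℝ≥0∞ × ℝ≥0 × ℝ) × ℝ → ℝ≥0∞ := fun p => p.1.1 *
    (if p.2 ≤ (x : ℝ) - p.1.2.1 then
      ENNReal.ofReal (f ((x : ℝ) - p.1.2.1 - p.2) (p.1.2.2 + M.a))
    else ENNReal.ofReal (p.1.2.2 ^ M.α))
  let h2 : (ℝ≥0∞ × ℝ≥0 × ℝ) × ℝ → ℝ≥0∞ := fun p => p.1.1 *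
    ENNReal.ofReal (min p.2 ((x : ℝ) - p.1.2.1))
  have hh1 : Measurable h1 := by
    refine (by fun_prop : Measurable fun p : (ℝ≥0∞ × ℝ≥0 × ℝ) × ℝ => p.1.1).mul
      (Measurable.ite ?_ ?_ ?_)
    · exact measurableSet_le (by fun_prop) (by fun_prop)
    · exact (hc.cont.measurable.comp (by fun_prop : Measurable fun p : (ℝ≥0∞ × ℝ≥0 × ℝ) × ℝ =>
        ((x : ℝ) - p.1.2.1 - p.2, p.1.2.2 + M.a))).ennreal_ofReal
    · fun_prop
  have hh2 : Measurable h2 := by fun_prop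
  have key1 := hN.lintegral_waitingArea hlam x n hY hh1
  have key2 := hN.lintegral_waitingArea hlam x n hY hh2
  rw [hcoe] at key1 key2
  have e1 : ∫⁻ ω in {ω | n ≤ N x ω}, δ ω * M.episodeValue f N x n (S ω) ω ∂P =
      ∫⁻ ω in {ω | n ≤ N x ω}, h1 ((δ ω, (exploredArea N x n ω, S ω)), waitingArea N x n ω) ∂P := by
    refine lintegral_congr_ae ((ae_restrict_iff' hEm).2 ?_)
    filter_upwards [hN.ae_depositLocation_lt_top hlam x n] with ω hω hn
    have h3 := hN.succ_le_count_iff hn (hω hn)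
    have h4 := hN.exploredArea_succ hn (hω hn)
    simp only [h1, NormalizedModel.episodeValue]
    congr 1
    by_cases hle : n + 1 ≤ N x ω
    · have h5 := h3.1 hle
      rw [if_pos hle, if_pos (by linarith), h4, min_eq_left h5, sub_sub]
    · have h5 := fun h => hle (h3.2 h)
      rw [if_neg hle, if_neg (fun h => h5 (by linarith))]
  have e2 : ∫⁻ ω in {ω | n ≤ N x ω}, δ ω *
        ((exploredArea N x (n + 1) ω - exploredArea N x n ω : ℝ≥0) : ℝ≥0∞) ∂P =
      ∫⁻ ω in {ω | n ≤ N x ω}, h2 ((δ ω, (exploredArea N x n ω, S ω)), waitingArea N x n ω) ∂P := by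
    refine lintegral_congr_ae ((ae_restrict_iff' hEm).2 ?_)
    filter_upwards [hN.ae_depositLocation_lt_top hlam x n] with ω hω hn
    have h4 := hN.exploredArea_succ hn (hω hn)
    simp only [h2]
    rw [← ENNReal.ofReal_coe_nnreal,
      NNReal.coe_sub (hN.exploredArea_mono x ω (Nat.le_succ n)), h4]
    congr 2
    rw [← min_sub_sub_right, add_sub_cancel_left]
  have hm : ∀ {h : (ℝ≥0∞ × ℝ≥0 × ℝ) × ℝ → ℝ≥0∞}, Measurable h →
      Measurable fun ω => ∫⁻ s, h ((δ ω, (exploredArea N x n ω, S ω)), s) ∂expMeasure M.lam :=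
    fun hh => hh.lintegral_prod_right'.comp (hY.mono (hN.info_le x n) le_rfl)
  rw [e1, e2, key1, key2, ← lintegral_const_mul _ (hm hh2),
    ← lintegral_add_right _ ((hm hh2).const_mul _)]
  refine lintegral_congr fun ω => ?_
  have hXx : (exploredArea N x n ω : ℝ) ≤ x := NNReal.coe_le_coe.2 (exploredArea_le x n ω)
  have hm1 : Measurable fun s => if s ≤ (x : ℝ) - exploredArea N x n ω then
      ENNReal.ofReal (f ((x : ℝ) - exploredArea N x n ω - s) (S ω + M.a))
      else ENNReal.ofReal (S ω ^ M.α) :=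
    Measurable.ite measurableSet_Iic (hc.cont.measurable.comp (by fun_prop :
      Measurable fun s : ℝ => ((x : ℝ) - exploredArea N x n ω - s, S ω + M.a))).ennreal_ofReal
      measurable_const
  simp only [h1, h2]
  rw [lintegral_const_mul _ hm1, lintegral_const_mul _ (by fun_prop),
    hc.lintegral_nextValue (by linarith) (hS0 ω), mul_add]
  ring

end IsPoissonProcess

end NextDeposit

/-! ## Consumption on a block of time -/

section TimeBlock

open Filter Topology

/-- The positive times `t` with `σ ≤ t < τ`. -/
def timeBlock (σ τ : ℝ≥0∞) : Set ℝ := {t | 0 < t ∧ σ ≤ ENNReal.ofReal t ∧ ENNReal.ofReal t < τ}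

/-- The exponential `e ^ (-ρ t)`, with value `0` at `t = ∞`. -/
noncomputable def decay (ρ : ℝ) (t : ℝ≥0∞) : ℝ := if t = ⊤ then 0 else Real.exp (-(ρ * t.toReal))

theorem decay_top (ρ : ℝ) : decay ρ ⊤ = 0 := if_pos rfl

theorem decay_zero (ρ : ℝ) : decay ρ 0 = 1 := by simp [decay]

theorem decay_of_ne_top {ρ : ℝ} {t : ℝ≥0∞} (h : t ≠ ⊤) : decay ρ t = Real.exp (-(ρ * t.toReal)) :=
  if_neg h

theorem decay_pos {ρ : ℝ} {t : ℝ≥0∞} (h : t ≠ ⊤) : 0 < decay ρ t := by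
  rw [decay_of_ne_top h]; exact Real.exp_pos _

theorem decay_nonneg (ρ : ℝ) (t : ℝ≥0∞) : 0 ≤ decay ρ t := by
  by_cases h : t = ⊤
  · rw [h, decay_top]
  · exact (decay_pos h).le

theorem decay_antitone {ρ : ℝ} (hρ : 0 ≤ ρ) : Antitone (decay ρ) := by
  intro s t hst
  by_cases h : t = ⊤
  · rw [h, decay_top]; exact decay_nonneg _ _
  · have hs : s ≠ ⊤ := ne_top_of_le_ne_top h hst
    rw [decay_of_ne_top h, decay_of_ne_top hs]
    have := mul_le_mul_of_nonneg_left (ENNReal.toReal_mono h hst) hρ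
    exact Real.exp_le_exp.2 (by linarith)

theorem decay_le_one {ρ : ℝ} (hρ : 0 ≤ ρ) (t : ℝ≥0∞) : decay ρ t ≤ 1 :=
  (decay_antitone hρ zero_le).trans_eq (decay_zero ρ)

theorem decay_mul {ρ b : ℝ} (hb : 0 < b) (t : ℝ≥0∞) : decay (ρ * b) t = decay ρ t ^ b := by
  by_cases h : t = ⊤
  · rw [h, decay_top, decay_top, Real.zero_rpow hb.ne']
  · rw [decay_of_ne_top h, decay_of_ne_top h, ← Real.exp_mul]
    congr 1
    ring

theorem measurable_decay (ρ : ℝ) : Measurable (decay ρ) :=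
  Measurable.ite (measurableSet_singleton _) measurable_const (by fun_prop)

theorem measurableSet_timeBlock (σ τ : ℝ≥0∞) : MeasurableSet (timeBlock σ τ) :=
  ((measurableSet_lt measurable_const measurable_id).inter
    ((measurableSet_le measurable_const ENNReal.measurable_ofReal).inter
      (measurableSet_lt ENNReal.measurable_ofReal measurable_const)))

theorem timeBlock_top (τ : ℝ≥0∞) : timeBlock ⊤ τ = ∅ := by
  ext t
  simp [timeBlock]

theorem timeBlock_self (σ : ℝ≥0∞) : timeBlock σ σ = ∅ := by
  ext t
  simp only [timeBlock, mem_ofPred_eq, mem_empty_iff_false, iff_false]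
  exact fun h => absurd h.2.1 (not_le.2 h.2.2)

theorem timeBlock_union {σ τ υ : ℝ≥0∞} (h : σ ≤ τ) (h' : τ ≤ υ) :
    timeBlock σ τ ∪ timeBlock τ υ = timeBlock σ υ := by
  ext t
  simp only [timeBlock, mem_union, mem_ofPred_eq]
  constructor
  · rintro (⟨h0, h1, h2⟩ | ⟨h0, h1, h2⟩)
    · exact ⟨h0, h1, h2.trans_le h'⟩
    · exact ⟨h0, h.trans h1, h2⟩
  · rintro ⟨h0, h1, h2⟩
    rcases lt_or_ge (ENNReal.ofReal t) τ with h3 | h3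
    · exact Or.inl ⟨h0, h1, h3⟩
    · exact Or.inr ⟨h0, h3, h2⟩

theorem disjoint_timeBlock (σ τ υ : ℝ≥0∞) : Disjoint (timeBlock σ τ) (timeBlock τ υ) :=
  Set.disjoint_left.2 fun _ h h' => absurd h'.2.1 (not_le.2 h.2.2)

theorem setLIntegral_timeBlock_add {σ τ υ : ℝ≥0∞} (h : σ ≤ τ) (h' : τ ≤ υ) (g : ℝ → ℝ≥0∞) :
    ∫⁻ t in timeBlock σ υ, g t =
      (∫⁻ t in timeBlock σ τ, g t) + ∫⁻ t in timeBlock τ υ, g t := by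
  rw [← timeBlock_union h h', lintegral_union (measurableSet_timeBlock _ _)
    (disjoint_timeBlock _ _ _)]

theorem timeBlock_zero_top : timeBlock 0 ⊤ = Ioi 0 := by
  ext t
  simp [timeBlock]

theorem setLIntegral_decay_from {ρ : ℝ} (hρ : 0 < ρ) (σ : ℝ≥0∞) :
    ∫⁻ t in timeBlock σ ⊤, ENNReal.ofReal (ρ * Real.exp (-(ρ * t))) = ENNReal.ofReal (decay ρ σ) := by
  by_cases h : σ = ⊤
  · rw [h, timeBlock_top, decay_top]; simp
  have hs : 0 ≤ σ.toReal := ENNReal.toReal_nonneg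
  rw [decay_of_ne_top h, ← expMeasure_Ioi hρ hs, ← lintegral_indicator_one measurableSet_Ioi,
    lintegral_expMeasure (measurable_one.indicator measurableSet_Ioi),
    ← lintegral_indicator (measurableSet_timeBlock _ _), ← lintegral_indicator measurableSet_Ioi]
  refine lintegral_congr_ae ?_
  filter_upwards [Measure.ae_ne volume σ.toReal] with t ht
  by_cases h1 : σ.toReal < t
  · have h2 : t ∈ timeBlock σ ⊤ := ⟨hs.trans_lt h1,
      (ENNReal.le_ofReal_iff_toReal_le h (hs.trans h1.le)).2 h1.le, ENNReal.ofReal_lt_top⟩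
    rw [indicator_of_mem h2, indicator_of_mem (mem_Ioi.2 (hs.trans_lt h1)),
      indicator_of_mem (mem_Ioi.2 h1)]
    simp
  · have h2 : t ∉ timeBlock σ ⊤ := fun h3 => ht (le_antisymm (not_lt.1 h1)
      ((ENNReal.le_ofReal_iff_toReal_le h h3.1.le).1 h3.2.1))
    rw [indicator_of_notMem h2, indicator_apply, indicator_of_notMem (by simpa using h1)]
    simp

theorem setLIntegral_decay {ρ : ℝ} (hρ : 0 < ρ) {σ τ : ℝ≥0∞} (h : σ ≤ τ) :
    ∫⁻ t in timeBlock σ τ, ENNReal.ofReal (ρ * Real.exp (-(ρ * t))) =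
      ENNReal.ofReal (decay ρ σ - decay ρ τ) := by
  have h1 := setLIntegral_timeBlock_add h le_top
    fun t => ENNReal.ofReal (ρ * Real.exp (-(ρ * t)))
  rw [setLIntegral_decay_from hρ, setLIntegral_decay_from hρ] at h1
  rw [ENNReal.ofReal_sub _ (decay_nonneg _ _), h1, ENNReal.add_sub_cancel_right
    ENNReal.ofReal_ne_top]

/-- Weighted arithmetic and geometric means of `c` and `Z * e / d`. In terms of utility it is the
tangent inequality at the consumption proportional to the decay factor `e`, with equality there. -/
theorem rpow_mul_rpow_le {α c e d Z : ℝ} (h0 : 0 < α) (h1 : α < 1) (hc : 0 ≤ c) (he : 0 ≤ e)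
    (hd : 0 < d) (hZ : 0 < Z) :
    e ^ (1 - α) * c ^ α ≤ (d / Z) ^ (1 - α) * (α * c + (1 - α) * (Z * e / d)) := by
  have h := Real.geom_mean_le_arith_mean2_weighted h0.le (by linarith : 0 ≤ 1 - α) hc
    (by positivity : 0 ≤ Z * e / d) (by ring)
  refine le_trans (le_of_eq ?_) (mul_le_mul_of_nonneg_left h (by positivity))
  have he' : e = d / Z * (Z * e / d) := by field_simp
  have h2 : e ^ (1 - α) = (d / Z) ^ (1 - α) * (Z * e / d) ^ (1 - α) := by
    conv_lhs => rw [he']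
    exact Real.mul_rpow (by positivity) (by positivity)
  rw [h2]
  ring

/-- A bound on total consumption up to every time before `τ` extends to the whole block. -/
theorem setLIntegral_timeBlock_le {g : ℝ → ℝ≥0∞} {τ K : ℝ≥0∞}
    (h : ∀ t : ℝ, 0 ≤ t → ENNReal.ofReal t < τ → ∫⁻ s in Ioc 0 t, g s ≤ K) :
    ∫⁻ s in timeBlock 0 τ, g s ≤ K := by
  -- Rational end points make the union countable, as needed for monotone convergence along a
  -- directed family; `τ` may be infinite.
  let ι := {u : ℚ // 0 ≤ u ∧ ENNReal.ofReal (u : ℝ) < τ}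
  let D : ι → Set ℝ := fun i => Ioc 0 ((i.1 : ℚ) : ℝ)
  have hd : Directed (· ⊆ ·) D := by
    intro i j
    rcases le_total i.1 j.1 with hij | hij
    · exact ⟨j, Ioc_subset_Ioc_right (by exact_mod_cast hij), subset_rfl⟩
    · exact ⟨i, subset_rfl, Ioc_subset_Ioc_right (by exact_mod_cast hij)⟩
  have hsub : timeBlock 0 τ ⊆ ⋃ i, D i := by
    rintro t ⟨ht0, -, htτ⟩
    have h1 : t < τ.toReal ∨ τ = ⊤ := by
      by_cases hτ : τ = ⊤
      · exact Or.inr hτ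
      · exact Or.inl ((ENNReal.ofReal_lt_iff_lt_toReal ht0.le hτ).1 htτ)
    obtain ⟨q, hq, hqτ⟩ : ∃ q : ℚ, t < q ∧ ENNReal.ofReal (q : ℝ) < τ := by
      rcases h1 with h1 | h1
      · obtain ⟨q, hq1, hq2⟩ := exists_rat_btwn h1
        refine ⟨q, hq1, ?_⟩
        have hτ : τ ≠ ⊤ := by
          rintro rfl
          simp only [ENNReal.toReal_top] at h1
          linarith
        exact (ENNReal.ofReal_lt_iff_lt_toReal (ht0.trans hq1).le hτ).2 hq2
      · obtain ⟨q, hq⟩ := exists_rat_gt t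
        exact ⟨q, hq, h1 ▸ ENNReal.ofReal_lt_top⟩
    have hq0 : (0 : ℝ) ≤ q := (ht0.trans hq).le
    exact mem_iUnion.2 ⟨⟨q, by exact_mod_cast hq0, hqτ⟩, ht0, hq.le⟩
  refine (lintegral_mono_set hsub).trans ?_
  rw [setLIntegral_iUnion_of_directed _ hd]
  exact iSup_le fun i => h _ (by exact_mod_cast i.2.1) i.2.2

end TimeBlock

/-! ### Hotelling's rule for the consumption of a known reserve. -/

section Hotelling

namespace ExplorationModel

variable (m : ExplorationModel)

/-- The rate at which a known reserve is depleted. -/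
noncomputable def depletionRate : ℝ := m.r / (1 - m.α)

/-- The Hotelling value of a unit reserve. -/
noncomputable def hotellingUnit : ℝ := ((1 - m.α) / m.r) ^ (1 - m.α) / m.α

theorem depletionRate_pos : 0 < m.depletionRate :=
  div_pos m.r_pos (by linarith [m.α_lt_one])

theorem hotellingUnit_pos : 0 < m.hotellingUnit :=
  div_pos (Real.rpow_pos_of_pos (div_pos (by linarith [m.α_lt_one]) m.r_pos) _) m.α_pos

theorem hotelling_eq (R : ℝ) : m.hotelling R = m.hotellingUnit * R ^ m.α := by
  rw [hotelling, hotellingUnit]; ring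

theorem hotellingUnit_eq :
    m.hotellingUnit = (1 / m.depletionRate) ^ (1 - m.α) / m.α := by
  rw [hotellingUnit, depletionRate, one_div_div]

theorem depletionRate_mul : m.depletionRate * (1 - m.α) = m.r :=
  div_mul_cancel₀ _ (by linarith [m.α_lt_one])

theorem discount_eq (t : ℝ≥0∞) :
    m.discount t = ENNReal.ofReal (decay m.depletionRate t ^ (1 - m.α)) := by
  rw [← decay_mul (by linarith [m.α_lt_one]), depletionRate_mul, discount]
  by_cases h : t = ⊤
  · rw [if_pos h, h, decay_top, ENNReal.ofReal_zero]
  · rw [if_neg h, decay_of_ne_top h, neg_mul]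

theorem discount_zero : m.discount 0 = 1 := by simp [discount]

theorem discount_le_one (t : ℝ≥0∞) : m.discount t ≤ 1 := by
  rw [discount_eq, ← ENNReal.ofReal_one]
  exact ENNReal.ofReal_le_ofReal (Real.rpow_le_one (decay_nonneg _ _)
    (decay_le_one m.depletionRate_pos.le _) (by linarith [m.α_lt_one]))

theorem measurable_discount : Measurable m.discount := by
  rw [show m.discount = fun t => ENNReal.ofReal (decay m.depletionRate t ^ (1 - m.α)) from
    funext m.discount_eq]
  exact ((measurable_decay _).pow_const _).ennreal_ofReal

theorem discounted_utility_eq (t c : ℝ) : Real.exp (-m.r * t) * m.utility c =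
    Real.exp (-(m.depletionRate * t)) ^ (1 - m.α) * c ^ m.α / m.α := by
  rw [← Real.exp_mul, ← m.depletionRate_mul, utility, mul_div_assoc]
  congr 2
  ring

/-- Discounted utility of the consumption `c` during a block of time. -/
noncomputable def blockUtility (c : ℝ → ℝ≥0) (σ τ : ℝ≥0∞) : ℝ≥0∞ :=
  ∫⁻ t in timeBlock σ τ, ENNReal.ofReal (Real.exp (-m.r * t) * m.utility (c t))

/-- Consuming `Z - z` during a block of time and keeping `z` is worth at most the Hotelling value
of `Z` at the beginning. -/
theorem blockUtility_add_le {c : ℝ → ℝ≥0} (hc : Measurable c) {σ τ : ℝ≥0∞} (hστ : σ ≤ τ) {Z z : ℝ}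
    (hz : 0 ≤ z) (hzZ : z ≤ Z)
    (h : ∫⁻ t in timeBlock σ τ, (c t : ℝ≥0∞) ≤ ENNReal.ofReal (Z - z)) :
    m.blockUtility c σ τ + m.discount τ * ENNReal.ofReal (m.hotellingUnit * z ^ m.α) ≤
      m.discount σ * ENNReal.ofReal (m.hotellingUnit * Z ^ m.α) := by
  have h0 := m.α_pos
  have h1 := m.α_lt_one
  have h1' : 0 < 1 - m.α := by linarith
  have hρ := m.depletionRate_pos
  have hB := m.hotellingUnit_pos
  have hZ0 : 0 ≤ Z := hz.trans hzZ
  by_cases hσ : σ = ⊤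
  · have hτ : τ = ⊤ := top_le_iff.1 (hσ ▸ hστ)
    rw [blockUtility, hσ, hτ, timeBlock_top]
    simp [discount]
  rcases hZ0.eq_or_lt with hZ | hZ
  · have hz0 : z = 0 := le_antisymm (hZ ▸ hzZ) hz
    rw [← hZ, hz0, sub_zero, ENNReal.ofReal_zero, nonpos_iff_eq_zero,
      lintegral_eq_zero_iff (by fun_prop)] at h
    rw [← hZ, hz0, Real.zero_rpow h0.ne', mul_zero, ENNReal.ofReal_zero, mul_zero, mul_zero,
      add_zero, nonpos_iff_eq_zero, blockUtility]
    refine (lintegral_congr_ae ?_).trans (lintegral_zero (μ := volume.restrict (timeBlock σ τ)))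
    filter_upwards [h] with t ht
    have : c t = 0 := by simpa using ht
    simp [this, utility, Real.zero_rpow h0.ne']
  set d := decay m.depletionRate σ with hd
  set d' := decay m.depletionRate τ with hd'
  have hd0 : 0 < d := decay_pos hσ
  have hd0' : 0 ≤ d' := decay_nonneg _ _
  have hdd : d' ≤ d := decay_antitone hρ.le hστ
  set ρ := m.depletionRate with hρdef
  -- The shadow price of the reserve: the discounted marginal utility along the optimal path `Z * ρ
  -- * exp (-(ρ t)) / d`, constant in time.
  set p := (d / (ρ * Z)) ^ (1 - m.α) with hp
  have hp0 : 0 ≤ p := by positivity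
  set w := (1 - m.α) / m.α with hw
  have hw0 : 0 ≤ w := by positivity
  have hpB : m.hotellingUnit * (d / Z) ^ (1 - m.α) * m.α = p := by
    rw [hotellingUnit_eq, hp, ← hρdef, show d / (ρ * Z) = 1 / ρ * (d / Z) by field_simp,
      Real.mul_rpow (by positivity) (by positivity)]
    field_simp
  have hA : m.blockUtility c σ τ ≤
      ENNReal.ofReal p * ENNReal.ofReal (Z - z) +
        ENNReal.ofReal (p * w * Z / d) * ENNReal.ofReal (d - d') := by
    -- The tangent inequality at the optimal path bounds discounted utility by the price of
    -- consumption plus a multiple of `exp (-(ρ t))`, so only total consumption enters after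
    -- integration.
    have hpt : ∀ t, ENNReal.ofReal (Real.exp (-m.r * t) * m.utility (c t)) ≤
        ENNReal.ofReal p * (c t : ℝ≥0∞) +
          ENNReal.ofReal (p * w * Z / d) * ENNReal.ofReal (ρ * Real.exp (-(ρ * t))) := by
      intro t
      rw [← ENNReal.ofReal_coe_nnreal, ← ENNReal.ofReal_mul hp0,
        ← ENNReal.ofReal_mul (by positivity), ← ENNReal.ofReal_add (by positivity) (by positivity)]
      refine ENNReal.ofReal_le_ofReal ?_
      have h2 := rpow_mul_rpow_le h0 h1 (c t).2 (Real.exp_pos (-(ρ * t))).le hd0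
        (mul_pos hρ hZ)
      rw [discounted_utility_eq, div_le_iff₀ h0]
      refine h2.trans (le_of_eq ?_)
      rw [hw]
      simp only [NNReal.val_eq_coe, ← hp]
      field_simp
    rw [blockUtility]
    refine (lintegral_mono hpt).trans ?_
    rw [lintegral_add_right _ (by fun_prop), lintegral_const_mul _ (by fun_prop),
      lintegral_const_mul _ (by fun_prop), setLIntegral_decay hρ hστ]
    gcongr
  -- The same tangent inequality for the reserve that is left, at the same price; the two bounds add
  -- up to `p * Z / α` exactly.
  have hT : m.discount τ * ENNReal.ofReal (m.hotellingUnit * z ^ m.α) ≤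
      ENNReal.ofReal (p * (z + w * (Z * d' / d))) := by
    rw [discount_eq, ← ENNReal.ofReal_mul (by positivity)]
    refine ENNReal.ofReal_le_ofReal ?_
    have h2 := mul_le_mul_of_nonneg_left (rpow_mul_rpow_le h0 h1 hz hd0' hd0 hZ) hB.le
    calc d' ^ (1 - m.α) * (m.hotellingUnit * z ^ m.α) =
        m.hotellingUnit * (d' ^ (1 - m.α) * z ^ m.α) := by ring
      _ ≤ _ := h2
      _ = (m.hotellingUnit * (d / Z) ^ (1 - m.α) * m.α) * (z + w * (Z * d' / d)) := by
        rw [hw]; field_simp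
      _ = _ := by rw [hpB]
  refine (add_le_add hA hT).trans ?_
  rw [discount_eq, ← ENNReal.ofReal_mul hp0, ← ENNReal.ofReal_mul (by positivity),
    ← ENNReal.ofReal_add (mul_nonneg hp0 (by linarith))
      (mul_nonneg (by positivity) (by linarith)), ← ENNReal.ofReal_add
      (add_nonneg (mul_nonneg hp0 (by linarith)) (mul_nonneg (by positivity) (by linarith)))
      (by positivity), ← ENNReal.ofReal_mul (by positivity)]
  refine ENNReal.ofReal_le_ofReal (le_of_eq ?_)
  have e1 : p * (Z - z) + p * w * Z / d * (d - d') + p * (z + w * (Z * d' / d)) =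
      p * Z / m.α := by
    rw [hw]; field_simp; ring
  rw [e1, ← hpB, Real.div_rpow hd0.le hZ.le, Real.rpow_sub hZ, Real.rpow_one]
  have := (Real.rpow_pos_of_pos hZ m.α).ne'
  rw [← hd]
  field_simp

/-- The optimal consumption rate of a reserve `Z` known at time `σ`. -/
noncomputable def depletion (Z : ℝ) (σ : ℝ≥0∞) (t : ℝ) : ℝ≥0 :=
  (Z * (m.depletionRate * Real.exp (-(m.depletionRate * t))) / decay m.depletionRate σ).toNNReal

theorem measurable_depletion :
    Measurable fun p : (ℝ × ℝ≥0∞) × ℝ => m.depletion p.1.1 p.1.2 p.2 := by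
  unfold depletion
  have := (measurable_decay m.depletionRate).comp
    (by fun_prop : Measurable fun p : (ℝ × ℝ≥0∞) × ℝ => p.1.2)
  exact ((by fun_prop : Measurable fun p : (ℝ × ℝ≥0∞) × ℝ =>
    p.1.1 * (m.depletionRate * Real.exp (-(m.depletionRate * p.2)))).div this).real_toNNReal

variable {m} in
theorem coe_depletion {Z : ℝ} (hZ : 0 ≤ Z) (σ : ℝ≥0∞) (t : ℝ) : (m.depletion Z σ t : ℝ) =
    Z / decay m.depletionRate σ * (m.depletionRate * Real.exp (-(m.depletionRate * t))) := by
  have hρ := m.depletionRate_pos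
  have := decay_nonneg m.depletionRate σ
  rw [depletion, Real.coe_toNNReal _ (by positivity)]
  ring

theorem setLIntegral_depletion_le {Z z : ℝ} {σ τ : ℝ≥0∞} (hστ : σ ≤ τ) (hZ : 0 ≤ Z) (hzZ : z ≤ Z)
    (hz : z * decay m.depletionRate σ ≤ Z * decay m.depletionRate τ) :
    ∫⁻ t in timeBlock σ τ, (m.depletion Z σ t : ℝ≥0∞) ≤ ENNReal.ofReal (Z - z) := by
  have hρ := m.depletionRate_pos
  have hd := decay_nonneg m.depletionRate σ
  have hdd := decay_antitone hρ.le hστ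
  have hpt : ∀ t, (m.depletion Z σ t : ℝ≥0∞) = ENNReal.ofReal (Z / decay m.depletionRate σ) *
      ENNReal.ofReal (m.depletionRate * Real.exp (-(m.depletionRate * t))) := fun t => by
    rw [← ENNReal.ofReal_coe_nnreal, coe_depletion hZ, ENNReal.ofReal_mul (by positivity)]
  simp_rw [hpt]
  rw [lintegral_const_mul _ (by fun_prop), setLIntegral_decay hρ hστ,
    ← ENNReal.ofReal_mul (by positivity)]
  refine ENNReal.ofReal_le_ofReal ?_
  rcases hd.eq_or_lt with h | h
  · rw [← h]; simp [hzZ]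
  · rw [div_mul_eq_mul_div, div_le_iff₀ h]
    nlinarith

theorem blockUtility_depletion {Z z : ℝ} {σ τ : ℝ≥0∞} (hστ : σ ≤ τ) (hZ : 0 ≤ Z)
    (hz : σ ≠ ⊤ → z = Z * decay m.depletionRate τ / decay m.depletionRate σ) :
    m.blockUtility (m.depletion Z σ) σ τ +
        m.discount τ * ENNReal.ofReal (m.hotellingUnit * z ^ m.α) =
      m.discount σ * ENNReal.ofReal (m.hotellingUnit * Z ^ m.α) := by
  have h0 := m.α_pos
  have h1 := m.α_lt_one
  have h1' : 0 < 1 - m.α := by linarith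
  have hρ := m.depletionRate_pos
  have hB := m.hotellingUnit_pos
  by_cases hσ : σ = ⊤
  · have hτ : τ = ⊤ := top_le_iff.1 (hσ ▸ hστ)
    rw [blockUtility, hσ, hτ, timeBlock_top]
    simp [discount]
  rw [hz hσ]
  set d := decay m.depletionRate σ with hd
  set d' := decay m.depletionRate τ with hd'
  have hd0 : 0 < d := decay_pos hσ
  have hd0' : 0 ≤ d' := decay_nonneg _ _
  have hdd : d' ≤ d := decay_antitone hρ.le hστ
  have hpt : ∀ t, ENNReal.ofReal (Real.exp (-m.r * t) * m.utility (m.depletion Z σ t)) =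
      ENNReal.ofReal (m.hotellingUnit * (Z / d) ^ m.α) *
        ENNReal.ofReal (m.depletionRate * Real.exp (-(m.depletionRate * t))) := by
    intro t
    rw [← ENNReal.ofReal_mul (by positivity), discounted_utility_eq, coe_depletion hZ,
      ← hd, hotellingUnit_eq]
    congr 1
    rw [Real.mul_rpow (by positivity) (by positivity), Real.mul_rpow hρ.le (by positivity),
      one_div, Real.inv_rpow hρ.le, Real.rpow_sub hρ, Real.rpow_sub (Real.exp_pos _),
      Real.rpow_one, Real.rpow_one]
    have h2 := (Real.rpow_pos_of_pos hρ m.α).ne'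
    have h3 := (Real.rpow_pos_of_pos (Real.exp_pos (-(m.depletionRate * t))) m.α).ne'
    field_simp
  rw [blockUtility]
  simp_rw [hpt]
  rw [lintegral_const_mul _ (by fun_prop), setLIntegral_decay hρ hστ, discount_eq, discount_eq,
    ← hd, ← hd', ← ENNReal.ofReal_mul (by positivity), ← ENNReal.ofReal_mul (by positivity),
    ← ENNReal.ofReal_mul (by positivity), ← ENNReal.ofReal_add
      (mul_nonneg (by positivity) (by linarith)) (by positivity)]
  congr 1
  have e1 : d' ^ (1 - m.α) * (m.hotellingUnit * (Z * d' / d) ^ m.α) =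
      m.hotellingUnit * (Z / d) ^ m.α * d' := by
    rw [mul_div_right_comm, Real.mul_rpow (by positivity) hd0']
    have : d' ^ (1 - m.α) * d' ^ m.α = d' := by
      rcases hd0'.eq_or_lt with h | h
      · rw [← h, Real.zero_rpow h0.ne', mul_zero]
      · rw [← Real.rpow_add h, sub_add_cancel, Real.rpow_one]
    linear_combination m.hotellingUnit * (Z / d) ^ m.α * this
  have e2 : d ^ (1 - m.α) * (m.hotellingUnit * Z ^ m.α) =
      m.hotellingUnit * (Z / d) ^ m.α * d := by
    rw [Real.div_rpow hZ hd0.le, Real.rpow_sub hd0, Real.rpow_one]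
    have := (Real.rpow_pos_of_pos hd0 m.α).ne'
    field_simp
  rw [e1, e2]
  ring

end ExplorationModel

end Hotelling

/-! ## Decomposition of a strategy into blocks -/

section StrategyBlocks

variable {Ω : Type*} {N : ℝ≥0 → Ω → ℕ} {x : ℝ≥0} {θ : ℕ → Ω → ℝ≥0∞} {c : ℕ → Ω → ℝ → ℝ≥0} {ω : Ω}

/-- The time at which the `n`-th consumption block starts. -/
def blockStart (θ : ℕ → Ω → ℝ≥0∞) : ℕ → Ω → ℝ≥0∞
  | 0 => fun _ => 0
  | n + 1 => θ n

theorem consumptionRate_of_mem_timeBlock (hθ : Monotone fun n => θ n ω) {n : ℕ} (hn : n ≤ N x ω)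
    {t : ℝ} (ht : t ∈ timeBlock (blockStart θ n ω) (θ n ω)) :
    consumptionRate N x θ c ω t = c n ω t := by
  have hlast : ¬θ (N x ω) ω ≤ ENNReal.ofReal t := not_le.2 (ht.2.2.trans_le (hθ hn))
  rw [consumptionRate, if_neg hlast, add_zero]
  cases n with
  | zero =>
    rw [if_pos ht.2.2, Finset.sum_eq_zero, add_zero]
    exact fun i _ => if_neg fun h => absurd (ht.2.2.trans_le (hθ (Nat.zero_le i))) (not_lt.2 h.1)
  | succ n =>
    have h1 : θ n ω ≤ ENNReal.ofReal t := ht.2.1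
    rw [if_neg (not_lt.2 ((hθ (Nat.zero_le n)).trans h1)), zero_add,
      Finset.sum_eq_single_of_mem n (Finset.mem_range.2 hn) ?_, if_pos ⟨h1, ht.2.2⟩]
    intro i _ hi
    refine if_neg fun h => ?_
    rcases lt_or_gt_of_ne hi with hi | hi
    · exact absurd (h.2.trans_le (hθ (Nat.succ_le_of_lt hi))) (not_lt.2 h1)
    · exact absurd (ht.2.2.trans_le (hθ (Nat.succ_le_of_lt hi))) (not_lt.2 h.1)

theorem consumptionRate_of_mem_last (hθ : Monotone fun n => θ n ω) {t : ℝ}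
    (ht : t ∈ timeBlock (θ (N x ω) ω) ⊤) :
    consumptionRate N x θ c ω t = c (N x ω + 1) ω t := by
  have h1 : θ (N x ω) ω ≤ ENNReal.ofReal t := ht.2.1
  rw [consumptionRate, if_pos h1, if_neg (not_lt.2 ((hθ (Nat.zero_le _)).trans h1)),
    Finset.sum_eq_zero, add_zero, zero_add]
  intro i hi
  exact if_neg fun h => absurd (h.2.trans_le (hθ (Nat.succ_le_of_lt (Finset.mem_range.1 hi))))
    (not_lt.2 h1)

/-- An integral over the time before `θ_n` is the sum of the integrals over the blocks. -/
theorem setLIntegral_consumptionRate_eq_sum (hθ : Monotone fun n => θ n ω)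
    (ψ : ℝ → ℝ≥0 → ℝ≥0∞) {n : ℕ} (hn : n ≤ N x ω) :
    ∫⁻ t in timeBlock 0 (θ n ω), ψ t (consumptionRate N x θ c ω t) =
      ∑ j ∈ Finset.range (n + 1),
        ∫⁻ t in timeBlock (blockStart θ j ω) (θ j ω), ψ t (c j ω t) := by
  have hblock : ∀ j ≤ N x ω,
      ∫⁻ t in timeBlock (blockStart θ j ω) (θ j ω), ψ t (consumptionRate N x θ c ω t) =
        ∫⁻ t in timeBlock (blockStart θ j ω) (θ j ω), ψ t (c j ω t) := fun j hj =>
    setLIntegral_congr_fun (measurableSet_timeBlock _ _) fun t ht => by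
      rw [consumptionRate_of_mem_timeBlock hθ hj ht]
  induction n with
  | zero =>
    rw [zero_add, Finset.sum_range_one, ← hblock 0 hn]
    rfl
  | succ n ih =>
    rw [Finset.sum_range_succ, ← ih (by omega), ← hblock (n + 1) hn]
    exact setLIntegral_timeBlock_add zero_le (hθ (Nat.le_succ n)) _

theorem setLIntegral_consumptionRate_Ioi (hθ : Monotone fun n => θ n ω) (ψ : ℝ → ℝ≥0 → ℝ≥0∞) :
    ∫⁻ t in Ioi 0, ψ t (consumptionRate N x θ c ω t) =
      (∑ j ∈ Finset.range (N x ω + 1),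
        ∫⁻ t in timeBlock (blockStart θ j ω) (θ j ω), ψ t (c j ω t)) +
      ∫⁻ t in timeBlock (θ (N x ω) ω) ⊤, ψ t (c (N x ω + 1) ω t) := by
  rw [← setLIntegral_consumptionRate_eq_sum hθ ψ le_rfl, ← timeBlock_zero_top,
    setLIntegral_timeBlock_add (zero_le : (0 : ℝ≥0∞) ≤ θ (N x ω) ω) le_top]
  congr 1
  exact setLIntegral_congr_fun (measurableSet_timeBlock _ _) fun t ht => by
      rw [consumptionRate_of_mem_last hθ ht]

/-- The budget constraint in terms of the blocks. -/
theorem budget_iff {R A : ℝ≥0∞} (hθ : Monotone fun n => θ n ω) :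
    (∀ t : ℝ, 0 ≤ t → ∫⁻ s in Ioc 0 t, (consumptionRate N x θ c ω s : ℝ≥0∞) ≤
      R + A * ∑ n ∈ Finset.range (N x ω), if θ n ω ≤ ENNReal.ofReal t then 1 else 0) ↔
    (∀ n ≤ N x ω, ∑ j ∈ Finset.range (n + 1),
        ∫⁻ t in timeBlock (blockStart θ j ω) (θ j ω), (c j ω t : ℝ≥0∞) ≤ R + A * n) ∧
      (∑ j ∈ Finset.range (N x ω + 1),
        ∫⁻ t in timeBlock (blockStart θ j ω) (θ j ω), (c j ω t : ℝ≥0∞)) +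
      ∫⁻ t in timeBlock (θ (N x ω) ω) ⊤, (c (N x ω + 1) ω t : ℝ≥0∞) ≤ R + A * N x ω := by
  rw [← setLIntegral_consumptionRate_Ioi hθ fun _ c => (c : ℝ≥0∞)]
  constructor
  · intro h
    constructor
    · intro n hn
      rw [← setLIntegral_consumptionRate_eq_sum hθ (fun _ c => (c : ℝ≥0∞)) hn]
      refine setLIntegral_timeBlock_le fun t ht htn => (h t ht).trans ?_
      gcongr
      rw [Finset.sum_boole]
      -- Before `θ_n` at most the first `n` deposits have been found; letting `t` increase to `θ_n`
      -- yields the constraint on whole blocks.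
      have hsub : (Finset.range (N x ω)).filter (fun i => θ i ω ≤ ENNReal.ofReal t) ⊆
          Finset.range n := by
        intro i hi
        rw [Finset.mem_filter] at hi
        by_contra hcon
        exact absurd (hi.2.trans_lt htn) (not_lt.2 (hθ (by simpa using hcon)))
      have := Finset.card_le_card hsub
      rw [Finset.card_range] at this
      exact_mod_cast this
    · rw [← timeBlock_zero_top]
      refine setLIntegral_timeBlock_le fun t ht _ => (h t ht).trans ?_
      gcongr
      rw [Finset.sum_boole]
      have := Finset.card_filter_le (Finset.range (N x ω)) fun i => θ i ω ≤ ENNReal.ofReal t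
      rw [Finset.card_range] at this
      exact_mod_cast this
  · rintro ⟨h1, h2⟩ t ht
    -- If some deposit is still to be found at `t`, the first such index `i` is also the number of
    -- deposits found so far, and `t` lies before the end of block `i`. Otherwise all deposits are
    -- available and the total bound applies.
    by_cases hex : ∃ i, i < N x ω ∧ ENNReal.ofReal t < θ i ω
    · classical
      obtain ⟨hlt, hti⟩ := Nat.find_spec hex
      set i := Nat.find hex with hi
      have hb : ∀ j < i, θ j ω ≤ ENNReal.ofReal t := by
        intro j hj
        have := Nat.find_min hex hj
        by_contra hcon
        exact this ⟨hj.trans hlt, not_le.1 hcon⟩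
      have h3 := h1 i hlt.le
      rw [← setLIntegral_consumptionRate_eq_sum hθ (fun _ c => (c : ℝ≥0∞)) hlt.le] at h3
      refine (lintegral_mono_set ?_).trans (h3.trans ?_)
      · intro s hs
        exact ⟨hs.1, zero_le, (ENNReal.ofReal_le_ofReal hs.2).trans_lt hti⟩
      · gcongr
        rw [Finset.sum_boole]
        have hsub : Finset.range i ⊆
            (Finset.range (N x ω)).filter (fun i => θ i ω ≤ ENNReal.ofReal t) := by
          intro j hj
          rw [Finset.mem_range] at hj
          rw [Finset.mem_filter, Finset.mem_range]
          exact ⟨hj.trans hlt, hb j hj⟩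
        have := Finset.card_le_card hsub
        rw [Finset.card_range] at this
        exact_mod_cast this
    · push Not at hex
      refine (lintegral_mono_set Ioc_subset_Ioi_self).trans (h2.trans ?_)
      gcongr
      rw [Finset.sum_congr rfl fun i hi => if_pos (hex i (Finset.mem_range.1 hi))]
      simp

end StrategyBlocks

/-! ## Verification -/

section Verification

open Filter Topology

variable {Ω : Type*} [MeasurableSpace Ω] {N : ℝ≥0 → Ω → ℕ} {P : Measure Ω}

theorem lintegral_coe_poissonMeasure_ne_top (μ : ℝ≥0) :
    ∫⁻ n : ℕ, (n : ℝ≥0∞) ∂poissonMeasure μ ≠ ⊤ := by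
  have hi : Integrable (fun n : ℕ => (n : ℝ)) (poissonMeasure μ) := by
    rw [integrable_poissonMeasure_iff]
    refine Summable.of_nonneg_of_le (fun n => by positivity) (fun n => ?_)
      ((Real.summable_pow_div_factorial (2 * μ)).mul_left (Real.exp (-μ)))
    -- This crude bound compares the series for the mean with the exponential series at `2 * μ`.
    have h2 : (n : ℝ) ≤ 2 ^ n := by exact_mod_cast n.lt_two_pow_self.le
    rw [Real.norm_natCast, mul_pow, mul_div_assoc, mul_assoc]
    refine mul_le_mul_of_nonneg_left ?_ (Real.exp_pos _).le
    have h3 : (0 : ℝ) ≤ (μ : ℝ) ^ n / n.factorial := by positivity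
    calc (μ : ℝ) ^ n / n.factorial * n ≤ (μ : ℝ) ^ n / n.factorial * 2 ^ n := by gcongr
      _ = _ := by ring
  have h := hi.2.ne
  refine ne_of_eq_of_ne (lintegral_congr fun n => ?_) h
  rw [Real.enorm_natCast]

theorem IsPoissonProcess.lintegral_count_ne_top {lam : ℝ≥0} (hN : IsPoissonProcess N lam P)
    (x : ℝ≥0) : ∫⁻ ω, (N x ω : ℝ≥0∞) ∂P ≠ ⊤ := by
  have h := hN.law 0 x zero_le
  simp only [hN.zero, tsub_zero] at h
  have h2 := lintegral_map (μ := P) (f := fun n : ℕ => (n : ℝ≥0∞)) (by fun_prop) (hN.measurable x)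
  rw [← h2, h]
  exact lintegral_coe_poissonMeasure_ne_top _

namespace NormalizedModel

variable {M : NormalizedModel} {f q : ℝ → ℝ → ℝ}

/-- Payoff when, after `n` episodes, one explores once more with the continuation value `f`. -/
noncomputable def exploringPayoff (M : NormalizedModel) (f : ℝ → ℝ → ℝ) (N : ℝ≥0 → Ω → ℕ) (x : ℝ≥0)
    (U δ : ℕ → Ω → ℝ≥0∞) (S : ℕ → Ω → ℝ) (T : Ω → ℝ≥0∞) (n : ℕ) (ω : Ω) : ℝ≥0∞ :=
  if n ≤ N x ω then
    U n ω + δ n ω * ENNReal.ofReal (M.stopValue f (x - exploredArea N x n ω) (S n ω))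
  else T ω

/-- The same payoff, gross of the exploration cost, once the outcome of the episode is known. -/
noncomputable def exploredPayoff (M : NormalizedModel) (f : ℝ → ℝ → ℝ) (N : ℝ≥0 → Ω → ℕ) (x : ℝ≥0)
    (U δ : ℕ → Ω → ℝ≥0∞) (S : ℕ → Ω → ℝ) (T : Ω → ℝ≥0∞) (n : ℕ) (ω : Ω) : ℝ≥0∞ :=
  if n ≤ N x ω then U n ω + δ n ω * M.episodeValue f N x n (S n ω) ω else T ω

/-- Expected cost of the episode after the first `n`, in units of `κ`. -/
noncomputable def episodeCost (N : ℝ≥0 → Ω → ℕ) (P : Measure Ω) (x : ℝ≥0) (δ : ℕ → Ω → ℝ≥0∞)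
    (n : ℕ) : ℝ≥0∞ :=
  ∫⁻ ω in {ω | n ≤ N x ω}, δ n ω *
    ((exploredArea N x (n + 1) ω - exploredArea N x n ω : ℝ≥0) : ℝ≥0∞) ∂P

variable {x : ℝ≥0} {U δ : ℕ → Ω → ℝ≥0∞} {S : ℕ → Ω → ℝ} {T : Ω → ℝ≥0∞}
  [IsProbabilityMeasure P] (hN : IsPoissonProcess N M.lam.toNNReal P) (hc : M.IsContinuation f q)
  (hU : ∀ n, Measurable[hN.info x n] (U n)) (hδ : ∀ n, Measurable[hN.info x n] (δ n))
  (hS : ∀ n, Measurable[hN.info x n] (S n)) (hS0 : ∀ n ω, 0 ≤ S n ω)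
include hc hU hδ hS hS0

/-- The martingale step: before and after the outcome of an episode is known, the expected payoffs
differ by its expected cost. Paths whose exploration has already ended contribute the same terminal
payoff `T` to both. -/
theorem lintegral_exploredPayoff (n : ℕ) :
    ∫⁻ ω, M.exploredPayoff f N x U δ S T n ω ∂P =
      (∫⁻ ω, M.exploringPayoff f N x U δ S T n ω ∂P) +
        ENNReal.ofReal M.κ * episodeCost N P x δ n := by
  have hE : MeasurableSet {ω | n ≤ N x ω} := hN.info_le x n _ (hN.measurableSet_info_le x n)
  have hUm := (hU n).mono (hN.info_le x n) le_rfl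
  have h1 : ∀ (V : Ω → ℝ≥0∞), ∫⁻ ω, (if n ≤ N x ω then U n ω + δ n ω * V ω else T ω) ∂P =
      ((∫⁻ ω in {ω | n ≤ N x ω}, U n ω ∂P) + ∫⁻ ω in {ω | n ≤ N x ω}, δ n ω * V ω ∂P) +
        ∫⁻ ω in {ω | n ≤ N x ω}ᶜ, T ω ∂P := by
    intro V
    rw [← lintegral_add_compl _ hE, ← lintegral_add_left hUm]
    congr 1
    · exact setLIntegral_congr_fun hE fun ω hω => if_pos hω
    · exact setLIntegral_congr_fun hE.compl fun ω hω => if_neg hω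
  unfold exploredPayoff exploringPayoff
  rw [h1, h1, hN.lintegral_episode hc x n (hδ n) (hS n) (hS0 n), episodeCost]
  ring

theorem lintegral_exploringPayoff_le
    (hstep : ∀ n, ∀ᵐ ω ∂P, M.exploringPayoff f N x U δ S T (n + 1) ω ≤
      M.exploredPayoff f N x U δ S T n ω) (n : ℕ) :
    ∫⁻ ω, M.exploringPayoff f N x U δ S T n ω ∂P ≤
      (∫⁻ ω, M.exploringPayoff f N x U δ S T 0 ω ∂P) +
        ENNReal.ofReal M.κ * ∑ i ∈ Finset.range n, episodeCost N P x δ i := by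
  induction n with
  | zero => simp
  | succ n ih =>
    refine (lintegral_mono_ae (hstep n)).trans ?_
    rw [lintegral_exploredPayoff hN hc hU hδ hS hS0, Finset.sum_range_succ, mul_add, ← add_assoc]
    gcongr

theorem le_lintegral_exploringPayoff
    (hstep : ∀ n, ∀ᵐ ω ∂P, M.exploredPayoff f N x U δ S T n ω ≤
      M.exploringPayoff f N x U δ S T (n + 1) ω) (n : ℕ) :
    (∫⁻ ω, M.exploringPayoff f N x U δ S T 0 ω ∂P) +
        ENNReal.ofReal M.κ * ∑ i ∈ Finset.range n, episodeCost N P x δ i ≤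
      ∫⁻ ω, M.exploringPayoff f N x U δ S T n ω ∂P := by
  induction n with
  | zero => simp
  | succ n ih =>
    refine le_trans ?_ (lintegral_mono_ae (hstep n))
    rw [lintegral_exploredPayoff hN hc hU hδ hS hS0, Finset.sum_range_succ, mul_add, ← add_assoc]
    gcongr

/-- A strategy which never beats the continuation value is worth at most that value. -/
theorem lintegral_le_of_exploringPayoff_le
    (hstep : ∀ n, ∀ᵐ ω ∂P, M.exploringPayoff f N x U δ S T (n + 1) ω ≤
      M.exploredPayoff f N x U δ S T n ω) :
    ∫⁻ ω, T ω ∂P ≤ (∫⁻ ω, M.exploringPayoff f N x U δ S T 0 ω ∂P) +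
        ENNReal.ofReal M.κ * ∑' i, episodeCost N P x δ i := by
  -- There are finitely many deposits on each path, so the sets where exploration has ended by `n`
  -- exhaust the space, and on them the payoff already is the terminal one.
  have hun : ⋃ n : ℕ, {ω | N x ω < n} = univ := by
    refine eq_univ_of_forall fun ω => mem_iUnion.2 ⟨N x ω + 1, Nat.lt_succ_self _⟩
  have hdir : Directed (· ⊆ ·) fun n : ℕ => {ω | N x ω < n} :=
    Monotone.directed_le fun i j hij ω hω => lt_of_lt_of_le hω hij
  rw [← setLIntegral_univ, ← hun, setLIntegral_iUnion_of_directed _ hdir]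
  refine iSup_le fun n => ?_
  have hE : MeasurableSet {ω | N x ω < n} := hN.measurable x measurableSet_Iio
  calc ∫⁻ ω in {ω | N x ω < n}, T ω ∂P =
      ∫⁻ ω in {ω | N x ω < n}, M.exploringPayoff f N x U δ S T n ω ∂P :=
        setLIntegral_congr_fun hE fun ω hω => (if_neg (not_le.2 hω)).symm
    _ ≤ ∫⁻ ω, M.exploringPayoff f N x U δ S T n ω ∂P := setLIntegral_le_lintegral _ _
    _ ≤ _ := lintegral_exploringPayoff_le hN hc hU hδ hS hS0 hstep n
    _ ≤ _ := by
      gcongr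
      exact ENNReal.sum_le_tsum _

/-- A strategy which always attains the continuation value is worth at least that value. -/
theorem le_lintegral_of_exploredPayoff_le
    (hstep : ∀ n, ∀ᵐ ω ∂P, M.exploredPayoff f N x U δ S T n ω ≤
      M.exploringPayoff f N x U δ S T (n + 1) ω)
    {C K : ℝ≥0∞} (hC : C ≠ ⊤) (hK : K ≠ ⊤)
    (hbound : ∀ n ω, n ≤ N x ω → M.exploringPayoff f N x U δ S T n ω ≤ C + K * n) :
    (∫⁻ ω, M.exploringPayoff f N x U δ S T 0 ω ∂P) +
        ENNReal.ofReal M.κ * ∑' i, episodeCost N P x δ i ≤ ∫⁻ ω, T ω ∂P := by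
  -- An integrable majorant, linear in the number of deposits, which makes the contribution of the
  -- paths still exploring after `n` episodes vanish in the limit.
  have hfin : ∫⁻ ω, C + K * N x ω ∂P ≠ ⊤ := by
    have hm : Measurable fun ω => (N x ω : ℝ≥0∞) := measurable_from_top.comp (hN.measurable x)
    rw [lintegral_add_left measurable_const, lintegral_const, measure_univ, mul_one,
      lintegral_const_mul _ hm]
    exact ENNReal.add_ne_top.2 ⟨hC, ENNReal.mul_ne_top hK (hN.lintegral_count_ne_top x)⟩
  have hE : ∀ n : ℕ, MeasurableSet {ω | n ≤ N x ω} := fun n =>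
    hN.measurable x measurableSet_Ici
  have hP : Tendsto (P ∘ fun n : ℕ => {ω | n ≤ N x ω}) atTop (𝓝 0) := by
    have h := tendsto_measure_iInter_atTop (μ := P) (s := fun n : ℕ => {ω | n ≤ N x ω})
      (fun n => (hE n).nullMeasurableSet) (fun i j hij ω hω => le_trans hij hω)
      ⟨0, measure_ne_top _ _⟩
    have hem : ⋂ n : ℕ, {ω | n ≤ N x ω} = ∅ := by
      refine eq_empty_of_forall_notMem fun ω hω => ?_
      have := mem_iInter.1 hω (N x ω + 1)
      simp only [mem_ofPred_eq] at this
      omega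
    rwa [hem, measure_empty] at h
  have htail := tendsto_setLIntegral_zero hfin hP
  have hle : ∀ n, (∫⁻ ω, M.exploringPayoff f N x U δ S T 0 ω ∂P) +
        ENNReal.ofReal M.κ * ∑ i ∈ Finset.range n, episodeCost N P x δ i ≤
      (∫⁻ ω, T ω ∂P) + ∫⁻ ω in {ω | n ≤ N x ω}, C + K * N x ω ∂P := by
    intro n
    refine (le_lintegral_exploringPayoff hN hc hU hδ hS hS0 hstep n).trans ?_
    rw [← lintegral_add_compl _ (hE n), add_comm]
    refine add_le_add ?_ (setLIntegral_mono' (hE n) fun ω hω => (hbound n ω hω).trans ?_)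
    · refine le_trans (le_of_eq ?_) (setLIntegral_le_lintegral {ω | n ≤ N x ω}ᶜ T)
      exact setLIntegral_congr_fun (hE n).compl fun ω hω => if_neg hω
    · gcongr
      exact hω
  have h1 : Tendsto (fun n => (∫⁻ ω, M.exploringPayoff f N x U δ S T 0 ω ∂P) +
        ENNReal.ofReal M.κ * ∑ i ∈ Finset.range n, episodeCost N P x δ i) atTop
      (𝓝 ((∫⁻ ω, M.exploringPayoff f N x U δ S T 0 ω ∂P) +
        ENNReal.ofReal M.κ * ∑' i, episodeCost N P x δ i)) :=
    tendsto_const_nhds.add (ENNReal.Tendsto.const_mul ENNReal.summable.hasSum.tendsto_sum_nat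
      (Or.inr ENNReal.ofReal_ne_top))
  have h2 := le_of_tendsto_of_tendsto' h1 (tendsto_const_nhds.add htail) hle
  rwa [add_zero] at h2

end NormalizedModel

end Verification

/-! ## No admissible strategy beats the solution -/

section UpperBound

open Filter Topology

theorem measurable_setLIntegral_timeBlock {Ω : Type*} [MeasurableSpace Ω] {σ τ : Ω → ℝ≥0∞}
    (hσ : Measurable σ) (hτ : Measurable τ) {c : Ω → ℝ → ℝ≥0}
    (hc : Measurable fun p : Ω × ℝ => c p.1 p.2) {ψ : ℝ × ℝ≥0 → ℝ≥0∞} (hψ : Measurable ψ) :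
    Measurable fun ω => ∫⁻ t in timeBlock (σ ω) (τ ω), ψ (t, c ω t) := by
  have hset : MeasurableSet {p : Ω × ℝ | p.2 ∈ timeBlock (σ p.1) (τ p.1)} :=
    (measurableSet_lt measurable_const measurable_snd).inter
      ((measurableSet_le (hσ.comp measurable_fst) (ENNReal.measurable_ofReal.comp
        measurable_snd)).inter (measurableSet_lt (ENNReal.measurable_ofReal.comp measurable_snd)
        (hτ.comp measurable_fst)))
  have h := ((hψ.comp (measurable_snd.prodMk hc)).indicator hset).lintegral_prod_right' (ν := volume)
  refine Eq.mp (congrArg _ (funext fun ω => ?_)) h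
  rw [← lintegral_indicator (measurableSet_timeBlock _ _)]
  rfl

namespace ExplorationModel

variable (m : ExplorationModel)

/-- The model in units in which a known reserve `R` is worth `R ^ α`. -/
noncomputable def normalize (hε : m.k / m.lam < m.hotelling m.a) : NormalizedModel where
  α := m.α
  a := m.a
  κ := m.k / m.hotellingUnit
  lam := m.lam
  α_pos := m.α_pos
  α_lt_one := m.α_lt_one
  a_pos := m.a_pos
  κ_pos := div_pos m.k_pos m.hotellingUnit_pos
  lam_pos := m.lam_pos
  gain := by
    rw [hotelling_eq, div_lt_iff₀ m.lam_pos] at hε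
    rw [div_lt_iff₀ m.hotellingUnit_pos]
    linarith

variable {m} {hε : m.k / m.lam < m.hotelling m.a} {f q : ℝ → ℝ → ℝ}

/-- Consuming down to `S` and then exploring is worth at most the improved value. -/
theorem blockUtility_add_stopValue_le (hc : (m.normalize hε).IsContinuation f q) {c : ℝ → ℝ≥0}
    (hcm : Measurable c) {σ τ : ℝ≥0∞} (hστ : σ ≤ τ) {y b S : ℝ} (hy : 0 ≤ y) (hS : 0 ≤ S)
    (hSb : S ≤ b) (h : ∫⁻ t in timeBlock σ τ, (c t : ℝ≥0∞) ≤ ENNReal.ofReal (b - S)) :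
    m.blockUtility c σ τ +
        ENNReal.ofReal m.hotellingUnit * m.discount τ *
          ENNReal.ofReal ((m.normalize hε).stopValue f y S) ≤
      ENNReal.ofReal m.hotellingUnit * m.discount σ *
        ENNReal.ofReal ((m.normalize hε).improve f y b) := by
  have hp := hc.stoppingProfile hy
  have h1 := hp.le_reserveEquivalent_envelope m.α_pos hS hSb
  have hz : 0 ≤ (m.normalize hε).stopReserve f y S := reserveEquivalent_nonneg (hp.value_nonneg hS)
  have hw : (m.normalize hε).stopReserve f y S ^ m.α = (m.normalize hε).stopValue f y S :=
    hc.stopReserve_rpow hy hS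
  have hv : reserveEquivalent m.α ((m.normalize hε).improve f y b) ^ m.α =
      (m.normalize hε).improve f y b :=
    reserveEquivalent_rpow m.α_pos (hp.envelope_nonneg m.α_pos (hS.trans hSb))
  have h2 := m.blockUtility_add_le hcm hστ hz
    (show (m.normalize hε).stopReserve f y S ≤
      reserveEquivalent m.α ((m.normalize hε).improve f y b) from le_trans (le_add_of_nonneg_left (sub_nonneg.2 hSb)) h1)
    (h.trans (ENNReal.ofReal_le_ofReal (by
      exact le_sub_iff_add_le.2 h1)))
  rw [hw, hv, ENNReal.ofReal_mul m.hotellingUnit_pos.le,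
    ENNReal.ofReal_mul m.hotellingUnit_pos.le] at h2
  calc _ = _ := by ring
    _ ≤ _ := h2
    _ = _ := by ring

end ExplorationModel

variable {Ω : Type*} [MeasurableSpace Ω] {N : ℝ≥0 → Ω → ℕ} {P : Measure Ω} {m : ExplorationModel}
  {x : ℝ≥0} {θ : ℕ → Ω → ℝ≥0∞} {c : ℕ → Ω → ℝ → ℝ≥0}

/-- Utility of the consumption in the blocks before the episode after the first `n`. -/
noncomputable def accumulatedUtility (m : ExplorationModel) (θ : ℕ → Ω → ℝ≥0∞)
    (c : ℕ → Ω → ℝ → ℝ≥0) (n : ℕ) (ω : Ω) : ℝ≥0∞ :=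
  ∑ j ∈ Finset.range (n + 1), m.blockUtility (c j ω) (blockStart θ j ω) (θ j ω)

/-- Total consumption in the blocks before the episode after the first `n`. -/
noncomputable def accumulatedConsumption (θ : ℕ → Ω → ℝ≥0∞)
    (c : ℕ → Ω → ℝ → ℝ≥0) (n : ℕ) (ω : Ω) : ℝ≥0∞ :=
  ∑ j ∈ Finset.range (n + 1), ∫⁻ t in timeBlock (blockStart θ j ω) (θ j ω), (c j ω t : ℝ≥0∞)

/-- Discounted utility of a strategy. -/
noncomputable def totalUtility (m : ExplorationModel) (N : ℝ≥0 → Ω → ℕ) (x : ℝ≥0)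
    (θ : ℕ → Ω → ℝ≥0∞) (c : ℕ → Ω → ℝ → ℝ≥0) (ω : Ω) : ℝ≥0∞ :=
  ∫⁻ t in Ioi (0 : ℝ),
    ENNReal.ofReal (Real.exp (-m.r * t) * m.utility (consumptionRate N x θ c ω t))

/-- Weight of the Hotelling value at the time of the episode after the first `n`. -/
noncomputable def episodeWeight (m : ExplorationModel) (θ : ℕ → Ω → ℝ≥0∞) (n : ℕ) (ω : Ω) : ℝ≥0∞ :=
  ENNReal.ofReal m.hotellingUnit * m.discount (θ n ω)

omit [MeasurableSpace Ω] in
theorem totalUtility_eq {ω : Ω} (hθ : Monotone fun n => θ n ω) : totalUtility m N x θ c ω =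
    accumulatedUtility m θ c (N x ω) ω +
      m.blockUtility (c (N x ω + 1) ω) (θ (N x ω) ω) ⊤ :=
  setLIntegral_consumptionRate_Ioi hθ fun t c => ENNReal.ofReal (Real.exp (-m.r * t) * m.utility c)

theorem measurable_rate_block {lam : ℝ≥0} (hN : IsPoissonProcess N lam P)
    (hθ : ∀ n, Measurable[hN.info x n] (θ n))
    (hc : ∀ n, Measurable[(hN.info x n).prod (inferInstance : MeasurableSpace ℝ)]
      (fun p : Ω × ℝ => c n p.1 p.2)) {ψ : ℝ × ℝ≥0 → ℝ≥0∞} (hψ : Measurable ψ) (n : ℕ) :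
    Measurable[hN.info x n] fun ω =>
      ∑ j ∈ Finset.range (n + 1), ∫⁻ t in timeBlock (blockStart θ j ω) (θ j ω), ψ (t, c j ω t) := by
  refine @Finset.measurable_sum _ _ _ _ _ _ (hN.info x n) _ _ fun j hj => ?_
  have hjn : j ≤ n := by simpa [Nat.lt_succ_iff] using hj
  refine Measurable.mono ?_ (hN.info_mono x hjn) le_rfl
  refine @measurable_setLIntegral_timeBlock Ω (hN.info x j) _ _ ?_ (hθ j) _ (hc j) _ hψ
  cases j with
  | zero => exact @measurable_const _ _ _ (hN.info x 0) _
  | succ j => exact (hθ j).mono (hN.info_mono x (Nat.le_succ j)) le_rfl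

theorem sum_exploredArea_sub_le {lam : ℝ≥0} (hN : IsPoissonProcess N lam P) (x : ℝ≥0) (ω : Ω)
    (n : ℕ) : ∑ i ∈ Finset.range n,
      ((exploredArea N x (i + 1) ω - exploredArea N x i ω : ℝ≥0) : ℝ≥0∞) ≤ x := by
  have h : ∑ i ∈ Finset.range n, (exploredArea N x (i + 1) ω - exploredArea N x i ω) ≤
      exploredArea N x n ω := by
    induction n with
    | zero => simp
    | succ n ih =>
      rw [Finset.sum_range_succ]
      calc _ ≤ exploredArea N x n ω + (exploredArea N x (n + 1) ω - exploredArea N x n ω) := by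
            gcongr
        _ = _ := add_tsub_cancel_of_le (hN.exploredArea_mono x ω (Nat.le_succ n))
  rw [← ENNReal.ofNNReal_finsetSum]
  exact_mod_cast h.trans (IsPoissonProcess.exploredArea_le x n ω)

/-- Discounts are at most one and the explored pieces telescope to at most `x`. Finiteness is what
allows the cost to be moved across the inequality in the extended reals. -/
theorem expectedCost_ne_top [IsProbabilityMeasure P] {lam : ℝ≥0} (hN : IsPoissonProcess N lam P) :
    expectedCost m N P x θ ≠ ⊤ := by
  have h : expectedCost m N P x θ ≤ ∫⁻ _ : Ω, ENNReal.ofReal m.k * x ∂P := by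
    refine lintegral_mono fun ω => ?_
    gcongr
    refine le_trans (Finset.sum_le_sum fun i _ => ?_) (sum_exploredArea_sub_le hN x ω (N x ω + 1))
    exact (mul_le_mul_left (m.discount_le_one _) _).trans_eq (one_mul _)
  rw [lintegral_const, measure_univ, mul_one] at h
  exact ne_top_of_le_ne_top (ENNReal.mul_ne_top ENNReal.ofReal_ne_top ENNReal.coe_ne_top) h

/-- Summation over episodes and expectation are exchanged, and `k = κ * B` is split between the
normalized cost and the weight `B * discount`, to match the verification argument. -/
theorem expectedCost_eq {hε : m.k / m.lam < m.hotelling m.a} {lam : ℝ≥0}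
    (hN : IsPoissonProcess N lam P) (hθ : ∀ n, Measurable[hN.info x n] (θ n)) :
    expectedCost m N P x θ = ENNReal.ofReal (m.normalize hε).κ *
      ∑' n, NormalizedModel.episodeCost N P x (episodeWeight m θ) n := by
  have hB := m.hotellingUnit_pos
  have hk : ENNReal.ofReal (m.normalize hε).κ * ENNReal.ofReal m.hotellingUnit =
      ENNReal.ofReal m.k := by
    rw [← ENNReal.ofReal_mul (m.normalize hε).κ_pos.le]
    congr 1
    exact div_mul_cancel₀ _ hB.ne'
  have hX : ∀ n, Measurable (exploredArea N x n) := fun n =>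
    (hN.measurable_exploredArea x n).mono (hN.info_le x n) le_rfl
  have hE : ∀ n, MeasurableSet {ω | n ≤ N x ω} := fun n => hN.measurable x measurableSet_Ici
  let g : ℕ → Ω → ℝ≥0∞ := fun n ω => episodeWeight m θ n ω *
    ((exploredArea N x (n + 1) ω - exploredArea N x n ω : ℝ≥0) : ℝ≥0∞)
  have hg : ∀ n, Measurable (g n) := fun n =>
    ((m.measurable_discount.comp ((hθ n).mono (hN.info_le x n) le_rfl)).const_mul _).mul
      ((hX (n + 1)).sub (hX n)).coe_nnreal_ennreal
  have h1 : ∀ n, NormalizedModel.episodeCost N P x (episodeWeight m θ) n =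
      ∫⁻ ω, {ω | n ≤ N x ω}.indicator (g n) ω ∂P := fun n =>
    (lintegral_indicator (hE n) _).symm
  simp_rw [h1]
  rw [← lintegral_tsum fun n => ((hg n).indicator (hE n)).aemeasurable, ← lintegral_const_mul _
    (Measurable.tsum fun n => (hg n).indicator (hE n)), expectedCost]
  refine lintegral_congr fun ω => ?_
  rw [tsum_eq_sum (s := Finset.range (N x ω + 1)) fun n hn => indicator_of_notMem (by
    simpa using hn) _, Finset.mul_sum, Finset.mul_sum]
  refine Finset.sum_congr rfl fun n hn => ?_
  rw [indicator_of_mem (show ω ∈ {ω | n ≤ N x ω} by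
    simpa [Nat.lt_succ_iff] using hn), ← hk]
  simp only [g, episodeWeight]
  ring

variable {hε : m.k / m.lam < m.hotelling m.a} {f q : ℝ → ℝ → ℝ} [IsProbabilityMeasure P]

/-- Supermartingale half of the verification. Utility so far plus discounted value of exploring with
the reserves left does not increase from one episode to the next beyond what the outcome provides:
consuming between episodes is bounded by the envelope, consuming at the end by the Hotelling value.
-/
theorem expectedUtility_le (hN : IsPoissonProcess N m.lam.toNNReal P)
    (hs : (m.normalize hε).IsSolution f q) {R : ℝ≥0} (had : IsAdmissible m hN x R θ c) :
    expectedUtility m N P x θ c ≤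
      ENNReal.ofReal (m.hotellingUnit * (m.normalize hε).improve f x R) +
        expectedCost m N P x θ := by
  have hc := hs.toCont
  have ha := m.a_pos
  have hθ := had.measurable_time
  have hU : ∀ n, Measurable[hN.info x n] (accumulatedUtility m θ c n) :=
    measurable_rate_block hN hθ had.measurable_rate
      (ψ := fun p => ENNReal.ofReal (Real.exp (-m.r * p.1) * m.utility p.2)) (by
        unfold ExplorationModel.utility; fun_prop)
  have hC : ∀ n, Measurable[hN.info x n] (accumulatedConsumption θ c n) :=
    measurable_rate_block hN hθ had.measurable_rate (ψ := fun p => (p.2 : ℝ≥0∞)) (by fun_prop)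
  have hδ : ∀ n, Measurable[hN.info x n] (episodeWeight m θ n) := fun n =>
    (m.measurable_discount.comp (hθ n)).const_mul _
  have hcm : ∀ n ω, Measurable (c n ω) := fun n ω =>
    (@Measurable.comp _ _ _ _ ((hN.info x n).prod inferInstance) _ _ _ (had.measurable_rate n)
      (@measurable_prodMk_left _ _ (hN.info x n) _ ω))
  -- The reserves left at the start of the episode after the first `n`, from the budget. The
  -- subtraction is truncated, which makes `S` nonnegative everywhere, and is genuine on the almost
  -- sure event where the budget holds.
  let S : ℕ → Ω → ℝ := fun n ω =>
    ((R : ℝ≥0∞) + ENNReal.ofReal m.a * n - accumulatedConsumption θ c n ω).toReal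
  have hS : ∀ n, Measurable[hN.info x n] (S n) := fun n =>
    ((hC n).const_sub _).ennreal_toReal
  have hS0 : ∀ n ω, 0 ≤ S n ω := fun n ω => ENNReal.toReal_nonneg
  have hsolve : ∀ y b, 0 ≤ y → m.a ≤ b → f y b = (m.normalize hε).improve f y b := hs.val
  have hfin : ∀ n : ℕ, (R : ℝ≥0∞) + ENNReal.ofReal m.a * n ≠ ⊤ := fun n =>
    ENNReal.add_ne_top.2 ⟨ENNReal.coe_ne_top,
      ENNReal.mul_ne_top ENNReal.ofReal_ne_top (ENNReal.natCast_ne_top n)⟩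
  have hSR : ∀ n ω, accumulatedConsumption θ c n ω ≤ R + ENNReal.ofReal m.a * n →
      S n ω = R + m.a * n - (accumulatedConsumption θ c n ω).toReal := by
    intro n ω h
    simp only [S]
    rw [ENNReal.toReal_sub_of_le h (hfin n), ENNReal.toReal_add ENNReal.coe_ne_top
      (ENNReal.mul_ne_top ENNReal.ofReal_ne_top (ENNReal.natCast_ne_top n)), ENNReal.toReal_mul,
      ENNReal.toReal_ofReal ha.le]
    simp
  have hyx : ∀ n ω, (0 : ℝ) ≤ x - exploredArea N x n ω := fun n ω =>
    sub_nonneg.2 (NNReal.coe_le_coe.2 (IsPoissonProcess.exploredArea_le x n ω))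
  have hstep : ∀ n, ∀ᵐ ω ∂P,
      (m.normalize hε).exploringPayoff f N x (accumulatedUtility m θ c) (episodeWeight m θ) S
        (totalUtility m N x θ c) (n + 1) ω ≤
      (m.normalize hε).exploredPayoff f N x (accumulatedUtility m θ c) (episodeWeight m θ) S
        (totalUtility m N x θ c) n ω := by
    intro n
    filter_upwards [had.budget] with ω hω
    obtain ⟨hb1, hb2⟩ := (budget_iff (had.monotone ω)).1 hω
    unfold NormalizedModel.exploringPayoff NormalizedModel.exploredPayoff
      NormalizedModel.episodeValue
    -- Exploration already ended; this episode ends it without a discovery; or a deposit is found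
    -- and a further episode follows.
    rcases lt_trichotomy (N x ω) n with hn | hn | hn
    · rw [if_neg (by omega), if_neg (by omega)]
    · rw [if_neg (by omega), if_pos hn.ge, if_neg (by omega), totalUtility_eq (had.monotone ω), hn]
      gcongr
      have h1 : accumulatedConsumption θ c n ω ≤ R + ENNReal.ofReal m.a * n := hb1 n hn.ge
      have h2 : accumulatedConsumption θ c n ω +
          ∫⁻ t in timeBlock (θ n ω) ⊤, (c (n + 1) ω t : ℝ≥0∞) ≤ R + ENNReal.ofReal m.a * n := by
        rw [← hn]; exact hb2
      have h3 := m.blockUtility_add_le (hcm (n + 1) ω) (le_top : θ n ω ≤ ⊤) le_rfl (hS0 n ω) (by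
        rw [sub_zero, ENNReal.ofReal_toReal (ne_top_of_le_ne_top (hfin n) tsub_le_self)]
        exact ENNReal.le_sub_of_add_le_left (ne_top_of_le_ne_top (hfin n) h1) h2)
      refine le_trans le_self_add (h3.trans (le_of_eq ?_))
      rw [ENNReal.ofReal_mul m.hotellingUnit_pos.le, episodeWeight]
      change _ = _ * ENNReal.ofReal (S n ω ^ m.α)
      ring
    · rw [if_pos (Nat.succ_le_of_lt hn), if_pos hn.le, if_pos (Nat.succ_le_of_lt hn)]
      have h1 : accumulatedConsumption θ c n ω ≤ R + ENNReal.ofReal m.a * n := hb1 n hn.le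
      have h2 : accumulatedConsumption θ c (n + 1) ω ≤ R + ENNReal.ofReal m.a * (n + 1 : ℕ) :=
        hb1 (n + 1) hn
      have h3 : accumulatedConsumption θ c (n + 1) ω = accumulatedConsumption θ c n ω +
          ∫⁻ t in timeBlock (θ n ω) (θ (n + 1) ω), (c (n + 1) ω t : ℝ≥0∞) :=
        Finset.sum_range_succ _ _
      have h4 : accumulatedUtility m θ c (n + 1) ω = accumulatedUtility m θ c n ω +
          m.blockUtility (c (n + 1) ω) (θ n ω) (θ (n + 1) ω) := Finset.sum_range_succ _ _
      have hf1 := ne_top_of_le_ne_top (hfin n) h1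
      have hf2 : ∫⁻ t in timeBlock (θ n ω) (θ (n + 1) ω), (c (n + 1) ω t : ℝ≥0∞) ≠ ⊤ :=
        ne_top_of_le_ne_top (hfin (n + 1)) ((h3 ▸ le_add_self).trans h2)
      have h5 : S n ω + m.a - S (n + 1) ω =
          (∫⁻ t in timeBlock (θ n ω) (θ (n + 1) ω), (c (n + 1) ω t : ℝ≥0∞)).toReal := by
        rw [hSR n ω h1, hSR (n + 1) ω h2, h3, ENNReal.toReal_add hf1 hf2]
        push_cast
        ring
      have h6 : S (n + 1) ω ≤ S n ω + m.a := by
        have := ENNReal.toReal_nonneg (a := ∫⁻ t in timeBlock (θ n ω) (θ (n + 1) ω),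
          (c (n + 1) ω t : ℝ≥0∞))
        linarith
      rw [h4, add_assoc]
      gcongr
      refine (ExplorationModel.blockUtility_add_stopValue_le hc (hcm (n + 1) ω)
        (had.monotone ω (Nat.le_succ n)) (hyx (n + 1) ω) (hS0 (n + 1) ω) h6 ?_).trans (le_of_eq ?_)
      · rw [h5, ENNReal.ofReal_toReal hf2]
      · rw [← hsolve _ _ (hyx (n + 1) ω) (by linarith [hS0 n ω])]
        rfl
  have h := NormalizedModel.lintegral_le_of_exploringPayoff_le hN hc hU hδ hS hS0 hstep
  rw [expectedCost_eq (hε := hε) hN hθ]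
  refine h.trans ?_
  gcongr
  have h0 : ∀ᵐ ω ∂P, (m.normalize hε).exploringPayoff f N x (accumulatedUtility m θ c)
      (episodeWeight m θ) S (totalUtility m N x θ c) 0 ω ≤
        ENNReal.ofReal (m.hotellingUnit * (m.normalize hε).improve f x R) := by
    filter_upwards [had.budget] with ω hω
    obtain ⟨hb1, -⟩ := (budget_iff (had.monotone ω)).1 hω
    have h1 : accumulatedConsumption θ c 0 ω ≤ R + ENNReal.ofReal m.a * (0 : ℕ) :=
      hb1 0 (Nat.zero_le _)
    have h2 : accumulatedConsumption θ c 0 ω =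
        ∫⁻ t in timeBlock 0 (θ 0 ω), (c 0 ω t : ℝ≥0∞) := Finset.sum_range_one _
    have h3 : accumulatedUtility m θ c 0 ω = m.blockUtility (c 0 ω) 0 (θ 0 ω) :=
      Finset.sum_range_one _
    have h4 := hSR 0 ω h1
    have h5 := ENNReal.toReal_nonneg (a := accumulatedConsumption θ c 0 ω)
    rw [Nat.cast_zero, mul_zero, add_zero] at h4
    rw [NormalizedModel.exploringPayoff, if_pos (Nat.zero_le _), h3, hN.exploredArea_zero,
      NNReal.coe_zero, sub_zero]
    refine (ExplorationModel.blockUtility_add_stopValue_le hc (hcm 0 ω) zero_le x.2 (hS0 0 ω)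
      (by linarith : S 0 ω ≤ R) ?_).trans (le_of_eq ?_)
    · rw [h4, sub_sub_cancel, ENNReal.ofReal_toReal (ne_top_of_le_ne_top (hfin 0) h1), h2]
    · rw [m.discount_zero, mul_one, ← ENNReal.ofReal_mul m.hotellingUnit_pos.le]
      rfl
  refine (lintegral_mono_ae h0).trans ?_
  rw [lintegral_const, measure_univ, mul_one]

end UpperBound

/-! ## The threshold strategy attains the solution -/

section ThresholdStrategy

open Filter Topology

namespace NormalizedModel

variable {M : NormalizedModel} {f q : ℝ → ℝ → ℝ} {ρ : ℝ → ℝ}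

/-- Reserves at which exploration starts. -/
noncomputable def restReserve (ρ : ℝ → ℝ) (b y : ℝ) : ℝ := if 0 < y then min b (ρ y) else b

/-- Reserve equivalent of consuming down to the threshold and then exploring. -/
noncomputable def availableReserve (M : NormalizedModel) (f : ℝ → ℝ → ℝ) (ρ : ℝ → ℝ) (b y : ℝ) : ℝ :=
  b - restReserve ρ b y + M.stopReserve f y (restReserve ρ b y)

namespace IsThreshold

variable (hρ : M.IsThreshold f q ρ) (hs : M.IsSolution f q)
include hρ

theorem restReserve_nonneg {b : ℝ} (hb : 0 ≤ b) (y : ℝ) : 0 ≤ restReserve ρ b y := by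
  unfold restReserve
  split_ifs
  · exact le_min hb (hρ.pos y).le
  · exact hb

omit hρ in
theorem restReserve_le (b y : ℝ) : restReserve ρ b y ≤ b := by
  unfold restReserve
  split_ifs
  · exact min_le_left _ _
  · exact le_rfl

omit hρ in
theorem restReserve_zero_area (b : ℝ) : restReserve ρ b 0 = b := if_neg (lt_irrefl 0)

omit hρ in
theorem availableReserve_zero_area {b : ℝ} (hb : 0 ≤ b) : M.availableReserve f ρ b 0 = b := by
  rw [availableReserve, restReserve_zero_area, stopReserve_zero_area hb]
  ring

include hs

theorem antitone : Antitone ρ := by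
  have h := (hρ.strictAntiOn hs).antitoneOn
  intro x y hxy
  rcases le_or_gt x 0 with hx | hx
  · rw [hρ.of_nonpos x hx]; exact hρ.le_criticalLevel y
  · exact h hx.le (hx.le.trans hxy) hxy

theorem measurable_restReserve : Measurable fun p : ℝ × ℝ => restReserve ρ p.1 p.2 :=
  Measurable.ite (measurableSet_lt measurable_const measurable_snd)
    (measurable_fst.min ((hρ.antitone hs).measurable.comp measurable_snd)) measurable_fst

theorem measurable_stopReserve_restReserve :
    Measurable fun p : ℝ × ℝ => M.stopReserve f p.2 (restReserve ρ p.1 p.2) :=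
  hs.toCont.continuous_stopReserve.measurable.comp
    (measurable_snd.prodMk (hρ.measurable_restReserve hs))

theorem measurable_availableReserve :
    Measurable fun p : ℝ × ℝ => M.availableReserve f ρ p.1 p.2 :=
  (measurable_fst.sub (hρ.measurable_restReserve hs)).add (hρ.measurable_stopReserve_restReserve hs)

theorem stopReserve_restReserve_nonneg {b y : ℝ} (hb : 0 ≤ b) (hy : 0 ≤ y) :
    0 ≤ M.stopReserve f y (restReserve ρ b y) :=
  reserveEquivalent_nonneg ((hs.toCont.stoppingProfile hy).value_nonneg (hρ.restReserve_nonneg hb y))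

theorem availableReserve_nonneg {b y : ℝ} (hb : 0 ≤ b) (hy : 0 ≤ y) :
    0 ≤ M.availableReserve f ρ b y :=
  add_nonneg (sub_nonneg.2 (restReserve_le b y)) (hρ.stopReserve_restReserve_nonneg hs hb hy)

theorem improve_eq_availableReserve {b y : ℝ} (hb : 0 ≤ b) (hy : 0 ≤ y) :
    M.improve f y b = M.availableReserve f ρ b y ^ M.α := by
  rcases hy.eq_or_lt with rfl | hy
  · obtain ⟨S, hS, h⟩ := exists_envelope_eq M.α_pos (hs.toCont.stoppingProfile le_rfl).cont hb
    rw [availableReserve_zero_area hb, improve, ← h, stopValue_zero_area,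
      reserveEquivalent_of_rpow M.α_pos hS.1, sub_add_cancel]
  · rcases le_total b (ρ y) with h | h
    · rw [hρ.improve_eq hs hy hb h, availableReserve, restReserve, if_pos hy, min_eq_left h,
        sub_self, zero_add, hs.toCont.stopReserve_rpow hy.le hb]
    · rw [hρ.improve_eq_shift hs hy h, availableReserve, restReserve, if_pos hy, min_eq_right h]

end IsThreshold

end NormalizedModel

namespace ExplorationModel

variable {m : ExplorationModel} {hε : m.k / m.lam < m.hotelling m.a} {f q : ℝ → ℝ → ℝ} {ρ : ℝ → ℝ}

open NormalizedModel

/-- Duration of the consumption down to the threshold. -/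
noncomputable def consumptionSpan (m : ExplorationModel) (hε : m.k / m.lam < m.hotelling m.a)
    (f : ℝ → ℝ → ℝ) (ρ : ℝ → ℝ) (b y : ℝ) : ℝ≥0∞ :=
  if 0 < (m.normalize hε).stopReserve f y (restReserve ρ b y) then
    ENNReal.ofReal (Real.log ((m.normalize hε).availableReserve f ρ b y /
      (m.normalize hε).stopReserve f y (restReserve ρ b y)) / m.depletionRate)
  else ⊤

theorem measurable_consumptionSpan (hρ : (m.normalize hε).IsThreshold f q ρ)
    (hs : (m.normalize hε).IsSolution f q) :
    Measurable fun p : ℝ × ℝ => m.consumptionSpan hε f ρ p.1 p.2 :=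
  Measurable.ite (measurableSet_lt measurable_const (hρ.measurable_stopReserve_restReserve hs))
    ((((hρ.measurable_availableReserve hs).div
      (hρ.measurable_stopReserve_restReserve hs)).log.div_const _).ennreal_ofReal) measurable_const

/-- With no area left the next episode is empty and may start at once; consumption then proceeds in
the last block. -/
theorem consumptionSpan_zero_area {b : ℝ} (hb : 0 < b) : m.consumptionSpan hε f ρ b 0 = 0 := by
  rw [consumptionSpan, IsThreshold.availableReserve_zero_area hb.le,
    IsThreshold.restReserve_zero_area, stopReserve_zero_area hb.le, if_pos hb, div_self hb.ne',
    Real.log_one, zero_div, ENNReal.ofReal_zero]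

/-- The span is the time the exponential path takes to bring the reserve equivalent from its initial
value down to that of exploring. The identity also covers the infinite span, where the latter is
zero, and an infinite starting time. -/
theorem decay_add_consumptionSpan (hρ : (m.normalize hε).IsThreshold f q ρ)
    (hs : (m.normalize hε).IsSolution f q) {b y : ℝ} (hb : 0 ≤ b) (hy : 0 ≤ y) (σ : ℝ≥0∞) :
    (m.normalize hε).stopReserve f y (restReserve ρ b y) * decay m.depletionRate σ =
      (m.normalize hε).availableReserve f ρ b y *
        decay m.depletionRate (σ + m.consumptionSpan hε f ρ b y) := by
  have hd := m.depletionRate_pos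
  have hz := hρ.stopReserve_restReserve_nonneg hs hb hy
  have hle : (m.normalize hε).stopReserve f y (restReserve ρ b y) ≤
      (m.normalize hε).availableReserve f ρ b y :=
    le_add_of_nonneg_left (sub_nonneg.2 (IsThreshold.restReserve_le b y))
  unfold consumptionSpan
  set z := (m.normalize hε).stopReserve f y (restReserve ρ b y)
  set Z := (m.normalize hε).availableReserve f ρ b y
  rcases hz.eq_or_lt with h | h
  · rw [← h, if_neg (lt_irrefl _), add_top, decay_top]; ring
  rw [if_pos h]
  by_cases hσ : σ = ⊤
  · rw [hσ, top_add, decay_top]; ring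
  have hZ := h.trans_le hle
  have hlog : 0 ≤ Real.log (Z / z) := Real.log_nonneg ((one_le_div h).2 hle)
  rw [decay_of_ne_top hσ, decay_of_ne_top (ENNReal.add_ne_top.2 ⟨hσ, ENNReal.ofReal_ne_top⟩),
    ENNReal.toReal_add hσ ENNReal.ofReal_ne_top, ENNReal.toReal_ofReal (by positivity),
    mul_add, mul_div_cancel₀ _ hd.ne', neg_add, Real.exp_add, Real.exp_neg (Real.log _),
    Real.exp_log (by positivity)]
  field_simp

theorem blockUtility_self (c : ℝ → ℝ≥0) (σ : ℝ≥0∞) : m.blockUtility c σ σ = 0 := by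
  rw [blockUtility, timeBlock_self, setLIntegral_empty]

/-- Consuming down to the threshold and then exploring attains the improved value. -/
theorem blockUtility_availableReserve (hρ : (m.normalize hε).IsThreshold f q ρ)
    (hs : (m.normalize hε).IsSolution f q) {b y : ℝ} (hb : 0 ≤ b) (hy : 0 ≤ y) (σ : ℝ≥0∞) :
    m.blockUtility (m.depletion ((m.normalize hε).availableReserve f ρ b y) σ) σ
        (σ + m.consumptionSpan hε f ρ b y) +
      ENNReal.ofReal m.hotellingUnit * m.discount (σ + m.consumptionSpan hε f ρ b y) *
        ENNReal.ofReal ((m.normalize hε).stopValue f y (restReserve ρ b y)) =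
      ENNReal.ofReal m.hotellingUnit * m.discount σ *
        ENNReal.ofReal ((m.normalize hε).improve f y b) := by
  have h := m.blockUtility_depletion (le_self_add : σ ≤ σ + m.consumptionSpan hε f ρ b y)
    (hρ.availableReserve_nonneg hs hb hy)
    (z := (m.normalize hε).stopReserve f y (restReserve ρ b y)) fun hσ => by
      rw [eq_div_iff (decay_pos hσ).ne', decay_add_consumptionSpan hρ hs hb hy]
  have hw : (m.normalize hε).stopReserve f y (restReserve ρ b y) ^ m.α =
      (m.normalize hε).stopValue f y (restReserve ρ b y) :=
    hs.toCont.stopReserve_rpow hy (hρ.restReserve_nonneg hb y)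
  have hv : (m.normalize hε).availableReserve f ρ b y ^ m.α = (m.normalize hε).improve f y b :=
    (hρ.improve_eq_availableReserve hs hb hy).symm
  rw [hw, hv, ENNReal.ofReal_mul m.hotellingUnit_pos.le,
    ENNReal.ofReal_mul m.hotellingUnit_pos.le] at h
  calc _ = _ := by ring
    _ = _ := h
    _ = _ := by ring

theorem setLIntegral_availableReserve_le (hρ : (m.normalize hε).IsThreshold f q ρ)
    (hs : (m.normalize hε).IsSolution f q) {b y : ℝ} (hb : 0 ≤ b) (hy : 0 ≤ y) (σ : ℝ≥0∞) :
    ∫⁻ t in timeBlock σ (σ + m.consumptionSpan hε f ρ b y),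
        (m.depletion ((m.normalize hε).availableReserve f ρ b y) σ t : ℝ≥0∞) ≤
      ENNReal.ofReal (b - restReserve ρ b y) := by
  have hle : (m.normalize hε).stopReserve f y (restReserve ρ b y) ≤
      (m.normalize hε).availableReserve f ρ b y :=
    le_add_of_nonneg_left (sub_nonneg.2 (IsThreshold.restReserve_le b y))
  refine (m.setLIntegral_depletion_le le_self_add (hρ.availableReserve_nonneg hs hb hy) hle
    (decay_add_consumptionSpan hρ hs hb hy σ).le).trans (le_of_eq ?_)
  rw [availableReserve, add_sub_cancel_right]

variable {Ω : Type*} {N : ℝ≥0 → Ω → ℕ} {x : ℝ≥0}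

/-- Starting time and reserves of the episode after the first `n`, for the threshold strategy. -/
noncomputable def thresholdState (m : ExplorationModel) (hε : m.k / m.lam < m.hotelling m.a)
    (f : ℝ → ℝ → ℝ) (ρ : ℝ → ℝ) (N : ℝ≥0 → Ω → ℕ) (x : ℝ≥0) (R : ℝ) : ℕ → Ω → ℝ≥0∞ × ℝ
  | 0 => fun ω => (m.consumptionSpan hε f ρ R (x - exploredArea N x 0 ω),
      restReserve ρ R (x - exploredArea N x 0 ω))
  | n + 1 => fun ω => ((m.thresholdState hε f ρ N x R n ω).1 +
        m.consumptionSpan hε f ρ ((m.thresholdState hε f ρ N x R n ω).2 + m.a)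
          (x - exploredArea N x (n + 1) ω),
      restReserve ρ ((m.thresholdState hε f ρ N x R n ω).2 + m.a)
        (x - exploredArea N x (n + 1) ω))

/-- Starting times of the episodes of the threshold strategy. -/
noncomputable def thresholdTime (m : ExplorationModel) (hε : m.k / m.lam < m.hotelling m.a)
    (f : ℝ → ℝ → ℝ) (ρ : ℝ → ℝ) (N : ℝ≥0 → Ω → ℕ) (x : ℝ≥0) (R : ℝ) (n : ℕ) (ω : Ω) : ℝ≥0∞ :=
  (m.thresholdState hε f ρ N x R n ω).1

/-- Reserves at the beginning of the episodes of the threshold strategy. -/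
noncomputable def thresholdReserve (m : ExplorationModel) (hε : m.k / m.lam < m.hotelling m.a)
    (f : ℝ → ℝ → ℝ) (ρ : ℝ → ℝ) (N : ℝ≥0 → Ω → ℕ) (x : ℝ≥0) (R : ℝ) (n : ℕ) (ω : Ω) : ℝ :=
  (m.thresholdState hε f ρ N x R n ω).2

/-- Consumption of the threshold strategy. -/
noncomputable def thresholdRate (m : ExplorationModel) (hε : m.k / m.lam < m.hotelling m.a)
    (f : ℝ → ℝ → ℝ) (ρ : ℝ → ℝ) (N : ℝ≥0 → Ω → ℕ) (x : ℝ≥0) (R : ℝ) : ℕ → Ω → ℝ → ℝ≥0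
  | 0 => fun ω => m.depletion
      ((m.normalize hε).availableReserve f ρ R (x - exploredArea N x 0 ω)) 0
  | n + 1 => fun ω => m.depletion
      (if exploredArea N x (n + 1) ω = x then m.thresholdReserve hε f ρ N x R n ω
        else (m.normalize hε).availableReserve f ρ (m.thresholdReserve hε f ρ N x R n ω + m.a)
          (x - exploredArea N x (n + 1) ω)) (m.thresholdTime hε f ρ N x R n ω)

theorem monotone_thresholdTime (R : ℝ) (ω : Ω) :
    Monotone fun n => m.thresholdTime hε f ρ N x R n ω :=
  monotone_nat_of_le_succ fun _ => le_self_add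

theorem thresholdReserve_nonneg (hρ : (m.normalize hε).IsThreshold f q ρ) {R : ℝ} (hR : 0 ≤ R)
    (n : ℕ) (ω : Ω) : 0 ≤ m.thresholdReserve hε f ρ N x R n ω := by
  induction n with
  | zero => exact hρ.restReserve_nonneg hR _
  | succ n ih => exact hρ.restReserve_nonneg (add_nonneg ih m.a_pos.le) _

/-- Reserves at the beginning of the consumption blocks of the threshold strategy. -/
noncomputable def thresholdBudget (m : ExplorationModel) (hε : m.k / m.lam < m.hotelling m.a)
    (f : ℝ → ℝ → ℝ) (ρ : ℝ → ℝ) (N : ℝ≥0 → Ω → ℕ) (x : ℝ≥0) (R : ℝ) : ℕ → Ω → ℝ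
  | 0 => fun _ => R
  | n + 1 => fun ω => m.thresholdReserve hε f ρ N x R n ω + m.a

theorem thresholdBudget_nonneg (hρ : (m.normalize hε).IsThreshold f q ρ) {R : ℝ} (hR : 0 ≤ R)
    (n : ℕ) (ω : Ω) : 0 ≤ m.thresholdBudget hε f ρ N x R n ω := by
  cases n with
  | zero => exact hR
  | succ n => exact add_nonneg (thresholdReserve_nonneg hρ hR n ω) m.a_pos.le

theorem thresholdTime_eq (R : ℝ) (n : ℕ) (ω : Ω) : m.thresholdTime hε f ρ N x R n ω =
    blockStart (m.thresholdTime hε f ρ N x R) n ω +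
      m.consumptionSpan hε f ρ (m.thresholdBudget hε f ρ N x R n ω)
        (x - exploredArea N x n ω) := by
  cases n with
  | zero => exact (zero_add _).symm
  | succ n => rfl

theorem thresholdReserve_eq (R : ℝ) (n : ℕ) (ω : Ω) : m.thresholdReserve hε f ρ N x R n ω =
    restReserve ρ (m.thresholdBudget hε f ρ N x R n ω) (x - exploredArea N x n ω) := by
  cases n <;> rfl

/-- The rate of index `n + 1` serves two purposes: the block before a further episode and, when `n =
N x`, the final block. The strategy tells them apart by whether the whole area is explored, which is
known at that moment. The only ambiguity is a deposit found exactly at the end of the area, and then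
the block before the next episode is empty. -/
theorem thresholdRate_eq_or (hρ : (m.normalize hε).IsThreshold f q ρ) {R : ℝ} (hR : 0 ≤ R)
    (n : ℕ) (ω : Ω) :
    m.thresholdRate hε f ρ N x R n ω = m.depletion ((m.normalize hε).availableReserve f ρ
        (m.thresholdBudget hε f ρ N x R n ω) (x - exploredArea N x n ω))
          (blockStart (m.thresholdTime hε f ρ N x R) n ω) ∨
      m.thresholdTime hε f ρ N x R n ω = blockStart (m.thresholdTime hε f ρ N x R) n ω := by
  cases n with
  | zero => exact Or.inl rfl
  | succ n =>
    by_cases h : exploredArea N x (n + 1) ω = x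
    · right
      have hb := thresholdReserve_nonneg (N := N) (x := x) hρ hR n ω
      rw [thresholdTime_eq, h, sub_self, thresholdBudget,
        consumptionSpan_zero_area (by linarith [m.a_pos]), add_zero]
    · left
      rw [thresholdRate]
      simp only [if_neg h]
      rfl

theorem blockUtility_thresholdRate (hρ : (m.normalize hε).IsThreshold f q ρ)
    (hs : (m.normalize hε).IsSolution f q) {R : ℝ} (hR : 0 ≤ R) (n : ℕ) (ω : Ω) :
    m.blockUtility (m.thresholdRate hε f ρ N x R n ω)
        (blockStart (m.thresholdTime hε f ρ N x R) n ω) (m.thresholdTime hε f ρ N x R n ω) +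
      episodeWeight m (m.thresholdTime hε f ρ N x R) n ω *
        ENNReal.ofReal ((m.normalize hε).stopValue f (x - exploredArea N x n ω)
          (m.thresholdReserve hε f ρ N x R n ω)) =
      ENNReal.ofReal m.hotellingUnit *
          m.discount (blockStart (m.thresholdTime hε f ρ N x R) n ω) *
        ENNReal.ofReal ((m.normalize hε).improve f (x - exploredArea N x n ω)
          (m.thresholdBudget hε f ρ N x R n ω)) := by
  have hy : (0 : ℝ) ≤ x - exploredArea N x n ω :=
    sub_nonneg.2 (NNReal.coe_le_coe.2 (IsPoissonProcess.exploredArea_le x n ω))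
  have h := blockUtility_availableReserve hρ hs (thresholdBudget_nonneg (N := N) (x := x) hρ hR n ω)
    hy (blockStart (m.thresholdTime hε f ρ N x R) n ω)
  rw [← h, episodeWeight, ← thresholdTime_eq, ← thresholdReserve_eq]
  rcases thresholdRate_eq_or (N := N) (x := x) hρ hR n ω with h1 | h1
  · rw [h1]
  · rw [h1, blockUtility_self, blockUtility_self]

theorem setLIntegral_thresholdRate_le (hρ : (m.normalize hε).IsThreshold f q ρ)
    (hs : (m.normalize hε).IsSolution f q) {R : ℝ} (hR : 0 ≤ R) (n : ℕ) (ω : Ω) :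
    ∫⁻ t in timeBlock (blockStart (m.thresholdTime hε f ρ N x R) n ω)
        (m.thresholdTime hε f ρ N x R n ω), (m.thresholdRate hε f ρ N x R n ω t : ℝ≥0∞) ≤
      ENNReal.ofReal (m.thresholdBudget hε f ρ N x R n ω -
        m.thresholdReserve hε f ρ N x R n ω) := by
  have hy : (0 : ℝ) ≤ x - exploredArea N x n ω :=
    sub_nonneg.2 (NNReal.coe_le_coe.2 (IsPoissonProcess.exploredArea_le x n ω))
  have h := setLIntegral_availableReserve_le hρ hs
    (thresholdBudget_nonneg (N := N) (x := x) hρ hR n ω) hy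
    (blockStart (m.thresholdTime hε f ρ N x R) n ω)
  rcases thresholdRate_eq_or (N := N) (x := x) hρ hR n ω with h1 | h1
  · rw [h1, thresholdReserve_eq, thresholdTime_eq]
    exact h
  · rw [h1, timeBlock_self, setLIntegral_empty]
    exact zero_le

theorem accumulatedConsumption_threshold_le (hρ : (m.normalize hε).IsThreshold f q ρ)
    (hs : (m.normalize hε).IsSolution f q) {R : ℝ} (hR : 0 ≤ R) (n : ℕ) (ω : Ω) :
    accumulatedConsumption (m.thresholdTime hε f ρ N x R) (m.thresholdRate hε f ρ N x R) n ω ≤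
      ENNReal.ofReal (R + m.a * n - m.thresholdReserve hε f ρ N x R n ω) := by
  have hle : ∀ n, m.thresholdReserve hε f ρ N x R n ω ≤ m.thresholdBudget hε f ρ N x R n ω := by
    intro n
    rw [thresholdReserve_eq]
    exact IsThreshold.restReserve_le _ _
  have hle2 : ∀ n : ℕ, m.thresholdReserve hε f ρ N x R n ω ≤ R + m.a * n := by
    intro n
    induction n with
    | zero => simpa [thresholdBudget] using hle 0
    | succ n ih =>
      refine (hle (n + 1)).trans ?_
      rw [thresholdBudget]
      push_cast
      linarith
  induction n with
  | zero =>
    rw [accumulatedConsumption, zero_add, Finset.sum_range_one]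
    simpa [thresholdBudget] using setLIntegral_thresholdRate_le (N := N) (x := x) hρ hs hR 0 ω
  | succ n ih =>
    rw [accumulatedConsumption, Finset.sum_range_succ]
    refine (add_le_add ih (setLIntegral_thresholdRate_le hρ hs hR (n + 1) ω)).trans
      (le_of_eq ?_)
    rw [← ENNReal.ofReal_add (by linarith [hle2 n]) (by linarith [hle (n + 1)]), thresholdBudget]
    congr 1
    push_cast
    ring

end ExplorationModel

end ThresholdStrategy

/-! ## Admissibility and value of the threshold strategy -/

section ThresholdValue

open Filter Topology

variable {Ω : Type*} [MeasurableSpace Ω] {N : ℝ≥0 → Ω → ℕ} {P : Measure Ω} {m : ExplorationModel}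
  {hε : m.k / m.lam < m.hotelling m.a} {f q : ℝ → ℝ → ℝ} {ρ : ℝ → ℝ} {x R : ℝ≥0}

namespace ExplorationModel

open NormalizedModel

theorem measurable_consumptionSpan_comp (hρ : (m.normalize hε).IsThreshold f q ρ)
    (hs : (m.normalize hε).IsSolution f q) {Ω' : Type*} [MeasurableSpace Ω'] {σ : Ω' → ℝ≥0∞}
    {b y : Ω' → ℝ} (hσ : Measurable σ) (hb : Measurable b) (hy : Measurable y) :
    Measurable fun ω => (σ ω + m.consumptionSpan hε f ρ (b ω) (y ω), restReserve ρ (b ω) (y ω)) :=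
  (hσ.add ((measurable_consumptionSpan hρ hs).comp (hb.prodMk hy))).prodMk
    ((hρ.measurable_restReserve hs).comp (hb.prodMk hy))

theorem measurable_thresholdState (hN : IsPoissonProcess N m.lam.toNNReal P)
    (hρ : (m.normalize hε).IsThreshold f q ρ) (hs : (m.normalize hε).IsSolution f q) (R : ℝ)
    (n : ℕ) : Measurable[hN.info x n] (m.thresholdState hε f ρ N x R n) := by
  have hy : ∀ n, Measurable[hN.info x n] fun ω => (x : ℝ) - exploredArea N x n ω := fun n =>
    (measurable_coe_nnreal_real.comp (hN.measurable_exploredArea x n)).const_sub _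
  induction n with
  | zero =>
    have h := @measurable_consumptionSpan_comp m hε f q ρ hρ hs Ω (hN.info x 0) (fun _ => 0)
      (fun _ => R) _ measurable_const measurable_const (hy 0)
    simp only [zero_add] at h
    exact h
  | succ n ih =>
    have ih' : Measurable[hN.info x (n + 1)] (m.thresholdState hε f ρ N x R n) :=
      ih.mono (hN.info_mono x (Nat.le_succ n)) le_rfl
    have hb : Measurable[hN.info x (n + 1)] fun ω =>
        (m.thresholdState hε f ρ N x R n ω).2 + m.a :=
      (by fun_prop : Measurable fun p : ℝ≥0∞ × ℝ => p.2 + m.a).comp ih'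
    exact @measurable_consumptionSpan_comp m hε f q ρ hρ hs Ω (hN.info x (n + 1)) _ _ _
      (measurable_fst.comp ih') hb (hy (n + 1))

theorem measurable_depletion_comp {Ω' : Type*} [MeasurableSpace Ω'] {Z : Ω' → ℝ} {σ : Ω' → ℝ≥0∞}
    (hZ : Measurable Z) (hσ : Measurable σ) :
    Measurable fun p : Ω' × ℝ => m.depletion (Z p.1) (σ p.1) p.2 :=
  m.measurable_depletion.comp
    (((hZ.comp measurable_fst).prodMk (hσ.comp measurable_fst)).prodMk measurable_snd)

theorem measurable_thresholdRate (hN : IsPoissonProcess N m.lam.toNNReal P)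
    (hρ : (m.normalize hε).IsThreshold f q ρ) (hs : (m.normalize hε).IsSolution f q) (R : ℝ)
    (n : ℕ) : Measurable[(hN.info x n).prod (inferInstance : MeasurableSpace ℝ)]
      fun p : Ω × ℝ => m.thresholdRate hε f ρ N x R n p.1 p.2 := by
  have hy : ∀ n, Measurable[hN.info x n] fun ω => (x : ℝ) - exploredArea N x n ω := fun n =>
    (measurable_coe_nnreal_real.comp (hN.measurable_exploredArea x n)).const_sub _
  cases n with
  | zero =>
    have hp : Measurable[hN.info x 0] fun ω => ((R : ℝ), (x : ℝ) - exploredArea N x 0 ω) :=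
      Measurable.prodMk measurable_const (hy 0)
    exact @measurable_depletion_comp m Ω (hN.info x 0) _ _
      ((hρ.measurable_availableReserve hs).comp hp) measurable_const
  | succ n =>
    have h := (measurable_thresholdState (x := x) hN hρ hs R n).mono
      (hN.info_mono x (Nat.le_succ n)) le_rfl
    have hb : Measurable[hN.info x (n + 1)] fun ω =>
        (m.thresholdState hε f ρ N x R n ω).2 + m.a :=
      (by fun_prop : Measurable fun p : ℝ≥0∞ × ℝ => p.2 + m.a).comp h
    have hp : Measurable[hN.info x (n + 1)] fun ω =>
        ((m.thresholdState hε f ρ N x R n ω).2 + m.a, (x : ℝ) - exploredArea N x (n + 1) ω) :=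
      Measurable.prodMk hb (hy (n + 1))
    exact @measurable_depletion_comp m Ω (hN.info x (n + 1)) _ _
      (Measurable.ite (hN.measurable_exploredArea x (n + 1) (measurableSet_singleton x))
        (measurable_snd.comp h) ((hρ.measurable_availableReserve hs).comp hp))
      (measurable_fst.comp h)

theorem thresholdRate_last (hN : IsPoissonProcess N m.lam.toNNReal P) (ω : Ω) :
    m.thresholdRate hε f ρ N x R (N x ω + 1) ω =
      m.depletion (m.thresholdReserve hε f ρ N x R (N x ω) ω)
        (m.thresholdTime hε f ρ N x R (N x ω) ω) := by
  rw [thresholdRate]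
  simp only [if_pos (hN.exploredArea_of_lt (Nat.lt_succ_self (N x ω)))]

theorem isAdmissible_threshold (hN : IsPoissonProcess N m.lam.toNNReal P)
    (hρ : (m.normalize hε).IsThreshold f q ρ) (hs : (m.normalize hε).IsSolution f q) :
    IsAdmissible m hN x R (m.thresholdTime hε f ρ N x R) (m.thresholdRate hε f ρ N x R) where
  monotone := monotone_thresholdTime R
  measurable_time n := measurable_fst.comp (measurable_thresholdState hN hρ hs R n)
  measurable_rate := measurable_thresholdRate hN hρ hs R
  budget := by
    refine ae_of_all _ fun ω => (budget_iff (monotone_thresholdTime R ω)).2 ?_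
    have ha := m.a_pos
    have hR : (0 : ℝ) ≤ R := R.2
    have hS := fun n => thresholdReserve_nonneg (N := N) (x := x) hρ hR n ω
    have hcast : ∀ n : ℕ, ENNReal.ofReal (R + m.a * n) = R + ENNReal.ofReal m.a * n := by
      intro n
      rw [ENNReal.ofReal_add hR (by positivity), ENNReal.ofReal_mul ha.le,
        ENNReal.ofReal_coe_nnreal, ENNReal.ofReal_natCast]
    have h1 := fun n => accumulatedConsumption_threshold_le (N := N) (x := x) hρ hs hR n ω
    constructor
    · intro n _
      refine (h1 n).trans ?_
      rw [← hcast]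
      exact ENNReal.ofReal_le_ofReal (by linarith [hS n])
    · rw [thresholdRate_last hN]
      have h2 := m.setLIntegral_depletion_le
        (le_top : m.thresholdTime hε f ρ N x R (N x ω) ω ≤ ⊤) (hS (N x ω)) (hS (N x ω)) (by
          rw [decay_top, mul_zero, zero_mul])
      rw [sub_zero] at h2
      refine (add_le_add (h1 (N x ω)) h2).trans ?_
      have h3 : m.thresholdReserve hε f ρ N x R (N x ω) ω ≤ R + m.a * N x ω := by
        induction (N x ω) with
        | zero =>
          rw [thresholdReserve_eq]
          refine (IsThreshold.restReserve_le _ _).trans ?_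
          simp [thresholdBudget]
        | succ n ih =>
          rw [thresholdReserve_eq]
          refine (IsThreshold.restReserve_le _ _).trans ?_
          rw [thresholdBudget]
          push_cast
          linarith
      rw [← ENNReal.ofReal_add (by linarith) (hS _), sub_add_cancel, hcast]

/-- A discovery raises the value by at most a constant depending on `x` alone. Accumulated over the
episodes it gives the majorant linear in the number of deposits. -/
theorem stopValue_add_gain (hc : (m.normalize hε).IsContinuation f q) {y y' S : ℝ} (hy : 0 ≤ y)
    (hy' : 0 ≤ y') (hyx : y' ≤ x) (hS : 0 ≤ S) :
    f y' (S + m.a) ≤ (m.normalize hε).stopValue f y S +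
      (m.a ^ m.α * (1 + m.lam * x) + (m.normalize hε).κ / m.lam) := by
  have ha := m.a_pos
  have hl := m.lam_pos
  have hκ := div_pos (m.normalize hε).κ_pos hl
  have h1 : f y' (S + m.a) ≤ (S + m.a) ^ m.α + m.lam * m.a ^ m.α * y' :=
    hc.upper y' (S + m.a) hy' (le_add_of_nonneg_left hS)
  have h2 : Real.exp (-(m.lam * y)) * S ^ m.α + (1 - Real.exp (-(m.lam * y))) *
      ((S + m.a) ^ m.α - (m.normalize hε).κ / m.lam) ≤ (m.normalize hε).stopValue f y S :=
    hc.le_stopValue hy hS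
  have h3 : (S + m.a) ^ m.α ≤ S ^ m.α + m.a ^ m.α := (m.normalize hε).add_rpow_le hS
  have h4 : S ^ m.α ≤ (S + m.a) ^ m.α := Real.rpow_le_rpow hS (by linarith) m.α_pos.le
  have h5 : Real.exp (-(m.lam * y)) ≤ 1 := Real.exp_le_one_iff.2 (by nlinarith)
  have h6 := Real.exp_pos (-(m.lam * y))
  have h7 := Real.rpow_pos_of_pos ha m.α
  have h8 : m.lam * m.a ^ m.α * y' ≤ m.lam * m.a ^ m.α * x :=
    mul_le_mul_of_nonneg_left hyx (by positivity)
  nlinarith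

/-- Martingale half of the verification: along the threshold strategy each block attains its bound,
because consumption follows the exponential path down to the optimal stopping level. -/
theorem le_expectedUtility_threshold [IsProbabilityMeasure P]
    (hN : IsPoissonProcess N m.lam.toNNReal P)
    (hρ : (m.normalize hε).IsThreshold f q ρ) (hs : (m.normalize hε).IsSolution f q) :
    ENNReal.ofReal (m.hotellingUnit * (m.normalize hε).improve f x R) +
        expectedCost m N P x (m.thresholdTime hε f ρ N x R) ≤
      expectedUtility m N P x (m.thresholdTime hε f ρ N x R) (m.thresholdRate hε f ρ N x R) := by
  have hc := hs.toCont
  have ha := m.a_pos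
  have had := isAdmissible_threshold (x := x) (R := R) hN hρ hs
  have hθ := had.measurable_time
  have hR : (0 : ℝ) ≤ R := R.2
  have hU : ∀ n, Measurable[hN.info x n] (accumulatedUtility m (m.thresholdTime hε f ρ N x R)
      (m.thresholdRate hε f ρ N x R) n) :=
    measurable_rate_block hN hθ had.measurable_rate
      (ψ := fun p => ENNReal.ofReal (Real.exp (-m.r * p.1) * m.utility p.2)) (by
        unfold ExplorationModel.utility; fun_prop)
  have hδ : ∀ n, Measurable[hN.info x n] (episodeWeight m (m.thresholdTime hε f ρ N x R) n) :=
    fun n => (m.measurable_discount.comp (hθ n)).const_mul _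
  have hS : ∀ n, Measurable[hN.info x n] (m.thresholdReserve hε f ρ N x R n) := fun n =>
    measurable_snd.comp (measurable_thresholdState hN hρ hs R n)
  have hS0 := fun n ω => thresholdReserve_nonneg (N := N) (x := x) hρ hR n ω
  have hsolve : ∀ y b, 0 ≤ y → m.a ≤ b → f y b = (m.normalize hε).improve f y b := hs.val
  have hyx : ∀ n ω, (0 : ℝ) ≤ x - exploredArea N x n ω := fun n ω =>
    sub_nonneg.2 (NNReal.coe_le_coe.2 (IsPoissonProcess.exploredArea_le x n ω))
  let Φ : ℕ → Ω → ℝ≥0∞ := fun n ω =>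
    accumulatedUtility m (m.thresholdTime hε f ρ N x R) (m.thresholdRate hε f ρ N x R) n ω +
      episodeWeight m (m.thresholdTime hε f ρ N x R) n ω * ENNReal.ofReal
        ((m.normalize hε).stopValue f (x - exploredArea N x n ω)
          (m.thresholdReserve hε f ρ N x R n ω))
  have hΦ0 : ∀ ω, Φ 0 ω = ENNReal.ofReal (m.hotellingUnit * (m.normalize hε).improve f x R) := by
    intro ω
    have h := blockUtility_thresholdRate (N := N) (x := x) hρ hs hR 0 ω
    have h2 : blockStart (m.thresholdTime hε f ρ N x R) 0 ω = 0 := rfl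
    rw [h2, m.discount_zero, mul_one, hN.exploredArea_zero, NNReal.coe_zero, sub_zero,
      ← ENNReal.ofReal_mul m.hotellingUnit_pos.le] at h
    simp only [Φ, accumulatedUtility, zero_add, Finset.sum_range_one]
    rw [h2, hN.exploredArea_zero, NNReal.coe_zero, sub_zero]
    exact h
  have hΦ : ∀ n ω, Φ (n + 1) ω =
      accumulatedUtility m (m.thresholdTime hε f ρ N x R) (m.thresholdRate hε f ρ N x R) n ω +
        episodeWeight m (m.thresholdTime hε f ρ N x R) n ω * ENNReal.ofReal
          (f (x - exploredArea N x (n + 1) ω) (m.thresholdReserve hε f ρ N x R n ω + m.a)) := by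
    intro n ω
    have h := blockUtility_thresholdRate (N := N) (x := x) hρ hs hR (n + 1) ω
    simp only [Φ]
    rw [accumulatedUtility, Finset.sum_range_succ, add_assoc, h,
      hsolve _ _ (hyx (n + 1) ω) (le_add_of_nonneg_left (hS0 n ω))]
    rfl
  have hstep : ∀ n, ∀ᵐ ω ∂P, (m.normalize hε).exploredPayoff f N x
        (accumulatedUtility m (m.thresholdTime hε f ρ N x R) (m.thresholdRate hε f ρ N x R))
        (episodeWeight m (m.thresholdTime hε f ρ N x R)) (m.thresholdReserve hε f ρ N x R)
        (totalUtility m N x (m.thresholdTime hε f ρ N x R) (m.thresholdRate hε f ρ N x R)) n ω ≤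
      (m.normalize hε).exploringPayoff f N x
        (accumulatedUtility m (m.thresholdTime hε f ρ N x R) (m.thresholdRate hε f ρ N x R))
        (episodeWeight m (m.thresholdTime hε f ρ N x R)) (m.thresholdReserve hε f ρ N x R)
        (totalUtility m N x (m.thresholdTime hε f ρ N x R) (m.thresholdRate hε f ρ N x R))
        (n + 1) ω := by
    refine fun n => ae_of_all _ fun ω => ?_
    unfold exploringPayoff exploredPayoff episodeValue
    rcases lt_trichotomy (N x ω) n with hn | hn | hn
    · rw [if_neg (by omega), if_neg (by omega)]
    · rw [if_pos hn.ge, if_neg (by omega), if_neg (by omega),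
        totalUtility_eq (monotone_thresholdTime R ω), thresholdRate_last hN, hn]
      refine add_le_add le_rfl (le_of_eq ?_)
      have h := m.blockUtility_depletion (Z := m.thresholdReserve hε f ρ N x R n ω) (z := 0)
        (le_top : m.thresholdTime hε f ρ N x R n ω ≤ ⊤) (hS0 n ω) fun _ => by
          rw [decay_top, mul_zero, zero_div]
      rw [Real.zero_rpow m.α_pos.ne', mul_zero, ENNReal.ofReal_zero, mul_zero, add_zero,
        ENNReal.ofReal_mul m.hotellingUnit_pos.le] at h
      rw [h, episodeWeight]
      change _ * ENNReal.ofReal (m.thresholdReserve hε f ρ N x R n ω ^ m.α) = _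
      ring
    · rw [if_pos (Nat.succ_le_of_lt hn), if_pos hn.le, if_pos (Nat.succ_le_of_lt hn)]
      exact (hΦ n ω).ge
  -- Replacing the next value by the current value of exploring plus the bounded gain of a
  -- discovery, and discounting by at most one, each episode adds at most a constant.
  have hK : ∀ n ω, Φ n ω ≤
      ENNReal.ofReal (m.hotellingUnit * (m.normalize hε).improve f x R) +
      (ENNReal.ofReal m.hotellingUnit *
        ENNReal.ofReal (m.a ^ m.α * (1 + m.lam * x) + (m.normalize hε).κ / m.lam)) * n := by
    intro n ω
    induction n with
    | zero => simp [hΦ0]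
    | succ n ih =>
      push_cast
      rw [mul_add, ← add_assoc, mul_one, hΦ]
      refine le_trans ?_ (add_le_add_left ih _)
      simp only [Φ]
      rw [add_assoc]
      gcongr
      refine (mul_le_mul_right (ENNReal.ofReal_le_ofReal (stopValue_add_gain hc (hyx n ω)
        (hyx (n + 1) ω) (by linarith [(exploredArea N x (n + 1) ω).2] :
          (x : ℝ) - exploredArea N x (n + 1) ω ≤ x) (hS0 n ω))) _).trans ?_
      refine (mul_le_mul_right ENNReal.ofReal_add_le _).trans ?_
      rw [mul_add]
      gcongr
      exact (mul_le_mul_right (m.discount_le_one _) _).trans_eq (mul_one _)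
  have h := le_lintegral_of_exploredPayoff_le hN hc hU hδ hS hS0 hstep
    (C := ENNReal.ofReal (m.hotellingUnit * (m.normalize hε).improve f x R))
    (K := ENNReal.ofReal m.hotellingUnit *
        ENNReal.ofReal (m.a ^ m.α * (1 + m.lam * x) + (m.normalize hε).κ / m.lam))
    ENNReal.ofReal_ne_top (ENNReal.mul_ne_top ENNReal.ofReal_ne_top ENNReal.ofReal_ne_top)
    fun n ω hn => by
      rw [exploringPayoff, if_pos hn]
      exact hK n ω
  rw [expectedCost_eq (hε := hε) hN hθ]
  refine le_trans (le_of_eq ?_) h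
  congr 1
  have h0 : ∀ ω, (m.normalize hε).exploringPayoff f N x
        (accumulatedUtility m (m.thresholdTime hε f ρ N x R) (m.thresholdRate hε f ρ N x R))
        (episodeWeight m (m.thresholdTime hε f ρ N x R)) (m.thresholdReserve hε f ρ N x R)
        (totalUtility m N x (m.thresholdTime hε f ρ N x R) (m.thresholdRate hε f ρ N x R)) 0 ω =
      ENNReal.ofReal (m.hotellingUnit * (m.normalize hε).improve f x R) := fun ω => by
    rw [exploringPayoff, if_pos (Nat.zero_le _)]
    exact hΦ0 ω
  rw [lintegral_congr h0, lintegral_const, measure_univ, mul_one]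

end ExplorationModel

end ThresholdValue

/-! ## The value function -/

section ValueFunction

open Filter Topology

variable {Ω : Type*} [MeasurableSpace Ω] {N : ℝ≥0 → Ω → ℕ} {P : Measure Ω} {m : ExplorationModel}
  {hε : m.k / m.lam < m.hotelling m.a} {f q : ℝ → ℝ → ℝ} {ρ : ℝ → ℝ}

namespace ExplorationModel

open NormalizedModel

section Probability

variable [IsProbabilityMeasure P] (hN : IsPoissonProcess N m.lam.toNNReal P)
  (hρ : (m.normalize hε).IsThreshold f q ρ) (hs : (m.normalize hε).IsSolution f q)
include hρ hs

/-- The two halves of the verification, with the cost subtracted back; it is finite, so the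
subtraction of extended reals behaves. -/
theorem extendedValue_eq (x R : ℝ≥0) : extendedValue m hN x R =
    ((m.hotellingUnit * (m.normalize hε).improve f x R : ℝ) : EReal) := by
  have hv : 0 ≤ m.hotellingUnit * (m.normalize hε).improve f x R :=
    mul_nonneg m.hotellingUnit_pos.le
      ((hs.toCont.stoppingProfile x.2).envelope_nonneg m.α_pos R.2)
  have hcoe : ((m.hotellingUnit * (m.normalize hε).improve f x R : ℝ) : EReal) =
      ((ENNReal.ofReal (m.hotellingUnit * (m.normalize hε).improve f x R) : ℝ≥0∞) : EReal) := by
    rw [EReal.coe_ennreal_ofReal, max_eq_left hv]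
  have hfin : ∀ θ, ((expectedCost m N P x θ : ℝ≥0∞) : EReal) ≠ ⊤ := fun θ => by
    simpa using expectedCost_ne_top hN
  have hbot : ∀ θ, ((expectedCost m N P x θ : ℝ≥0∞) : EReal) ≠ ⊥ := fun θ =>
    EReal.coe_ennreal_ne_bot _
  rw [hcoe]
  refine le_antisymm (iSup_le fun θ => iSup_le fun c => iSup_le fun had => ?_) ?_
  · refine EReal.sub_le_of_le_add ?_
    rw [← EReal.coe_ennreal_add, EReal.coe_ennreal_le_coe_ennreal_iff]
    exact expectedUtility_le hN hs had
  · refine le_iSup_of_le (m.thresholdTime hε f ρ N x R)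
      (le_iSup_of_le (m.thresholdRate hε f ρ N x R)
        (le_iSup_of_le (isAdmissible_threshold hN hρ hs) ?_))
    refine (EReal.le_sub_iff_add_le (Or.inl (hbot _)) (Or.inl (hfin _))).2 ?_
    rw [← EReal.coe_ennreal_add, EReal.coe_ennreal_le_coe_ennreal_iff]
    exact le_expectedUtility_threshold hN hρ hs

theorem valueFunction_eq {x R : ℝ} (hx : 0 ≤ x) (hR : 0 ≤ R) :
    valueFunction m hN x R = m.hotellingUnit * (m.normalize hε).improve f x R := by
  rw [valueFunction, extendedValue_eq hN hρ hs, EReal.toReal_coe, Real.coe_toNNReal _ hx,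
    Real.coe_toNNReal _ hR]

theorem explorationValue_eq {x R : ℝ} (hx : 0 ≤ x) (hR : 0 ≤ R) :
    explorationValue m hN x R = m.hotellingUnit * (m.normalize hε).stopValue f x R := by
  have hB := m.hotellingUnit_pos
  have hint : ∫ s in (0 : ℝ)..x, valueFunction m hN (x - s) (R + m.a) *
      (m.lam * Real.exp (-m.lam * s)) = m.hotellingUnit * (Real.exp (-(m.lam * x)) *
        (m.normalize hε).depositMean (fun y => f y (R + m.a)) x) := by
    -- The operator integrates over the area explored, the normalized one over the area left; the
    -- substitution `z = x - s` relates them, and the fixed point equation replaces the value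
    -- function by `f`.
    have h := intervalIntegral.integral_comp_sub_left (a := 0) (b := x)
      (fun z => m.hotellingUnit * Real.exp (-(m.lam * x)) *
        (m.lam * Real.exp (m.lam * z) * f z (R + m.a))) x
    rw [sub_zero, sub_self] at h
    rw [← mul_assoc, depositMean, ← intervalIntegral.integral_const_mul]
    refine Eq.trans ?_ h
    refine intervalIntegral.integral_congr fun s hs' => ?_
    rw [uIcc_of_le hx] at hs'
    have hv : f (x - s) (R + m.a) = (m.normalize hε).improve f (x - s) (R + m.a) :=
      hs.val _ _ (by linarith [hs'.2]) (le_add_of_nonneg_left hR)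
    rw [valueFunction_eq hN hρ hs (by linarith [hs'.2]) (by linarith [m.a_pos]), ← hv,
      show -m.lam * s = -(m.lam * x) + m.lam * (x - s) by ring, Real.exp_add]
    ring
  have hκ : (m.normalize hε).κ * m.hotellingUnit = m.k := div_mul_cancel₀ _ hB.ne'
  rw [explorationValue, hint, hotelling_eq, stopValue, neg_mul]
  change _ = m.hotellingUnit * (Real.exp (-(m.lam * x)) * (R ^ m.α +
    (m.normalize hε).depositMean (fun y => f y (R + m.a)) x) -
      (m.normalize hε).κ * ((1 - Real.exp (-(m.lam * x))) / m.lam))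
  rw [← hκ]
  ring

theorem intervalIntegrable_valueFunction {x R : ℝ} (hx : 0 ≤ x) (hR : 0 ≤ R) :
    IntervalIntegrable (fun y => valueFunction m hN y R) volume 0 x := by
  have hcont : Continuous fun y => m.hotellingUnit * (m.normalize hε).improve f y R :=
    (hs.toCont.continuous_improve continuous_id continuous_const fun _ => hR).const_mul _
  refine (hcont.intervalIntegrable 0 x).congr fun y hy => ?_
  rw [uIoc_of_le hx] at hy
  exact (valueFunction_eq hN hρ hs hy.1.le hR).symm

theorem consumptionRegion_slice {x : ℝ} (hx : 0 < x) :
    {R | (x, R) ∈ consumptionRegion m hN} = Ioi (ρ x) := by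
  have hB := m.hotellingUnit_pos
  ext R
  simp only [consumptionRegion, mem_ofPred_eq, mem_Ioi]
  constructor
  · rintro ⟨-, hR, h⟩
    rw [explorationValue_eq hN hρ hs hx.le hR, valueFunction_eq hN hρ hs hx.le hR] at h
    by_contra hcon
    rw [hρ.improve_eq hs hx hR (not_lt.1 hcon)] at h
    exact lt_irrefl _ h
  · intro h
    have hR := (hρ.pos x).le.trans h.le
    refine ⟨hx.le, hR, ?_⟩
    rw [explorationValue_eq hN hρ hs hx.le hR, valueFunction_eq hN hρ hs hx.le hR]
    exact mul_lt_mul_of_pos_left (hρ.stopValue_lt_improve hs hx h) hB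

theorem explorationRegion_slice {x : ℝ} (hx : 0 < x) :
    {R | (x, R) ∈ explorationRegion m hN} = Icc 0 (ρ x) := by
  have hB := m.hotellingUnit_pos
  ext R
  simp only [explorationRegion, mem_ofPred_eq, mem_Icc]
  constructor
  · rintro ⟨-, hR, h⟩
    refine ⟨hR, ?_⟩
    rw [explorationValue_eq hN hρ hs hx.le hR, valueFunction_eq hN hρ hs hx.le hR] at h
    by_contra hcon
    exact (mul_lt_mul_of_pos_left (hρ.stopValue_lt_improve hs hx (not_le.1 hcon)) hB).ne' h
  · rintro ⟨hR, h⟩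
    refine ⟨hx.le, hR, ?_⟩
    rw [explorationValue_eq hN hρ hs hx.le hR, valueFunction_eq hN hρ hs hx.le hR,
      hρ.improve_eq hs hx hR h]

end Probability

/-- Dividing by `Z ^ α` turns the drift into a function of `a / Z`, with `κ / λ = ε * a ^ α`. So the
exhaustion equation expresses that the drift vanishes. -/
theorem switchDrift_normalize {Z : ℝ} (hZ : 0 < Z) : (m.normalize hε).switchDrift Z =
    m.lam * Z ^ m.α / (1 - m.α) * (m.α * (1 + m.a / Z) ^ (m.α - 1) +
      (1 - m.α) * (1 + m.a / Z) ^ m.α - (1 - m.α) * (m.a / Z) ^ m.α * m.eps - 1) := by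
  have ha := m.a_pos
  have hl := m.lam_pos
  have hB := m.hotellingUnit_pos
  have h1 : 1 - m.α ≠ 0 := by linarith [m.α_lt_one]
  have hza : 1 + m.a / Z = (Z + m.a) / Z := by field_simp
  have e1 := Real.rpow_pos_of_pos hZ m.α
  have e2 := Real.rpow_pos_of_pos ha m.α
  have e3 : 0 < (Z + m.a) ^ m.α := by positivity
  have e4 : Z + m.a ≠ 0 := by positivity
  change m.lam * ((Z + m.a) ^ m.α - Z ^ m.α) - m.k / m.hotellingUnit +
    Z / (1 - m.α) * (m.lam * (m.α * (Z + m.a) ^ (m.α - 1) - m.α * Z ^ (m.α - 1))) = _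
  rw [hza, eps, hotelling_eq, Real.rpow_sub_one (by positivity), Real.rpow_sub_one (by positivity),
    Real.rpow_sub_one (by positivity), Real.div_rpow (by positivity) hZ.le,
    Real.div_rpow ha.le hZ.le]
  field_simp
  ring

theorem isExhaustionLevel_iff {Z : ℝ} (hZ : 0 < Z) :
    m.IsExhaustionLevel Z ↔ (m.normalize hε).switchDrift Z = 0 := by
  have h1 : 0 < 1 - m.α := by linarith [m.α_lt_one]
  have h2 : m.lam * Z ^ m.α / (1 - m.α) ≠ 0 :=
    (div_pos (mul_pos m.lam_pos (Real.rpow_pos_of_pos hZ _)) h1).ne'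
  rw [switchDrift_normalize hZ, mul_eq_zero, or_iff_right h2, sub_eq_zero, IsExhaustionLevel]

end ExplorationModel

end ValueFunction

theorem theorem2 {Ω : Type*} [MeasurableSpace Ω] {P : Measure Ω} [IsProbabilityMeasure P]
    (m : ExplorationModel) (N : ℝ≥0 → Ω → ℕ) (hN : IsPoissonProcess N m.lam.toNNReal P)
    (hε : m.k / m.lam < m.hotelling m.a) :
    -- the value function is finite, and the integral in the exploration operator exists
    (∀ x R : ℝ≥0, 0 ≤ extendedValue m hN x R ∧ extendedValue m hN x R < ⊤) ∧
    (∀ x R : ℝ, 0 ≤ x → 0 ≤ R →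
      IntervalIntegrable (fun y => valueFunction m hN y R) volume 0 x) ∧
    ∃ Rstar : ℝ → ℝ,
      (∀ x : ℝ, 0 < x → 0 < Rstar x ∧
        {R | (x, R) ∈ consumptionRegion m hN} = Ioi (Rstar x) ∧
        {R | (x, R) ∈ explorationRegion m hN} = Icc 0 (Rstar x)) ∧
      StrictAntiOn Rstar (Ici 0) ∧
      ContDiffOn ℝ 1 Rstar (Ici 0) ∧
      0 < Rstar 0 ∧
      m.IsExhaustionLevel (Rstar 0) ∧
      ∀ R : ℝ, 0 < R → m.IsExhaustionLevel R → R = Rstar 0 := by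
  obtain ⟨f, q, hc, hval, hmarg⟩ := NormalizedModel.exists_fixedPoint (m.normalize hε)
  have hs : (m.normalize hε).IsSolution f q := ⟨hc, hval, hmarg⟩
  obtain ⟨ρ, hρ⟩ := hs.exists_isThreshold
  -- The value of the threshold at zero area is assigned by convention; that it is the right one is
  -- contained in the differentiability up to zero.
  have h0 := hρ.of_nonpos 0 le_rfl
  refine ⟨fun x R => ?_, fun x R hx hR =>
    ExplorationModel.intervalIntegrable_valueFunction hN hρ hs hx hR, ρ, fun x hx => ⟨hρ.pos x,
      ExplorationModel.consumptionRegion_slice hN hρ hs hx,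
      ExplorationModel.explorationRegion_slice hN hρ hs hx⟩,
    hρ.strictAntiOn hs, hρ.contDiffOn hs, hρ.pos 0,
    (ExplorationModel.isExhaustionLevel_iff (hε := hε) (hρ.pos 0)).2 ?_, fun R hR h => ?_⟩
  · rw [ExplorationModel.extendedValue_eq hN hρ hs]
    refine ⟨EReal.coe_nonneg.2 (mul_nonneg m.hotellingUnit_pos.le
      ((hs.toCont.stoppingProfile x.2).envelope_nonneg m.α_pos R.2)), EReal.coe_lt_top _⟩
  · rw [h0]
    exact NormalizedModel.switchDrift_criticalLevel
  · rw [h0]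
    exact NormalizedModel.eq_criticalLevel hR
      ((ExplorationModel.isExhaustionLevel_iff (hε := hε) hR).1 h)
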